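/- Let $E_j=B_j+iA_j$, $j=1,2$, with $A_1,A_2>0$ and $B_1<B_2$. Let $\Sigma_j=[\bar E_j,E_j]$ be the vertical segments, oriented upward, $\Sigma=\Sigma_1\cup\Sigma_2$, and let $m_+$, $m_-$ denote nontangential boundary values from the left and from the right. Let $\dot E^2(\hat{\mathbb C}\setminus\Sigma)$ be the Smirnoff class: the functions $f$ that are analytic in $\hat{\mathbb C}\setminus\Sigma$, vanish at $\infty$, and have bounded $L^2$ norms with respect to arc length on a sequence of systems of curves $C_n$ in $\mathbb C\setminus\Sigma$ that eventually surround each compact subset of $\hat{\mathbb C}\setminus\Sigma$ ($C_n$ being the union of an ellipse with foci $E_1,\bar E_1$ and an ellipse with foci $E_2,\bar E_2$, shrinking to $\Sigma_1$ and $\Sigma_2$). **Definitions.** Let $\tilde w(k)=\sqrt{(k-E_1)(k-\bar E_1)(k-E_2)(k-\bar E_2)}$ on $\mathbb C\setminus\Sigma$, with $\tilde w(k)>0$ for $k\gg0$. Let $\tilde M$ be the genus $1$ Riemann surface of $\tilde w$ with branch cuts $\Sigma_1,\Sigma_2$; its points are written $k^\pm=(k,\pm\tilde w(k))$. Let $a_1$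 be the counterclockwise loop around $\Sigma_1$ on the upper sheet, and let $b_1$ be the cycle that runs from $\Sigma_2$ to $\Sigma_1$ on the upper sheet, from $\bar E_2$ to $\bar E_1$, and back on the lower sheet. Let $\tilde\zeta$ be the multiple of $dk/w$ with $\int_{a_1}\tilde\zeta=1$, and set $\tau=\int_{b_1}\tilde\zeta$ and $$\tilde\Theta(z)=\sum_{n\in\mathbb Z}e^{2\pi i(\frac12n^2\tau+nz)}.$$ Let $\tilde\varphi(P)=\int_{\bar E_2}^P\tilde\zeta$, with a path of integration on the upper sheet; the value is then determined modulo $\mathbb Z$, and $\tilde\Theta$ has period $1$. Let $\nu(k)=\left(\frac{(k-E_1)(k-E_2)}{(k-\bar E_1)(k-\bar E_2)}\right)^{1/4}$ on $\mathbb C\setminus\Sigma$, with $\nu(\infty)=1$, and let $\hat\nu(k^\pm)=\pm\nu(k)^2$. Let $P_1$ be the zero of $\hat\nu-1$ on $\tilde M$ other than $\infty^+$; it lies on the upper sheet over $k=\operatorname{Im}(E_1E_2)/\operatorname{Im}(E_1+E_2)$. Set $\tilde d=\tilde\varphi(P_1)+\frac12(1+\tau)$. **Theorem (Solution of the model RH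 problem).** For all real constants $\Omega_1,\omega_1$ and all $t\ge0$, there is a unique $2\times2$-matrix-valued function $m^{\mathrm{mod}}$ on $\mathbb C\setminus\Sigma$ such that $m^{\mathrm{mod}}\in I+\dot E^2(\hat{\mathbb C}\setminus\Sigma)$ and $m^{\mathrm{mod}}_+=m^{\mathrm{mod}}_-v^{\mathrm{mod}}$ a.e. on $\Sigma$, where $$v^{\mathrm{mod}}=\begin{pmatrix}0&ie^{-2i(t\Omega_1+\omega_1)}\\ ie^{2i(t\Omega_1+\omega_1)}&0\end{pmatrix}\ \text{on }\Sigma_1,\qquad v^{\mathrm{mod}}=\begin{pmatrix}0&i\\ i&0\end{pmatrix}\ \text{on }\Sigma_2 .$$ Moreover, with $\tilde v=-\frac1\pi(t\Omega_1+\omega_1)$, $$\lim_{k\to\infty}k\,(m^{\mathrm{mod}}(k))_{12}=-\frac i2\operatorname{Im}(E_1+E_2)\,\frac{\tilde\Theta(\tilde\varphi(\infty^+)+\tilde d)\,\tilde\Theta(\tilde\varphi(\infty^+)-\tilde v-\tilde d)}{\tilde\Theta(\tilde\varphi(\infty^+)+\tilde v+\tilde d)\,\tilde\Theta(\tilde\varphi(\infty^+)-\tilde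 d)},$$ uniformly with respect to $\arg k\in[0,2\pi]$. -/

import Mathlib

open Complex Filter Topology MeasureTheory Set
open scoped ComplexConjugate

noncomputable section

namespace ModelRH

/-- The vertical segment `[conj E, E]` (for `0 < E.im`); it is oriented upward. -/
def cut (E : ℂ) : Set ℂ := segment ℝ (conj E) E

/-- The jump contour `Σ^mod = Σ₁ ∪ Σ₂`. -/
def contour (E₁ E₂ : ℂ) : Set ℂ := cut E₁ ∪ cut E₂

/-! ### The genus one surface `w² = (k - E₁)(k - conj E₁)(k - E₂)(k - conj E₂)` -/

/-- The branch of `√((k - E)(k - conj E))` that is analytic off the segment `[conj E, E]` and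
is asymptotic to `k` at infinity. -/
def rootFactor (E k : ℂ) : ℂ :=
  (k - (E.re : ℂ)) * (1 + ((E.im : ℂ) / (k - (E.re : ℂ))) ^ 2) ^ ((1 : ℂ) / 2)

/-- The function `w̃` on `ℂ \ Σ^mod`, positive for large positive `k`. The upper sheet of the
surface consists of the points `k⁺ = (k, w̃ k)`, the lower sheet of the points
`k⁻ = (k, - w̃ k)`. -/
def wTilde (E₁ E₂ k : ℂ) : ℂ := rootFactor E₁ k * rootFactor E₂ k

theorem rootFactor_sq (E k : ℂ) (hk : k ≠ (E.re : ℂ)) :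
    rootFactor E k ^ 2 = (k - E) * (k - conj E) := by
  have h0 : k - (E.re : ℂ) ≠ 0 := sub_ne_zero.mpr hk
  have h1 : ∀ z : ℂ, (z ^ ((1 : ℂ) / 2)) ^ 2 = z := by
    intro z
    rw [← Complex.cpow_nat_mul]
    norm_num
  have h2 : E = (E.re : ℂ) + (E.im : ℂ) * I := (Complex.re_add_im E).symm
  have h3 : conj E = (E.re : ℂ) - (E.im : ℂ) * I := by
    apply Complex.ext <;> simp
  have h4 : (k - E) * (k - conj E) = (k - (E.re : ℂ)) ^ 2 + (E.im : ℂ) ^ 2 := by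
    rw [h3]
    nth_rewrite 1 [h2]
    linear_combination (-(E.im : ℂ) ^ 2) * I_sq
  rw [rootFactor, mul_pow, h1, h4]
  field_simp

theorem wTilde_sq (E₁ E₂ k : ℂ) (h₁ : k ≠ (E₁.re : ℂ)) (h₂ : k ≠ (E₂.re : ℂ)) :
    wTilde E₁ E₂ k ^ 2 = (k - E₁) * (k - conj E₁) * ((k - E₂) * (k - conj E₂)) := by
  rw [wTilde, mul_pow, rootFactor_sq E₁ k h₁, rootFactor_sq E₂ k h₂]

/-- `∫ f(s) ds` along the oriented straight segment from `a` to `b`. -/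
def segInt (f : ℂ → ℂ) (a b : ℂ) : ℂ :=
  ∫ s in (0 : ℝ)..1, f (a + (s : ℂ) * (b - a)) * (b - a)

/-- `∫ f(s) ds` along the ray from `a` to infinity in direction `v`. -/
def rayInt (f : ℂ → ℂ) (a v : ℂ) : ℂ :=
  ∫ s in Set.Ioi (0 : ℝ), f (a + (s : ℂ) * v) * v

/-- The holomorphic differential `dk / w`, on the upper sheet. -/
def form (E₁ E₂ k : ℂ) : ℂ := 1 / wTilde E₁ E₂ k

/-- The integral of `dk / w` over the cycle `a₁`, represented by the boundary of a rectangle on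
the upper sheet which goes once counterclockwise around `Σ₁` and leaves `Σ₂` outside. -/
def aPeriod (E₁ E₂ : ℂ) : ℂ :=
  let l : ℝ := E₁.re - 1
  let r : ℝ := (E₁.re + E₂.re) / 2
  let h : ℝ := E₁.im + 1
  segInt (form E₁ E₂) (l - h * I) (r - h * I) + segInt (form E₁ E₂) (r - h * I) (r + h * I) +
    segInt (form E₁ E₂) (r + h * I) (l + h * I) + segInt (form E₁ E₂) (l + h * I) (l - h * I)

/-- The normalized holomorphic differential `ζ̃`, with `∫_{a₁} ζ̃ = 1`, on the upper sheet. -/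
def zeta (E₁ E₂ k : ℂ) : ℂ := (aPeriod E₁ E₂)⁻¹ * form E₁ E₂ k

/-- The period `τ = ∫_{b₁} ζ̃`. The cycle `b₁` runs on the upper sheet from `conj E₂` (on `Σ₂`) to
`conj E₁` (on `Σ₁`) and back on the lower sheet, where `ζ̃` has the opposite sign. -/
def tau (E₁ E₂ : ℂ) : ℂ :=
  segInt (zeta E₁ E₂) (conj E₂) (conj E₁) + segInt (fun k => - zeta E₁ E₂ k) (conj E₁) (conj E₂)

/-- The Riemann theta function `Θ̃ z = ∑ n, exp (2πi (n² τ / 2 + n z))`. -/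
def theta (E₁ E₂ z : ℂ) : ℂ := jacobiTheta₂ z (tau E₁ E₂)

theorem theta_eq (E₁ E₂ z : ℂ) :
    theta E₁ E₂ z = ∑' n : ℤ, cexp (2 * Real.pi * I *
      ((1 / 2 : ℂ) * (n : ℂ) ^ 2 * tau E₁ E₂ + (n : ℂ) * z)) := by
  unfold theta jacobiTheta₂ jacobiTheta₂_term
  congr 1
  funext n
  congr 1
  ring

/-- The Abel map `φ̃(k⁺) = ∫ ζ̃` from `conj E₂` to `k⁺` along the straight segment on the upper
sheet; to be used when this segment meets `Σ^mod` in `conj E₂` only. On the upper sheet, another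
path changes the value by an integer, and `Θ̃` has period `1`. -/
def abelMap (E₁ E₂ k : ℂ) : ℂ := segInt (zeta E₁ E₂) (conj E₂) k

/-- The value `φ̃(∞⁺)` of the Abel map, along the vertical ray on the upper sheet that goes from
`conj E₂` downward to infinity. -/
def abelInfty (E₁ E₂ : ℂ) : ℂ := rayInt (zeta E₁ E₂) (conj E₂) (-I)

/-- `ν(k)`, the fourth root of `(k - E₁)(k - E₂) / ((k - conj E₁)(k - conj E₂))` that is analytic
off `Σ^mod` and tends to `1` at infinity (principal branches: each quotient is a nonpositive real
or has vanishing denominator exactly when `k` is on the corresponding segment). The meromorphic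
function `ν̂` on the surface is `ν²` on the upper and `-ν²` on the lower sheet. -/
def nu (E₁ E₂ k : ℂ) : ℂ :=
  ((k - E₁) / (k - conj E₁)) ^ ((1 : ℂ) / 4) * ((k - E₂) / (k - conj E₂)) ^ ((1 : ℂ) / 4)

/-- The projection `Im (E₁ E₂) / Im (E₁ + E₂)` to the `k`-plane of the zero `P₁ ≠ ∞⁺` of `ν̂ - 1`.
By the facts that follow, `P₁` lies on the upper sheet, off the branch cuts, and is the only
zero of `ν̂ - 1` besides `∞⁺` (over the branch cuts, `ν̂ = 1` would force `ν̂² = 1`). -/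
def P₁ (E₁ E₂ : ℂ) : ℂ := (((E₁ * E₂).im / (E₁ + E₂).im : ℝ) : ℂ)

theorem nuHat_sq_eq_one_iff {E₁ E₂ : ℂ} (h₁ : 0 < E₁.im) (h₂ : 0 < E₂.im) (k : ℂ) :
    (k - E₁) * (k - E₂) = (k - conj E₁) * (k - conj E₂) ↔ k = P₁ E₁ E₂ := by
  have hS : (((E₁ + E₂).im : ℝ) : ℂ) ≠ 0 := by
    rw [Complex.ofReal_ne_zero, Complex.add_im]
    positivity
  have e1 := Complex.sub_conj (E₁ + E₂)
  have e2 := Complex.sub_conj (E₁ * E₂)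
  rw [map_add] at e1
  rw [map_mul] at e2
  have h2I : (2 : ℂ) * I ≠ 0 := mul_ne_zero two_ne_zero I_ne_zero
  unfold P₁
  rw [Complex.ofReal_div, eq_div_iff hS]
  push_cast at e1 e2 hS ⊢
  constructor
  · intro h
    apply mul_left_cancel₀ h2I
    linear_combination -h - k * e1 + e2
  · intro h
    linear_combination -(2 * I) * h - k * e1 + e2

theorem re_eq_of_mem_cut {E k : ℂ} (hk : k ∈ cut E) : k.re = E.re := by
  obtain ⟨a, b, -, -, hab, rfl⟩ := hk
  simp
  linear_combination E.re * hab

theorem P₁_notMem_contour {E₁ E₂ : ℂ} (h₁ : 0 < E₁.im) (h₂ : 0 < E₂.im) (h : E₁.re < E₂.re) :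
    P₁ E₁ E₂ ∉ contour E₁ E₂ := by
  have hS : 0 < (E₁ + E₂).im := by rw [Complex.add_im]; positivity
  have hp : (P₁ E₁ E₂).re * (E₁ + E₂).im = (E₁ * E₂).im := by
    rw [P₁, Complex.ofReal_re]
    field_simp
  rw [Complex.add_im, Complex.mul_im] at hp
  have hd : 0 < E₂.re - E₁.re := sub_pos.mpr h
  rintro (hk | hk)
  · rw [re_eq_of_mem_cut hk] at hp
    nlinarith [mul_pos hd h₁]
  · rw [re_eq_of_mem_cut hk] at hp
    nlinarith [mul_pos hd h₂]

theorem mem_cut_of_div_nonpos {E k : ℂ} {x : ℝ} (hx : x ≤ 0)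
    (hk : (k - E) / (k - conj E) = (x : ℂ)) (hk' : k ≠ conj E) : k ∈ cut E := by
  have h0 : k - conj E ≠ 0 := sub_ne_zero.mpr hk'
  rw [div_eq_iff h0] at hk
  have hx1 : (0 : ℝ) < 1 - x := by linarith
  have hx2 : (1 : ℂ) - (x : ℂ) ≠ 0 := by
    rw [← Complex.ofReal_one, ← Complex.ofReal_sub]
    exact Complex.ofReal_ne_zero.mpr hx1.ne'
  refine ⟨-x / (1 - x), 1 / (1 - x), by apply div_nonneg <;> linarith, by positivity,
    by field_simp; ring, ?_⟩
  rw [Complex.real_smul, Complex.real_smul]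
  push_cast
  field_simp
  linear_combination -hk

theorem ne_conj_of_notMem_cut {E k : ℂ} (hk : k ∉ cut E) : k ≠ conj E := by
  rintro rfl
  exact hk (left_mem_segment ℝ _ _)

theorem ne_of_notMem_cut {E k : ℂ} (hk : k ∉ cut E) : k ≠ E := by
  rintro rfl
  exact hk (right_mem_segment ℝ _ _)

theorem nu_pow_four {E₁ E₂ : ℂ} (k : ℂ) : nu E₁ E₂ k ^ 4 =
    (k - E₁) / (k - conj E₁) * ((k - E₂) / (k - conj E₂)) := by
  have h1 : ∀ z : ℂ, (z ^ ((1 : ℂ) / 4)) ^ 4 = z := by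
    intro z
    rw [← Complex.cpow_nat_mul]
    norm_num
  rw [nu, mul_pow, h1, h1]

theorem eq_P₁_of_nu_pow_four {E₁ E₂ : ℂ} (h₁ : 0 < E₁.im) (h₂ : 0 < E₂.im) {k : ℂ}
    (hk : k ∉ contour E₁ E₂) (h4 : nu E₁ E₂ k ^ 4 = 1) : k = P₁ E₁ E₂ := by
  have hk1 := sub_ne_zero.mpr (ne_conj_of_notMem_cut fun h' => hk (Or.inl h'))
  have hk2 := sub_ne_zero.mpr (ne_conj_of_notMem_cut fun h' => hk (Or.inr h'))
  rw [nu_pow_four, div_mul_div_comm, div_eq_one_iff_eq (mul_ne_zero hk1 hk2)] at h4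
  exact (nuHat_sq_eq_one_iff h₁ h₂ k).mp h4

theorem nu_P₁_sq {E₁ E₂ : ℂ} (h₁ : 0 < E₁.im) (h₂ : 0 < E₂.im) (h : E₁.re < E₂.re) :
    nu E₁ E₂ (P₁ E₁ E₂) ^ 2 = 1 := by
  have hP := P₁_notMem_contour h₁ h₂ h
  set k := P₁ E₁ E₂ with hkdef
  have hn1 : k ∉ cut E₁ := fun h' => hP (Or.inl h')
  have hn2 : k ∉ cut E₂ := fun h' => hP (Or.inr h')
  have hc1 := sub_ne_zero.mpr (ne_conj_of_notMem_cut hn1)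
  have hc2 := sub_ne_zero.mpr (ne_conj_of_notMem_cut hn2)
  have hd1 := sub_ne_zero.mpr (ne_of_notMem_cut hn1)
  have hd2 := sub_ne_zero.mpr (ne_of_notMem_cut hn2)
  have hinv : (k - E₂) / (k - conj E₂) = ((k - E₁) / (k - conj E₁))⁻¹ := by
    have := (nuHat_sq_eq_one_iff h₁ h₂ k).mpr rfl
    rw [inv_div, div_eq_div_iff hc2 hd1]
    linear_combination this
  have harg : ((k - E₁) / (k - conj E₁)).arg ≠ Real.pi := by
    intro ha
    rw [Complex.arg_eq_pi_iff] at ha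
    refine hn1 (mem_cut_of_div_nonpos (x := ((k - E₁) / (k - conj E₁)).re) ha.1.le ?_
      (ne_conj_of_notMem_cut hn1))
    apply Complex.ext <;> simp [ha.2]
  have hne : ((k - E₁) / (k - conj E₁)) ^ ((1 : ℂ) / 4) ≠ 0 := by
    rw [Complex.cpow_ne_zero_iff]
    exact Or.inl (div_ne_zero hd1 hc1)
  rw [nu, hinv, Complex.inv_cpow _ _ harg, mul_inv_cancel₀ hne, one_pow]

/-- Off the branch cuts, the only zero of `ν̂ - 1` on the upper sheet is over `P₁`. -/
theorem nu_sq_eq_one_iff {E₁ E₂ : ℂ} (h₁ : 0 < E₁.im) (h₂ : 0 < E₂.im) (h : E₁.re < E₂.re)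
    {k : ℂ} (hk : k ∉ contour E₁ E₂) : nu E₁ E₂ k ^ 2 = 1 ↔ k = P₁ E₁ E₂ := by
  constructor
  · intro h2
    apply eq_P₁_of_nu_pow_four h₁ h₂ hk
    linear_combination (nu E₁ E₂ k ^ 2 + 1) * h2
  · rintro rfl
    exact nu_P₁_sq h₁ h₂ h

/-- Off the branch cuts, `ν̂ - 1` has no zero on the lower sheet. -/
theorem neg_nu_sq_ne_one {E₁ E₂ : ℂ} (h₁ : 0 < E₁.im) (h₂ : 0 < E₂.im) (h : E₁.re < E₂.re)
    {k : ℂ} (hk : k ∉ contour E₁ E₂) : -nu E₁ E₂ k ^ 2 ≠ 1 := by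
  intro h2
  have hP : k = P₁ E₁ E₂ := by
    apply eq_P₁_of_nu_pow_four h₁ h₂ hk
    linear_combination (-nu E₁ E₂ k ^ 2 + 1) * h2
  rw [hP, nu_P₁_sq h₁ h₂ h] at h2
  norm_num at h2

/-- The constant `d̃ = φ̃(P₁) + (1 + τ) / 2`. -/
def dTilde (E₁ E₂ : ℂ) : ℂ := abelMap E₁ E₂ (P₁ E₁ E₂) + (1 / 2) * (1 + tau E₁ E₂)

/-- The real number `ṽ = -(t Ω₁ + ω₁) / π`. -/
def vTilde (Ω₁ ω₁ t : ℝ) : ℝ := -(1 / Real.pi) * (t * Ω₁ + ω₁)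

/-! ### The Riemann-Hilbert problem -/

/-- For `r > 0`, the ellipse with foci `E` and `conj E` and semi-axes `E.im * cosh r`
(vertical) and `E.im * sinh r` (horizontal), parametrized by `θ ∈ [0, 2π]`. It surrounds the
segment `[conj E, E]` and shrinks to it as `r → 0`. -/
def ellipse (E : ℂ) (r θ : ℝ) : ℂ := E.re + E.im * I * Complex.cosh (r + θ * I)

/-- The square of the norm of `f` in `L²` of the ellipse with respect to arc length. -/
def ellipseNormSq (f : ℂ → ℂ) (E : ℂ) (r : ℝ) : ℝ :=
  ∫ θ in (0 : ℝ)..(2 * Real.pi), ‖f (ellipse E r θ)‖ ^ 2 * ‖deriv (ellipse E r) θ‖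

/-- The Smirnoff class `Ė²(D)` of `D = Ĉ \ Σ^mod` (`∞ ∈ D`): `f` is analytic in `D`, vanishes
at `∞`, and there are curves `Cₙ` in `D` that eventually surround each compact subset of `D`, on
which the `L²` norms of `f` are bounded. As usual the curves are taken among the level curves of
the conformal maps of the complements of the boundary components onto the exterior of a disk:
`Cₙ` consists of an ellipse with foci `E₁`, `conj E₁` and an ellipse with foci `E₂`, `conj E₂`,
which shrink to `Σ₁` and `Σ₂` as `n → ∞`. -/
def IsSmirnoff (E₁ E₂ : ℂ) (f : ℂ → ℂ) : Prop :=
  DifferentiableOn ℂ f (contour E₁ E₂)ᶜ ∧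
  Tendsto f (Bornology.cobounded ℂ) (𝓝 0) ∧
  ∃ r₁ r₂ : ℕ → ℝ,
    (∀ n, 0 < r₁ n ∧ 0 < r₂ n) ∧ Tendsto r₁ atTop (𝓝 0) ∧ Tendsto r₂ atTop (𝓝 0) ∧
    (∀ n θ, ellipse E₁ (r₁ n) θ ∉ contour E₁ E₂ ∧ ellipse E₂ (r₂ n) θ ∉ contour E₁ E₂) ∧
    ∃ M : ℝ, ∀ n, ellipseNormSq f E₁ (r₁ n) + ellipseNormSq f E₂ (r₂ n) ≤ M

/-- `L` is the nontangential limit of `m` at the point `k` of an upward oriented vertical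
segment, from the left (`+`) side. -/
def IsLeftValue (m : ℂ → Matrix (Fin 2) (Fin 2) ℂ) (k : ℂ) (L : Matrix (Fin 2) (Fin 2) ℂ) : Prop :=
  ∀ α : ℝ, 0 < α → Tendsto m (𝓝[{z : ℂ | z.re < k.re ∧ |z.im - k.im| < α * (k.re - z.re)}] k) (𝓝 L)

/-- `L` is the nontangential limit of `m` at the point `k` of an upward oriented vertical
segment, from the right (`-`) side. -/
def IsRightValue (m : ℂ → Matrix (Fin 2) (Fin 2) ℂ) (k : ℂ) (L : Matrix (Fin 2) (Fin 2) ℂ) : Prop :=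
  ∀ α : ℝ, 0 < α → Tendsto m (𝓝[{z : ℂ | k.re < z.re ∧ |z.im - k.im| < α * (z.re - k.re)}] k) (𝓝 L)

/-- The boundary values of `m` on the segment `[conj E, E]` exist and satisfy `m₊ = m₋ v`, almost
everywhere with respect to arc length. -/
def HasJump (m : ℂ → Matrix (Fin 2) (Fin 2) ℂ) (E : ℂ) (v : Matrix (Fin 2) (Fin 2) ℂ) : Prop :=
  ∀ᵐ y : ℝ ∂(volume.restrict (Set.Icc (-E.im) E.im)),
    ∃ mPlus mMinus : Matrix (Fin 2) (Fin 2) ℂ,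
      IsLeftValue m (E.re + y * I) mPlus ∧ IsRightValue m (E.re + y * I) mMinus ∧
      mPlus = mMinus * v

/-- The jump matrix on `Σ₁`. -/
def jump₁ (Ω₁ ω₁ t : ℝ) : Matrix (Fin 2) (Fin 2) ℂ :=
  !![0, I * cexp (-2 * I * (t * Ω₁ + ω₁)); I * cexp (2 * I * (t * Ω₁ + ω₁)), 0]

/-- The jump matrix on `Σ₂`. -/
def jump₂ : Matrix (Fin 2) (Fin 2) ℂ := !![0, I; I, 0]

/-- `m` solves the model Riemann-Hilbert problem. Only the values of `m` off `Σ^mod` matter. -/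
structure IsModelSolution (E₁ E₂ : ℂ) (Ω₁ ω₁ t : ℝ) (m : ℂ → Matrix (Fin 2) (Fin 2) ℂ) :
    Prop where
  smirnoff : ∀ i j, IsSmirnoff E₁ E₂ (fun k => m k i j - (1 : Matrix (Fin 2) (Fin 2) ℂ) i j)
  jump_one : HasJump m E₁ (jump₁ Ω₁ ω₁ t)
  jump_two : HasJump m E₂ jump₂

end ModelRH

end

noncomputable section

namespace ModelRH

/-! ### The factors of the square root -/

/-! The solution is written down with theta functions of the Abel map `φ`, and uniqueness is a
Liouville argument. Near a cut with end point `E` both parts use the coordinate `z` of `k = E.re + i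
E.im cosh z` (`ellMap`). Vertical lines become confocal ellipses, the imaginary axis covers the cut
twice, `θ ∈ (0, π)` is its left side and `θ ∈ (π, 2π)` its right side, and `z ↦ 2πi - z` exchanges
the two boundary points over one point of the cut. As `rootFactor E` is the derivative of `ellMap E`
(`rootFactor_ellMap`), the differential `dk/w` is regular on the imaginary axis, and its primitive
continues across it (`locPrim`).

Existence. Under `z ↦ 2πi - z` the Abel map turns into `τ - φ` at `Σ₁` and into `-φ` at `Σ₂`
(`abelLeft_reflect`, `abelRight_reflect`), while `ν₊ = i ν₋` (`nuLoc_reflect`). As `Θ̃` is even and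
quasi-periodic, `(ν + ν⁻¹) Θ̃(φ + v + d) / Θ̃(φ + d)` and `(ν - ν⁻¹) Θ̃(φ - v - d) / Θ̃(φ - d)` are
then exchanged across the cuts, up to exactly the factors of the jump matrix.

The denominators are the main difficulty. The product `Θ̃(φ + d) Θ̃(φ - d)`, times a factor
`outFactor` that absorbs the quasi-period, has no jump, grows linearly and vanishes at `P₁`; hence
it is a multiple of `k - P₁` (`exists_thetaProd_mul_eq`). So `Θ̃(φ + d)` has no zero off the cuts,
and the simple zero of `Θ̃(φ - d)` at `P₁` is cancelled by `ν - ν⁻¹`. At infinity, the Möbius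
involution exchanging `E₁` with `E₂` and `∞` with `P₁` gives `φ(∞) + φ(P₁) = τ/2`
(`abelInfty_add_abelMap_P₁`). This puts the arguments of the relevant theta values on lines on which
`Θ̃` has no zeros, because `τ` is purely imaginary.

Uniqueness. The constructed `m` has `|m|² |dk|` bounded by a multiple of `dθ` near the cuts. If `m'`
is another solution, the entries of `m' adj(m)` are bounded in `L²(dθ)` after multiplication by
`dk/dz`, and their boundary values agree on the two sides because the jump matrices have determinant
`1`. Such a function extends to an entire one (`exists_entire`), so `m' adj(m) = 1`. The case `m' =
m` shows that `adj(m)` inverts `m`, and `m' = m` follows. -/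

theorem mem_cut_iff {E k : ℂ} (hE : 0 < E.im) : k ∈ cut E ↔ k.re = E.re ∧ |k.im| ≤ E.im := by
  constructor
  · intro hk
    refine ⟨re_eq_of_mem_cut hk, ?_⟩
    obtain ⟨a, b, ha, hb, hab, rfl⟩ := hk
    simp only [add_im, smul_im, conj_im, smul_eq_mul]
    rw [abs_le]
    constructor <;> nlinarith
  · rintro ⟨h1, h2⟩
    rw [abs_le] at h2
    refine ⟨(E.im - k.im) / (2 * E.im), (E.im + k.im) / (2 * E.im),
      div_nonneg (by linarith) (by linarith), div_nonneg (by linarith) (by linarith),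
      by field_simp; ring, ?_⟩
    apply Complex.ext
    · simp only [add_re, smul_re, conj_re, smul_eq_mul]
      rw [h1]
      field_simp
      ring
    · simp only [add_im, smul_im, conj_im, smul_eq_mul]
      field_simp
      ring

theorem isClosed_cut (E : ℂ) : IsClosed (cut E) := by
  rw [cut, segment_eq_image]
  exact (isCompact_Icc.image (by fun_prop)).isClosed

theorem isClosed_contour (E₁ E₂ : ℂ) : IsClosed (contour E₁ E₂) :=
  (isClosed_cut E₁).union (isClosed_cut E₂)

theorem isOpen_compl_contour (E₁ E₂ : ℂ) : IsOpen (contour E₁ E₂)ᶜ :=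
  (isClosed_contour E₁ E₂).isOpen_compl

theorem conj_mem_cut {E k : ℂ} (hE : 0 < E.im) : conj k ∈ cut E ↔ k ∈ cut E := by
  simp [mem_cut_iff hE]

theorem ne_center_of_notMem_cut {E k : ℂ} (hE : 0 < E.im) (hk : k ∉ cut E) :
    k - (E.re : ℂ) ≠ 0 := by
  intro h
  apply hk
  rw [sub_eq_zero.mp h, mem_cut_iff hE]
  simp [hE.le]

theorem re_ne_or_of_notMem_cut {E k : ℂ} (hE : 0 < E.im) (hk : k ∉ cut E) :
    k.re ≠ E.re ∨ E.im < |k.im| := by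
  rw [mem_cut_iff hE] at hk
  by_cases h : k.re = E.re
  · right
    by_contra! h'
    exact hk ⟨h, h'⟩
  · exact Or.inl h

/-- The argument of the principal root in `rootFactor` is a nonpositive real only if `(k - E.re)²`
lies in `[-E.im², 0)`, that is, only on the cut. The analyticity of the root off the cut rests on
this. -/
theorem one_add_sq_mem_slitPlane {E k : ℂ} (hE : 0 < E.im) (hk : k ∉ cut E) :
    1 + ((E.im : ℂ) / (k - (E.re : ℂ))) ^ 2 ∈ slitPlane := by
  have hne := ne_center_of_notMem_cut hE hk
  rw [mem_slitPlane_iff_not_le_zero]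
  intro h
  rw [Complex.le_def] at h
  set x := (1 + ((E.im : ℂ) / (k - (E.re : ℂ))) ^ 2).re with hx
  have h1 : 1 + ((E.im : ℂ) / (k - (E.re : ℂ))) ^ 2 = (x : ℂ) := by
    apply Complex.ext
    · simp [hx]
    · simpa using h.2
  have hx0 : x ≤ 0 := by simpa [hx] using h.1
  have h2 : (E.im : ℂ) ^ 2 = ((x : ℂ) - 1) * (k - (E.re : ℂ)) ^ 2 := by
    rw [← h1]
    field_simp
    ring
  have hre := congrArg Complex.re h2
  have him := congrArg Complex.im h2
  simp [pow_two] at hre him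
  rcases re_ne_or_of_notMem_cut hE hk with h' | h'
  · rcases him with h3 | h3
    · linarith
    · have h4 : k.im = 0 := by
        have : (k.re - E.re) * k.im = 0 := by linarith
        exact (mul_eq_zero.mp this).resolve_left (sub_ne_zero.mpr h')
      rw [h4] at hre
      nlinarith [mul_pos hE hE, mul_self_nonneg (k.re - E.re)]
  · by_cases h5 : k.re = E.re
    · rw [h5] at hre
      have : E.im * E.im = (1 - x) * (|k.im| * |k.im|) := by
        rw [abs_mul_abs_self]
        linarith
      nlinarith [mul_pos hE hE, mul_self_nonneg (|k.im|)]
    · rcases him with h3 | h3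
      · linarith
      · have h4 : k.im = 0 := by
          have : (k.re - E.re) * k.im = 0 := by linarith
          exact (mul_eq_zero.mp this).resolve_left (sub_ne_zero.mpr h5)
        rw [h4] at h'
        simp at h'
        linarith

theorem rootFactor_sq' {E k : ℂ} (hE : 0 < E.im) (hk : k ∉ cut E) :
    rootFactor E k ^ 2 = (k - (E.re : ℂ)) ^ 2 + (E.im : ℂ) ^ 2 := by
  rw [rootFactor_sq E k (sub_ne_zero.mp (ne_center_of_notMem_cut hE hk))]
  have h2 : E = (E.re : ℂ) + (E.im : ℂ) * I := (Complex.re_add_im E).symm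
  have h3 : conj E = (E.re : ℂ) - (E.im : ℂ) * I := by
    apply Complex.ext <;> simp
  rw [h3]
  nth_rewrite 1 [h2]
  linear_combination (-(E.im : ℂ) ^ 2) * I_sq

theorem rootFactor_ne_zero {E k : ℂ} (hE : 0 < E.im) (hk : k ∉ cut E) : rootFactor E k ≠ 0 := by
  intro h
  have h1 := rootFactor_sq E k (sub_ne_zero.mp (ne_center_of_notMem_cut hE hk))
  rw [h] at h1
  have h2 := mul_ne_zero (sub_ne_zero.mpr (ne_of_notMem_cut hk))
    (sub_ne_zero.mpr (ne_conj_of_notMem_cut hk))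
  exact h2 (by simpa using h1.symm)

theorem differentiableAt_rootFactor {E k : ℂ} (hE : 0 < E.im) (hk : k ∉ cut E) :
    DifferentiableAt ℂ (rootFactor E) k := by
  have hne := ne_center_of_notMem_cut hE hk
  have := one_add_sq_mem_slitPlane hE hk
  unfold rootFactor
  refine DifferentiableAt.mul (by fun_prop) (DifferentiableAt.cpow_const ?_ this)
  refine DifferentiableAt.add (by fun_prop) (DifferentiableAt.pow ?_ 2)
  exact DifferentiableAt.div (by fun_prop) (by fun_prop) hne

theorem hasDerivAt_rootFactor {E k : ℂ} (hE : 0 < E.im) (hk : k ∉ cut E) :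
    HasDerivAt (rootFactor E) ((k - (E.re : ℂ)) / rootFactor E k) k := by
  have h1 := (differentiableAt_rootFactor hE hk).hasDerivAt
  have h2 := h1.pow 2
  have h3 : HasDerivAt (fun k : ℂ => (k - (E.re : ℂ)) ^ 2 + (E.im : ℂ) ^ 2)
      (2 * (k - (E.re : ℂ))) k := by
    have := (((hasDerivAt_id k).sub_const (E.re : ℂ)).pow 2).add_const ((E.im : ℂ) ^ 2)
    simpa using this
  have h4 : (rootFactor E ^ 2) =ᶠ[𝓝 k] (fun k : ℂ => (k - (E.re : ℂ)) ^ 2 + (E.im : ℂ) ^ 2) := by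
    filter_upwards [(isClosed_cut E).isOpen_compl.mem_nhds hk] with x hx
    exact rootFactor_sq' hE hx
  have h5 := (h3.congr_of_eventuallyEq h4).unique h2
  have hR := rootFactor_ne_zero hE hk
  have h6 : deriv (rootFactor E) k = (k - (E.re : ℂ)) / rootFactor E k := by
    rw [eq_div_iff hR]
    simp at h5
    linear_combination -h5 / 2
  rwa [h6] at h1

theorem rootFactor_conj {E k : ℂ} (hE : 0 < E.im) (hk : k ∉ cut E) :
    rootFactor E (conj k) = conj (rootFactor E k) := by
  have := one_add_sq_mem_slitPlane hE hk
  rw [mem_slitPlane_iff_arg] at this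
  unfold rootFactor
  rw [map_mul, map_sub, conj_ofReal]
  congr 1
  have h2 : (1 : ℂ) / 2 = conj ((1 : ℂ) / 2) := by
    rw [map_div₀, map_one, Complex.conj_ofNat]
  have h3 := Complex.conj_cpow _ ((1 : ℂ) / 2) this.1
  rw [← h2] at h3
  rw [← h3]
  simp

theorem rootFactor_re_mul_im {E k : ℂ} (hE : 0 < E.im) (hk : k ∉ cut E) :
    (rootFactor E k).re * (rootFactor E k).im = (k.re - E.re) * k.im := by
  have h := congrArg Complex.im (rootFactor_sq' hE hk)
  simp [pow_two] at h
  linarith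

/-- The principal square root has positive real part, so `rootFactor E k` makes an acute angle with
`k - E.re`. Together with `rootFactor_re_mul_im` this determines the signs of its real and imaginary
parts. -/
theorem rootFactor_inner_pos {E k : ℂ} (hE : 0 < E.im) (hk : k ∉ cut E) :
    0 < (k.re - E.re) * (rootFactor E k).re + k.im * (rootFactor E k).im := by
  have hne := ne_center_of_notMem_cut hE hk
  have h1 := one_add_sq_mem_slitPlane hE hk
  set u := 1 + ((E.im : ℂ) / (k - (E.re : ℂ))) ^ 2 with hu
  have hre : 0 < (u ^ ((1 : ℂ) / 2)).re := by
    have hu0 : u ≠ 0 := slitPlane_ne_zero h1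
    rw [cpow_def_of_ne_zero hu0, exp_re]
    have him : (log u * (1 / 2)).im = u.arg / 2 := by
      rw [show log u * (1 / 2) = ((1 / 2 : ℝ) : ℂ) * log u by push_cast; ring, im_ofReal_mul,
        log_im]
      ring
    rw [him]
    have h3 := neg_pi_lt_arg u
    have h4 := lt_of_le_of_ne (arg_le_pi u) (mem_slitPlane_iff_arg.mp h1).1
    exact mul_pos (Real.exp_pos _) (Real.cos_pos_of_mem_Ioo ⟨by linarith, by linarith⟩)
  have h5 : (k.re - E.re) * (rootFactor E k).re + k.im * (rootFactor E k).im =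
      normSq (k - (E.re : ℂ)) * (u ^ ((1 : ℂ) / 2)).re := by
    unfold rootFactor
    rw [← hu]
    simp [normSq_apply]
    ring
  rw [h5]
  exact mul_pos (normSq_pos.mpr hne) hre

theorem norm_rootFactor_sq {E k : ℂ} (hE : 0 < E.im) (hk : k ∉ cut E) :
    ‖rootFactor E k‖ ^ 2 = ‖k - E‖ * ‖k - conj E‖ := by
  rw [← norm_pow, rootFactor_sq E k (sub_ne_zero.mp (ne_center_of_notMem_cut hE hk)), norm_mul]

theorem rootFactor_re_pos {E k : ℂ} (hE : 0 < E.im) (hk : E.re < k.re) :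
    0 < (rootFactor E k).re := by
  have hc : k ∉ cut E := fun h => hk.ne' (re_eq_of_mem_cut h)
  have h1 := rootFactor_inner_pos hE hc
  have h2 := rootFactor_re_mul_im hE hc
  by_contra! h3
  set x := (rootFactor E k).re
  set y := (rootFactor E k).im
  rcases h3.eq_or_lt with h0 | h0
  · rw [h0] at h2
    have : k.im = 0 := by
      have h4 : (k.re - E.re) * k.im = 0 := by linarith
      exact (mul_eq_zero.mp h4).resolve_left (by linarith)
    rw [h0, this] at h1
    simp at h1
  · have h5 : 0 < k.im * y := by nlinarith
    have h6 : x * (k.im * y) = (k.re - E.re) * k.im ^ 2 := by linear_combination k.im * h2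
    nlinarith [mul_pos (neg_pos.mpr h0) h5, mul_nonneg (sub_pos.mpr hk).le (sq_nonneg k.im)]

theorem rootFactor_re_neg {E k : ℂ} (hE : 0 < E.im) (hk : k.re < E.re) :
    (rootFactor E k).re < 0 := by
  have hc : k ∉ cut E := fun h => hk.ne (re_eq_of_mem_cut h)
  have h1 := rootFactor_inner_pos hE hc
  have h2 := rootFactor_re_mul_im hE hc
  by_contra! h3
  set x := (rootFactor E k).re
  set y := (rootFactor E k).im
  rcases h3.eq_or_lt with h0 | h0
  · rw [← h0] at h2
    have : k.im = 0 := by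
      have h4 : (k.re - E.re) * k.im = 0 := by linarith
      exact (mul_eq_zero.mp h4).resolve_left (by linarith)
    rw [← h0, this] at h1
    simp at h1
  · have h5 : 0 < k.im * y := by nlinarith
    have h6 : x * (k.im * y) = (k.re - E.re) * k.im ^ 2 := by linear_combination k.im * h2
    nlinarith [mul_pos h0 h5, mul_nonneg (sub_pos.mpr hk).le (sq_nonneg k.im)]

theorem rootFactor_below {E k : ℂ} (hE : 0 < E.im) (hre : k.re = E.re) (him : k.im < -E.im) :
    (rootFactor E k).re = 0 ∧ (rootFactor E k).im < 0 := by
  have hc : k ∉ cut E := by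
    rw [mem_cut_iff hE, hre, abs_le]
    rintro ⟨-, h, -⟩
    linarith
  have h1 := rootFactor_inner_pos hE hc
  have h2 := rootFactor_re_mul_im hE hc
  rw [hre] at h1 h2
  have h3 : (rootFactor E k).im < 0 := by
    by_contra! h
    nlinarith
  refine ⟨?_, h3⟩
  have : (rootFactor E k).re * (rootFactor E k).im = 0 := by linarith
  exact (mul_eq_zero.mp this).resolve_right h3.ne

/-! ### The uniformization `k = E.re + i E.im cosh z` near a cut -/

/-- The map `z ↦ E.re + i E.im cosh z`, whose restriction to vertical lines parametrizes the
ellipses with foci `E`, `conj E`. -/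
def ellMap (E z : ℂ) : ℂ := E.re + E.im * I * Complex.cosh z

/-- The derivative of `ellMap`. -/
def ellMap' (E z : ℂ) : ℂ := E.im * I * Complex.sinh z

theorem ellipse_eq (E : ℂ) (r θ : ℝ) : ellipse E r θ = ellMap E (r + θ * I) := rfl

theorem hasDerivAt_ellMap (E z : ℂ) : HasDerivAt (ellMap E) (ellMap' E z) z :=
  ((hasDerivAt_cosh z).const_mul _).const_add _

theorem continuous_ellMap (E : ℂ) : Continuous (ellMap E) := by
  unfold ellMap
  fun_prop

theorem continuous_ellMap' (E : ℂ) : Continuous (ellMap' E) := by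
  unfold ellMap'
  fun_prop

theorem differentiable_ellMap (E : ℂ) : Differentiable ℂ (ellMap E) :=
  fun z => (hasDerivAt_ellMap E z).differentiableAt

theorem differentiable_ellMap' (E : ℂ) : Differentiable ℂ (ellMap' E) :=
  Complex.differentiable_sinh.const_mul _

theorem ellMap_neg (E z : ℂ) : ellMap E (-z) = ellMap E z := by simp [ellMap]

theorem ellMap'_neg (E z : ℂ) : ellMap' E (-z) = -ellMap' E z := by simp [ellMap']

theorem cosh_add_two_pi_I (z : ℂ) : cosh (z + 2 * Real.pi * I) = cosh z := by
  rw [← cos_mul_I, add_mul, show (2 : ℂ) * Real.pi * I * I = -(2 * Real.pi) by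
    linear_combination 2 * (Real.pi : ℂ) * I_mul_I, ← sub_eq_add_neg, cos_sub_two_pi, cos_mul_I]

theorem sinh_add_two_pi_I (z : ℂ) : sinh (z + 2 * Real.pi * I) = sinh z := by
  have h := sin_mul_I (z + 2 * Real.pi * I)
  rw [add_mul, show (2 : ℂ) * Real.pi * I * I = -(2 * Real.pi) by
    linear_combination 2 * (Real.pi : ℂ) * I_mul_I, ← sub_eq_add_neg, sin_sub_two_pi,
    sin_mul_I] at h
  exact (mul_right_cancel₀ I_ne_zero h).symm

theorem ellMap_add_period (E z : ℂ) : ellMap E (z + 2 * Real.pi * I) = ellMap E z := by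
  simp [ellMap, cosh_add_two_pi_I]

theorem ellMap'_add_period (E z : ℂ) : ellMap' E (z + 2 * Real.pi * I) = ellMap' E z := by
  simp [ellMap', sinh_add_two_pi_I]

theorem cosh_re' (z : ℂ) : (cosh z).re = Real.cosh z.re * Real.cos z.im := by
  conv_lhs => rw [← re_add_im z, cosh_add, cosh_mul_I, sinh_mul_I]
  simp [← ofReal_cosh, ← ofReal_sinh, ← ofReal_cos, ← ofReal_sin]

theorem cosh_im' (z : ℂ) : (cosh z).im = Real.sinh z.re * Real.sin z.im := by
  conv_lhs => rw [← re_add_im z, cosh_add, cosh_mul_I, sinh_mul_I]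
  simp [← ofReal_cosh, ← ofReal_sinh, ← ofReal_cos, ← ofReal_sin]

theorem ellMap_re (E z : ℂ) :
    (ellMap E z).re = E.re - E.im * (Real.sinh z.re * Real.sin z.im) := by
  simp [ellMap, cosh_im', cosh_re']
  ring

theorem ellMap_im (E z : ℂ) : (ellMap E z).im = E.im * (Real.cosh z.re * Real.cos z.im) := by
  simp [ellMap, cosh_im', cosh_re']

/-- Sum of the distances to the foci. -/
def focal (E k : ℂ) : ℝ := ‖k - E‖ + ‖k - conj E‖

theorem continuous_focal (E : ℂ) : Continuous (focal E) := by
  unfold focal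
  fun_prop

theorem norm_sq_sinh_add_cosh (z : ℂ) : ‖sinh z‖ ^ 2 + ‖cosh z‖ ^ 2 = Real.cosh (2 * z.re) := by
  have hs : (sinh z).re = Real.sinh z.re * Real.cos z.im ∧
      (sinh z).im = Real.cosh z.re * Real.sin z.im := by
    constructor
    · conv_lhs => rw [← re_add_im z, sinh_add, cosh_mul_I, sinh_mul_I]
      simp [← ofReal_cosh, ← ofReal_sinh, ← ofReal_cos, ← ofReal_sin]
    · conv_lhs => rw [← re_add_im z, sinh_add, cosh_mul_I, sinh_mul_I]
      simp [← ofReal_cosh, ← ofReal_sinh, ← ofReal_cos, ← ofReal_sin]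
  rw [← normSq_eq_norm_sq, ← normSq_eq_norm_sq, normSq_apply, normSq_apply, hs.1, hs.2, cosh_re',
    cosh_im', Real.cosh_two_mul]
  linear_combination (Real.sinh z.re ^ 2 + Real.cosh z.re ^ 2) * Real.sin_sq_add_cos_sq z.im

theorem ellMap_sub (E z : ℂ) : ellMap E z - E = 2 * (E.im * I) * sinh (z / 2) ^ 2 := by
  have h2 : E = (E.re : ℂ) + (E.im : ℂ) * I := (Complex.re_add_im E).symm
  have h := cosh_two_mul (z / 2)
  have h' := cosh_sq (z / 2)
  rw [mul_div_cancel₀ _ two_ne_zero] at h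
  nth_rewrite 2 [h2]
  rw [ellMap, h, h']
  ring

theorem ellMap_sub_conj (E z : ℂ) : ellMap E z - conj E = 2 * (E.im * I) * cosh (z / 2) ^ 2 := by
  have h3 : conj E = (E.re : ℂ) - (E.im : ℂ) * I := by
    apply Complex.ext <;> simp
  have h := cosh_two_mul (z / 2)
  have h' := cosh_sq (z / 2)
  rw [mul_div_cancel₀ _ two_ne_zero] at h
  rw [ellMap, h, h3]
  linear_combination -(E.im * I : ℂ) * h'

theorem ellMap'_eq (E z : ℂ) : ellMap' E z = 2 * (E.im * I) * (sinh (z / 2) * cosh (z / 2)) := by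
  have h := sinh_two_mul (z / 2)
  rw [mul_div_cancel₀ _ two_ne_zero] at h
  rw [ellMap', h]
  ring

/-- The differences to the foci are `2i E.im` times the squares of `sinh (z/2)` and `cosh (z/2)`, so
the focal sum depends on `z.re` only. Thus `z.re` labels the confocal ellipse through the point. -/
theorem focal_ellMap {E : ℂ} (hE : 0 < E.im) (z : ℂ) :
    focal E (ellMap E z) = 2 * E.im * Real.cosh z.re := by
  have h := norm_sq_sinh_add_cosh (z / 2)
  rw [focal, ellMap_sub, ellMap_sub_conj]
  simp only [norm_mul, norm_pow, norm_I, norm_real, Real.norm_eq_abs, abs_of_pos hE, norm_ofNat]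
  rw [show 2 * (z / 2).re = z.re by simp; ring] at h
  rw [← h]
  ring

theorem exists_ellMap_eq {E : ℂ} (hE : 0 < E.im) (k : ℂ) : ∃ z, 0 ≤ z.re ∧ ellMap E z = k := by
  have hA : (E.im : ℂ) * I ≠ 0 := mul_ne_zero (ofReal_ne_zero.mpr hE.ne') I_ne_zero
  obtain ⟨w, hw⟩ := Complex.cos_surjective ((k - E.re) / (E.im * I))
  have h1 : ellMap E (w * I) = k := by
    rw [ellMap, cosh_mul_I, hw, mul_div_cancel₀ _ hA]
    ring
  rcases le_total 0 (w * I).re with h | h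
  · exact ⟨_, h, h1⟩
  · exact ⟨-(w * I), by rw [neg_re]; linarith, by rw [ellMap_neg, h1]⟩

theorem mem_cut_iff_focal {E k : ℂ} (hE : 0 < E.im) : k ∈ cut E ↔ focal E k = 2 * E.im := by
  obtain ⟨z, hz, rfl⟩ := exists_ellMap_eq hE k
  rw [focal_ellMap hE, mem_cut_iff hE, ellMap_re, ellMap_im]
  constructor
  · rintro ⟨h1, h2⟩
    have h3 : Real.sinh z.re * Real.sin z.im = 0 := by
      have : E.im * (Real.sinh z.re * Real.sin z.im) = 0 := by linarith
      exact (mul_eq_zero.mp this).resolve_left hE.ne'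
    rcases mul_eq_zero.mp h3 with h | h
    · rw [Real.sinh_eq_zero.mp h]
      simp
    · have hc : |Real.cos z.im| = 1 := by
        have := Real.sin_sq_add_cos_sq z.im
        rw [h] at this
        rw [← sq_eq_sq₀ (abs_nonneg _) zero_le_one, sq_abs]
        linarith
      rw [abs_mul, abs_mul, hc, abs_of_pos hE, abs_of_pos (Real.cosh_pos _)] at h2
      have h4 : Real.cosh z.re ≤ 1 := by
        by_contra! h'
        nlinarith
      have := Real.one_le_cosh z.re
      rw [le_antisymm h4 this]
      ring
  · intro h
    have h1 : Real.cosh z.re = 1 := by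
      have : E.im * (Real.cosh z.re - 1) = 0 := by linarith
      linarith [(mul_eq_zero.mp this).resolve_left hE.ne']
    have h2 : z.re = 0 := by
      by_contra h'
      exact absurd h1 (Real.one_lt_cosh.mpr h').ne'
    rw [h2]
    refine ⟨by simp, ?_⟩
    rw [Real.cosh_zero, one_mul, abs_mul, abs_of_pos hE]
    exact mul_le_of_le_one_right hE.le (Real.abs_cos_le_one _)

theorem ellMap_notMem_cut {E z : ℂ} (hE : 0 < E.im) (hz : 0 < z.re) : ellMap E z ∉ cut E := by
  rw [mem_cut_iff_focal hE, focal_ellMap hE]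
  have := Real.one_lt_cosh.mpr hz.ne'
  nlinarith

theorem ellMap_mem_cut {E z : ℂ} (hE : 0 < E.im) (hz : z.re = 0) : ellMap E z ∈ cut E := by
  rw [mem_cut_iff_focal hE, focal_ellMap hE, hz, Real.cosh_zero, mul_one]

theorem exists_ellMap_eq_of_notMem_cut {E k : ℂ} (hE : 0 < E.im) (hk : k ∉ cut E) :
    ∃ z, 0 < z.re ∧ ellMap E z = k := by
  obtain ⟨z, hz, rfl⟩ := exists_ellMap_eq hE k
  refine ⟨z, lt_of_le_of_ne hz fun h => hk (ellMap_mem_cut hE h.symm), rfl⟩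

/-- The argument of the principal root is `tanh² z`, and for `0 < z.re` the number `tanh z` is in
the right half plane, so the root is `tanh z` itself. This cancels `dk/dz` against one factor of `w`
and makes the differential regular on the cut. -/
theorem rootFactor_ellMap {E z : ℂ} (hE : 0 < E.im) (hz : 0 < z.re) :
    rootFactor E (ellMap E z) = ellMap' E z := by
  have hc := ellMap_notMem_cut hE hz
  have hne := ne_center_of_notMem_cut hE hc
  have hA : (E.im : ℂ) * I ≠ 0 := mul_ne_zero (ofReal_ne_zero.mpr hE.ne') I_ne_zero
  have hk : ellMap E z - (E.re : ℂ) = E.im * I * cosh z := by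
    rw [ellMap]
    ring
  rw [hk] at hne
  have hcosh : cosh z ≠ 0 := right_ne_zero_of_mul hne
  have hA' : (E.im : ℂ) ≠ 0 := left_ne_zero_of_mul hA
  unfold rootFactor
  rw [hk]
  have h1 : 1 + ((E.im : ℂ) / (E.im * I * cosh z)) ^ 2 = (sinh z / cosh z) ^ 2 := by
    have := cosh_sq z
    field_simp
    rw [I_sq]
    linear_combination -this
  have hre : 0 < (sinh z / cosh z).re := by
    have h2 : sinh z / cosh z = (sinh z * conj (cosh z)) / (normSq (cosh z) : ℂ) := by
      rw [← mul_conj]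
      field_simp [(map_ne_zero (starRingEnd ℂ)).mpr hcosh]
    have h3 : (sinh z * conj (cosh z)).re = Real.sinh z.re * Real.cosh z.re := by
      have hs : (sinh z).re = Real.sinh z.re * Real.cos z.im ∧
          (sinh z).im = Real.cosh z.re * Real.sin z.im := by
        constructor
        · conv_lhs => rw [← re_add_im z, sinh_add, cosh_mul_I, sinh_mul_I]
          simp [← ofReal_cosh, ← ofReal_sinh, ← ofReal_cos, ← ofReal_sin]
        · conv_lhs => rw [← re_add_im z, sinh_add, cosh_mul_I, sinh_mul_I]
          simp [← ofReal_cosh, ← ofReal_sinh, ← ofReal_cos, ← ofReal_sin]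
      rw [mul_re, conj_re, conj_im, hs.1, hs.2, cosh_re', cosh_im']
      linear_combination Real.sinh z.re * Real.cosh z.re * Real.sin_sq_add_cos_sq z.im
    rw [h2, div_ofReal_re, h3]
    have := Real.sinh_pos_iff.mpr hz
    have := Real.cosh_pos z.re
    have := normSq_pos.mpr hcosh
    positivity
  rw [h1, show (1 : ℂ) / 2 = 2⁻¹ by norm_num, Complex.sq_cpow_two_inv hre, ellMap']
  field_simp

/-- The open mapping theorem. It allows limits in the `k`-plane to be read off in the coordinate
`z`, although `ellMap` is not injective and is critical over the end points of the cut. -/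
theorem nhds_le_map_ellMap {E : ℂ} (hE : 0 < E.im) (z : ℂ) :
    𝓝 (ellMap E z) ≤ map (ellMap E) (𝓝 z) := by
  have hA : (E.im : ℂ) * I ≠ 0 := mul_ne_zero (ofReal_ne_zero.mpr hE.ne') I_ne_zero
  have han : AnalyticAt ℂ (ellMap E) z := (differentiable_ellMap E).analyticAt z
  refine (han.eventually_constant_or_nhds_le_map_nhds).resolve_left fun h => ?_
  have h1 : ellMap E = fun _ => ellMap E z :=
    AnalyticOnNhd.eq_of_eventuallyEq (fun w _ => (differentiable_ellMap E).analyticAt w)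
      (fun w _ => analyticAt_const) h
  have h2 := congrFun h1 0
  have h3 := congrFun h1 (Real.pi * I)
  rw [← h3, ellMap, ellMap, cosh_mul_I, cos_pi, cosh_zero] at h2
  have : (2 : ℂ) * (E.im * I) = 0 := by linear_combination h2
  exact mul_ne_zero two_ne_zero hA this

/-! ### The holomorphic differential -/

theorem wTilde_ne_zero {E₁ E₂ k : ℂ} (h₁ : 0 < E₁.im) (h₂ : 0 < E₂.im) (hk : k ∉ contour E₁ E₂) :
    wTilde E₁ E₂ k ≠ 0 :=
  mul_ne_zero (rootFactor_ne_zero h₁ fun h => hk (Or.inl h))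
    (rootFactor_ne_zero h₂ fun h => hk (Or.inr h))

theorem form_comm (E₁ E₂ : ℂ) : form E₂ E₁ = form E₁ E₂ := by
  funext k
  rw [form, form, wTilde, wTilde, mul_comm]

theorem contour_comm (E₁ E₂ : ℂ) : contour E₂ E₁ = contour E₁ E₂ := union_comm _ _

theorem conj_mem_contour {E₁ E₂ k : ℂ} (h₁ : 0 < E₁.im) (h₂ : 0 < E₂.im) :
    conj k ∈ contour E₁ E₂ ↔ k ∈ contour E₁ E₂ := by
  rw [contour, mem_union, mem_union, conj_mem_cut h₁, conj_mem_cut h₂]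

theorem form_conj {E₁ E₂ k : ℂ} (h₁ : 0 < E₁.im) (h₂ : 0 < E₂.im) (hk : k ∉ contour E₁ E₂) :
    form E₁ E₂ (conj k) = conj (form E₁ E₂ k) := by
  rw [form, form, wTilde, wTilde, rootFactor_conj h₁ fun h => hk (Or.inl h),
    rootFactor_conj h₂ fun h => hk (Or.inr h)]
  simp

theorem norm_form_sq {E₁ E₂ k : ℂ} (h₁ : 0 < E₁.im) (h₂ : 0 < E₂.im) (hk : k ∉ contour E₁ E₂) :
    ‖form E₁ E₂ k‖ ^ 2 = (‖k - E₁‖ * ‖k - conj E₁‖ * (‖k - E₂‖ * ‖k - conj E₂‖))⁻¹ := by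
  rw [form, wTilde, norm_div, norm_one, one_div, norm_mul, inv_pow, mul_pow,
    norm_rootFactor_sq h₁ fun h => hk (Or.inl h), norm_rootFactor_sq h₂ fun h => hk (Or.inr h)]

theorem norm_form_le {E₁ E₂ k : ℂ} {m : ℝ} (h₁ : 0 < E₁.im) (h₂ : 0 < E₂.im)
    (hk : k ∉ contour E₁ E₂) (hm : 0 < m) (a : m ≤ ‖k - E₁‖) (b : m ≤ ‖k - conj E₁‖)
    (c : m ≤ ‖k - E₂‖) (d : m ≤ ‖k - conj E₂‖) : ‖form E₁ E₂ k‖ ≤ (m ^ 2)⁻¹ := by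
  rw [← sq_le_sq₀ (norm_nonneg _) (by positivity), norm_form_sq h₁ h₂ hk, inv_pow]
  apply inv_anti₀ (by positivity)
  calc (m ^ 2) ^ 2 = m * m * (m * m) := by ring
    _ ≤ _ := by gcongr

/-- The derivative of `form`. -/
def form' (E₁ E₂ k : ℂ) : ℂ := -(form E₁ E₂ k) *
  ((k - (E₁.re : ℂ)) / rootFactor E₁ k ^ 2 + (k - (E₂.re : ℂ)) / rootFactor E₂ k ^ 2)

theorem hasDerivAt_form {E₁ E₂ k : ℂ} (h₁ : 0 < E₁.im) (h₂ : 0 < E₂.im)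
    (hk : k ∉ contour E₁ E₂) : HasDerivAt (form E₁ E₂) (form' E₁ E₂ k) k := by
  have d1 := hasDerivAt_rootFactor h₁ fun h => hk (Or.inl h)
  have d2 := hasDerivAt_rootFactor h₂ fun h => hk (Or.inr h)
  have n1 := rootFactor_ne_zero h₁ fun h => hk (Or.inl h)
  have n2 := rootFactor_ne_zero h₂ fun h => hk (Or.inr h)
  have := (d1.mul d2).inv (mul_ne_zero n1 n2)
  have e : form E₁ E₂ = (rootFactor E₁ * rootFactor E₂)⁻¹ := by
    funext k
    simp [form, wTilde]
  rw [e]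
  convert! this using 1
  rw [form', form, wTilde]
  simp only [Pi.mul_apply]
  field_simp

theorem differentiableOn_form {E₁ E₂ : ℂ} (h₁ : 0 < E₁.im) (h₂ : 0 < E₂.im) :
    DifferentiableOn ℂ (form E₁ E₂) (contour E₁ E₂)ᶜ := fun _ hk =>
  (hasDerivAt_form h₁ h₂ hk).differentiableAt.differentiableWithinAt

/-- `k - E.re` is the mean of `k - E` and `k - conj E`, whereas the denominator has the modulus of
their product; so the quotient is at most the mean of two reciprocal distances. -/
theorem norm_center_div_le {E k : ℂ} {m : ℝ} (hE : 0 < E.im) (hk : k ∉ cut E) (hm : 0 < m)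
    (a : m ≤ ‖k - E‖) (b : m ≤ ‖k - conj E‖) :
    ‖(k - (E.re : ℂ)) / rootFactor E k ^ 2‖ ≤ m⁻¹ := by
  have h2 : E + conj E = 2 * (E.re : ℂ) := by rw [add_conj]; push_cast; ring
  have h : ‖k - (E.re : ℂ)‖ ≤ (‖k - E‖ + ‖k - conj E‖) / 2 := by
    have : k - (E.re : ℂ) = ((k - E) + (k - conj E)) / 2 := by linear_combination h2 / 2
    rw [this, norm_div, norm_ofNat]
    gcongr
    exact norm_add_le _ _
  rw [norm_div, norm_pow, norm_rootFactor_sq hE hk, div_le_iff₀ (by nlinarith), inv_mul_eq_div,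
    le_div_iff₀ hm]
  nlinarith [mul_le_mul_of_nonneg_left a (norm_nonneg (k - conj E)),
    mul_le_mul_of_nonneg_left b (norm_nonneg (k - E))]

theorem norm_form'_le {E₁ E₂ k : ℂ} {m : ℝ} (h₁ : 0 < E₁.im) (h₂ : 0 < E₂.im)
    (hk : k ∉ contour E₁ E₂) (hm : 0 < m) (a : m ≤ ‖k - E₁‖) (b : m ≤ ‖k - conj E₁‖)
    (c : m ≤ ‖k - E₂‖) (d : m ≤ ‖k - conj E₂‖) : ‖form' E₁ E₂ k‖ ≤ (m ^ 2)⁻¹ * (m⁻¹ + m⁻¹) := by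
  rw [form', norm_mul, norm_neg]
  refine mul_le_mul (norm_form_le h₁ h₂ hk hm a b c d) ?_ (norm_nonneg _) (by positivity)
  exact (norm_add_le _ _).trans (add_le_add
    (norm_center_div_le h₁ (fun h => hk (Or.inl h)) hm a b)
    (norm_center_div_le h₂ (fun h => hk (Or.inr h)) hm c d))

/-! ### Primitives of the differential along vertical rays -/

/-- The points from which the downward ray does not meet the cuts. -/
def downSet (E₁ E₂ : ℂ) : Set ℂ :=
  {k | (k.re = E₁.re → k.im < -E₁.im) ∧ (k.re = E₂.re → k.im < -E₂.im)}

theorem downSet_comm (E₁ E₂ : ℂ) : downSet E₂ E₁ = downSet E₁ E₂ := by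
  ext k
  exact and_comm

theorem isOpen_downSet (E₁ E₂ : ℂ) : IsOpen (downSet E₁ E₂) := by
  have key : ∀ E : ℂ, IsOpen {k : ℂ | k.re = E.re → k.im < -E.im} := by
    intro E
    have : {k : ℂ | k.re = E.re → k.im < -E.im} = {k : ℂ | k.re ≠ E.re} ∪ {k : ℂ | k.im < -E.im} := by
      ext k
      simp [imp_iff_not_or]
    rw [this]
    exact (isOpen_ne_fun continuous_re continuous_const).union
      (isOpen_lt continuous_im continuous_const)
  exact (key E₁).inter (key E₂)

theorem downSet_subset {E₁ E₂ k : ℂ} (h₁ : 0 < E₁.im) (h₂ : 0 < E₂.im) (hk : k ∈ downSet E₁ E₂) :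
    k ∉ contour E₁ E₂ := by
  rintro (h | h)
  · rw [mem_cut_iff h₁, abs_le] at h
    linarith [hk.1 h.1, h.2.1]
  · rw [mem_cut_iff h₂, abs_le] at h
    linarith [hk.2 h.1, h.2.1]

theorem downSet_ray {E₁ E₂ k : ℂ} (hk : k ∈ downSet E₁ E₂) {s : ℝ} (hs : 0 ≤ s) :
    k + (s : ℂ) * (-I) ∈ downSet E₁ E₂ := by
  constructor
  · intro h
    have := hk.1 (by simpa using h)
    simp
    linarith
  · intro h
    have := hk.2 (by simpa using h)
    simp
    linarith

theorem mem_downSet_of_re_ne {E₁ E₂ k : ℂ} (h : k.re ≠ E₁.re) (h' : k.re ≠ E₂.re) :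
    k ∈ downSet E₁ E₂ := ⟨fun h'' => absurd h'' h, fun h'' => absurd h'' h'⟩

/-- The primitive of `form` obtained by integration along downward rays. -/
def downInt (E₁ E₂ k : ℂ) : ℂ := -rayInt (form E₁ E₂) k (-I)

/-- The primitive of `form` obtained by integration along upward rays. -/
def upInt (E₁ E₂ k : ℂ) : ℂ := -rayInt (form E₁ E₂) k I

theorem downInt_comm (E₁ E₂ : ℂ) : downInt E₂ E₁ = downInt E₁ E₂ := by
  funext k
  rw [downInt, downInt, form_comm]

theorem upInt_comm (E₁ E₂ : ℂ) : upInt E₂ E₁ = upInt E₁ E₂ := by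
  funext k
  rw [upInt, upInt, form_comm]

/-- The bound `ε` is good for small `s` and `s - K` for large `s`; adding them with weights `1 + K`
and `ε` gives one bound linear in `1 + s`. -/
theorem ray_lower_bound {a e : ℂ} {ε K s : ℝ} (hε : 0 < ε) (hK : ‖a - e‖ ≤ K) (hs : 0 ≤ s)
    (h : ε ≤ ‖a + (s : ℂ) * (-I) - e‖) :
    ε / (1 + K + ε) * (1 + s) ≤ ‖a + (s : ℂ) * (-I) - e‖ := by
  have hK0 : 0 ≤ K := (norm_nonneg _).trans hK
  have h2 : s - K ≤ ‖a + (s : ℂ) * (-I) - e‖ := by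
    have : (s : ℂ) * (-I) = (a + (s : ℂ) * (-I) - e) - (a - e) := by ring
    have h3 := norm_sub_le (a + (s : ℂ) * (-I) - e) (a - e)
    rw [← this] at h3
    rw [norm_mul, norm_neg, norm_I, mul_one, norm_real, Real.norm_of_nonneg hs] at h3
    linarith
  rw [div_mul_eq_mul_div, div_le_iff₀ (by positivity)]
  nlinarith [mul_nonneg hs hK0]

/-- Locally uniform distance bounds along the rays, as needed to differentiate under the integral
sign. -/
theorem exists_ray_bound {E₁ E₂ k₀ : ℂ} (h₁ : 0 < E₁.im) (h₂ : 0 < E₂.im)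
    (hk : k₀ ∈ downSet E₁ E₂) :
    ∃ ε > 0, ∃ c > 0, ∀ k ∈ Metric.ball k₀ ε, k ∈ downSet E₁ E₂ ∧ ∀ s : ℝ, 0 ≤ s →
      c * (1 + s) ≤ ‖k + (s : ℂ) * (-I) - E₁‖ ∧ c * (1 + s) ≤ ‖k + (s : ℂ) * (-I) - conj E₁‖ ∧
      c * (1 + s) ≤ ‖k + (s : ℂ) * (-I) - E₂‖ ∧ c * (1 + s) ≤ ‖k + (s : ℂ) * (-I) - conj E₂‖ := by
  obtain ⟨ε, hε, hball⟩ := Metric.isOpen_iff.mp (isOpen_downSet E₁ E₂) k₀ hk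
  set K := ‖k₀ - E₁‖ + ‖k₀ - conj E₁‖ + ‖k₀ - E₂‖ + ‖k₀ - conj E₂‖ + ε with hKdef
  have hK : 0 < K := by positivity
  have key : ∀ k ∈ Metric.ball k₀ (ε / 2), ∀ e : ℂ, e ∉ downSet E₁ E₂ → ‖k₀ - e‖ + ε ≤ K →
      ∀ s : ℝ, 0 ≤ s → (ε / 2) / (1 + K + ε / 2) * (1 + s) ≤ ‖k + (s : ℂ) * (-I) - e‖ := by
    intro k hk e he heK s hs
    rw [Metric.mem_ball, dist_eq_norm] at hk
    refine ray_lower_bound (by positivity) ?_ hs ?_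
    · have : k - e = (k - k₀) + (k₀ - e) := by ring
      rw [this]
      have := norm_add_le (k - k₀) (k₀ - e)
      linarith
    · by_contra! hlt
      apply he
      -- If the ray from `k` came too close to `e`, then the ray from this point of the ball would
      -- pass through `e` itself, although `downSet` is stable under moving down and does not
      -- contain `e`.
      have h3 : e - (s : ℂ) * (-I) ∈ Metric.ball k₀ ε := by
        rw [Metric.mem_ball, dist_eq_norm]
        have : e - (s : ℂ) * (-I) - k₀ = -(k + (s : ℂ) * (-I) - e) + (k - k₀) := by ring
        rw [this]
        have := norm_add_le (-(k + (s : ℂ) * (-I) - e)) (k - k₀)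
        rw [norm_neg] at this
        linarith
      have := downSet_ray (hball h3) hs
      simpa using this
  have n1 := norm_nonneg (k₀ - E₁)
  have n2 := norm_nonneg (k₀ - conj E₁)
  have n3 := norm_nonneg (k₀ - E₂)
  have n4 := norm_nonneg (k₀ - conj E₂)
  refine ⟨ε / 2, by positivity, (ε / 2) / (1 + K + ε / 2), by positivity, fun k hk =>
    ⟨hball (Metric.ball_subset_ball (by linarith) hk), fun s hs => ⟨key k hk _ ?_ ?_ s hs,
      key k hk _ ?_ ?_ s hs, key k hk _ ?_ ?_ s hs, key k hk _ ?_ ?_ s hs⟩⟩⟩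
  · exact fun h => by linarith [h.1 rfl]
  · linarith
  · exact fun h => by simpa using h.1 (by simp)
  · linarith
  · exact fun h => by linarith [h.2 rfl]
  · linarith
  · exact fun h => by simpa using h.2 (by simp)
  · linarith

theorem inv_sq_le_of_pos {c s : ℝ} (hc : 0 < c) (hs : 0 ≤ s) :
    ((c * (1 + s)) ^ 2)⁻¹ ≤ (c ^ 2)⁻¹ * (1 + s ^ 2)⁻¹ := by
  rw [← mul_inv]
  apply inv_anti₀ (by positivity)
  rw [mul_pow]
  gcongr
  nlinarith

theorem continuousOn_ray {E₁ E₂ k : ℂ} {g : ℂ → ℂ} (h₁ : 0 < E₁.im) (h₂ : 0 < E₂.im)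
    (hg : ContinuousOn g (contour E₁ E₂)ᶜ) (hk : k ∈ downSet E₁ E₂) :
    ContinuousOn (fun s : ℝ => g (k + (s : ℂ) * (-I))) (Ici 0) := by
  refine hg.comp (by fun_prop) fun s hs => ?_
  exact downSet_subset h₁ h₂ (downSet_ray hk hs)

theorem continuousOn_form' {E₁ E₂ : ℂ} (h₁ : 0 < E₁.im) (h₂ : 0 < E₂.im) :
    ContinuousOn (form' E₁ E₂) (contour E₁ E₂)ᶜ := by
  have h : EqOn (form' E₁ E₂) (deriv (form E₁ E₂)) (contour E₁ E₂)ᶜ :=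
    fun k hk => (hasDerivAt_form h₁ h₂ hk).deriv.symm
  exact ((differentiableOn_form h₁ h₂).deriv (isOpen_compl_contour _ _)).continuousOn.congr h

theorem integrableOn_form_ray {E₁ E₂ k : ℂ} (h₁ : 0 < E₁.im) (h₂ : 0 < E₂.im)
    (hk : k ∈ downSet E₁ E₂) :
    IntegrableOn (fun s : ℝ => form E₁ E₂ (k + (s : ℂ) * (-I)) * (-I)) (Ioi 0) := by
  obtain ⟨ε, hε, c, hc, H⟩ := exists_ray_bound h₁ h₂ hk
  obtain ⟨-, H⟩ := H k (Metric.mem_ball_self hε)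
  refine Integrable.mono' (g := fun s : ℝ => (c ^ 2)⁻¹ * (1 + s ^ 2)⁻¹)
    ((integrable_inv_one_add_sq.const_mul _).integrableOn) ?_ ?_
  · refine ContinuousOn.aestronglyMeasurable ?_ measurableSet_Ioi
    exact ((continuousOn_ray h₁ h₂ (differentiableOn_form h₁ h₂).continuousOn hk).mono
      Ioi_subset_Ici_self).mul continuousOn_const
  · refine (ae_restrict_iff' measurableSet_Ioi).mpr (Eventually.of_forall fun s hs => ?_)
    obtain ⟨a, b, c', d⟩ := H s (le_of_lt hs)
    have hs0 : (0 : ℝ) < s := hs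
    rw [norm_mul, norm_neg, norm_I, mul_one]
    exact (norm_form_le h₁ h₂ (downSet_subset h₁ h₂ (downSet_ray hk hs0.le)) (by positivity) a b c'
      d).trans (inv_sq_le_of_pos hc hs0.le)

/-- Differentiation under the integral sign leaves the integral of the derivative of `form` along
the ray, and the fundamental theorem of calculus evaluates it at the starting point. -/
theorem hasDerivAt_downInt {E₁ E₂ k₀ : ℂ} (h₁ : 0 < E₁.im) (h₂ : 0 < E₂.im)
    (hk : k₀ ∈ downSet E₁ E₂) : HasDerivAt (downInt E₁ E₂) (form E₁ E₂ k₀) k₀ := by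
  obtain ⟨ε, hε, c, hc, H⟩ := exists_ray_bound h₁ h₂ hk
  have hoff : ∀ k ∈ Metric.ball k₀ ε, ∀ s : ℝ, 0 ≤ s → k + (s : ℂ) * (-I) ∉ contour E₁ E₂ :=
    fun k hk' s hs => downSet_subset h₁ h₂ (downSet_ray (H k hk').1 hs)
  have hbd : ∀ k ∈ Metric.ball k₀ ε, ∀ s : ℝ, 0 < s →
      ‖form' E₁ E₂ (k + (s : ℂ) * (-I)) * (-I)‖ ≤
        ((c ^ 2)⁻¹ * (c⁻¹ + c⁻¹)) * (1 + s ^ 2)⁻¹ := by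
    intro k hk' s hs
    obtain ⟨a, b, c', d⟩ := (H k hk').2 s hs.le
    rw [norm_mul, norm_neg, norm_I, mul_one]
    refine (norm_form'_le h₁ h₂ (hoff k hk' s hs.le) (by positivity) a b c' d).trans ?_
    have h3 := inv_sq_le_of_pos hc hs.le
    have h4 : (c * (1 + s))⁻¹ ≤ c⁻¹ := inv_anti₀ hc (by nlinarith)
    calc _ ≤ ((c ^ 2)⁻¹ * (1 + s ^ 2)⁻¹) * (c⁻¹ + c⁻¹) := by gcongr
      _ = _ := by ring
  have hder := (hasDerivAt_integral_of_dominated_loc_of_deriv_le (𝕜 := ℂ)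
    (μ := volume.restrict (Ioi (0 : ℝ)))
    (F := fun k (s : ℝ) => form E₁ E₂ (k + (s : ℂ) * (-I)) * (-I))
    (F' := fun k (s : ℝ) => form' E₁ E₂ (k + (s : ℂ) * (-I)) * (-I)) (x₀ := k₀)
    (bound := fun s => ((c ^ 2)⁻¹ * (c⁻¹ + c⁻¹)) * (1 + s ^ 2)⁻¹)
    (Metric.ball_mem_nhds k₀ hε) ?_ (integrableOn_form_ray h₁ h₂ hk) ?_ ?_
    ((integrable_inv_one_add_sq.const_mul _).integrableOn) ?_)
  · obtain ⟨hint, hder⟩ := hder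
    have hftc : ∫ s in Ioi (0 : ℝ), form' E₁ E₂ (k₀ + (s : ℂ) * (-I)) * (-I) =
        0 - form E₁ E₂ (k₀ + ((0 : ℝ) : ℂ) * (-I)) := by
      refine integral_Ioi_of_hasDerivAt_of_tendsto'
        (f := fun s : ℝ => form E₁ E₂ (k₀ + (s : ℂ) * (-I))) (fun s hs => ?_) hint ?_
      · have h3 := hasDerivAt_form h₁ h₂ (hoff k₀ (Metric.mem_ball_self hε) s hs)
        have h4 : HasDerivAt (fun s : ℝ => k₀ + (s : ℂ) * (-I)) (-I) s := by
          have := ((hasDerivAt_id s).ofReal_comp.mul_const (-I)).const_add k₀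
          simpa using this
        exact HasDerivAt.comp (h := fun s : ℝ => k₀ + (s : ℂ) * (-I)) (h₂ := form E₁ E₂) s h3 h4
      · rw [tendsto_zero_iff_norm_tendsto_zero]
        refine squeeze_zero' (g := fun s : ℝ => (c ^ 2)⁻¹ * (1 + s ^ 2)⁻¹)
          (Eventually.of_forall fun _ => norm_nonneg _) ?_ ?_
        · filter_upwards [eventually_ge_atTop (0 : ℝ)] with s hs
          obtain ⟨a, b, c', d⟩ := (H k₀ (Metric.mem_ball_self hε)).2 s hs
          exact (norm_form_le h₁ h₂ (hoff k₀ (Metric.mem_ball_self hε) s hs)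
            (by positivity) a b c' d).trans (inv_sq_le_of_pos hc hs)
        · rw [show (0 : ℝ) = (c ^ 2)⁻¹ * 0 by ring]
          refine Tendsto.const_mul _ (tendsto_inv_atTop_zero.comp ?_)
          exact tendsto_atTop_add_const_left _ _ (tendsto_pow_atTop two_ne_zero)
    rw [hftc] at hder
    have := hder.neg
    simp only [ofReal_zero, zero_mul, add_zero, zero_sub, neg_neg] at this
    exact this
  · filter_upwards [Metric.ball_mem_nhds k₀ hε] with k hk'
    exact (integrableOn_form_ray h₁ h₂ (H k hk').1).aestronglyMeasurable
  · refine ContinuousOn.aestronglyMeasurable ?_ measurableSet_Ioi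
    exact ((continuousOn_ray h₁ h₂ (continuousOn_form' h₁ h₂) hk).mono
      Ioi_subset_Ici_self).mul continuousOn_const
  · exact (ae_restrict_iff' measurableSet_Ioi).mpr (Eventually.of_forall fun s hs k hk' =>
      hbd k hk' s hs)
  · refine (ae_restrict_iff' measurableSet_Ioi).mpr (Eventually.of_forall fun s hs k hk' => ?_)
    have h3 := hasDerivAt_form h₁ h₂ (hoff k hk' s (le_of_lt hs))
    exact (h3.comp_add_const k _).mul_const _

theorem upInt_conj {E₁ E₂ k : ℂ} (h₁ : 0 < E₁.im) (h₂ : 0 < E₂.im)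
    (hk : ∀ s : ℝ, 0 < s → k + (s : ℂ) * (-I) ∉ contour E₁ E₂) :
    upInt E₁ E₂ (conj k) = conj (downInt E₁ E₂ k) := by
  rw [upInt, downInt, map_neg, rayInt, rayInt, ← integral_conj]
  congr 1
  refine setIntegral_congr_fun measurableSet_Ioi fun s hs => ?_
  have := form_conj h₁ h₂ (hk s hs)
  simp only [map_mul, ← this]
  simp

theorem hasDerivAt_upInt {E₁ E₂ k₀ : ℂ} (h₁ : 0 < E₁.im) (h₂ : 0 < E₂.im)
    (hk : conj k₀ ∈ downSet E₁ E₂) : HasDerivAt (upInt E₁ E₂) (form E₁ E₂ k₀) k₀ := by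
  have h := (hasDerivAt_downInt h₁ h₂ hk)
  have h3 := h.conj_conj
  rw [conj_conj, form_conj h₁ h₂ ((conj_mem_contour h₁ h₂).not.mp (downSet_subset h₁ h₂ hk)),
    conj_conj] at h3
  refine h3.congr_of_eventuallyEq ?_
  have hopen : ∀ᶠ k in 𝓝 k₀, conj k ∈ downSet E₁ E₂ :=
    continuous_conj.continuousAt.eventually ((isOpen_downSet E₁ E₂).mem_nhds hk)
  filter_upwards [hopen] with k hk'
  have := upInt_conj h₁ h₂ fun s hs => downSet_subset h₁ h₂ (downSet_ray hk' hs.le)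
  rw [conj_conj] at this
  exact this

theorem norm_form_far {E₁ E₂ k : ℂ} (h₁ : 0 < E₁.im) (h₂ : 0 < E₂.im)
    (hk : 2 * (‖E₁‖ + ‖E₂‖) + 1 ≤ ‖k‖) :
    k ∉ contour E₁ E₂ ∧ ‖form E₁ E₂ k‖ ≤ 4 * (‖k‖ ^ 2)⁻¹ := by
  have p1 := norm_nonneg E₁
  have p2 := norm_nonneg E₂
  have key : ∀ e : ℂ, (‖e‖ = ‖E₁‖ ∨ ‖e‖ = ‖E₂‖) → ‖k‖ / 2 ≤ ‖k - e‖ := by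
    intro e he
    have := norm_sub_norm_le k e
    rcases he with he | he <;> rw [he] at this <;> linarith
  have hoff : k ∉ contour E₁ E₂ := by
    rintro (h | h)
    · have h3 : ‖k‖ ≤ ‖E₁‖ := by
        have := (convex_closedBall (0 : ℂ) ‖E₁‖).segment_subset
          (by simp : conj E₁ ∈ _) (by simp : E₁ ∈ _) h
        simpa using this
      linarith
    · have h3 : ‖k‖ ≤ ‖E₂‖ := by
        have := (convex_closedBall (0 : ℂ) ‖E₂‖).segment_subset
          (by simp : conj E₂ ∈ _) (by simp : E₂ ∈ _) h
        simpa using this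
      linarith
  refine ⟨hoff, ?_⟩
  have := norm_form_le h₁ h₂ hoff (m := ‖k‖ / 2) (by linarith) (key _ (by simp)) (key _ (by simp))
    (key _ (by simp)) (key _ (by simp))
  refine this.trans_eq ?_
  rw [div_pow, inv_div]
  ring

/-- From a point of the lower half plane the downward ray leads away from the origin, `|k - is|² ≥
|k|² + s²`, and dominated convergence applies. Downward rays from the upper half plane may pass near
a cut; there `upInt` takes over. -/
theorem tendsto_downInt {E₁ E₂ : ℂ} (h₁ : 0 < E₁.im) (h₂ : 0 < E₂.im) :
    Tendsto (downInt E₁ E₂) (Bornology.cobounded ℂ ⊓ 𝓟 {k | k.im ≤ 0}) (𝓝 0) := by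
  have hcg : (Bornology.cobounded ℂ).IsCountablyGenerated := by
    rw [← comap_norm_atTop]
    infer_instance
  have hnorm : ∀ k : ℂ, k.im ≤ 0 → ∀ s : ℝ, 0 ≤ s →
      ‖k‖ ^ 2 + s ^ 2 ≤ ‖k + (s : ℂ) * (-I)‖ ^ 2 := by
    intro k hk s hs
    rw [← normSq_eq_norm_sq, ← normSq_eq_norm_sq, normSq_apply, normSq_apply]
    simp
    nlinarith [mul_nonneg hs (neg_nonneg.mpr hk)]
  have hle : ∀ k : ℂ, k.im ≤ 0 → ∀ s : ℝ, 0 ≤ s → ‖k‖ ≤ ‖k + (s : ℂ) * (-I)‖ := by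
    intro k hk s hs
    rw [← sq_le_sq₀ (norm_nonneg _) (norm_nonneg _)]
    nlinarith [hnorm k hk s hs]
  set L := 2 * (‖E₁‖ + ‖E₂‖) + 1
  have hev : ∀ᶠ k : ℂ in Bornology.cobounded ℂ ⊓ 𝓟 {k | k.im ≤ 0}, L ≤ ‖k‖ ∧ k.im ≤ 0 := by
    refine eventually_inf_principal.mpr ?_
    filter_upwards [tendsto_norm_cobounded_atTop.eventually (eventually_ge_atTop L)] with k hk hk'
    exact ⟨hk, hk'⟩
  have hL1 : 1 ≤ L := by
    have := norm_nonneg E₁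
    have := norm_nonneg E₂
    simp only [L]
    linarith
  have hbd : ∀ k : ℂ, (L ≤ ‖k‖ ∧ k.im ≤ 0) → ∀ s : ℝ, 0 ≤ s →
      ‖form E₁ E₂ (k + (s : ℂ) * (-I)) * (-I)‖ ≤ 4 * (‖k‖ ^ 2 + s ^ 2)⁻¹ := by
    intro k hk s hs
    rw [norm_mul, norm_neg, norm_I, mul_one]
    refine (norm_form_far h₁ h₂ (hk.1.trans (hle k hk.2 s hs))).2.trans ?_
    have : 0 < ‖k‖ := by linarith [hk.1]
    gcongr
    exact hnorm k hk.2 s hs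
  have key : Tendsto (fun k => ∫ s in Ioi (0 : ℝ), form E₁ E₂ (k + (s : ℂ) * (-I)) * (-I))
      (Bornology.cobounded ℂ ⊓ 𝓟 {k | k.im ≤ 0}) (𝓝 (∫ _ in Ioi (0 : ℝ), (0 : ℂ))) := by
    refine tendsto_integral_filter_of_dominated_convergence (fun s => 4 * (1 + s ^ 2)⁻¹) ?_ ?_
      ((integrable_inv_one_add_sq.const_mul _).integrableOn) ?_
    · filter_upwards [hev] with k hk
      refine ContinuousOn.aestronglyMeasurable ?_ measurableSet_Ioi
      refine ContinuousOn.mul ?_ continuousOn_const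
      refine (differentiableOn_form h₁ h₂).continuousOn.comp (by fun_prop) fun s hs => ?_
      exact (norm_form_far h₁ h₂ (hk.1.trans (hle k hk.2 s (le_of_lt hs)))).1
    · filter_upwards [hev] with k hk
      refine (ae_restrict_iff' measurableSet_Ioi).mpr (Eventually.of_forall fun s hs => ?_)
      refine (hbd k hk s (le_of_lt hs)).trans ?_
      gcongr
      nlinarith [hk.1]
    · refine (ae_restrict_iff' measurableSet_Ioi).mpr (Eventually.of_forall fun s hs => ?_)
      rw [tendsto_zero_iff_norm_tendsto_zero]
      refine squeeze_zero' (g := fun k : ℂ => 4 * (‖k‖ ^ 2 + s ^ 2)⁻¹)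
        (Eventually.of_forall fun _ => norm_nonneg _) ?_ ?_
      · filter_upwards [hev] with k hk
        exact hbd k hk s (le_of_lt hs)
      · rw [show (0 : ℝ) = 4 * 0 by ring]
        refine Tendsto.const_mul _ (tendsto_inv_atTop_zero.comp ?_)
        refine tendsto_atTop_add_const_right _ _ ((tendsto_pow_atTop two_ne_zero).comp ?_)
        exact tendsto_norm_cobounded_atTop.mono_left inf_le_left
  simp only [integral_zero] at key
  have := key.neg
  rw [neg_zero] at this
  exact this

theorem tendsto_upInt {E₁ E₂ : ℂ} (h₁ : 0 < E₁.im) (h₂ : 0 < E₂.im) :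
    Tendsto (upInt E₁ E₂) (Bornology.cobounded ℂ ⊓ 𝓟 {k | 0 ≤ k.im}) (𝓝 0) := by
  have hc : Tendsto (fun k : ℂ => conj k) (Bornology.cobounded ℂ ⊓ 𝓟 {k | 0 ≤ k.im})
      (Bornology.cobounded ℂ ⊓ 𝓟 {k | k.im ≤ 0}) := by
    refine tendsto_inf.mpr ⟨?_, tendsto_principal.mpr (eventually_inf_principal.mpr
      (Eventually.of_forall fun k hk => by simpa using hk))⟩
    rw [← tendsto_norm_atTop_iff_cobounded]
    simp only [RCLike.norm_conj]
    exact tendsto_norm_cobounded_atTop.mono_left inf_le_left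
  have h3 := (continuous_conj.tendsto (0 : ℂ)).comp ((tendsto_downInt h₁ h₂).comp hc)
  rw [map_zero] at h3
  refine h3.congr' ?_
  refine eventually_inf_principal.mpr ?_
  filter_upwards [tendsto_norm_cobounded_atTop.eventually
    (eventually_ge_atTop (2 * (‖E₁‖ + ‖E₂‖) + 1))] with k hk hk'
  have hk0 : (0 : ℝ) ≤ k.im := hk'
  have := upInt_conj h₁ h₂ (k := conj k) fun s hs => (norm_form_far h₁ h₂ ?_).1
  · rw [conj_conj] at this
    exact this.symm
  · refine hk.trans ?_
    rw [← sq_le_sq₀ (norm_nonneg _) (norm_nonneg _), ← normSq_eq_norm_sq, ← normSq_eq_norm_sq,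
      normSq_apply, normSq_apply]
    simp
    nlinarith [mul_nonneg hs.le hk0]

/-! ### The `a`-period -/

theorem segInt_eq_of_hasDerivAt {f F : ℂ → ℂ} {a b : ℂ} {U : Set ℂ}
    (hF : ∀ k ∈ U, HasDerivAt F (f k) k) (hf : ContinuousOn f U)
    (hU : ∀ s ∈ Icc (0 : ℝ) 1, a + (s : ℂ) * (b - a) ∈ U) : segInt f a b = F b - F a := by
  have hpath : ∀ s : ℝ, HasDerivAt (fun s : ℝ => a + (s : ℂ) * (b - a)) (b - a) s := by
    intro s
    have := ((hasDerivAt_id s).ofReal_comp.mul_const (b - a)).const_add a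
    simpa using this
  have hu : uIcc (0 : ℝ) 1 = Icc 0 1 := uIcc_of_le zero_le_one
  rw [segInt, intervalIntegral.integral_eq_sub_of_hasDerivAt
    (f := fun s : ℝ => F (a + (s : ℂ) * (b - a)))]
  · simp
  · intro s hs
    rw [hu] at hs
    exact HasDerivAt.comp (h := fun s : ℝ => a + (s : ℂ) * (b - a)) (h₂ := F) s (hF _ (hU s hs))
      (hpath s)
  · apply ContinuousOn.intervalIntegrable
    rw [hu]
    exact (hf.comp (by fun_prop) hU).mul continuousOn_const

theorem conj_mem_downSet_of_re_ne {E₁ E₂ k : ℂ} (h : k.re ≠ E₁.re) (h' : k.re ≠ E₂.re) :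
    conj k ∈ downSet E₁ E₂ := mem_downSet_of_re_ne (by simpa using h) (by simpa using h')

theorem downInt_sub_upInt_const {E₁ E₂ : ℂ} (h₁ : 0 < E₁.im) (h₂ : 0 < E₂.im) {U : Set ℂ}
    (hU : IsOpen U) (hconv : Convex ℝ U) (hre : ∀ k ∈ U, k.re ≠ E₁.re ∧ k.re ≠ E₂.re)
    {x y : ℂ} (hx : x ∈ U) (hy : y ∈ U) :
    downInt E₁ E₂ x - upInt E₁ E₂ x = downInt E₁ E₂ y - upInt E₁ E₂ y := by
  have hd : ∀ k ∈ U, HasDerivAt (downInt E₁ E₂ - upInt E₁ E₂) 0 k := by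
    intro k hk
    have := (hasDerivAt_downInt h₁ h₂ (mem_downSet_of_re_ne (hre k hk).1 (hre k hk).2)).sub
      (hasDerivAt_upInt h₁ h₂ (conj_mem_downSet_of_re_ne (hre k hk).1 (hre k hk).2))
    rwa [sub_self] at this
  exact hU.is_const_of_deriv_eq_zero hconv.isPreconnected
    (fun k hk => (hd k hk).differentiableAt.differentiableWithinAt)
    (fun k hk => (hd k hk).deriv) hx hy

theorem tendsto_downInt_sub_upInt {E₁ E₂ : ℂ} (h₁ : 0 < E₁.im) (h₂ : 0 < E₂.im) :
    Tendsto (fun k => downInt E₁ E₂ k - upInt E₁ E₂ k)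
      (Bornology.cobounded ℂ ⊓ 𝓟 {k | k.im = 0}) (𝓝 0) := by
  have h1 := (tendsto_downInt h₁ h₂).mono_left (inf_le_inf_left (Bornology.cobounded ℂ)
    (principal_mono.mpr (fun k (hk : k.im = 0) => hk.le) : 𝓟 {k : ℂ | k.im = 0} ≤ _))
  have h2 := (tendsto_upInt h₁ h₂).mono_left (inf_le_inf_left (Bornology.cobounded ℂ)
    (principal_mono.mpr (fun k (hk : k.im = 0) => hk.ge) : 𝓟 {k : ℂ | k.im = 0} ≤ _))
  simpa using h1.sub h2

/-- Both are primitives of `form` in the half plane left of the cuts, so the difference is constant,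
and along the negative real axis both tend to `0`. -/
theorem downInt_eq_upInt_left {E₁ E₂ k : ℂ} (h₁ : 0 < E₁.im) (h₂ : 0 < E₂.im)
    (hk₁ : k.re < E₁.re) (hk₂ : k.re < E₂.re) : downInt E₁ E₂ k = upInt E₁ E₂ k := by
  have hlim : Tendsto (fun x : ℝ => (x : ℂ)) atBot
      (Bornology.cobounded ℂ ⊓ 𝓟 {k | k.im = 0}) := by
    refine tendsto_inf.mpr ⟨?_, tendsto_principal.mpr (Eventually.of_forall fun x => by simp)⟩
    rw [← tendsto_norm_atTop_iff_cobounded]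
    simp only [norm_real, Real.norm_eq_abs]
    exact tendsto_abs_atBot_atTop
  have h3 := (tendsto_downInt_sub_upInt h₁ h₂).comp hlim
  have h4 : ∀ᶠ x : ℝ in atBot, downInt E₁ E₂ k - upInt E₁ E₂ k =
      downInt E₁ E₂ x - upInt E₁ E₂ x := by
    filter_upwards [eventually_lt_atBot (min E₁.re E₂.re)] with x hx
    refine downInt_sub_upInt_const h₁ h₂ (U := {k : ℂ | k.re < min E₁.re E₂.re})
      (isOpen_lt continuous_re continuous_const) (convex_halfSpace_re_lt _) (fun k hk => ?_) ?_ ?_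
    · exact ⟨(lt_min_iff.mp hk).1.ne, (lt_min_iff.mp hk).2.ne⟩
    · exact lt_min hk₁ hk₂
    · simpa using hx
  have h5 := tendsto_nhds_unique (tendsto_const_nhds.congr' h4) h3
  exact sub_eq_zero.mp h5

theorem downInt_eq_upInt_right {E₁ E₂ k : ℂ} (h₁ : 0 < E₁.im) (h₂ : 0 < E₂.im)
    (hk₁ : E₁.re < k.re) (hk₂ : E₂.re < k.re) : downInt E₁ E₂ k = upInt E₁ E₂ k := by
  have hlim : Tendsto (fun x : ℝ => (x : ℂ)) atTop
      (Bornology.cobounded ℂ ⊓ 𝓟 {k | k.im = 0}) := by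
    refine tendsto_inf.mpr ⟨?_, tendsto_principal.mpr (Eventually.of_forall fun x => by simp)⟩
    rw [← tendsto_norm_atTop_iff_cobounded]
    simp only [norm_real]
    exact tendsto_norm_atTop_atTop
  have h3 := (tendsto_downInt_sub_upInt h₁ h₂).comp hlim
  have h4 : ∀ᶠ x : ℝ in atTop, downInt E₁ E₂ k - upInt E₁ E₂ k =
      downInt E₁ E₂ x - upInt E₁ E₂ x := by
    filter_upwards [eventually_gt_atTop (max E₁.re E₂.re)] with x hx
    refine downInt_sub_upInt_const h₁ h₂ (U := {k : ℂ | max E₁.re E₂.re < k.re})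
      (isOpen_lt continuous_const continuous_re) (convex_halfSpace_re_gt _) (fun k hk => ?_) ?_ ?_
    · exact ⟨(max_lt_iff.mp hk).1.ne', (max_lt_iff.mp hk).2.ne'⟩
    · exact max_lt hk₁ hk₂
    · simpa using hx
  have h5 := tendsto_nhds_unique (tendsto_const_nhds.congr' h4) h3
  exact sub_eq_zero.mp h5

/-- On the upper side of the rectangle `upInt` is a primitive, on the three others `downInt`. The
primitives agree at the upper left corner, so only their difference at the upper right corner
remains; it is constant in the strip. -/
theorem downInt_sub_upInt_strip {E₁ E₂ k : ℂ} (h₁ : 0 < E₁.im) (h₂ : 0 < E₂.im)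
    (hk₁ : E₁.re < k.re) (hk₂ : k.re < E₂.re) :
    downInt E₁ E₂ k - upInt E₁ E₂ k = aPeriod E₁ E₂ := by
  have h : E₁.re < E₂.re := hk₁.trans hk₂
  have hcont := (differentiableOn_form h₁ h₂).continuousOn
  have hdown : ∀ a b : ℂ, (∀ s ∈ Icc (0 : ℝ) 1, a + (s : ℂ) * (b - a) ∈ downSet E₁ E₂) →
      segInt (form E₁ E₂) a b = downInt E₁ E₂ b - downInt E₁ E₂ a := fun a b hab =>
    segInt_eq_of_hasDerivAt (fun k hk => hasDerivAt_downInt h₁ h₂ hk)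
      (hcont.mono fun k hk => downSet_subset h₁ h₂ hk) hab
  have hup : ∀ a b : ℂ, (∀ s ∈ Icc (0 : ℝ) 1, conj (a + (s : ℂ) * (b - a)) ∈ downSet E₁ E₂) →
      segInt (form E₁ E₂) a b = upInt E₁ E₂ b - upInt E₁ E₂ a := fun a b hab =>
    segInt_eq_of_hasDerivAt (U := {k | conj k ∈ downSet E₁ E₂})
      (fun k hk => hasDerivAt_upInt h₁ h₂ hk)
      (hcont.mono fun k hk => (conj_mem_contour h₁ h₂).not.mp (downSet_subset h₁ h₂ hk)) hab
  obtain ⟨r, hr0⟩ : ∃ r : ℝ, r = (E₁.re + E₂.re) / 2 := ⟨_, rfl⟩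
  have hr : E₁.re < r := by linarith
  have hr' : r < E₂.re := by linarith
  have hre_le : ∀ s ∈ Icc (0 : ℝ) 1,
      E₁.re - 1 + s * (r - (E₁.re - 1)) < E₂.re := by
    rintro s ⟨hs0, hs1⟩
    nlinarith
  have hre_le' : ∀ s ∈ Icc (0 : ℝ) 1,
      r + s * ((E₁.re - 1) - r) < E₂.re := by
    rintro s ⟨hs0, hs1⟩
    nlinarith
  rw [aPeriod, ← hr0]
  rw [hdown, hdown, hup, hdown]
  · have e1 := downInt_sub_upInt_const h₁ h₂
      (U := {k : ℂ | E₁.re < k.re} ∩ {k : ℂ | k.re < E₂.re})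
      ((isOpen_lt continuous_const continuous_re).inter (isOpen_lt continuous_re continuous_const))
      ((convex_halfSpace_re_gt _).inter (convex_halfSpace_re_lt _))
      (fun k hk => ⟨ne_of_gt hk.1, ne_of_lt hk.2⟩) (x := k)
      (y := (r : ℂ) + ((E₁.im + 1 : ℝ) : ℂ) * I) ⟨hk₁, hk₂⟩
      ⟨by simpa using hr, by simpa using hr'⟩
    have e2 := downInt_eq_upInt_left h₁ h₂
      (k := ((E₁.re - 1 : ℝ) : ℂ) + ((E₁.im + 1 : ℝ) : ℂ) * I) (by simp) (by simp; linarith)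
    rw [e1]
    linear_combination e2
  · intro s hs
    refine mem_downSet_of_re_ne (ne_of_lt ?_) (ne_of_lt ?_) <;> simp
    linarith
  · intro s hs
    constructor
    · intro
      simp
    · intro h'
      have := hre_le' s hs
      simp at h'
      linarith
  · intro s hs
    refine mem_downSet_of_re_ne (ne_of_gt ?_) (ne_of_lt ?_) <;> simp <;> linarith
  · intro s hs
    constructor
    · intro
      simp
    · intro h'
      have := hre_le s hs
      simp at h'
      linarith

/-! ### The vertical ray from a branch point -/

theorem tip_ray_mem {E₁ E₂ : ℂ} (hne : E₁.re ≠ E₂.re)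
    {s : ℝ} (hs : 0 < s) : conj E₁ + (s : ℂ) * (-I) ∈ downSet E₁ E₂ := by
  constructor
  · intro
    simpa using hs
  · intro h
    simp at h
    exact absurd h hne

/-- Of the four distances in `norm_form_sq` one is exactly `s`, and the others are at least a
multiple of `1 + s`. So `form` is of order `s^(-1/2)` at the tip and `s^(-2)` at infinity; squaring
avoids the roots. -/
theorem exists_tip_bound {E₁ E₂ : ℂ} (h₁ : 0 < E₁.im) (h₂ : 0 < E₂.im) (hne : E₁.re ≠ E₂.re) :
    ∃ c > 0, ∀ s : ℝ, 0 < s →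
      ‖form E₁ E₂ (conj E₁ + (s : ℂ) * (-I))‖ ^ 2 ≤ (s * (c * (1 + s)) ^ 3)⁻¹ := by
  have hD : 0 < |E₁.re - E₂.re| := abs_pos.mpr (sub_ne_zero.mpr hne)
  have key : ∀ e : ℂ, ∀ ε : ℝ, 0 < ε → (∀ s : ℝ, 0 < s → ε ≤ ‖conj E₁ + (s : ℂ) * (-I) - e‖) →
      ∃ c > 0, ∀ s : ℝ, 0 < s → c * (1 + s) ≤ ‖conj E₁ + (s : ℂ) * (-I) - e‖ := by
    intro e ε hε H
    exact ⟨ε / (1 + ‖conj E₁ - e‖ + ε), by positivity, fun s hs =>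
      ray_lower_bound hε le_rfl hs.le (H s hs)⟩
  have hre : ∀ e : ℂ, e.re = E₂.re → ∀ s : ℝ, 0 < s →
      |E₁.re - E₂.re| ≤ ‖conj E₁ + (s : ℂ) * (-I) - e‖ := by
    intro e he s _
    have := abs_re_le_norm (conj E₁ + (s : ℂ) * (-I) - e)
    simpa [he] using this
  obtain ⟨c1, hc1, H1⟩ := key E₁ (2 * E₁.im) (by positivity) (fun s hs => by
    have := abs_im_le_norm (conj E₁ + (s : ℂ) * (-I) - E₁)
    refine le_trans ?_ this
    simp
    rw [abs_sub_comm, abs_of_pos (by linarith)]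
    linarith)
  obtain ⟨c2, hc2, H2⟩ := key E₂ _ hD (hre _ rfl)
  obtain ⟨c3, hc3, H3⟩ := key (conj E₂) _ hD (hre _ (by simp))
  refine ⟨min c1 (min c2 c3), by positivity, fun s hs => ?_⟩
  rw [norm_form_sq h₁ h₂ (downSet_subset h₁ h₂ (tip_ray_mem hne hs))]
  have hc : 0 < min c1 (min c2 c3) := by positivity
  set c := min c1 (min c2 c3) with hcdef
  have e1 : c * (1 + s) ≤ ‖conj E₁ + (s : ℂ) * (-I) - E₁‖ :=
    (mul_le_mul_of_nonneg_right (min_le_left _ _) (by linarith)).trans (H1 s hs)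
  have e2 : c * (1 + s) ≤ ‖conj E₁ + (s : ℂ) * (-I) - E₂‖ :=
    (mul_le_mul_of_nonneg_right ((min_le_right _ _).trans (min_le_left _ _))
      (by linarith)).trans (H2 s hs)
  have e3 : c * (1 + s) ≤ ‖conj E₁ + (s : ℂ) * (-I) - conj E₂‖ :=
    (mul_le_mul_of_nonneg_right ((min_le_right _ _).trans (min_le_right _ _))
      (by linarith)).trans (H3 s hs)
  have e4 : ‖conj E₁ + (s : ℂ) * (-I) - conj E₁‖ = s := by
    rw [add_sub_cancel_left, norm_mul, norm_neg, norm_I, mul_one, norm_real,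
      Real.norm_of_nonneg hs.le]
  rw [e4]
  apply inv_anti₀ (by positivity)
  calc s * (c * (1 + s)) ^ 3 = (c * (1 + s)) * s * ((c * (1 + s)) * (c * (1 + s))) := by ring
    _ ≤ _ := by gcongr

theorem integrableOn_form_tip {E₁ E₂ : ℂ} (h₁ : 0 < E₁.im) (h₂ : 0 < E₂.im)
    (hne : E₁.re ≠ E₂.re) :
    IntegrableOn (fun s : ℝ => form E₁ E₂ (conj E₁ + (s : ℂ) * (-I))) (Ioi 0) := by
  obtain ⟨c, hc, H⟩ := exists_tip_bound h₁ h₂ hne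
  have hcont : ContinuousOn (fun s : ℝ => form E₁ E₂ (conj E₁ + (s : ℂ) * (-I))) (Ioi 0) :=
    (differentiableOn_form h₁ h₂).continuousOn.comp (by fun_prop)
      fun s hs => downSet_subset h₁ h₂ (tip_ray_mem hne hs)
  have hsplit : Ioi (0 : ℝ) = Ioc 0 1 ∪ Ioi 1 := (Ioc_union_Ioi_eq_Ioi zero_le_one).symm
  set K := √((c ^ 3)⁻¹) with hK
  have hK2 : K ^ 2 = (c ^ 3)⁻¹ := Real.sq_sqrt (by positivity)
  rw [hsplit]
  refine IntegrableOn.union ?_ ?_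
  · refine Integrable.mono' (g := fun s : ℝ => K * s ^ (-(1 / 2) : ℝ)) ?_ ?_ ?_
    · have := (intervalIntegral.intervalIntegrable_rpow' (a := 0) (b := 1) (r := -(1 / 2))
        (by norm_num)).const_mul K
      rwa [intervalIntegrable_iff_integrableOn_Ioc_of_le zero_le_one] at this
    · exact (hcont.mono Ioc_subset_Ioi_self).aestronglyMeasurable measurableSet_Ioc
    · refine (ae_restrict_iff' measurableSet_Ioc).mpr (Eventually.of_forall fun s hs => ?_)
      have hs0 : 0 < s := hs.1
      rw [← sq_le_sq₀ (norm_nonneg _) (by positivity), mul_pow, hK2, ← Real.rpow_mul_natCast hs0.le]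
      refine (H s hs0).trans ?_
      have : s ^ (-(1 / 2) * ((2 : ℕ) : ℝ)) = s⁻¹ := by
        rw [← Real.rpow_neg_one]
        norm_num
      rw [this, ← mul_inv]
      apply inv_anti₀ (by positivity)
      rw [mul_comm, mul_pow]
      have : (1 : ℝ) ≤ (1 + s) ^ 3 := one_le_pow₀ (by linarith)
      have h3 : 0 < c ^ 3 := by positivity
      nlinarith [mul_pos h3 hs0]
  · refine Integrable.mono' (g := fun s : ℝ => K * (1 + s ^ 2)⁻¹) ?_ ?_ ?_
    · exact (integrable_inv_one_add_sq.const_mul _).integrableOn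
    · exact (hcont.mono (Ioi_subset_Ioi zero_le_one)).aestronglyMeasurable measurableSet_Ioi
    · refine (ae_restrict_iff' measurableSet_Ioi).mpr (Eventually.of_forall fun s hs => ?_)
      have hs1 : 1 < s := hs
      have hs0 : 0 < s := by linarith
      rw [← sq_le_sq₀ (norm_nonneg _) (by positivity), mul_pow, hK2]
      refine (H s hs0).trans ?_
      rw [inv_pow, ← mul_inv]
      apply inv_anti₀ (by positivity)
      have h3 : 0 < c ^ 3 := by positivity
      have h4 : (1 + s ^ 2) ^ 2 ≤ s * (1 + s) ^ 3 := by nlinarith [pow_pos hs0 3]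
      nlinarith [mul_le_mul_of_nonneg_left h4 h3.le]

/-- The tip is a singular point of `form`, so `downInt` is not differentiable there; continuity
along the ray comes from integrability of the singularity. -/
theorem tendsto_downInt_tip {E₁ E₂ : ℂ} (h₁ : 0 < E₁.im) (h₂ : 0 < E₂.im)
    (hne : E₁.re ≠ E₂.re) :
    Tendsto (fun r : ℝ => downInt E₁ E₂ (conj E₁ + (r : ℂ) * (-I))) (𝓝[>] 0)
      (𝓝 (downInt E₁ E₂ (conj E₁))) := by
  set u : ℝ → ℂ := fun s => form E₁ E₂ (conj E₁ + (s : ℂ) * (-I)) * (-I) with hu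
  have hint : IntegrableOn u (Ioi 0) := (integrableOn_form_tip h₁ h₂ hne).mul_const _
  have hval : ∀ r : ℝ, 0 ≤ r → downInt E₁ E₂ (conj E₁ + (r : ℂ) * (-I)) =
      -(∫ s in Ioi 0, u s) + ∫ s in (0 : ℝ)..r, u s := by
    intro r hr
    have h3 : ∫ s in Ioi (0 : ℝ), u (s + r) = ∫ s in Ioi r, u s := by
      have := (measurePreserving_add_right volume r).setIntegral_preimage_emb
        (MeasurableEquiv.addRight r).measurableEmbedding u (Ioi r)
      rw [← this]
      congr 2
      ext x
      simp
    have h4 : ∫ s in Ioi (0 : ℝ), u s = (∫ s in (0 : ℝ)..r, u s) + ∫ s in Ioi r, u s := by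
      rw [intervalIntegral.integral_of_le hr, ← setIntegral_union Ioc_disjoint_Ioi_same
        measurableSet_Ioi (hint.mono_set Ioc_subset_Ioi_self)
        (hint.mono_set (Ioi_subset_Ioi hr)), Ioc_union_Ioi_eq_Ioi hr]
    rw [h4, ← h3, downInt, rayInt]
    simp only [hu]
    have h5 : ∀ s : ℝ, conj E₁ + (r : ℂ) * (-I) + (s : ℂ) * (-I) =
        conj E₁ + ((s + r : ℝ) : ℂ) * (-I) := fun s => by push_cast; ring
    simp only [h5]
    ring
  have hii : IntervalIntegrable u volume 0 1 := by
    rw [intervalIntegrable_iff_integrableOn_Ioc_of_le zero_le_one]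
    exact hint.mono_set Ioc_subset_Ioi_self
  have hcont : ContinuousOn (fun r => ∫ s in (0 : ℝ)..r, u s) (Icc 0 1) := by
    have := intervalIntegral.continuousOn_primitive_interval
      ((intervalIntegrable_iff_integrableOn_Icc_of_le (f := u) zero_le_one).mp hii |>.congr_set_ae
        (by rw [uIcc_of_le zero_le_one]; exact ae_eq_refl _))
    rwa [uIcc_of_le zero_le_one] at this
  have hlim : Tendsto (fun r => ∫ s in (0 : ℝ)..r, u s) (𝓝[>] 0) (𝓝 0) := by
    have h3 := (hcont 0 (by simp)).tendsto
    simp only [intervalIntegral.integral_same] at h3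
    refine h3.mono_left ?_
    rw [← nhdsWithin_Ioc_eq_nhdsGT zero_lt_one]
    exact nhdsWithin_mono _ Ioc_subset_Icc_self
  have h0 := hval 0 le_rfl
  simp only [ofReal_zero, zero_mul, add_zero, intervalIntegral.integral_same] at h0
  rw [h0]
  have := hlim.const_add (-(∫ s in Ioi 0, u s))
  rw [add_zero] at this
  refine this.congr' ?_
  filter_upwards [self_mem_nhdsWithin] with r hr
  exact (hval r (le_of_lt hr)).symm

theorem downInt_tip {E₁ E₂ : ℂ} :
    downInt E₁ E₂ (conj E₁) = I * ∫ s in Ioi (0 : ℝ), form E₁ E₂ (conj E₁ + (s : ℂ) * (-I)) := by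
  rw [downInt, rayInt, integral_mul_const]
  ring

theorem form_re_im (E₁ E₂ k : ℂ) :
    (form E₁ E₂ k).re = ((rootFactor E₁ k).re * (rootFactor E₂ k).re -
        (rootFactor E₁ k).im * (rootFactor E₂ k).im) / normSq (wTilde E₁ E₂ k) ∧
    (form E₁ E₂ k).im = -((rootFactor E₁ k).re * (rootFactor E₂ k).im +
        (rootFactor E₁ k).im * (rootFactor E₂ k).re) / normSq (wTilde E₁ E₂ k) := by
  rw [form, one_div, inv_re, inv_im]
  simp only [wTilde, mul_re, mul_im]
  exact ⟨trivial, trivial⟩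

theorem setIntegral_Ioi_pos {u : ℝ → ℝ} (hu : IntegrableOn u (Ioi 0)) (hpos : ∀ s, 0 < s → 0 < u s) :
    0 < ∫ s in Ioi (0 : ℝ), u s := by
  rw [setIntegral_pos_iff_support_of_nonneg_ae ?_ hu]
  · have : Function.support u ∩ Ioi 0 = Ioi 0 :=
      inter_eq_right.mpr fun s hs => (hpos s hs).ne'
    rw [this]
    simp
  · exact (ae_restrict_iff' measurableSet_Ioi).mpr
      (Eventually.of_forall fun s hs => (hpos s hs).le)

theorem tip_values {E₁ E₂ : ℂ} (h₁ : 0 < E₁.im) (h₂ : 0 < E₂.im) (hne : E₁.re ≠ E₂.re) :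
    (downInt E₁ E₂ (conj E₁)).im =
        ∫ s in Ioi (0 : ℝ), (form E₁ E₂ (conj E₁ + (s : ℂ) * (-I))).re ∧
    (downInt E₁ E₂ (conj E₁)).re =
        -∫ s in Ioi (0 : ℝ), (form E₁ E₂ (conj E₁ + (s : ℂ) * (-I))).im := by
  have hint := integrableOn_form_tip h₁ h₂ hne
  have e1 := reCLM.integral_comp_comm hint
  have e2 := imCLM.integral_comp_comm hint
  simp only [reCLM_apply, imCLM_apply] at e1 e2
  rw [downInt_tip, e1, e2]
  simp

/-- On the ray `rootFactor E₁` is a negative multiple of `i`, and `rootFactor E₂` has negative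
imaginary part whichever cut is on the left; so `form` has negative real part. The nonvanishing of
the `a`-period rests on this. -/
theorem tip_im_neg {E₁ E₂ : ℂ} (h₁ : 0 < E₁.im) (h₂ : 0 < E₂.im) (hne : E₁.re ≠ E₂.re) :
    (downInt E₁ E₂ (conj E₁)).im < 0 := by
  have hint := integrableOn_form_tip h₁ h₂ hne
  rw [(tip_values h₁ h₂ hne).1]
  have := setIntegral_Ioi_pos (u := fun s => -(form E₁ E₂ (conj E₁ + (s : ℂ) * (-I))).re)
    hint.re.neg ?_
  · rw [integral_neg] at this
    linarith
  · intro s hs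
    have hw := normSq_pos.mpr
      (wTilde_ne_zero h₁ h₂ (downSet_subset h₁ h₂ (tip_ray_mem hne hs)))
    rw [(form_re_im _ _ _).1, ← neg_div]
    apply div_pos _ hw
    obtain ⟨r1, i1⟩ := rootFactor_below h₁ (k := conj E₁ + (s : ℂ) * (-I)) (by simp) (by simpa)
    have hc := fun h' => downSet_subset h₁ h₂ (tip_ray_mem hne hs) (Or.inr h')
    have hm := rootFactor_re_mul_im h₂ hc
    have him : (conj E₁ + (s : ℂ) * (-I)).im < 0 := by
      simp
      linarith
    rw [r1]
    rcases lt_or_gt_of_ne hne with h | h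
    · have := rootFactor_re_neg h₂ (k := conj E₁ + (s : ℂ) * (-I)) (by simpa)
      have h3 : (conj E₁ + (s : ℂ) * (-I)).re - E₂.re < 0 := by simpa
      have h4 := mul_pos_of_neg_of_neg h3 him
      rw [← hm] at h4
      nlinarith [neg_of_mul_pos_right h4 this.le]
    · have := rootFactor_re_pos h₂ (k := conj E₁ + (s : ℂ) * (-I)) (by simpa)
      have h3 : 0 < (conj E₁ + (s : ℂ) * (-I)).re - E₂.re := by simpa
      have h4 := mul_neg_of_pos_of_neg h3 him
      rw [← hm] at h4
      have h5 : (rootFactor E₂ (conj E₁ + (s : ℂ) * (-I))).im < 0 := by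
        by_contra! h6
        nlinarith
      nlinarith

/-- Unlike the imaginary part, the real part takes its sign from `(rootFactor E₂).re`, hence from
the side on which the other cut lies. The opposite signs at the two tips give `τ` its positive
imaginary part. -/
theorem tip_re_pos {E₁ E₂ : ℂ} (h₁ : 0 < E₁.im) (h₂ : 0 < E₂.im) (h : E₁.re < E₂.re) :
    0 < (downInt E₁ E₂ (conj E₁)).re := by
  have hne := h.ne
  have hint := integrableOn_form_tip h₁ h₂ hne
  rw [(tip_values h₁ h₂ hne).2, ← integral_neg]
  refine setIntegral_Ioi_pos (u := fun s => -(form E₁ E₂ (conj E₁ + (s : ℂ) * (-I))).im)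
    hint.im.neg ?_
  intro s hs
  have hw := normSq_pos.mpr
    (wTilde_ne_zero h₁ h₂ (downSet_subset h₁ h₂ (tip_ray_mem hne hs)))
  rw [(form_re_im _ _ _).2, ← neg_div, neg_neg]
  apply div_pos _ hw
  obtain ⟨r1, i1⟩ := rootFactor_below h₁ (k := conj E₁ + (s : ℂ) * (-I)) (by simp) (by simpa)
  have := rootFactor_re_neg h₂ (k := conj E₁ + (s : ℂ) * (-I)) (by simpa)
  rw [r1]
  nlinarith

theorem tip_re_neg {E₁ E₂ : ℂ} (h₁ : 0 < E₁.im) (h₂ : 0 < E₂.im) (h : E₂.re < E₁.re) :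
    (downInt E₁ E₂ (conj E₁)).re < 0 := by
  have hne := h.ne'
  have hint := integrableOn_form_tip h₁ h₂ hne
  rw [(tip_values h₁ h₂ hne).2]
  have := setIntegral_Ioi_pos (u := fun s => (form E₁ E₂ (conj E₁ + (s : ℂ) * (-I))).im)
    hint.im ?_
  · linarith
  intro s hs
  have hw := normSq_pos.mpr
    (wTilde_ne_zero h₁ h₂ (downSet_subset h₁ h₂ (tip_ray_mem hne hs)))
  rw [(form_re_im _ _ _).2]
  apply div_pos _ hw
  obtain ⟨r1, i1⟩ := rootFactor_below h₁ (k := conj E₁ + (s : ℂ) * (-I)) (by simp) (by simpa)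
  have := rootFactor_re_pos h₂ (k := conj E₁ + (s : ℂ) * (-I)) (by simpa)
  rw [r1]
  nlinarith

section

/-! ### Local primitives in the uniformizing coordinate -/

/-- A radius `ρ` such that the ellipses around `cut E` with parameter less than `ρ` have horizontal
semi-axis less than `D`. -/
def stripRadius (E : ℂ) (D : ℝ) : ℝ := Real.arsinh (D / E.im)

theorem stripRadius_pos {E : ℂ} {D : ℝ} (hE : 0 < E.im) (hD : 0 < D) : 0 < stripRadius E D :=
  Real.arsinh_pos_iff.mpr (div_pos hD hE)

theorem abs_ellMap_re_sub_lt {E z : ℂ} {D : ℝ} (hE : 0 < E.im) (hz : |z.re| < stripRadius E D) :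
    |(ellMap E z).re - E.re| < D := by
  rw [ellMap_re, sub_sub_cancel_left, abs_neg, abs_mul, abs_mul, abs_of_pos hE, Real.abs_sinh]
  have h1 : Real.sinh |z.re| < D / E.im := by
    rw [← Real.sinh_arsinh (D / E.im)]
    exact Real.sinh_lt_sinh.mpr hz
  rw [lt_div_iff₀ hE] at h1
  have h2 := Real.abs_sin_le_one z.im
  have h3 : 0 ≤ Real.sinh |z.re| := Real.sinh_nonneg_iff.mpr (abs_nonneg _)
  nlinarith [mul_le_mul_of_nonneg_left h2 h3]

theorem ellMap_notMem_other {E₁ E₂ z : ℂ} (h₁ : 0 < E₁.im)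
    (hz : |z.re| < stripRadius E₁ |E₁.re - E₂.re|) : ellMap E₁ z ∉ cut E₂ := by
  intro h
  have := abs_ellMap_re_sub_lt h₁ hz
  rw [re_eq_of_mem_cut h, abs_sub_comm] at this
  exact lt_irrefl _ this

theorem ellMap_notMem_contour {E₁ E₂ z : ℂ} (h₁ : 0 < E₁.im) (hz0 : 0 < z.re)
    (hz : z.re < stripRadius E₁ |E₁.re - E₂.re|) : ellMap E₁ z ∉ contour E₁ E₂ := by
  rintro (h | h)
  · exact ellMap_notMem_cut h₁ hz0 h
  · exact ellMap_notMem_other h₁ (by rwa [abs_of_pos hz0]) h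

/-- An ellipse meets the line of its own cut above the cut at `z.im = 0` and below it at `z.im = π`;
only the second value is admitted. The bound on `z.re` keeps the ellipse away from the line of the
other cut. -/
theorem ellMap_mem_downSet {E₁ E₂ z : ℂ} (h₁ : 0 < E₁.im) (hz0 : 0 < z.re)
    (hz : z.re < stripRadius E₁ |E₁.re - E₂.re|) (hi0 : 0 < z.im) (hi : z.im < 2 * Real.pi) :
    ellMap E₁ z ∈ downSet E₁ E₂ := by
  constructor
  · intro h
    rw [ellMap_re] at h
    have h3 : Real.sin z.im = 0 := by
      have : E₁.im * (Real.sinh z.re * Real.sin z.im) = 0 := by linarith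
      rcases mul_eq_zero.mp this with h' | h'
      · exact absurd h' h₁.ne'
      · exact (mul_eq_zero.mp h').resolve_left (Real.sinh_pos_iff.mpr hz0).ne'
    have h4 : z.im = Real.pi := by
      rcases lt_trichotomy z.im Real.pi with h5 | h5 | h5
      · exact absurd h3 (Real.sin_pos_of_pos_of_lt_pi hi0 h5).ne'
      · exact h5
      · have := Real.sin_neg_of_neg_of_neg_pi_lt (x := z.im - 2 * Real.pi) (by linarith)
          (by linarith)
        rw [Real.sin_sub_two_pi] at this
        exact absurd h3 this.ne
    rw [ellMap_im, h4, Real.cos_pi]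
    have := Real.one_lt_cosh.mpr hz0.ne'
    nlinarith
  · intro h
    have := abs_ellMap_re_sub_lt h₁ (by rwa [abs_of_pos hz0])
    rw [h, abs_sub_comm] at this
    exact absurd this (lt_irrefl _)

theorem convex_strip (ρ : ℝ) : Convex ℝ {z : ℂ | |z.re| < ρ} := by
  have : {z : ℂ | |z.re| < ρ} = {z : ℂ | -ρ < z.re} ∩ {z : ℂ | z.re < ρ} := by
    ext z
    simp only [mem_ofPred_eq, mem_inter_iff]
    exact abs_lt
  rw [this]
  exact (convex_halfSpace_re_gt _).inter (convex_halfSpace_re_lt _)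

theorem isOpen_strip (ρ : ℝ) : IsOpen {z : ℂ | |z.re| < ρ} :=
  isOpen_lt (continuous_abs.comp continuous_re) continuous_const

/-- In the coordinate `z` the differential is `dz / rootFactor E₂ (ellMap E₁ z)`, which is analytic
in the whole strip, imaginary axis included. A primitive of it is fitted to `downInt` by a constant
on a connected set where both are defined. -/
theorem exists_locPrim {E₁ E₂ : ℂ} (h₁ : 0 < E₁.im) (h₂ : 0 < E₂.im) (hne : E₁.re ≠ E₂.re) :
    ∃ ψ : ℂ → ℂ, (∀ z : ℂ, |z.re| < stripRadius E₁ |E₁.re - E₂.re| →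
        HasDerivAt ψ (1 / rootFactor E₂ (ellMap E₁ z)) z) ∧
      ∀ z : ℂ, 0 < z.re → z.re < stripRadius E₁ |E₁.re - E₂.re| → 0 < z.im → z.im < 2 * Real.pi →
        downInt E₁ E₂ (ellMap E₁ z) = ψ z := by
  set ρ := stripRadius E₁ |E₁.re - E₂.re| with hρ
  have hρ0 : 0 < ρ := stripRadius_pos h₁ (abs_pos.mpr (sub_ne_zero.mpr hne))
  have hdiff : DifferentiableOn ℂ (fun z => 1 / rootFactor E₂ (ellMap E₁ z)) {z : ℂ | |z.re| < ρ} := by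
    intro z hz
    have hz' := ellMap_notMem_other h₁ hz
    exact ((differentiableAt_const _).div ((differentiableAt_rootFactor h₂ hz').comp z
      (differentiable_ellMap E₁ z)) (rootFactor_ne_zero h₂ hz')).differentiableWithinAt
  obtain ⟨ψ₀, hψ₀⟩ := (convex_strip ρ).exists_forall_hasDerivWithinAt hdiff
  have hd : ∀ z : ℂ, |z.re| < ρ → HasDerivAt ψ₀ (1 / rootFactor E₂ (ellMap E₁ z)) z :=
    fun z hz => (hψ₀ z hz).hasDerivAt ((isOpen_strip ρ).mem_nhds hz)
  set U : Set ℂ := ({z : ℂ | 0 < z.re} ∩ {z : ℂ | z.re < ρ}) ∩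
    ({z : ℂ | 0 < z.im} ∩ {z : ℂ | z.im < 2 * Real.pi}) with hU
  have hUo : IsOpen U := ((isOpen_lt continuous_const continuous_re).inter
    (isOpen_lt continuous_re continuous_const)).inter
      ((isOpen_lt continuous_const continuous_im).inter (isOpen_lt continuous_im continuous_const))
  have hUc : Convex ℝ U := ((convex_halfSpace_re_gt _).inter (convex_halfSpace_re_lt _)).inter
    ((convex_halfSpace_im_gt _).inter (convex_halfSpace_im_lt _))
  have hder : ∀ z ∈ U, HasDerivAt (fun z => downInt E₁ E₂ (ellMap E₁ z) - ψ₀ z) 0 z := by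
    rintro z ⟨⟨a, b⟩, c, d⟩
    have hz : |z.re| < ρ := by
      rw [abs_of_pos a]
      exact b
    have e1 := (hasDerivAt_downInt h₁ h₂ (ellMap_mem_downSet h₁ a b c d)).comp z
      (hasDerivAt_ellMap E₁ z)
    have e2 := e1.sub (hd z hz)
    convert! e2 using 1
    have hc := ellMap_notMem_contour h₁ a b
    have n2 := rootFactor_ne_zero h₂ fun h => hc (Or.inr h)
    have n1 := rootFactor_ne_zero h₁ fun h => hc (Or.inl h)
    rw [form, wTilde, ← rootFactor_ellMap h₁ a]
    field_simp
    ring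
  set z₀ : ℂ := (ρ / 2 : ℝ) + Real.pi * I
  have hz₀ : z₀ ∈ U := by
    have := Real.pi_pos
    refine ⟨⟨?_, ?_⟩, ?_, ?_⟩ <;> simp [z₀] <;> linarith
  refine ⟨fun z => ψ₀ z + (downInt E₁ E₂ (ellMap E₁ z₀) - ψ₀ z₀), fun z hz =>
    (hd z hz).add_const _, fun z a b c d => ?_⟩
  have := hUo.is_const_of_deriv_eq_zero hUc.isPreconnected
    (fun z hz => (hder z hz).differentiableAt.differentiableWithinAt)
    (fun z hz => (hder z hz).deriv) (⟨⟨a, b⟩, c, d⟩ : z ∈ U) hz₀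
  rw [← this]
  ring

open Classical in
/-- The analytic continuation of `downInt ∘ ellMap E₁` to a vertical strip around the imaginary
axis. -/
def locPrim (E₁ E₂ : ℂ) : ℂ → ℂ :=
  if h : 0 < E₁.im ∧ 0 < E₂.im ∧ E₁.re ≠ E₂.re then (exists_locPrim h.1 h.2.1 h.2.2).choose else 0

theorem hasDerivAt_locPrim {E₁ E₂ z : ℂ} (h₁ : 0 < E₁.im) (h₂ : 0 < E₂.im) (hne : E₁.re ≠ E₂.re)
    (hz : |z.re| < stripRadius E₁ |E₁.re - E₂.re|) :
    HasDerivAt (locPrim E₁ E₂) (1 / rootFactor E₂ (ellMap E₁ z)) z := by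
  rw [locPrim, dif_pos ⟨h₁, h₂, hne⟩]
  exact (exists_locPrim h₁ h₂ hne).choose_spec.1 z hz

theorem downInt_ellMap {E₁ E₂ z : ℂ} (h₁ : 0 < E₁.im) (h₂ : 0 < E₂.im) (hne : E₁.re ≠ E₂.re)
    (hz0 : 0 < z.re) (hz : z.re < stripRadius E₁ |E₁.re - E₂.re|) (hi0 : 0 < z.im)
    (hi : z.im < 2 * Real.pi) : downInt E₁ E₂ (ellMap E₁ z) = locPrim E₁ E₂ z := by
  rw [locPrim, dif_pos ⟨h₁, h₂, hne⟩]
  exact (exists_locPrim h₁ h₂ hne).choose_spec.2 z hz0 hz hi0 hi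

theorem stripRadius_sep_pos {E₁ E₂ : ℂ} (h₁ : 0 < E₁.im) (hne : E₁.re ≠ E₂.re) :
    0 < stripRadius E₁ |E₁.re - E₂.re| :=
  stripRadius_pos h₁ (abs_pos.mpr (sub_ne_zero.mpr hne))

/-- The half line `z = x + πi`, `x > 0`, is the vertical ray below `conj E₁`, along which `downInt`
is known to be continuous down to the tip. -/
theorem locPrim_pi {E₁ E₂ : ℂ} (h₁ : 0 < E₁.im) (h₂ : 0 < E₂.im) (hne : E₁.re ≠ E₂.re) :
    locPrim E₁ E₂ (Real.pi * I) = downInt E₁ E₂ (conj E₁) := by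
  have hρ := stripRadius_sep_pos h₁ hne
  have h3 : conj E₁ = (E₁.re : ℂ) - (E₁.im : ℂ) * I := by
    apply Complex.ext <;> simp
  have hpath : Tendsto (fun x : ℝ => (x : ℂ) + Real.pi * I) (𝓝[>] 0) (𝓝 (Real.pi * I)) := by
    have : Continuous fun x : ℝ => (x : ℂ) + Real.pi * I := by fun_prop
    have := this.tendsto 0
    simp only [ofReal_zero, zero_add] at this
    exact this.mono_left nhdsWithin_le_nhds
  have hc : Tendsto (locPrim E₁ E₂) (𝓝 (Real.pi * I)) (𝓝 (locPrim E₁ E₂ (Real.pi * I))) :=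
    (hasDerivAt_locPrim h₁ h₂ hne (by simpa using hρ)).continuousAt
  have e1 := hc.comp hpath
  have htip : Tendsto (fun x : ℝ => E₁.im * (Real.cosh x - 1)) (𝓝[>] 0) (𝓝[>] 0) := by
    refine tendsto_nhdsWithin_iff.mpr ⟨?_, ?_⟩
    · have : Continuous fun x : ℝ => E₁.im * (Real.cosh x - 1) := by fun_prop
      have := this.tendsto 0
      simp only [Real.cosh_zero, sub_self, mul_zero] at this
      exact this.mono_left nhdsWithin_le_nhds
    · filter_upwards [self_mem_nhdsWithin] with x hx
      have := Real.one_lt_cosh.mpr (ne_of_gt hx)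
      exact mul_pos h₁ (by linarith)
  have e2 := (tendsto_downInt_tip h₁ h₂ hne).comp htip
  refine tendsto_nhds_unique (e1.congr' ?_) e2
  have hlt : ∀ᶠ x : ℝ in 𝓝[>] 0, x < stripRadius E₁ |E₁.re - E₂.re| :=
    nhdsWithin_le_nhds (eventually_lt_nhds hρ)
  filter_upwards [self_mem_nhdsWithin, hlt] with x hx hx'
  have hp := Real.pi_pos
  have := downInt_ellMap h₁ h₂ hne (z := (x : ℂ) + Real.pi * I) (by simpa using hx)
    (by simpa using hx') (by simpa using hp) (by simp; linarith)
  simp only [Function.comp]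
  rw [← this, h3, ellMap, cosh_add, cosh_mul_I, sinh_mul_I, cos_pi, sin_pi]
  congr 1
  push_cast
  ring

/-- `ellMap E₁` is invariant under `z ↦ 2πi - z`, so the derivative of the sum vanishes, and the
fixed point `πi` gives the constant. Both reflection laws of the Abel map come from here. -/
theorem locPrim_reflect {E₁ E₂ z : ℂ} (h₁ : 0 < E₁.im) (h₂ : 0 < E₂.im) (hne : E₁.re ≠ E₂.re)
    (hz : |z.re| < stripRadius E₁ |E₁.re - E₂.re|) :
    locPrim E₁ E₂ z + locPrim E₁ E₂ (2 * Real.pi * I - z) = 2 * downInt E₁ E₂ (conj E₁) := by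
  set ρ := stripRadius E₁ |E₁.re - E₂.re| with hρ
  have hρ0 : 0 < ρ := stripRadius_sep_pos h₁ hne
  have hd : ∀ z ∈ {z : ℂ | |z.re| < ρ},
      HasDerivAt (fun z => locPrim E₁ E₂ z + locPrim E₁ E₂ (2 * Real.pi * I - z)) 0 z := by
    intro z hz
    have hz' : |(2 * Real.pi * I - z).re| < ρ := by simpa using hz
    have e1 := hasDerivAt_locPrim h₁ h₂ hne hz
    have e2 := (hasDerivAt_locPrim h₁ h₂ hne hz').comp z
      ((hasDerivAt_id z).const_sub (2 * Real.pi * I))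
    have e3 := e1.add e2
    convert! e3 using 1
    have : ellMap E₁ (2 * Real.pi * I - z) = ellMap E₁ z := by
      rw [sub_eq_neg_add, ellMap_add_period, ellMap_neg]
    rw [this]
    ring
  have := (isOpen_strip ρ).is_const_of_deriv_eq_zero (convex_strip ρ).isPreconnected
    (fun z hz => (hd z hz).differentiableAt.differentiableWithinAt)
    (fun z hz => (hd z hz).deriv) (x := z) (y := Real.pi * I) hz (by simpa using hρ0)
  rw [this, show (2 : ℂ) * Real.pi * I - Real.pi * I = Real.pi * I by ring, locPrim_pi h₁ h₂ hne]
  ring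

/-- Limits in the `k`-plane from limits in the uniformizing coordinate. -/
theorem tendsto_of_ellMap {X : Type*} [TopologicalSpace X] {E z₀ z₁ : ℂ} (hE : 0 < E.im)
    {T q : ℂ → X} {side : Set ℂ} (hq : ContinuousAt q z₁)
    (h : ∀ᶠ z in 𝓝 z₀, ellMap E z ∈ side → ∃ z', ‖z' - z₁‖ = ‖z - z₀‖ ∧ T (ellMap E z) = q z') :
    Tendsto T (𝓝[side] (ellMap E z₀)) (𝓝 (q z₁)) := by
  intro U hU
  obtain ⟨δ, hδ, hδU⟩ := Metric.mem_nhds_iff.mp (hq hU)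
  have h1 : {z | ‖z - z₀‖ < δ ∧ (ellMap E z ∈ side →
      ∃ z', ‖z' - z₁‖ = ‖z - z₀‖ ∧ T (ellMap E z) = q z')} ∈ 𝓝 z₀ := by
    filter_upwards [h, Metric.ball_mem_nhds z₀ hδ] with z hz hz'
    rw [Metric.mem_ball, dist_eq_norm] at hz'
    exact ⟨hz', hz⟩
  have h2 := nhds_le_map_ellMap hE z₀ (image_mem_map h1)
  rw [mem_map, mem_nhdsWithin_iff_exists_mem_nhds_inter]
  refine ⟨_, h2, ?_⟩
  rintro _ ⟨⟨z, ⟨hz, hz'⟩, rfl⟩, hside⟩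
  obtain ⟨z', e1, e2⟩ := hz' hside
  rw [mem_preimage, e2]
  exact hδU (by rw [Metric.mem_ball, dist_eq_norm, e1]; exact hz)

theorem eventually_abs_re_lt {z₀ : ℂ} (h : z₀.re = 0) {ρ : ℝ} (hρ : 0 < ρ) :
    ∀ᶠ z : ℂ in 𝓝 z₀, |z.re| < ρ :=
  (isOpen_strip ρ).mem_nhds (by simpa [h] using hρ)

theorem eventually_im_mem_Ioo {z₀ : ℂ} {a b : ℝ} (h : z₀.im ∈ Ioo a b) :
    ∀ᶠ z : ℂ in 𝓝 z₀, a < z.im ∧ z.im < b :=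
  continuous_im.continuousAt.eventually (Ioo_mem_nhds h.1 h.2)

theorem sin_pos_of_ellMap_re_lt {E z : ℂ} (hE : 0 < E.im) (h : (ellMap E z).re < E.re) :
    0 < z.re * Real.sin z.im := by
  rw [ellMap_re] at h
  have h1 : 0 < Real.sinh z.re * Real.sin z.im := by
    by_contra! h'
    nlinarith
  rcases lt_trichotomy z.re 0 with h2 | h2 | h2
  · have := Real.sinh_neg_iff.mpr h2
    nlinarith
  · rw [h2] at h1
    simp at h1
  · have := Real.sinh_pos_iff.mpr h2
    nlinarith

theorem sin_neg_of_ellMap_re_gt {E z : ℂ} (hE : 0 < E.im) (h : E.re < (ellMap E z).re) :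
    z.re * Real.sin z.im < 0 := by
  rw [ellMap_re] at h
  have h1 : Real.sinh z.re * Real.sin z.im < 0 := by
    by_contra! h'
    nlinarith
  rcases lt_trichotomy z.re 0 with h2 | h2 | h2
  · have := Real.sinh_neg_iff.mpr h2
    nlinarith
  · rw [h2] at h1
    simp at h1
  · have := Real.sinh_pos_iff.mpr h2
    nlinarith

/-! ### One-sided limits at the points of a cut, read off in the coordinate `z` -/

section Limits

variable {X : Type*} [TopologicalSpace X] {E : ℂ} {ρ : ℝ} {T q : ℂ → X}

theorem tendsto_left_interior (hE : 0 < E.im) (hρ : 0 < ρ)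
    (hT : ∀ z : ℂ, 0 < z.re → z.re < ρ → 0 < z.im → z.im < 2 * Real.pi → T (ellMap E z) = q z)
    {θ : ℝ} (hθ : θ ∈ Ioo 0 Real.pi) (hq : ContinuousAt q (θ * I)) :
    Tendsto T (𝓝[{k | k.re < E.re}] (ellMap E (θ * I))) (𝓝 (q (θ * I))) := by
  refine tendsto_of_ellMap hE hq ?_
  filter_upwards [eventually_abs_re_lt (z₀ := θ * I) (by simp) hρ,
    eventually_im_mem_Ioo (z₀ := θ * I) (by simpa using hθ)] with z hz hz' hs
  have h1 := sin_pos_of_ellMap_re_lt hE hs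
  have h2 := Real.sin_pos_of_pos_of_lt_pi hz'.1 hz'.2
  have h3 := pos_of_mul_pos_left h1 h2.le
  exact ⟨z, rfl, hT z h3 (lt_of_abs_lt hz) hz'.1 (by linarith [Real.pi_pos])⟩

theorem tendsto_right_interior (hE : 0 < E.im) (hρ : 0 < ρ)
    (hT : ∀ z : ℂ, 0 < z.re → z.re < ρ → 0 < z.im → z.im < 2 * Real.pi → T (ellMap E z) = q z)
    {θ : ℝ} (hθ : θ ∈ Ioo Real.pi (2 * Real.pi)) (hq : ContinuousAt q (θ * I)) :
    Tendsto T (𝓝[{k | E.re < k.re}] (ellMap E (θ * I))) (𝓝 (q (θ * I))) := by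
  refine tendsto_of_ellMap hE hq ?_
  filter_upwards [eventually_abs_re_lt (z₀ := θ * I) (by simp) hρ,
    eventually_im_mem_Ioo (z₀ := θ * I) (by simpa using hθ)] with z hz hz' hs
  have h1 := sin_neg_of_ellMap_re_gt hE hs
  have h2 := Real.sin_neg_of_neg_of_neg_pi_lt (x := z.im - 2 * Real.pi) (by linarith)
    (by linarith)
  rw [Real.sin_sub_two_pi] at h2
  have h3 : 0 < z.re := by
    by_contra! h
    nlinarith
  exact ⟨z, rfl, hT z h3 (lt_of_abs_lt hz) (by linarith [Real.pi_pos]) hz'.2⟩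

theorem tendsto_left_top (hE : 0 < E.im) (hρ : 0 < ρ)
    (hT : ∀ z : ℂ, 0 < z.re → z.re < ρ → 0 < z.im → z.im < 2 * Real.pi → T (ellMap E z) = q z)
    (hq : ContinuousAt q 0) : Tendsto T (𝓝[{k | k.re < E.re}] E) (𝓝 (q 0)) := by
  have hE0 : ellMap E 0 = E := by
    rw [ellMap, cosh_zero, mul_one, re_add_im]
  have hp := Real.pi_pos
  suffices key : Tendsto T (𝓝[{k | k.re < E.re}] (ellMap E 0)) (𝓝 (q 0)) by rwa [hE0] at key
  refine tendsto_of_ellMap hE hq ?_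
  filter_upwards [eventually_abs_re_lt (z₀ := 0) (by simp) hρ,
    eventually_im_mem_Ioo (z₀ := 0) (a := -Real.pi) (b := Real.pi) (by simpa)] with z hz hz' hs
  have h1 := sin_pos_of_ellMap_re_lt hE hs
  rw [abs_lt] at hz
  rcases lt_trichotomy z.im 0 with h2 | h2 | h2
  · have h3 := Real.sin_neg_of_neg_of_neg_pi_lt h2 hz'.1
    have h4 : z.re < 0 := by
      by_contra! h
      nlinarith
    -- Both `z` and `-z` lie over the same point; the one with positive real part is in the domain
    -- of `hT`.
    refine ⟨-z, by simp, ?_⟩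
    rw [← ellMap_neg]
    exact hT (-z) (by simpa) (by simp; linarith) (by simpa) (by simp; linarith)
  · rw [h2] at h1
    simp at h1
  · have h3 := Real.sin_pos_of_pos_of_lt_pi h2 hz'.2
    exact ⟨z, rfl, hT z (pos_of_mul_pos_left h1 h3.le) hz.2 h2 (by linarith)⟩

/-- The upper end point is represented by `0` when approached from the left and by `2πi` from the
right. Since `q` is not assumed periodic, the two limits may differ; for `locPrim` they differ by
plus or minus the `a`-period. -/
theorem tendsto_right_top (hE : 0 < E.im) (hρ : 0 < ρ)
    (hT : ∀ z : ℂ, 0 < z.re → z.re < ρ → 0 < z.im → z.im < 2 * Real.pi → T (ellMap E z) = q z)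
    (hq : ContinuousAt q (2 * Real.pi * I)) :
    Tendsto T (𝓝[{k | E.re < k.re}] E) (𝓝 (q (2 * Real.pi * I))) := by
  have hE0 : ellMap E 0 = E := by
    rw [ellMap, cosh_zero, mul_one, re_add_im]
  have hp := Real.pi_pos
  suffices key : Tendsto T (𝓝[{k | E.re < k.re}] (ellMap E 0)) (𝓝 (q (2 * Real.pi * I))) by rwa [hE0] at key
  refine tendsto_of_ellMap hE hq ?_
  filter_upwards [eventually_abs_re_lt (z₀ := 0) (by simp) hρ,
    eventually_im_mem_Ioo (z₀ := 0) (a := -Real.pi) (b := Real.pi) (by simpa)] with z hz hz' hs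
  have h1 := sin_neg_of_ellMap_re_gt hE hs
  rw [abs_lt] at hz
  rcases lt_trichotomy z.im 0 with h2 | h2 | h2
  · have h3 := Real.sin_neg_of_neg_of_neg_pi_lt h2 hz'.1
    have h4 : 0 < z.re := by
      by_contra! h
      nlinarith
    refine ⟨z + 2 * Real.pi * I, by simp, ?_⟩
    rw [← ellMap_add_period]
    exact hT _ (by simpa) (by simpa using hz.2) (by simp; linarith) (by simpa)
  · rw [h2] at h1
    simp at h1
  · have h3 := Real.sin_pos_of_pos_of_lt_pi h2 hz'.2
    have h4 : z.re < 0 := by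
      by_contra! h
      nlinarith
    refine ⟨-z + 2 * Real.pi * I, by simp, ?_⟩
    rw [← ellMap_neg, ← ellMap_add_period]
    exact hT _ (by simpa) (by simp; linarith) (by simp; linarith) (by simpa)

/-- Near `πi` both `z` and `2πi - z` satisfy the bounds on the imaginary part, so one representative
serves both sides of the cut. -/
theorem tendsto_bottom (hE : 0 < E.im) (hρ : 0 < ρ)
    (hT : ∀ z : ℂ, 0 < z.re → z.re < ρ → 0 < z.im → z.im < 2 * Real.pi → T (ellMap E z) = q z)
    (hq : ContinuousAt q (Real.pi * I)) :
    Tendsto T (𝓝[(cut E)ᶜ] (conj E)) (𝓝 (q (Real.pi * I))) := by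
  have h3 : conj E = (E.re : ℂ) - (E.im : ℂ) * I := by
    apply Complex.ext <;> simp
  have hE0 : ellMap E (Real.pi * I) = conj E := by
    rw [ellMap, cosh_mul_I, cos_pi, h3]
    ring
  have hp := Real.pi_pos
  conv_lhs => rw [← hE0]
  refine tendsto_of_ellMap hE hq ?_
  filter_upwards [eventually_abs_re_lt (z₀ := Real.pi * I) (by simp) hρ,
    eventually_im_mem_Ioo (z₀ := Real.pi * I) (a := 0) (b := 2 * Real.pi)
      (by simp; constructor <;> linarith)] with z hz hz' hs
  rw [abs_lt] at hz
  rcases lt_trichotomy z.re 0 with h2 | h2 | h2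
  · refine ⟨-z + 2 * Real.pi * I, ?_, ?_⟩
    · rw [← norm_neg]
      congr 1
      ring
    · rw [← ellMap_neg, ← ellMap_add_period]
      exact hT _ (by simpa) (by simp; linarith) (by simp; linarith) (by simp; linarith)
  · exact absurd (ellMap_mem_cut hE h2) hs
  · exact ⟨z, rfl, hT z h2 hz.2 hz'.1 hz'.2⟩

end Limits

end

/-! ### Values of the primitive at the branch points, and the periods -/

theorem tendsto_downInt_corner {E₁ E₂ : ℂ} (h₁ : 0 < E₁.im) (h₂ : 0 < E₂.im)
    (hne : E₁.re ≠ E₂.re) :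
    Tendsto (downInt E₁ E₂) (𝓝[(cut E₁)ᶜ] (conj E₁)) (𝓝 (downInt E₁ E₂ (conj E₁))) := by
  have hρ := stripRadius_sep_pos h₁ hne
  rw [← locPrim_pi h₁ h₂ hne]
  exact tendsto_bottom h₁ hρ (fun z a b c d => downInt_ellMap h₁ h₂ hne a b c d)
    (hasDerivAt_locPrim h₁ h₂ hne (by simpa using hρ)).continuousAt

theorem neBot_left (k : ℂ) : (𝓝[{x : ℂ | x.re < k.re}] k).NeBot := by
  rw [← mem_closure_iff_nhdsWithin_neBot, closure_setOfPred_re_lt]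
  exact le_refl k.re

theorem neBot_right (k : ℂ) : (𝓝[{x : ℂ | k.re < x.re}] k).NeBot := by
  rw [← mem_closure_iff_nhdsWithin_neBot, closure_setOfPred_lt_re]
  exact le_refl k.re

/-- Values of `upInt` near `E₁` from values of `downInt` near `conj E₁`. -/
theorem tendsto_upInt_corner {E₁ E₂ : ℂ} (h₁ : 0 < E₁.im) (h₂ : 0 < E₂.im)
    (hne : E₁.re ≠ E₂.re) :
    Tendsto (upInt E₁ E₂) (𝓝[{k | k.re ≠ E₁.re}] E₁) (𝓝 (conj (downInt E₁ E₂ (conj E₁)))) := by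
  have hc : Tendsto (fun k : ℂ => conj k) (𝓝[{k | k.re ≠ E₁.re}] E₁) (𝓝[(cut E₁)ᶜ] (conj E₁)) := by
    refine tendsto_nhdsWithin_iff.mpr
      ⟨(continuous_conj.tendsto E₁).mono_left nhdsWithin_le_nhds, ?_⟩
    filter_upwards [self_mem_nhdsWithin] with k hk h
    exact hk (by simpa using re_eq_of_mem_cut h)
  have h3 := (continuous_conj.tendsto _).comp ((tendsto_downInt_corner h₁ h₂ hne).comp hc)
  refine h3.congr' ?_
  have hev : ∀ᶠ k : ℂ in 𝓝 E₁, k.re ≠ E₂.re :=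
    continuous_re.continuousAt.eventually_ne hne
  filter_upwards [self_mem_nhdsWithin, nhdsWithin_le_nhds hev] with k hk hk'
  have := upInt_conj h₁ h₂ (k := conj k) fun s hs =>
    downSet_subset h₁ h₂ (downSet_ray (mem_downSet_of_re_ne (by simpa using hk) (by simpa using hk'))
      hs.le)
  rw [conj_conj] at this
  exact this.symm

/-- Near `E₁` the function `upInt` is the conjugate of `downInt` near `conj E₁`, and left of both
cuts it coincides with `downInt`. -/
theorem locPrim_zero_left {E₁ E₂ : ℂ} (h₁ : 0 < E₁.im) (h₂ : 0 < E₂.im) (h : E₁.re < E₂.re) :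
    locPrim E₁ E₂ 0 = conj (downInt E₁ E₂ (conj E₁)) := by
  have hρ := stripRadius_sep_pos h₁ h.ne
  have e1 := tendsto_left_top h₁ hρ (fun z a b c d => downInt_ellMap h₁ h₂ h.ne a b c d)
    (hasDerivAt_locPrim h₁ h₂ h.ne (by simpa using hρ)).continuousAt
  have e2 := (tendsto_upInt_corner h₁ h₂ h.ne).mono_left
    (nhdsWithin_mono E₁ (fun k (hk : k.re < E₁.re) => hk.ne : {k : ℂ | k.re < E₁.re} ⊆ _))
  have := neBot_left E₁
  refine tendsto_nhds_unique e1 (e2.congr' ?_)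
  filter_upwards [self_mem_nhdsWithin] with k hk
  have hk' : k.re < E₁.re := hk
  exact (downInt_eq_upInt_left h₁ h₂ hk' (hk'.trans h)).symm

theorem locPrim_two_pi_left {E₁ E₂ : ℂ} (h₁ : 0 < E₁.im) (h₂ : 0 < E₂.im) (h : E₁.re < E₂.re) :
    locPrim E₁ E₂ (2 * Real.pi * I) = conj (downInt E₁ E₂ (conj E₁)) + aPeriod E₁ E₂ := by
  have hρ := stripRadius_sep_pos h₁ h.ne
  have e1 := tendsto_right_top h₁ hρ (fun z a b c d => downInt_ellMap h₁ h₂ h.ne a b c d)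
    (hasDerivAt_locPrim h₁ h₂ h.ne (by simpa using hρ)).continuousAt
  have e2 := ((tendsto_upInt_corner h₁ h₂ h.ne).mono_left
    (nhdsWithin_mono E₁ (fun k (hk : E₁.re < k.re) => hk.ne' : {k : ℂ | E₁.re < k.re} ⊆ _))).add_const
      (aPeriod E₁ E₂)
  have := neBot_right E₁
  refine tendsto_nhds_unique e1 (e2.congr' ?_)
  have hev : ∀ᶠ k : ℂ in 𝓝 E₁, k.re < E₂.re := continuous_re.continuousAt.eventually_lt_const h
  filter_upwards [self_mem_nhdsWithin, nhdsWithin_le_nhds hev] with k hk hk'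
  rw [← downInt_sub_upInt_strip h₁ h₂ hk hk']
  ring

theorem locPrim_zero_right {E₁ E₂ : ℂ} (h₁ : 0 < E₁.im) (h₂ : 0 < E₂.im) (h : E₁.re < E₂.re) :
    locPrim E₂ E₁ 0 = conj (downInt E₁ E₂ (conj E₂)) + aPeriod E₁ E₂ := by
  have hρ := stripRadius_sep_pos h₂ h.ne'
  have e1 := tendsto_left_top h₂ hρ (fun z a b c d => downInt_ellMap h₂ h₁ h.ne' a b c d)
    (hasDerivAt_locPrim h₂ h₁ h.ne' (by simpa using hρ)).continuousAt
  have e2 := ((tendsto_upInt_corner h₂ h₁ h.ne').mono_left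
    (nhdsWithin_mono E₂ (fun k (hk : k.re < E₂.re) => hk.ne : {k : ℂ | k.re < E₂.re} ⊆ _))).add_const
      (aPeriod E₁ E₂)
  rw [upInt_comm, downInt_comm] at e2
  rw [downInt_comm] at e1
  have := neBot_left E₂
  refine tendsto_nhds_unique e1 (e2.congr' ?_)
  have hev : ∀ᶠ k : ℂ in 𝓝 E₂, E₁.re < k.re := continuous_re.continuousAt.eventually_const_lt h
  filter_upwards [self_mem_nhdsWithin, nhdsWithin_le_nhds hev] with k hk hk'
  rw [← downInt_sub_upInt_strip h₁ h₂ hk' hk]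
  ring

theorem locPrim_two_pi_right {E₁ E₂ : ℂ} (h₁ : 0 < E₁.im) (h₂ : 0 < E₂.im) (h : E₁.re < E₂.re) :
    locPrim E₂ E₁ (2 * Real.pi * I) = conj (downInt E₁ E₂ (conj E₂)) := by
  have hρ := stripRadius_sep_pos h₂ h.ne'
  have e1 := tendsto_right_top h₂ hρ (fun z a b c d => downInt_ellMap h₂ h₁ h.ne' a b c d)
    (hasDerivAt_locPrim h₂ h₁ h.ne' (by simpa using hρ)).continuousAt
  have e2 := (tendsto_upInt_corner h₂ h₁ h.ne').mono_left
    (nhdsWithin_mono E₂ (fun k (hk : E₂.re < k.re) => hk.ne' : {k : ℂ | E₂.re < k.re} ⊆ _))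
  rw [upInt_comm, downInt_comm] at e2
  rw [downInt_comm] at e1
  have := neBot_right E₂
  refine tendsto_nhds_unique e1 (e2.congr' ?_)
  filter_upwards [self_mem_nhdsWithin] with k hk
  have hk' : E₂.re < k.re := hk
  exact (downInt_eq_upInt_right h₁ h₂ (h.trans hk') hk').symm

/-- `locPrim_reflect` at `z = 0` compares the two values at the upper end of the cut with the one at
the lower end. As conjugation relates the ends, the period is purely imaginary and determined by a
single tip value. -/
theorem aPeriod_eq_left {E₁ E₂ : ℂ} (h₁ : 0 < E₁.im) (h₂ : 0 < E₂.im) (h : E₁.re < E₂.re) :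
    aPeriod E₁ E₂ =
      2 * (downInt E₁ E₂ (conj E₁) - conj (downInt E₁ E₂ (conj E₁))) := by
  have := locPrim_reflect h₁ h₂ h.ne (z := 0) (by simpa using stripRadius_sep_pos h₁ h.ne)
  rw [sub_zero, locPrim_zero_left h₁ h₂ h, locPrim_two_pi_left h₁ h₂ h] at this
  linear_combination this

theorem aPeriod_eq_right {E₁ E₂ : ℂ} (h₁ : 0 < E₁.im) (h₂ : 0 < E₂.im) (h : E₁.re < E₂.re) :
    aPeriod E₁ E₂ =
      2 * (downInt E₁ E₂ (conj E₂) - conj (downInt E₁ E₂ (conj E₂))) := by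
  have := locPrim_reflect h₂ h₁ h.ne' (z := 0) (by simpa using stripRadius_sep_pos h₂ h.ne')
  rw [sub_zero, locPrim_zero_right h₁ h₂ h, locPrim_two_pi_right h₁ h₂ h, downInt_comm E₁ E₂] at this
  linear_combination this

theorem aPeriod_re_im {E₁ E₂ : ℂ} (h₁ : 0 < E₁.im) (h₂ : 0 < E₂.im) (h : E₁.re < E₂.re) :
    (aPeriod E₁ E₂).re = 0 ∧ (aPeriod E₁ E₂).im < 0 := by
  rw [aPeriod_eq_left h₁ h₂ h]
  have := tip_im_neg h₁ h₂ h.ne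
  constructor
  · simp
  · simp
    linarith

theorem aPeriod_ne_zero {E₁ E₂ : ℂ} (h₁ : 0 < E₁.im) (h₂ : 0 < E₂.im) (h : E₁.re < E₂.re) :
    aPeriod E₁ E₂ ≠ 0 := by
  intro h0
  have := (aPeriod_re_im h₁ h₂ h).2
  rw [h0] at this
  simp at this

theorem tip_im_eq {E₁ E₂ : ℂ} (h₁ : 0 < E₁.im) (h₂ : 0 < E₂.im) (h : E₁.re < E₂.re) :
    (downInt E₁ E₂ (conj E₁)).im = (downInt E₁ E₂ (conj E₂)).im := by
  have := (aPeriod_eq_left h₁ h₂ h).symm.trans (aPeriod_eq_right h₁ h₂ h)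
  have := congrArg Complex.im this
  simp at this
  linarith

/-- Integration along a segment whose interior is in the domain of a primitive. -/
theorem segInt_eq_of_tendsto {f F : ℂ → ℂ} {a b Fa Fb : ℂ} {C : ℝ}
    (hF : ∀ s ∈ Ioo (0 : ℝ) 1, HasDerivAt F (f (a + (s : ℂ) * (b - a))) (a + (s : ℂ) * (b - a)))
    (hf : ContinuousOn (fun s : ℝ => f (a + (s : ℂ) * (b - a))) (Ioo 0 1))
    (hbd : ∀ s ∈ Ioo (0 : ℝ) 1, ‖f (a + (s : ℂ) * (b - a))‖ ^ 2 ≤ C * (s⁻¹ + (1 - s)⁻¹))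
    (ha : Tendsto (fun s : ℝ => F (a + (s : ℂ) * (b - a))) (𝓝[>] 0) (𝓝 Fa))
    (hb : Tendsto (fun s : ℝ => F (a + (s : ℂ) * (b - a))) (𝓝[<] 1) (𝓝 Fb)) :
    segInt f a b = Fb - Fa := by
  have hC : 0 ≤ C := by
    have h1 := hbd (1 / 2) (by norm_num)
    have h2 := sq_nonneg ‖f (a + ((1 / 2 : ℝ) : ℂ) * (b - a))‖
    by_contra! h3
    have h4 : ((1 / 2 : ℝ)⁻¹ + (1 - 1 / 2 : ℝ)⁻¹) = 4 := by norm_num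
    rw [h4] at h1
    linarith
  have hpath : ∀ s : ℝ, HasDerivAt (fun s : ℝ => a + (s : ℂ) * (b - a)) (b - a) s := by
    intro s
    have := ((hasDerivAt_id s).ofReal_comp.mul_const (b - a)).const_add a
    simpa using this
  rw [segInt]
  refine intervalIntegral.integral_eq_sub_of_hasDerivAt_of_tendsto zero_lt_one
    (f := fun s : ℝ => F (a + (s : ℂ) * (b - a))) (fun s hs => ?_) ?_ ha hb
  · exact HasDerivAt.comp (h := fun s : ℝ => a + (s : ℂ) * (b - a)) (h₂ := F) s (hF s hs) (hpath s)
  · refine IntervalIntegrable.mul_const ?_ _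
    rw [intervalIntegrable_iff_integrableOn_Ioo_of_le zero_le_one]
    have hi : IntegrableOn (fun s : ℝ => √C * (s ^ (-(1 / 2) : ℝ) + (1 - s) ^ (-(1 / 2) : ℝ)))
        (Ioo 0 1) := by
      have e1 := (intervalIntegral.intervalIntegrable_rpow' (a := 0) (b := 1) (r := -(1 / 2))
        (by norm_num))
      have e2 := (e1.comp_sub_left 1).symm
      simp only [sub_zero, sub_self] at e2
      have := (e1.add e2).const_mul √C
      rwa [intervalIntegrable_iff_integrableOn_Ioo_of_le zero_le_one] at this
    refine Integrable.mono' hi (hf.aestronglyMeasurable measurableSet_Ioo) ?_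
    refine (ae_restrict_iff' measurableSet_Ioo).mpr (Eventually.of_forall fun s hs => ?_)
    have hs0 : 0 < s := hs.1
    have hs1 : 0 < 1 - s := by linarith [hs.2]
    have e : ∀ x : ℝ, 0 < x → (x ^ (-(1 / 2) : ℝ)) ^ 2 = x⁻¹ := by
      intro x hx
      rw [← Real.rpow_mul_natCast hx.le, ← Real.rpow_neg_one]
      norm_num
    rw [← sq_le_sq₀ (norm_nonneg _) (by positivity), mul_pow, Real.sq_sqrt hC]
    refine (hbd s hs).trans ?_
    gcongr
    rw [← e s hs0, ← e (1 - s) hs1]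
    have p1 : 0 < s ^ (-(1 / 2) : ℝ) := by positivity
    have p2 : 0 < (1 - s) ^ (-(1 / 2) : ℝ) := by positivity
    nlinarith [mul_pos p1 p2]

theorem tendsto_segment_start (a b : ℂ) :
    Tendsto (fun s : ℝ => a + (s : ℂ) * (b - a)) (𝓝[>] 0) (𝓝 a) := by
  have : Continuous fun s : ℝ => a + (s : ℂ) * (b - a) := by fun_prop
  have := this.tendsto 0
  simp only [ofReal_zero, zero_mul, add_zero] at this
  exact this.mono_left nhdsWithin_le_nhds

theorem tendsto_segment_end (a b : ℂ) :
    Tendsto (fun s : ℝ => a + (s : ℂ) * (b - a)) (𝓝[<] 1) (𝓝 b) := by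
  have : Continuous fun s : ℝ => a + (s : ℂ) * (b - a) := by fun_prop
  have := this.tendsto 1
  simp only [ofReal_one, one_mul, add_sub_cancel] at this
  exact this.mono_left nhdsWithin_le_nhds

theorem segInt_form_of_corner {E₁ E₂ b Fb : ℂ} (h₁ : 0 < E₁.im) (h₂ : 0 < E₂.im)
    (h : E₁.re < E₂.re) (hre : E₁.re ≤ b.re ∧ b.re < E₂.re) {C : ℝ}
    (hbd : ∀ s ∈ Ioo (0 : ℝ) 1,
      ‖form E₁ E₂ (conj E₂ + (s : ℂ) * (b - conj E₂))‖ ^ 2 ≤ C * (s⁻¹ + (1 - s)⁻¹))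
    (hb : Tendsto (fun s : ℝ => downInt E₁ E₂ (conj E₂ + (s : ℂ) * (b - conj E₂))) (𝓝[<] 1)
      (𝓝 Fb)) :
    segInt (form E₁ E₂) (conj E₂) b = Fb - downInt E₁ E₂ (conj E₂) := by
  have hstrip : ∀ s ∈ Ioo (0 : ℝ) 1, E₁.re < (conj E₂ + (s : ℂ) * (b - conj E₂)).re ∧
      (conj E₂ + (s : ℂ) * (b - conj E₂)).re < E₂.re := by
    rintro s ⟨hs0, hs1⟩
    simp
    constructor <;> nlinarith
  have hdown : ∀ s ∈ Ioo (0 : ℝ) 1, conj E₂ + (s : ℂ) * (b - conj E₂) ∈ downSet E₁ E₂ :=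
    fun s hs => mem_downSet_of_re_ne (hstrip s hs).1.ne' (hstrip s hs).2.ne
  refine segInt_eq_of_tendsto (F := downInt E₁ E₂)
    (fun s hs => hasDerivAt_downInt h₁ h₂ (hdown s hs)) ?_ hbd ?_ hb
  · exact (differentiableOn_form h₁ h₂).continuousOn.comp (by fun_prop)
      fun s hs => downSet_subset h₁ h₂ (hdown s hs)
  · have hc := tendsto_downInt_corner h₂ h₁ h.ne'
    rw [downInt_comm] at hc
    refine hc.comp (tendsto_nhdsWithin_iff.mpr ⟨tendsto_segment_start _ _, ?_⟩)
    filter_upwards [Ioo_mem_nhdsGT zero_lt_one] with s hs h3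
    exact (hstrip s hs).2.ne (re_eq_of_mem_cut h3)

theorem segInt_form_corners {E₁ E₂ : ℂ} (h₁ : 0 < E₁.im) (h₂ : 0 < E₂.im) (h : E₁.re < E₂.re) :
    segInt (form E₁ E₂) (conj E₂) (conj E₁) =
      downInt E₁ E₂ (conj E₁) - downInt E₁ E₂ (conj E₂) := by
  have hL : 0 < ‖conj E₁ - conj E₂‖ := by
    rw [norm_pos_iff, sub_ne_zero]
    intro h3
    have := congrArg Complex.re h3
    simp at this
    linarith
  have hstrip : ∀ s ∈ Ioo (0 : ℝ) 1, E₁.re < (conj E₂ + (s : ℂ) * (conj E₁ - conj E₂)).re ∧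
      (conj E₂ + (s : ℂ) * (conj E₁ - conj E₂)).re < E₂.re := by
    rintro s ⟨hs0, hs1⟩
    simp
    constructor <;> nlinarith
  -- The distances to `conj E₁` and `conj E₂` are the fractions `1 - s` and `s` of the length of the
  -- segment; those to `E₁` and `E₂` are at least `E₁.im` and `E₂.im`, since the segment is in the
  -- lower half plane.
  refine segInt_form_of_corner h₁ h₂ h (by simpa using h)
    (C := (‖conj E₁ - conj E₂‖ * ‖conj E₁ - conj E₂‖ * (E₁.im * E₂.im))⁻¹) ?_ ?_
  · intro s hs
    have hs0 : 0 < s := hs.1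
    have hs1 : 0 < 1 - s := by linarith [hs.2]
    have hoff := downSet_subset h₁ h₂
      (mem_downSet_of_re_ne (hstrip s hs).1.ne' (hstrip s hs).2.ne)
    have him : (conj E₂ + (s : ℂ) * (conj E₁ - conj E₂)).im ≤ 0 := by
      simp
      nlinarith
    have n2 : ‖conj E₂ + (s : ℂ) * (conj E₁ - conj E₂) - conj E₂‖ = s * ‖conj E₁ - conj E₂‖ := by
      rw [add_sub_cancel_left, norm_mul, norm_real, Real.norm_of_nonneg hs0.le]
    have n1 : ‖conj E₂ + (s : ℂ) * (conj E₁ - conj E₂) - conj E₁‖ =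
        (1 - s) * ‖conj E₁ - conj E₂‖ := by
      have : conj E₂ + (s : ℂ) * (conj E₁ - conj E₂) - conj E₁ =
          -(((1 - s : ℝ) : ℂ) * (conj E₁ - conj E₂)) := by
        push_cast
        ring
      rw [this, norm_neg, norm_mul, norm_real, Real.norm_of_nonneg hs1.le]
    have m1 : E₁.im ≤ ‖conj E₂ + (s : ℂ) * (conj E₁ - conj E₂) - E₁‖ := by
      have := abs_im_le_norm (conj E₂ + (s : ℂ) * (conj E₁ - conj E₂) - E₁)
      rw [sub_im, abs_sub_comm] at this
      exact le_trans (by linarith [le_abs_self (E₁.im -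
        (conj E₂ + (s : ℂ) * (conj E₁ - conj E₂)).im)]) this
    have m2 : E₂.im ≤ ‖conj E₂ + (s : ℂ) * (conj E₁ - conj E₂) - E₂‖ := by
      have := abs_im_le_norm (conj E₂ + (s : ℂ) * (conj E₁ - conj E₂) - E₂)
      rw [sub_im, abs_sub_comm] at this
      exact le_trans (by linarith [le_abs_self (E₂.im -
        (conj E₂ + (s : ℂ) * (conj E₁ - conj E₂)).im)]) this
    rw [norm_form_sq h₁ h₂ hoff, n1, n2]
    have : s⁻¹ + (1 - s)⁻¹ = (s * (1 - s))⁻¹ := by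
      field_simp
      ring
    rw [this, ← mul_inv]
    apply inv_anti₀ (by positivity)
    calc _ = E₁.im * ((1 - s) * ‖conj E₁ - conj E₂‖) * (E₂.im * (s * ‖conj E₁ - conj E₂‖)) := by
          ring
      _ ≤ _ := by gcongr
  · refine (tendsto_downInt_corner h₁ h₂ h.ne).comp
      (tendsto_nhdsWithin_iff.mpr ⟨tendsto_segment_end _ _, ?_⟩)
    filter_upwards [Ioo_mem_nhdsLT zero_lt_one] with s hs h3
    exact (hstrip s hs).1.ne' (re_eq_of_mem_cut h3)

/-- `P₁` is the mean of `E₁.re` and `E₂.re` with weights `E₂.im` and `E₁.im`. -/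
theorem P₁_strip {E₁ E₂ : ℂ} (h₁ : 0 < E₁.im) (h₂ : 0 < E₂.im) (h : E₁.re < E₂.re) :
    E₁.re < (P₁ E₁ E₂).re ∧ (P₁ E₁ E₂).re < E₂.re := by
  rw [P₁, ofReal_re, mul_im, add_im, lt_div_iff₀ (by positivity), div_lt_iff₀ (by positivity)]
  constructor <;> nlinarith

theorem segInt_form_P₁ {E₁ E₂ : ℂ} (h₁ : 0 < E₁.im) (h₂ : 0 < E₂.im) (h : E₁.re < E₂.re) :
    segInt (form E₁ E₂) (conj E₂) (P₁ E₁ E₂) =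
      downInt E₁ E₂ (P₁ E₁ E₂) - downInt E₁ E₂ (conj E₂) := by
  obtain ⟨hP1, hP2⟩ := P₁_strip h₁ h₂ h
  have hPim : (P₁ E₁ E₂).im = 0 := by rw [P₁, ofReal_im]
  set P := P₁ E₁ E₂ with hP
  have hL : 0 < ‖P - conj E₂‖ := by
    rw [norm_pos_iff, sub_ne_zero]
    intro h3
    have := congrArg Complex.re h3
    simp at this
    linarith
  have hstrip : ∀ s ∈ Ioo (0 : ℝ) 1, P.re < (conj E₂ + (s : ℂ) * (P - conj E₂)).re ∧
      (conj E₂ + (s : ℂ) * (P - conj E₂)).re < E₂.re := by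
    rintro s ⟨hs0, hs1⟩
    simp
    constructor <;> nlinarith
  have hd : 0 < P.re - E₁.re := by linarith
  refine segInt_form_of_corner h₁ h₂ h ⟨hP1.le, hP2⟩
    (C := ((P.re - E₁.re) * (P.re - E₁.re) * (E₂.im * ‖P - conj E₂‖))⁻¹) ?_ ?_
  · intro s hs
    have hs0 : 0 < s := hs.1
    have hs1 : 0 < 1 - s := by linarith [hs.2]
    have hoff := downSet_subset h₁ h₂
      (mem_downSet_of_re_ne (hP1.trans (hstrip s hs).1).ne' (hstrip s hs).2.ne)
    have him : (conj E₂ + (s : ℂ) * (P - conj E₂)).im ≤ 0 := by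
      simp [hPim]
      nlinarith
    have n2 : ‖conj E₂ + (s : ℂ) * (P - conj E₂) - conj E₂‖ = s * ‖P - conj E₂‖ := by
      rw [add_sub_cancel_left, norm_mul, norm_real, Real.norm_of_nonneg hs0.le]
    have m2 : E₂.im ≤ ‖conj E₂ + (s : ℂ) * (P - conj E₂) - E₂‖ := by
      have := abs_im_le_norm (conj E₂ + (s : ℂ) * (P - conj E₂) - E₂)
      rw [sub_im, abs_sub_comm] at this
      exact le_trans (by linarith [le_abs_self (E₂.im -
        (conj E₂ + (s : ℂ) * (P - conj E₂)).im)]) this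
    have m1 : ∀ e : ℂ, e.re = E₁.re →
        P.re - E₁.re ≤ ‖conj E₂ + (s : ℂ) * (P - conj E₂) - e‖ := by
      intro e he
      have := re_le_norm (conj E₂ + (s : ℂ) * (P - conj E₂) - e)
      rw [sub_re, he] at this
      linarith [(hstrip s hs).1]
    rw [norm_form_sq h₁ h₂ hoff, n2]
    have : s⁻¹ ≤ s⁻¹ + (1 - s)⁻¹ := by
      have : 0 < (1 - s)⁻¹ := by positivity
      linarith
    refine le_trans ?_ (mul_le_mul_of_nonneg_left this (by positivity))
    rw [← mul_inv]
    apply inv_anti₀ (by positivity)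
    calc _ = (P.re - E₁.re) * (P.re - E₁.re) * (E₂.im * (s * ‖P - conj E₂‖)) := by ring
      _ ≤ _ := by
        have a1 := m1 E₁ rfl
        have a2 := m1 (conj E₁) (by simp)
        gcongr
  · exact (hasDerivAt_downInt h₁ h₂ (mem_downSet_of_re_ne hP1.ne' hP2.ne)).continuousAt.tendsto.comp
      (tendsto_segment_end _ _)

/-! ### The period `τ` and the Abel map at `∞` and `P₁` -/

theorem segInt_const_mul (c : ℂ) (f : ℂ → ℂ) (a b : ℂ) :
    segInt (fun k => c * f k) a b = c * segInt f a b := by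
  rw [segInt, segInt, ← intervalIntegral.integral_const_mul]
  simp only [mul_assoc]

theorem segInt_neg_swap (f : ℂ → ℂ) (a b : ℂ) :
    segInt (fun k => -f k) b a = segInt f a b := by
  rw [segInt, segInt]
  have := intervalIntegral.integral_comp_sub_left (a := 0) (b := 1)
    (fun s : ℝ => f (a + (s : ℂ) * (b - a)) * (b - a)) 1
  simp only [sub_zero, sub_self] at this
  rw [← this]
  congr 1
  funext s
  have e : b + (s : ℂ) * (a - b) = a + ((1 - s : ℝ) : ℂ) * (b - a) := by
    push_cast
    ring
  rw [e]
  ring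

theorem tau_eq {E₁ E₂ : ℂ} (h₁ : 0 < E₁.im) (h₂ : 0 < E₂.im) (h : E₁.re < E₂.re) :
    tau E₁ E₂ = 2 * ((aPeriod E₁ E₂)⁻¹ *
      (downInt E₁ E₂ (conj E₁) - downInt E₁ E₂ (conj E₂))) := by
  rw [tau, segInt_neg_swap, ← two_mul]
  have : zeta E₁ E₂ = fun k => (aPeriod E₁ E₂)⁻¹ * form E₁ E₂ k := rfl
  rw [this, segInt_const_mul, segInt_form_corners h₁ h₂ h]

/-- The two tip values have the same imaginary part, a quarter of that of the `a`-period, so their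
difference is real; it is positive by the signs at the tips. The `a`-period is a negative multiple
of `i`. -/
theorem tau_eq_I_mul {E₁ E₂ : ℂ} (h₁ : 0 < E₁.im) (h₂ : 0 < E₂.im) (h : E₁.re < E₂.re) :
    ∃ s : ℝ, 0 < s ∧ tau E₁ E₂ = s * I := by
  obtain ⟨ha, ha'⟩ := aPeriod_re_im h₁ h₂ h
  have hre1 := tip_re_pos h₁ h₂ h
  have hre2 := tip_re_neg h₂ h₁ h
  have him := tip_im_eq h₁ h₂ h
  rw [downInt_comm] at hre2
  set g₁ := downInt E₁ E₂ (conj E₁)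
  set g₂ := downInt E₁ E₂ (conj E₂)
  have hg : g₁ - g₂ = ((g₁.re - g₂.re : ℝ) : ℂ) := by
    apply Complex.ext
    · simp
    · simp [him]
  have hA : aPeriod E₁ E₂ = ((aPeriod E₁ E₂).im : ℂ) * I := by
    apply Complex.ext <;> simp [ha]
  refine ⟨2 * ((g₁.re - g₂.re) / (-(aPeriod E₁ E₂).im)), by
    have : 0 < -(aPeriod E₁ E₂).im := by linarith
    have : 0 < g₁.re - g₂.re := by linarith
    positivity, ?_⟩
  rw [tau_eq h₁ h₂ h]
  have hA0 : ((aPeriod E₁ E₂).im : ℂ) ≠ 0 := ofReal_ne_zero.mpr ha'.ne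
  rw [hg, hA]
  push_cast
  simp only [mul_im, ofReal_re, ofReal_im, I_re, I_im, mul_one, mul_zero, add_zero]
  field_simp
  rw [I_sq]
  ring

theorem tau_im_pos {E₁ E₂ : ℂ} (h₁ : 0 < E₁.im) (h₂ : 0 < E₂.im) (h : E₁.re < E₂.re) :
    0 < (tau E₁ E₂).im := by
  obtain ⟨s, hs, hτ⟩ := tau_eq_I_mul h₁ h₂ h
  rw [hτ]
  simpa using hs

theorem abelInfty_eq (E₁ E₂ : ℂ) :
    abelInfty E₁ E₂ = -((aPeriod E₁ E₂)⁻¹ * downInt E₁ E₂ (conj E₂)) := by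
  rw [abelInfty, downInt, rayInt, rayInt, mul_neg, neg_neg, ← integral_const_mul]
  simp only [zeta, mul_assoc]

theorem abelMap_P₁ {E₁ E₂ : ℂ} (h₁ : 0 < E₁.im) (h₂ : 0 < E₂.im) (h : E₁.re < E₂.re) :
    abelMap E₁ E₂ (P₁ E₁ E₂) = (aPeriod E₁ E₂)⁻¹ *
      (downInt E₁ E₂ (P₁ E₁ E₂) - downInt E₁ E₂ (conj E₂)) := by
  have : zeta E₁ E₂ = fun k => (aPeriod E₁ E₂)⁻¹ * form E₁ E₂ k := rfl
  rw [abelMap, this, segInt_const_mul, segInt_form_P₁ h₁ h₂ h]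

/-! ### The involution exchanging `∞` and `P₁` -/

theorem eq_of_sq_eq_of_re_pos {x y : ℂ} (h : x ^ 2 = y ^ 2) (hx : 0 < x.re) (hy : 0 < y.re) :
    x = y := by
  rcases sq_eq_sq_iff_eq_or_eq_neg.mp h with h | h
  · exact h
  · rw [h, neg_re] at hx
    linarith

/-- The involution `k ↦ P + c / (k - P)` exchanges `E₁` with `E₂`, their conjugates likewise, and
`P` with `∞`. It therefore maps `dk/w` to plus or minus itself; the sign is found by comparing real
parts of roots below `Σ₂`. -/
theorem form_involution {E₁ E₂ : ℂ} (h₁ : 0 < E₁.im) (h₂ : 0 < E₂.im) {P c : ℝ} {k κ : ℂ}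
    (hP₂ : P < E₂.re) (hc : ((c : ℝ) : ℂ) = (E₁ - P) * (E₂ - P))
    (hc0 : c < 0) (hE : E₁.re < E₂.re) (hk : k.re = E₂.re) (hk' : k.im < -E₂.im)
    (hκ : κ = P + c / (k - P)) (hκ₁ : E₁.re < κ.re) (hκ₂ : κ.re < E₂.re) :
    form E₁ E₂ κ * (-c / (k - P) ^ 2) = -form E₁ E₂ k := by
  have hkP : k - P ≠ 0 := by
    intro h
    have := congrArg Complex.re h
    simp at this
    linarith
  have hcc : ((c : ℝ) : ℂ) = (conj E₁ - P) * (conj E₂ - P) := by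
    have := congrArg conj hc
    simpa using this
  have hk1 : k ∉ cut E₁ := fun h => by
    rw [re_eq_of_mem_cut h] at hk
    linarith
  have hk2 : k ∉ cut E₂ := fun h => by
    rw [mem_cut_iff h₂, abs_le] at h
    linarith [h.2.1]
  have hκ1 : κ ∉ cut E₁ := fun h => hκ₁.ne' (re_eq_of_mem_cut h)
  have hκ2 : κ ∉ cut E₂ := fun h => hκ₂.ne (re_eq_of_mem_cut h)
  have n₁ : ((‖E₁ - P‖ : ℝ) : ℂ) ^ 2 = (E₁ - P) * (conj E₁ - P) := by
    have := mul_conj' (E₁ - P)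
    rw [← this, map_sub, conj_ofReal]
  have n₂ : ((‖E₂ - P‖ : ℝ) : ℂ) ^ 2 = (E₂ - P) * (conj E₂ - P) := by
    have := mul_conj' (E₂ - P)
    rw [← this, map_sub, conj_ofReal]
  have hn : ((‖E₁ - P‖ : ℝ) : ℂ) * ((‖E₂ - P‖ : ℝ) : ℂ) = -c := by
    rw [← ofReal_mul, ← norm_mul, ← hc, norm_real, Real.norm_eq_abs, abs_of_neg hc0]
    push_cast
    ring
  have m1 : κ - E₁ = (E₁ - P) * (E₂ - k) / (k - P) := by
    rw [hκ, hc]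
    field_simp
    ring
  have m1c : κ - conj E₁ = (conj E₁ - P) * (conj E₂ - k) / (k - P) := by
    rw [hκ, hcc]
    field_simp
    ring
  have m2 : κ - E₂ = (E₂ - P) * (E₁ - k) / (k - P) := by
    rw [hκ, hc]
    field_simp
    ring
  have m2c : κ - conj E₂ = (conj E₂ - P) * (conj E₁ - k) / (k - P) := by
    rw [hκ, hcc]
    field_simp
    ring
  have p₁ : 0 < ‖E₁ - P‖ := by
    rw [norm_pos_iff]
    intro h
    have := congrArg Complex.im h
    simp at this
    linarith
  have p₂ : 0 < ‖E₂ - P‖ := by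
    rw [norm_pos_iff]
    intro h
    have := congrArg Complex.im h
    simp at this
    linarith
  obtain ⟨b1, b2⟩ := rootFactor_below h₂ hk hk'
  have hinv : ∀ x : ℂ, ∀ n : ℝ, ((n : ℂ) * x / (k - P)).re =
      n * (x.re * (k.re - P) + x.im * k.im) / normSq (k - P) := by
    intro x n
    rw [div_re]
    simp
    ring
  have hns := normSq_pos.mpr hkP
  have r1 : rootFactor E₁ κ = (‖E₁ - P‖ : ℝ) * rootFactor E₂ k / (k - P) := by
    refine eq_of_sq_eq_of_re_pos ?_ (rootFactor_re_pos h₁ hκ₁) ?_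
    · rw [div_pow, mul_pow, n₁, rootFactor_sq _ _ (sub_ne_zero.mp (ne_center_of_notMem_cut h₁ hκ1)),
        rootFactor_sq _ _ (sub_ne_zero.mp (ne_center_of_notMem_cut h₂ hk2)), m1, m1c]
      field_simp
      ring
    · rw [hinv, b1]
      apply div_pos _ hns
      apply mul_pos p₁
      nlinarith
  -- The sign is needed because `κ` is to the left of `Σ₂`, where this root has negative real part;
  -- it produces the minus sign of the conclusion.
  have r2 : -rootFactor E₂ κ = (‖E₂ - P‖ : ℝ) * rootFactor E₁ k / (k - P) := by
    refine eq_of_sq_eq_of_re_pos ?_ ?_ ?_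
    · rw [neg_sq, div_pow, mul_pow, n₂,
        rootFactor_sq _ _ (sub_ne_zero.mp (ne_center_of_notMem_cut h₂ hκ2)),
        rootFactor_sq _ _ (sub_ne_zero.mp (ne_center_of_notMem_cut h₁ hk1)), m2, m2c]
      field_simp
      ring
    · rw [neg_re]
      linarith [rootFactor_re_neg h₂ hκ₂]
    · rw [hinv]
      apply div_pos _ hns
      apply mul_pos p₂
      have q1 := rootFactor_re_pos h₁ (k := k) (by linarith)
      have q2 := rootFactor_re_mul_im h₁ hk1
      have q3 : (rootFactor E₁ k).im < 0 := by
        by_contra! h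
        have : (k.re - E₁.re) * k.im < 0 := mul_neg_of_pos_of_neg (by linarith) (by linarith)
        nlinarith [mul_nonneg q1.le h]
      nlinarith [mul_pos q1 (by linarith : 0 < k.re - P)]
  have hw : wTilde E₁ E₂ κ = c * wTilde E₁ E₂ k / (k - P) ^ 2 := by
    rw [wTilde, wTilde, ← neg_neg (rootFactor E₂ κ), r1, r2]
    field_simp
    linear_combination (-rootFactor E₁ k * rootFactor E₂ k) * hn
  have hw0 : wTilde E₁ E₂ k ≠ 0 := wTilde_ne_zero h₁ h₂ (by rintro (h | h); exacts [hk1 h, hk2 h])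
  have hc' : (c : ℂ) ≠ 0 := ofReal_ne_zero.mpr hc0.ne
  rw [form, form, hw]
  field_simp

/-- While `k` descends from `conj E₂` to infinity, its image `κ` under the involution runs from
`conj E₁` to `P₁`, and `downInt κ + downInt k` is constant by `form_involution`. The claim compares
the two ends. -/
theorem downInt_P₁ {E₁ E₂ : ℂ} (h₁ : 0 < E₁.im) (h₂ : 0 < E₂.im) (h : E₁.re < E₂.re) :
    downInt E₁ E₂ (P₁ E₁ E₂) = downInt E₁ E₂ (conj E₁) + downInt E₁ E₂ (conj E₂) := by
  obtain ⟨hP1, hP2⟩ := P₁_strip h₁ h₂ h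
  obtain ⟨P, hP⟩ : ∃ P : ℝ, P₁ E₁ E₂ = P := ⟨_, rfl⟩
  -- The imaginary part of `(E₁ - P)(E₂ - P)` vanishes. So `c` is real, and the involution commutes
  -- with conjugation.
  have hrel : (E₁.re - P) * E₂.im + (E₂.re - P) * E₁.im = 0 := by
    have : P = (E₁ * E₂).im / (E₁ + E₂).im := by
      rw [P₁] at hP
      exact (ofReal_injective hP).symm
    have hS : 0 < E₁.im + E₂.im := by positivity
    rw [this, mul_im, add_im]
    field_simp
    ring
  rw [hP, ofReal_re] at hP1 hP2
  rw [hP]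
  obtain ⟨c, hcdef⟩ : ∃ c : ℝ, c = (E₁.re - P) * (E₂.re - P) - E₁.im * E₂.im := ⟨_, rfl⟩
  have hc : ((c : ℝ) : ℂ) = (E₁ - P) * (E₂ - P) := by
    apply Complex.ext
    · simp [hcdef]
    · simp
      linarith
  have hcc : ((c : ℝ) : ℂ) = (conj E₁ - P) * (conj E₂ - P) := by
    have := congrArg conj hc
    simpa using this
  have hc0 : c < 0 := by
    rw [hcdef]
    nlinarith [mul_pos (sub_pos.mpr hP1) (sub_pos.mpr hP2), mul_pos h₁ h₂]
  set k : ℝ → ℂ := fun s => conj E₂ + (s : ℂ) * (-I) with hk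
  set κ : ℝ → ℂ := fun s => P + c / (k s - P) with hκ
  have hkre : ∀ s, (k s).re = E₂.re := fun s => by simp [hk]
  have hkim : ∀ s, (k s).im = -E₂.im - s := fun s => by simp [hk]; ring
  have hkP : ∀ s, k s - P ≠ 0 := by
    intro s h'
    have := congrArg Complex.re h'
    rw [sub_re, hkre] at this
    simp at this
    linarith
  have hκre : ∀ s, (κ s).re = P + c * (E₂.re - P) / ((E₂.re - P) ^ 2 + (E₂.im + s) ^ 2) := by
    intro s
    simp only [hκ]
    rw [add_re, div_re, normSq_apply, sub_re, sub_im, hkre, hkim]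
    simp
    congr 1
    ring
  have hD1 : (E₁.re - P) * ((E₂.re - P) ^ 2 + E₂.im ^ 2) = c * (E₂.re - P) := by
    rw [hcdef]
    linear_combination E₂.im * hrel
  have hκ1 : ∀ s, 0 < s → E₁.re < (κ s).re := by
    intro s hs
    rw [hκre]
    have hq : 0 < (E₂.re - P) ^ 2 + (E₂.im + s) ^ 2 := by positivity
    have : E₁.re - P < c * (E₂.re - P) / ((E₂.re - P) ^ 2 + (E₂.im + s) ^ 2) := by
      rw [lt_div_iff₀ hq, ← hD1]
      have : (E₂.re - P) ^ 2 + E₂.im ^ 2 < (E₂.re - P) ^ 2 + (E₂.im + s) ^ 2 := by nlinarith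
      nlinarith
    linarith
  have hκ2 : ∀ s, 0 < s → (κ s).re < E₂.re := by
    intro s hs
    rw [hκre]
    have hq : 0 < (E₂.re - P) ^ 2 + (E₂.im + s) ^ 2 := by positivity
    have : c * (E₂.re - P) / ((E₂.re - P) ^ 2 + (E₂.im + s) ^ 2) < 0 := by
      rw [div_lt_iff₀ hq]
      nlinarith
    linarith
  have hkd : ∀ s, HasDerivAt k (-I) s := by
    intro s
    have : HasDerivAt (fun s : ℝ => conj E₂ + (s : ℂ) * (-I)) (1 * (-I)) s :=
      ((hasDerivAt_id s).ofReal_comp.mul_const (-I)).const_add (conj E₂)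
    rwa [one_mul] at this
  have hder : ∀ s ∈ Ioi (0 : ℝ),
      HasDerivAt (fun s => downInt E₁ E₂ (κ s) + downInt E₁ E₂ (k s)) 0 s := by
    intro s hs
    have hs0 : 0 < s := hs
    have d1 := HasDerivAt.comp (h := k) (h₂ := downInt E₁ E₂) s
      (hasDerivAt_downInt h₁ h₂ (by
        have := tip_ray_mem (E₁ := E₂) (E₂ := E₁) h.ne' hs0
        rwa [downSet_comm] at this)) (hkd s)
    have d2 : HasDerivAt κ (-(c : ℂ) * (-I) / (k s - P) ^ 2) s := by
      have := ((((hkd s).sub_const (P : ℂ)).fun_inv (hkP s)).const_mul (c : ℂ)).const_add (P : ℂ)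
      convert! this using 1
      ring
    have d3 := HasDerivAt.comp (h := κ) (h₂ := downInt E₁ E₂) s
      (hasDerivAt_downInt h₁ h₂ (mem_downSet_of_re_ne (hκ1 s hs0).ne' (hκ2 s hs0).ne)) d2
    have d4 := d3.add d1
    convert! d4 using 1
    have := form_involution h₁ h₂ hP2 hc hc0 h (hkre s) (by rw [hkim]; linarith)
      (rfl : κ s = P + c / (k s - P)) (hκ1 s hs0) (hκ2 s hs0)
    linear_combination I * this
  have hconst : ∀ s ∈ Ioi (0 : ℝ), downInt E₁ E₂ (κ s) + downInt E₁ E₂ (k s) =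
      downInt E₁ E₂ (κ 1) + downInt E₁ E₂ (k 1) := fun s hs =>
    isOpen_Ioi.is_const_of_deriv_eq_zero isPreconnected_Ioi
      (fun s hs => (hder s hs).differentiableAt.differentiableWithinAt)
      (fun s hs => (hder s hs).deriv) hs (by simp)
  have hk0 : Tendsto (fun s => downInt E₁ E₂ (k s)) (𝓝[>] 0) (𝓝 (downInt E₁ E₂ (conj E₂))) := by
    have := tendsto_downInt_tip h₂ h₁ h.ne'
    rwa [downInt_comm] at this
  have hκ0 : Tendsto (fun s => downInt E₁ E₂ (κ s)) (𝓝[>] 0) (𝓝 (downInt E₁ E₂ (conj E₁))) := by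
    refine (tendsto_downInt_corner h₁ h₂ h.ne).comp (tendsto_nhdsWithin_iff.mpr ⟨?_, ?_⟩)
    · have hcont : ContinuousAt κ 0 := by
        have : ContinuousAt k 0 := (hkd 0).continuousAt
        exact continuousAt_const.add (continuousAt_const.div (this.sub continuousAt_const) (hkP 0))
      have := hcont.tendsto
      have e : κ 0 = conj E₁ := by
        have h0 := hkP 0
        simp only [hκ, hk, ofReal_zero, zero_mul, add_zero] at h0 ⊢
        rw [hcc]
        field_simp
        ring
      rw [e] at this
      exact this.mono_left nhdsWithin_le_nhds
    · filter_upwards [self_mem_nhdsWithin] with s hs h'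
      exact (hκ1 s hs).ne' (re_eq_of_mem_cut h')
  have hkinf : Tendsto k atTop (Bornology.cobounded ℂ ⊓ 𝓟 {k | k.im ≤ 0}) := by
    refine tendsto_inf.mpr ⟨?_, tendsto_principal.mpr ?_⟩
    · rw [← tendsto_norm_atTop_iff_cobounded]
      refine tendsto_atTop_mono (f := fun s => s) (fun s => ?_) tendsto_id
      have := abs_im_le_norm (k s)
      rw [hkim] at this
      have h3 := neg_abs_le (-E₂.im - s)
      linarith
    · filter_upwards [eventually_gt_atTop 0] with s hs
      rw [hkim]
      linarith
  have hk1 := (tendsto_downInt h₁ h₂).comp hkinf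
  have hκinf : Tendsto κ atTop (𝓝 P) := by
    have e1 : Tendsto (fun s => k s - P) atTop (Bornology.cobounded ℂ) := by
      have := (tendsto_inf.mp hkinf).1
      rw [← tendsto_norm_atTop_iff_cobounded] at this ⊢
      refine tendsto_atTop_mono (fun s => ?_)
        (tendsto_atTop_add_const_right _ (-‖(P : ℂ)‖) this)
      have := norm_sub_norm_le (k s) (P : ℂ)
      linarith
    have e2 := ((tendsto_inv₀_cobounded (α := ℂ)).comp e1).const_mul (c : ℂ)
    have e3 := e2.const_add (P : ℂ)
    simp only [mul_zero, add_zero] at e3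
    exact e3
  have hκ1' : Tendsto (fun s => downInt E₁ E₂ (κ s)) atTop (𝓝 (downInt E₁ E₂ P)) :=
    (hasDerivAt_downInt h₁ h₂ (mem_downSet_of_re_ne (by simpa using hP1.ne')
      (by simpa using hP2.ne))).continuousAt.tendsto.comp hκinf
  have l0 := (hκ0.add hk0)
  have l1 := hκ1'.add hk1
  have c0 := tendsto_nhds_unique (l0.congr' (by
    filter_upwards [self_mem_nhdsWithin] with s hs
    exact hconst s hs)) tendsto_const_nhds
  have c1 := tendsto_nhds_unique (l1.congr' (by
    filter_upwards [eventually_gt_atTop 0] with s hs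
    exact hconst s hs)) tendsto_const_nhds
  rw [c0, ← c1, add_zero]

/-- With the definition of `dTilde` this puts `φ̃(∞⁺) + d̃` at `1/2 + τ`. -/
theorem abelInfty_add_abelMap_P₁ {E₁ E₂ : ℂ} (h₁ : 0 < E₁.im) (h₂ : 0 < E₂.im)
    (h : E₁.re < E₂.re) :
    abelInfty E₁ E₂ + abelMap E₁ E₂ (P₁ E₁ E₂) = tau E₁ E₂ / 2 := by
  rw [abelInfty_eq, abelMap_P₁ h₁ h₂ h, tau_eq h₁ h₂ h, downInt_P₁ h₁ h₂ h]
  ring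

/-- By `downInt_P₁` the Abel map at `P₁` is the tip value at `conj E₁` divided by the purely
imaginary `a`-period, and `1/4` is the ratio of the imaginary parts. It follows that `φ̃(∞⁺) - d̃`
has real part `-1`. -/
theorem abelMap_P₁_re {E₁ E₂ : ℂ} (h₁ : 0 < E₁.im) (h₂ : 0 < E₂.im) (h : E₁.re < E₂.re) :
    (abelMap E₁ E₂ (P₁ E₁ E₂)).re = 1 / 4 := by
  obtain ⟨ha, ha'⟩ := aPeriod_re_im h₁ h₂ h
  have ha2 := congrArg Complex.im (aPeriod_eq_left h₁ h₂ h)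
  simp at ha2
  rw [abelMap_P₁ h₁ h₂ h, downInt_P₁ h₁ h₂ h, add_sub_cancel_right, mul_re, inv_re, inv_im,
    normSq_apply, ha]
  have hne : (aPeriod E₁ E₂).im ≠ 0 := ha'.ne
  have hg : (downInt E₁ E₂ (conj E₁)).im = (aPeriod E₁ E₂).im / 4 := by linarith
  rw [hg]
  field_simp
  ring

section

/-! ### The theta function -/

/-- For a purely imaginary period and argument every term of the series is positive. -/
theorem jacobiTheta₂_imag_ne_zero {s : ℝ} (hs : 0 < s) (y : ℝ) :
    jacobiTheta₂ (y * I) (s * I) ≠ 0 := by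
  have hτ : 0 < ((s : ℂ) * I).im := by simpa using hs
  have hterm : ∀ n : ℤ, jacobiTheta₂_term n (y * I) (s * I) =
      ((Real.exp (-(2 * Real.pi * n * y) - Real.pi * n ^ 2 * s) : ℝ) : ℂ) := by
    intro n
    rw [jacobiTheta₂_term]
    push_cast
    congr 1
    linear_combination (2 * Real.pi * n * y + Real.pi * n ^ 2 * s : ℂ) * I_sq
  have hsum := (hasSum_jacobiTheta₂_term ((y : ℂ) * I) hτ).summable
  simp_rw [hterm] at hsum
  have hsum' := Complex.summable_ofReal.mp hsum
  rw [jacobiTheta₂]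
  simp_rw [hterm]
  rw [← Complex.ofReal_tsum, Complex.ofReal_ne_zero]
  exact (hsum'.tsum_pos (fun n => (Real.exp_pos _).le) 0 (Real.exp_pos _)).ne'

/-- The modular transformation carries the real axis to the imaginary axis and keeps the period
purely imaginary. -/
theorem jacobiTheta₂_real_ne_zero {s : ℝ} (hs : 0 < s) (x : ℝ) :
    jacobiTheta₂ x (s * I) ≠ 0 := by
  have hs' : (s : ℂ) ≠ 0 := ofReal_ne_zero.mpr hs.ne'
  rw [jacobiTheta₂_functional_equation]
  refine mul_ne_zero (mul_ne_zero (one_div_ne_zero ?_) (exp_ne_zero _)) ?_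
  · rw [Complex.cpow_ne_zero_iff]
    left
    have : -I * (s * I) = (s : ℂ) := by linear_combination (-s : ℂ) * I_sq
    rwa [this]
  · have e1 : (x : ℂ) / (s * I) = ((-(x / s) : ℝ) : ℂ) * I := by
      push_cast
      field_simp
      rw [I_sq]
      ring
    have e2 : -1 / ((s : ℂ) * I) = ((s⁻¹ : ℝ) : ℂ) * I := by
      push_cast
      field_simp
      rw [I_sq]
    rw [e1, e2]
    exact jacobiTheta₂_imag_ne_zero (inv_pos.mpr hs) _

variable {E₁ E₂ : ℂ}

theorem theta_add_one (z : ℂ) : theta E₁ E₂ (z + 1) = theta E₁ E₂ z :=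
  jacobiTheta₂_add_left z _

theorem theta_neg (z : ℂ) : theta E₁ E₂ (-z) = theta E₁ E₂ z :=
  jacobiTheta₂_neg_left z _

theorem theta_add_tau (z : ℂ) : theta E₁ E₂ (z + tau E₁ E₂) =
    cexp (-Real.pi * I * (tau E₁ E₂ + 2 * z)) * theta E₁ E₂ z :=
  jacobiTheta₂_add_left' z _

theorem theta_sub_tau (z : ℂ) : theta E₁ E₂ (z - tau E₁ E₂) =
    cexp (-Real.pi * I * (tau E₁ E₂ - 2 * z)) * theta E₁ E₂ z := by
  have := theta_add_tau (E₁ := E₁) (E₂ := E₂) (-z)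
  rw [theta_neg] at this
  rw [← theta_neg, neg_sub, sub_eq_add_neg, add_comm, this]
  congr 2
  ring

theorem theta_tau_sub (z c : ℂ) : theta E₁ E₂ (tau E₁ E₂ - z + c) =
    cexp (Real.pi * I * (2 * (z - c) - tau E₁ E₂)) * theta E₁ E₂ (z - c) := by
  have := theta_sub_tau (E₁ := E₁) (E₂ := E₂) (z - c)
  rw [← theta_neg, show -(tau E₁ E₂ - z + c) = z - c - tau E₁ E₂ by ring, this]
  congr 2
  ring

theorem differentiable_theta (h₁ : 0 < E₁.im) (h₂ : 0 < E₂.im) (h : E₁.re < E₂.re) :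
    Differentiable ℂ (theta E₁ E₂) := fun z =>
  differentiableAt_jacobiTheta₂_fst z (tau_im_pos h₁ h₂ h)

/-- The points `±(1 + τ)/2` differ by the period `1 + τ`, whose multiplier at this point is `-1`;
but theta is even. -/
theorem theta_half_period :
    theta E₁ E₂ (-((1 + tau E₁ E₂) / 2)) = 0 := by
  have h1 := theta_add_tau (E₁ := E₁) (E₂ := E₂) (-((1 + tau E₁ E₂) / 2) + 1)
  rw [theta_add_one, show -((1 + tau E₁ E₂) / 2) + 1 + tau E₁ E₂ = (1 + tau E₁ E₂) / 2 by ring,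
    show -(Real.pi : ℂ) * I * (tau E₁ E₂ + 2 * (-((1 + tau E₁ E₂) / 2) + 1)) =
      -(Real.pi * I) by ring, Complex.exp_neg, Complex.exp_pi_mul_I,
    ← theta_neg ((1 + tau E₁ E₂) / 2)] at h1
  norm_num at h1
  linear_combination h1 / 2

theorem theta_ofReal_add_tau_ne_zero (h₁ : 0 < E₁.im) (h₂ : 0 < E₂.im) (h : E₁.re < E₂.re)
    (x : ℝ) : theta E₁ E₂ (x + tau E₁ E₂) ≠ 0 := by
  obtain ⟨s, hs, hτ⟩ := tau_eq_I_mul h₁ h₂ h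
  rw [theta_add_tau]
  refine mul_ne_zero (exp_ne_zero _) ?_
  rw [theta, hτ]
  exact jacobiTheta₂_real_ne_zero hs x

theorem theta_abelInfty_add_ne_zero (h₁ : 0 < E₁.im) (h₂ : 0 < E₂.im) (h : E₁.re < E₂.re)
    (v : ℝ) : theta E₁ E₂ (abelInfty E₁ E₂ + v + dTilde E₁ E₂) ≠ 0 := by
  have := theta_ofReal_add_tau_ne_zero h₁ h₂ h (1 / 2 + v)
  convert this using 2
  rw [dTilde]
  push_cast
  linear_combination abelInfty_add_abelMap_P₁ h₁ h₂ h

theorem theta_abelInfty_sub_ne_zero (h₁ : 0 < E₁.im) (h₂ : 0 < E₂.im) (h : E₁.re < E₂.re) :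
    theta E₁ E₂ (abelInfty E₁ E₂ - dTilde E₁ E₂) ≠ 0 := by
  obtain ⟨s, hs, hτ⟩ := tau_eq_I_mul h₁ h₂ h
  set y : ℝ := 2 * (abelMap E₁ E₂ (P₁ E₁ E₂)).im
  have e : abelInfty E₁ E₂ - dTilde E₁ E₂ = -(y * I + 1) := by
    have h1 := abelInfty_add_abelMap_P₁ h₁ h₂ h
    have h2 : abelMap E₁ E₂ (P₁ E₁ E₂) = 1 / 4 + (y / 2 : ℝ) * I := by
      apply Complex.ext
      · simp [abelMap_P₁_re h₁ h₂ h]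
      · simp [y]
    rw [dTilde]
    push_cast at h2
    linear_combination h1 - 2 * h2
  rw [e, theta_neg, theta_add_one, theta, hτ]
  exact jacobiTheta₂_imag_ne_zero hs y

theorem theta_abelMap_P₁_sub : theta E₁ E₂ (abelMap E₁ E₂ (P₁ E₁ E₂) - dTilde E₁ E₂) = 0 := by
  rw [dTilde, show abelMap E₁ E₂ (P₁ E₁ E₂) - (abelMap E₁ E₂ (P₁ E₁ E₂) +
    1 / 2 * (1 + tau E₁ E₂)) = -((1 + tau E₁ E₂) / 2) by ring]
  exact theta_half_period

end

section

/-! ### The Abel map off the contour, modulo integers -/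

/-- The Abel map on the upper sheet; it is analytic off the contour modulo integers. -/
def abelPlus (E₁ E₂ k : ℂ) : ℂ :=
  abelInfty E₁ E₂ + (aPeriod E₁ E₂)⁻¹ * if 0 ≤ k.im then upInt E₁ E₂ k else downInt E₁ E₂ k

/-- The Abel map near `Σ₁`, in the coordinate `k = ellMap E₁ z`. -/
def abelLeft (E₁ E₂ z : ℂ) : ℂ :=
  abelInfty E₁ E₂ + (aPeriod E₁ E₂)⁻¹ * locPrim E₁ E₂ z

/-- The Abel map near `Σ₂`, in the coordinate `k = ellMap E₂ z`. -/
def abelRight (E₁ E₂ z : ℂ) : ℂ :=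
  abelInfty E₁ E₂ + (aPeriod E₁ E₂)⁻¹ * locPrim E₂ E₁ z

variable {E₁ E₂ k z : ℂ}

theorem exists_downInt_sub_upInt (h₁ : 0 < E₁.im) (h₂ : 0 < E₂.im) (h : E₁.re < E₂.re)
    (hk₁ : k.re ≠ E₁.re) (hk₂ : k.re ≠ E₂.re) :
    ∃ n : ℤ, (aPeriod E₁ E₂)⁻¹ * downInt E₁ E₂ k = (aPeriod E₁ E₂)⁻¹ * upInt E₁ E₂ k + n := by
  have ha := aPeriod_ne_zero h₁ h₂ h
  rcases lt_or_gt_of_ne hk₁ with hk | hk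
  · exact ⟨0, by rw [downInt_eq_upInt_left h₁ h₂ hk (hk.trans h)]; simp⟩
  · rcases lt_or_gt_of_ne hk₂ with hk' | hk'
    · refine ⟨1, ?_⟩
      rw [sub_eq_iff_eq_add.mp (downInt_sub_upInt_strip h₁ h₂ hk hk'), mul_add,
        inv_mul_cancel₀ ha]
      push_cast
      ring
    · exact ⟨0, by rw [downInt_eq_upInt_right h₁ h₂ hk hk']; simp⟩

theorem exists_abelPlus_eq_down (h₁ : 0 < E₁.im) (h₂ : 0 < E₂.im) (h : E₁.re < E₂.re)
    (hk : k ∈ downSet E₁ E₂) : ∃ n : ℤ, abelPlus E₁ E₂ k =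
      abelInfty E₁ E₂ + (aPeriod E₁ E₂)⁻¹ * downInt E₁ E₂ k + n := by
  rw [abelPlus]
  split_ifs with hi
  · obtain ⟨n, hn⟩ := exists_downInt_sub_upInt h₁ h₂ h
      (fun e => by linarith [hk.1 e]) (fun e => by linarith [hk.2 e])
    exact ⟨-n, by rw [hn]; push_cast; ring⟩
  · exact ⟨0, by simp⟩

theorem exists_abelPlus_eq_up (h₁ : 0 < E₁.im) (h₂ : 0 < E₂.im) (h : E₁.re < E₂.re)
    (hk : conj k ∈ downSet E₁ E₂) : ∃ n : ℤ, abelPlus E₁ E₂ k =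
      abelInfty E₁ E₂ + (aPeriod E₁ E₂)⁻¹ * upInt E₁ E₂ k + n := by
  rw [abelPlus]
  split_ifs with hi
  · exact ⟨0, by simp⟩
  · have e1 := hk.1
    have e2 := hk.2
    rw [conj_re, conj_im] at e1 e2
    obtain ⟨n, hn⟩ := exists_downInt_sub_upInt h₁ h₂ h
      (fun e => by linarith [e1 e]) (fun e => by linarith [e2 e])
    exact ⟨n, by rw [hn]; ring⟩

theorem mem_downSet_of_notMem_contour (h₁ : 0 < E₁.im) (h₂ : 0 < E₂.im)
    (hk : k ∉ contour E₁ E₂) (hi : k.im ≤ 0) : k ∈ downSet E₁ E₂ := by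
  have key : ∀ E : ℂ, 0 < E.im → k ∉ cut E → k.re = E.re → k.im < -E.im := by
    intro E hE hk hre
    rw [mem_cut_iff hE, abs_of_nonpos hi] at hk
    by_contra! h'
    exact hk ⟨hre, by linarith⟩
  exact ⟨key E₁ h₁ fun h' => hk (Or.inl h'), key E₂ h₂ fun h' => hk (Or.inr h')⟩

variable {Q : ℂ → ℂ}

theorem periodic_add_int (hper : Function.Periodic Q 1) (n : ℤ) (z : ℂ) : Q (z + n) = Q z := by
  simpa using hper.int_mul n z

/-- `abelPlus` changes by an integer across the real axis between the cuts, so only `1`-periodic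
functions of it are analytic. Locally it equals, modulo integers, one of the two primitives. -/
theorem differentiableAt_comp_abelPlus (h₁ : 0 < E₁.im) (h₂ : 0 < E₂.im) (h : E₁.re < E₂.re)
    (hQ : Differentiable ℂ Q) (hper : Function.Periodic Q 1) (hk : k ∉ contour E₁ E₂) :
    DifferentiableAt ℂ (fun k => Q (abelPlus E₁ E₂ k)) k := by
  rcases le_total k.im 0 with hi | hi
  · have hd := mem_downSet_of_notMem_contour h₁ h₂ hk hi
    have : DifferentiableAt ℂ
        (fun k => Q (abelInfty E₁ E₂ + (aPeriod E₁ E₂)⁻¹ * downInt E₁ E₂ k)) k :=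
      (hQ _).comp k (((hasDerivAt_downInt h₁ h₂ hd).differentiableAt.const_mul _).const_add _)
    refine this.congr_of_eventuallyEq ?_
    filter_upwards [(isOpen_downSet E₁ E₂).mem_nhds hd] with k' hk'
    obtain ⟨n, hn⟩ := exists_abelPlus_eq_down h₁ h₂ h hk'
    rw [hn, periodic_add_int hper]
  · have hd := mem_downSet_of_notMem_contour h₁ h₂ ((conj_mem_contour h₁ h₂).not.mpr hk)
      (by simpa using hi)
    have : DifferentiableAt ℂ
        (fun k => Q (abelInfty E₁ E₂ + (aPeriod E₁ E₂)⁻¹ * upInt E₁ E₂ k)) k :=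
      (hQ _).comp k (((hasDerivAt_upInt h₁ h₂ hd).differentiableAt.const_mul _).const_add _)
    refine this.congr_of_eventuallyEq ?_
    have hopen : ∀ᶠ k' in 𝓝 k, conj k' ∈ downSet E₁ E₂ :=
      continuous_conj.continuousAt.eventually ((isOpen_downSet E₁ E₂).mem_nhds hd)
    filter_upwards [hopen] with k' hk'
    obtain ⟨n, hn⟩ := exists_abelPlus_eq_up h₁ h₂ h hk'
    rw [hn, periodic_add_int hper]

theorem tendsto_abelPlus (h₁ : 0 < E₁.im) (h₂ : 0 < E₂.im) :
    Tendsto (abelPlus E₁ E₂) (Bornology.cobounded ℂ) (𝓝 (abelInfty E₁ E₂)) := by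
  have : Tendsto (fun k : ℂ => if 0 ≤ k.im then upInt E₁ E₂ k else downInt E₁ E₂ k)
      (Bornology.cobounded ℂ) (𝓝 0) := by
    refine Tendsto.if (tendsto_upInt h₁ h₂) ((tendsto_downInt h₁ h₂).mono_left ?_)
    exact inf_le_inf_left _ (principal_mono.mpr fun k hk => (not_le.mp hk).le)
  have := (this.const_mul (aPeriod E₁ E₂)⁻¹).const_add (abelInfty E₁ E₂)
  rwa [mul_zero, add_zero] at this

theorem exists_abelPlus_P₁ (h₁ : 0 < E₁.im) (h₂ : 0 < E₂.im) (h : E₁.re < E₂.re) :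
    ∃ n : ℤ, abelPlus E₁ E₂ (P₁ E₁ E₂) = abelMap E₁ E₂ (P₁ E₁ E₂) + n := by
  have hs := P₁_strip h₁ h₂ h
  obtain ⟨n, hn⟩ := exists_abelPlus_eq_down h₁ h₂ h (mem_downSet_of_re_ne hs.1.ne' hs.2.ne)
  refine ⟨n, ?_⟩
  rw [hn, abelMap_P₁ h₁ h₂ h, abelInfty_eq]
  ring

/-! ### The Abel map near the cuts -/

theorem differentiableOn_abelLeft (h₁ : 0 < E₁.im) (h₂ : 0 < E₂.im) (h : E₁.re < E₂.re) :
    DifferentiableOn ℂ (abelLeft E₁ E₂) {z | |z.re| < stripRadius E₁ |E₁.re - E₂.re|} :=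
  fun _ hz => (((hasDerivAt_locPrim h₁ h₂ h.ne hz).const_mul _).const_add
    _).differentiableAt.differentiableWithinAt

theorem differentiableOn_abelRight (h₁ : 0 < E₁.im) (h₂ : 0 < E₂.im) (h : E₁.re < E₂.re) :
    DifferentiableOn ℂ (abelRight E₁ E₂) {z | |z.re| < stripRadius E₂ |E₂.re - E₁.re|} :=
  fun _ hz => (((hasDerivAt_locPrim h₂ h₁ h.ne' hz).const_mul _).const_add
    _).differentiableAt.differentiableWithinAt

theorem abelLeft_reflect (h₁ : 0 < E₁.im) (h₂ : 0 < E₂.im) (h : E₁.re < E₂.re)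
    (hz : |z.re| < stripRadius E₁ |E₁.re - E₂.re|) :
    abelLeft E₁ E₂ (2 * Real.pi * I - z) = tau E₁ E₂ - abelLeft E₁ E₂ z := by
  have := locPrim_reflect h₁ h₂ h.ne hz
  rw [abelLeft, abelLeft, tau_eq h₁ h₂ h, abelInfty_eq]
  linear_combination (aPeriod E₁ E₂)⁻¹ * this

theorem abelRight_reflect (h₁ : 0 < E₁.im) (h₂ : 0 < E₂.im) (h : E₁.re < E₂.re)
    (hz : |z.re| < stripRadius E₂ |E₂.re - E₁.re|) :
    abelRight E₁ E₂ (2 * Real.pi * I - z) = -abelRight E₁ E₂ z := by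
  have := locPrim_reflect h₂ h₁ h.ne' hz
  rw [downInt_comm] at this
  rw [abelRight, abelRight, abelInfty_eq]
  linear_combination (aPeriod E₁ E₂)⁻¹ * this

theorem locPrim_add_period (h₁ : 0 < E₁.im) (h₂ : 0 < E₂.im) (hne : E₁.re ≠ E₂.re)
    (hz : |z.re| < stripRadius E₁ |E₁.re - E₂.re|) :
    locPrim E₁ E₂ (z + 2 * Real.pi * I) - locPrim E₁ E₂ z =
      locPrim E₁ E₂ (2 * Real.pi * I) - locPrim E₁ E₂ 0 := by
  set ρ := stripRadius E₁ |E₁.re - E₂.re|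
  have hre : ∀ z : ℂ, (z + 2 * Real.pi * I).re = z.re := fun z => by simp
  have hd : ∀ z ∈ {z : ℂ | |z.re| < ρ}, HasDerivAt
      (fun z => locPrim E₁ E₂ (z + 2 * Real.pi * I) - locPrim E₁ E₂ z) 0 z := by
    intro z hz
    have e1 := (hasDerivAt_locPrim h₁ h₂ hne (z := z + 2 * Real.pi * I)
      (by rw [hre]; exact hz)).comp_add_const z (2 * Real.pi * I)
    have := e1.sub (hasDerivAt_locPrim h₁ h₂ hne hz)
    rwa [ellMap_add_period, sub_self] at this
  have := (isOpen_strip ρ).is_const_of_deriv_eq_zero (convex_strip ρ).isPreconnected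
    (fun z hz => (hd z hz).differentiableAt.differentiableWithinAt)
    (fun z hz => (hd z hz).deriv) hz
    (show (0 : ℂ) ∈ {z : ℂ | |z.re| < ρ} by simpa using stripRadius_sep_pos h₁ hne)
  simpa using this

theorem abelLeft_add_period (h₁ : 0 < E₁.im) (h₂ : 0 < E₂.im) (h : E₁.re < E₂.re)
    (hz : |z.re| < stripRadius E₁ |E₁.re - E₂.re|) :
    abelLeft E₁ E₂ (z + 2 * Real.pi * I) = abelLeft E₁ E₂ z + 1 := by
  have := locPrim_add_period h₁ h₂ h.ne hz
  rw [locPrim_zero_left h₁ h₂ h, locPrim_two_pi_left h₁ h₂ h] at this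
  rw [abelLeft, abelLeft]
  linear_combination (aPeriod E₁ E₂)⁻¹ * this + inv_mul_cancel₀ (aPeriod_ne_zero h₁ h₂ h)

/-- For `0 < z.im < 2π` the two arguments agree modulo integers; the identity theorem removes the
restriction on `z.im`. -/
theorem comp_abelPlus_ellMap_left (h₁ : 0 < E₁.im) (h₂ : 0 < E₂.im) (h : E₁.re < E₂.re)
    (hQ : Differentiable ℂ Q) (hper : Function.Periodic Q 1) (hz0 : 0 < z.re)
    (hz : z.re < stripRadius E₁ |E₁.re - E₂.re|) :
    Q (abelPlus E₁ E₂ (ellMap E₁ z)) = Q (abelLeft E₁ E₂ z) := by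
  set ρ := stripRadius E₁ |E₁.re - E₂.re|
  set U : Set ℂ := {z : ℂ | 0 < z.re} ∩ {z : ℂ | z.re < ρ}
  have hU : IsOpen U := (isOpen_lt continuous_const continuous_re).inter
    (isOpen_lt continuous_re continuous_const)
  have hUc : IsPreconnected U :=
    ((convex_halfSpace_re_gt 0).inter (convex_halfSpace_re_lt ρ)).isPreconnected
  have hρ : 0 < ρ := stripRadius_sep_pos h₁ h.ne
  have d1 : DifferentiableOn ℂ (fun z => Q (abelPlus E₁ E₂ (ellMap E₁ z))) U := fun z hz =>
    (DifferentiableAt.comp (f := ellMap E₁) (g := fun k => Q (abelPlus E₁ E₂ k)) z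
      (differentiableAt_comp_abelPlus h₁ h₂ h hQ hper (ellMap_notMem_contour h₁ hz.1 hz.2))
      (differentiable_ellMap E₁ z)).differentiableWithinAt
  have d2 : DifferentiableOn ℂ (fun z => Q (abelLeft E₁ E₂ z)) U :=
    hQ.comp_differentiableOn ((differentiableOn_abelLeft h₁ h₂ h).mono fun z hz => by
      change |z.re| < ρ
      rw [abs_of_pos hz.1]
      exact hz.2)
  set z₀ : ℂ := (ρ / 2 : ℝ) + Real.pi * I
  have hz₀ : z₀ ∈ U := by
    constructor
    · change 0 < z₀.re
      simp [z₀, hρ]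
    · change z₀.re < ρ
      simp [z₀, hρ]
  refine (d1.analyticOnNhd hU).eqOn_of_preconnected_of_eventuallyEq (d2.analyticOnNhd hU)
    hUc hz₀ ?_ ⟨hz0, hz⟩
  have hi := eventually_im_mem_Ioo (z₀ := z₀) (a := 0) (b := 2 * Real.pi)
    ⟨by simp [z₀, Real.pi_pos], by simp [z₀]; linarith [Real.pi_pos]⟩
  filter_upwards [hi, hU.mem_nhds hz₀] with w hw hwU
  obtain ⟨n, hn⟩ := exists_abelPlus_eq_down h₁ h₂ h
    (ellMap_mem_downSet h₁ hwU.1 hwU.2 hw.1 hw.2)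
  rw [hn, periodic_add_int hper, downInt_ellMap h₁ h₂ h.ne hwU.1 hwU.2 hw.1 hw.2, abelLeft]

theorem comp_abelPlus_ellMap_right (h₁ : 0 < E₁.im) (h₂ : 0 < E₂.im) (h : E₁.re < E₂.re)
    (hQ : Differentiable ℂ Q) (hper : Function.Periodic Q 1) (hz0 : 0 < z.re)
    (hz : z.re < stripRadius E₂ |E₂.re - E₁.re|) :
    Q (abelPlus E₁ E₂ (ellMap E₂ z)) = Q (abelRight E₁ E₂ z) := by
  set ρ := stripRadius E₂ |E₂.re - E₁.re|
  set U : Set ℂ := {z : ℂ | 0 < z.re} ∩ {z : ℂ | z.re < ρ}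
  have hU : IsOpen U := (isOpen_lt continuous_const continuous_re).inter
    (isOpen_lt continuous_re continuous_const)
  have hUc : IsPreconnected U :=
    ((convex_halfSpace_re_gt 0).inter (convex_halfSpace_re_lt ρ)).isPreconnected
  have hρ : 0 < ρ := stripRadius_sep_pos h₂ h.ne'
  have d1 : DifferentiableOn ℂ (fun z => Q (abelPlus E₁ E₂ (ellMap E₂ z))) U := fun z hz =>
    (DifferentiableAt.comp (f := ellMap E₂) (g := fun k => Q (abelPlus E₁ E₂ k)) z
      (differentiableAt_comp_abelPlus h₁ h₂ h hQ hper
        (contour_comm E₁ E₂ ▸ ellMap_notMem_contour h₂ hz.1 hz.2))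
      (differentiable_ellMap E₂ z)).differentiableWithinAt
  have d2 : DifferentiableOn ℂ (fun z => Q (abelRight E₁ E₂ z)) U :=
    hQ.comp_differentiableOn ((differentiableOn_abelRight h₁ h₂ h).mono fun z hz => by
      change |z.re| < ρ
      rw [abs_of_pos hz.1]
      exact hz.2)
  set z₀ : ℂ := (ρ / 2 : ℝ) + Real.pi * I
  have hz₀ : z₀ ∈ U := by
    constructor
    · change 0 < z₀.re
      simp [z₀, hρ]
    · change z₀.re < ρ
      simp [z₀, hρ]
  refine (d1.analyticOnNhd hU).eqOn_of_preconnected_of_eventuallyEq (d2.analyticOnNhd hU)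
    hUc hz₀ ?_ ⟨hz0, hz⟩
  have hi := eventually_im_mem_Ioo (z₀ := z₀) (a := 0) (b := 2 * Real.pi)
    ⟨by simp [z₀, Real.pi_pos], by simp [z₀]; linarith [Real.pi_pos]⟩
  filter_upwards [hi, hU.mem_nhds hz₀] with w hw hwU
  obtain ⟨n, hn⟩ := exists_abelPlus_eq_down h₁ h₂ h
    (downSet_comm E₁ E₂ ▸ ellMap_mem_downSet h₂ hwU.1 hwU.2 hw.1 hw.2)
  rw [hn, periodic_add_int hper, ← downInt_comm, downInt_ellMap h₂ h₁ h.ne' hwU.1 hwU.2 hw.1 hw.2,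
    abelRight]

end

/-! ### Cauchy integrals over ellipses -/

/-- Logarithmic differentiation: in terms of `ξ = exp z`, the difference `cosh z - cosh w` is `(ξ -
exp w)(ξ - exp (-w)) / (2ξ)`. -/
theorem sinh_div_cosh_sub_cosh {z w : ℂ} (h1 : cexp z ≠ cexp w) (h2 : cexp z ≠ cexp (-w)) :
    sinh z / (cosh z - cosh w) =
      cexp z / (cexp z - cexp w) + cexp z / (cexp z - cexp (-w)) - 1 := by
  have ha := exp_ne_zero z
  have hb := exp_ne_zero w
  rw [sinh, cosh, cosh]
  rw [Complex.exp_neg] at h2 ⊢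
  rw [Complex.exp_neg]
  set a := cexp z
  set b := cexp w
  have h1' : a - b ≠ 0 := sub_ne_zero.mpr h1
  have h2' : a - b⁻¹ ≠ 0 := sub_ne_zero.mpr h2
  have hab : (a + a⁻¹) / 2 - (b + b⁻¹) / 2 = (a - b) * (a - b⁻¹) / (2 * a) := by
    field_simp
    ring
  rw [hab]
  have h3 : a * b - 1 ≠ 0 := by
    intro h'
    apply h2'
    field_simp
    linear_combination h'
  field_simp
  ring

theorem integral_exp_div_sub {s : ℝ} {w : ℂ} (h : ‖w‖ ≠ Real.exp s) :
    ∫ θ in (0 : ℝ)..(2 * Real.pi), cexp (s + θ * I) / (cexp (s + θ * I) - w) * I =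
      if ‖w‖ < Real.exp s then 2 * Real.pi * I else 0 := by
  have e : ∫ θ in (0 : ℝ)..(2 * Real.pi), cexp (s + θ * I) / (cexp (s + θ * I) - w) * I =
      ∮ ξ in C(0, Real.exp s), (ξ - w)⁻¹ := by
    rw [circleIntegral]
    refine intervalIntegral.integral_congr fun θ _ => ?_
    simp only [deriv_circleMap, smul_eq_mul, circleMap, zero_add]
    rw [Complex.exp_add, ofReal_exp]
    ring
  rw [e]
  split_ifs with hw
  · exact circleIntegral.integral_sub_inv_of_mem_ball (by simpa using hw)
  · refine DiffContOnCl.circleIntegral_eq_zero (Real.exp_pos s).le ?_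
    have hne : ∀ ξ ∈ Metric.closedBall (0 : ℂ) (Real.exp s), ξ - w ≠ 0 := by
      intro ξ hξ h0
      rw [sub_eq_zero.mp h0] at hξ
      rw [mem_closedBall_zero_iff] at hξ
      exact hw (lt_of_le_of_ne hξ h)
    have : DifferentiableOn ℂ (fun ξ : ℂ => (ξ - w)⁻¹)
        (closure (Metric.ball 0 (Real.exp s))) := by
      rw [closure_ball _ (Real.exp_pos s).ne']
      exact fun ξ hξ => ((differentiableAt_id.sub_const w).inv (hne ξ hξ)).differentiableWithinAt
    exact this.diffContOnCl

theorem exp_ne_exp_of_re {z w : ℂ} (h : z.re ≠ w.re) : cexp z ≠ cexp w := by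
  intro h'
  have := congrArg norm h'
  rw [norm_exp, norm_exp] at this
  exact h (Real.exp_injective this)

theorem ellMap_sub_ellMap (E z w : ℂ) :
    ellMap E z - ellMap E w = E.im * I * (cosh z - cosh w) := by
  rw [ellMap, ellMap]
  ring

theorem ellMap_ne_of_re {E z w : ℂ} (hE : 0 < E.im) (hz : 0 < z.re) (hw : 0 < w.re)
    (h : z.re ≠ w.re) : ellMap E z ≠ ellMap E w := by
  intro h'
  have := congrArg (focal E) h'
  rw [focal_ellMap hE, focal_ellMap hE] at this
  have h2 := mul_left_cancel₀ (by positivity) this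
  have h3 := Real.cosh_le_cosh.mp h2.le
  have h4 := Real.cosh_le_cosh.mp h2.ge
  rw [abs_of_pos hz, abs_of_pos hw] at h3 h4
  exact h (le_antisymm h3 h4)

/-- In terms of `ξ = exp z`, the circle of radius `exp s` always encloses `exp (-w)`, which is
compensated by the constant `-1` of the decomposition. The point `exp w` decides. -/
theorem integral_winding {E w : ℂ} {s : ℝ} (hE : 0 < E.im) (hs : 0 < s) (hw : 0 < w.re)
    (hne : s ≠ w.re) :
    ∫ θ in (0 : ℝ)..(2 * Real.pi), ellMap' E (s + θ * I) * I /
      (ellMap E (s + θ * I) - ellMap E w) = if w.re < s then 2 * Real.pi * I else 0 := by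
  have hre : ∀ θ : ℝ, ((s : ℂ) + θ * I).re = s := fun θ => by simp
  have hn1 : ∀ θ : ℝ, cexp (s + θ * I) ≠ cexp w := fun θ =>
    exp_ne_exp_of_re (by rw [hre]; exact hne)
  have hn2 : ∀ θ : ℝ, cexp (s + θ * I) ≠ cexp (-w) := fun θ =>
    exp_ne_exp_of_re (by rw [hre, neg_re]; linarith)
  have hcont : ∀ w' : ℂ, (∀ θ : ℝ, cexp (s + θ * I) ≠ w') → IntervalIntegrable
      (fun θ : ℝ => cexp (s + θ * I) / (cexp (s + θ * I) - w') * I) volume 0 (2 * Real.pi) := by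
    intro w' h'
    refine Continuous.intervalIntegrable ?_ _ _
    refine Continuous.mul (Continuous.div (by fun_prop) (by fun_prop)
      fun θ => sub_ne_zero.mpr (h' θ)) continuous_const
  have hA : (E.im : ℂ) * I ≠ 0 := mul_ne_zero (ofReal_ne_zero.mpr hE.ne') I_ne_zero
  have e : ∀ θ : ℝ, ellMap' E (s + θ * I) * I / (ellMap E (s + θ * I) - ellMap E w) =
      cexp (s + θ * I) / (cexp (s + θ * I) - cexp w) * I +
        cexp (s + θ * I) / (cexp (s + θ * I) - cexp (-w)) * I - I := by
    intro θ
    rw [ellMap_sub_ellMap, ellMap', mul_assoc, mul_div_mul_left _ _ hA, mul_div_right_comm,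
      sinh_div_cosh_sub_cosh (hn1 θ) (hn2 θ)]
    ring
  simp_rw [e]
  rw [intervalIntegral.integral_sub ((hcont _ hn1).add (hcont _ hn2)) intervalIntegrable_const,
    intervalIntegral.integral_add (hcont _ hn1) (hcont _ hn2), intervalIntegral.integral_const,
    integral_exp_div_sub, integral_exp_div_sub]
  · rw [norm_exp, norm_exp, neg_re, if_pos (Real.exp_lt_exp.mpr (by linarith : -w.re < s)),
      sub_zero, real_smul]
    simp only [Real.exp_lt_exp]
    push_cast
    ring
  · rw [norm_exp, neg_re]
    exact fun h' => by linarith [Real.exp_injective h']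
  · rw [norm_exp]
    exact fun h' => hne (Real.exp_injective h').symm

/-- The Cauchy integral at `k` over the ellipse `ellipse E s` of the function given in the
coordinate `z` of `ellMap E z` by `q`. -/
def cauchyInt (E : ℂ) (q : ℂ → ℂ) (s : ℝ) (k : ℂ) : ℂ :=
  (2 * Real.pi * I)⁻¹ * ∫ θ in (0 : ℝ)..(2 * Real.pi),
    q (s + θ * I) * (ellMap' E (s + θ * I) * I / (ellMap E (s + θ * I) - k))

theorem eq_of_ellMap_eq {E z w : ℂ} (hE : 0 < E.im) (hz : 0 < z.re) (hw : 0 < w.re)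
    (him : |z.im - w.im| ≤ Real.pi) (h : ellMap E z = ellMap E w) : z = w := by
  have hA : (E.im : ℂ) * I ≠ 0 := mul_ne_zero (ofReal_ne_zero.mpr hE.ne') I_ne_zero
  have hre : z.re = w.re := by
    by_contra h'
    exact ellMap_ne_of_re hE hz hw h' h
  have h1 : cosh z = cosh w := by
    have := ellMap_sub_ellMap E z w
    rw [h, sub_self] at this
    exact sub_eq_zero.mp ((mul_eq_zero.mp this.symm).resolve_left hA)
  rw [← Complex.cos_mul_I, ← Complex.cos_mul_I, Complex.cos_eq_cos_iff] at h1
  obtain ⟨n, hn⟩ := h1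
  rcases hn with hn | hn
  · have h2 : w.re = 2 * n * Real.pi + z.re ∨ True := Or.inr trivial
    have h3 := congrArg Complex.re hn
    simp at h3
    have h4 : (|(n : ℝ)|) * 2 ≤ 1 := by
      have e : z.im - w.im = 2 * n * Real.pi := by linarith
      rw [e, abs_mul, abs_mul, abs_of_pos Real.pi_pos, abs_of_pos (by norm_num : (0 : ℝ) < 2)] at him
      nlinarith [Real.pi_pos]
    have h5 : n = 0 := by
      have : |(n : ℝ)| < 1 := by linarith
      exact_mod_cast Int.abs_lt_one_iff.mp (by exact_mod_cast this)
    rw [h5] at h3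
    simp at h3
    exact Complex.ext hre h3.symm
  · have h3 := congrArg Complex.im hn
    simp at h3
    linarith

theorem differentiableOn_dslope_div {q J : ℂ → ℂ} {U : Set ℂ} {w : ℂ} (hU : U ∈ 𝓝 w)
    (hq : DifferentiableOn ℂ q U) (hJ : DifferentiableOn ℂ J U) {S : Set ℂ} (hS : S ⊆ U)
    (hne : ∀ z ∈ S, dslope J w z ≠ 0) :
    DifferentiableOn ℂ (fun z => dslope q w z / dslope J w z) S :=
  (((Complex.differentiableOn_dslope hU).mpr hq).mono hS).div
    (((Complex.differentiableOn_dslope hU).mpr hJ).mono hS) hne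

/-- Cauchy's theorem on a period rectangle for `(q z - q w) ellMap' z / (ellMap z - ellMap w)`,
whose singularity at `w` is removable. The horizontal sides cancel by periodicity; the vertical ones
give the Cauchy integrals, less `q w` times winding numbers. -/
theorem cauchy_annulus {E w : ℂ} {q : ℂ → ℂ} {ρ r R : ℝ} (hE : 0 < E.im)
    (hq : DifferentiableOn ℂ q {z | 0 < z.re ∧ z.re < ρ})
    (hper : ∀ z : ℂ, q (z + 2 * Real.pi * I) = q z) (hr : 0 < r) (hrw : r < w.re)
    (hwR : w.re < R) (hR : R < ρ) :
    q w = cauchyInt E q R (ellMap E w) - cauchyInt E q r (ellMap E w) := by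
  have hw0 : 0 < w.re := hr.trans hrw
  set U : Set ℂ := {z : ℂ | 0 < z.re ∧ z.re < ρ}
  have hUo : IsOpen U := (isOpen_lt continuous_const continuous_re).inter
    (isOpen_lt continuous_re continuous_const)
  have hwU : w ∈ U := ⟨hw0, hwR.trans hR⟩
  -- With the period centred at `w`, no horizontal side passes through `w`, and in the closed
  -- rectangle `ellMap` takes its value at `w` nowhere else.
  set c : ℝ := w.im - Real.pi with hc
  have hpi := Real.pi_pos
  set h : ℂ → ℂ := fun z => dslope q w z / dslope (ellMap E) w z * ellMap' E z with hh
  set h₂ : ℂ → ℂ := fun z => (q z - q w) * ellMap' E z / (ellMap E z - ellMap E w) with hh₂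
  have hrect := Complex.integral_boundary_rect_eq_zero_of_differentiableOn h
    (r + c * I) (R + (c + 2 * Real.pi : ℝ) * I) (by
      have hS : (uIcc ((r : ℂ) + c * I).re ((R : ℂ) + (c + 2 * Real.pi : ℝ) * I).re ×ℂ
          uIcc ((r : ℂ) + c * I).im ((R : ℂ) + (c + 2 * Real.pi : ℝ) * I).im) =
          Icc r R ×ℂ Icc c (c + 2 * Real.pi) := by
        simp only [add_re, ofReal_re, mul_re, I_re, mul_zero, ofReal_im, I_im, mul_one, sub_self,
          add_zero, add_im, mul_im, zero_add]
        rw [uIcc_of_le (by linarith), uIcc_of_le (by linarith)]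
      rw [hS]
      refine DifferentiableOn.mul (differentiableOn_dslope_div (hUo.mem_nhds hwU) hq
        (differentiable_ellMap E).differentiableOn ?_ ?_) (differentiable_ellMap' E).differentiableOn
      · rintro z ⟨hz, -⟩
        exact ⟨hr.trans_le hz.1, hz.2.trans_lt hR⟩
      · rintro z ⟨hz, hz'⟩
        by_cases hzw : z = w
        · rw [hzw, dslope_same, (hasDerivAt_ellMap E w).deriv, ← rootFactor_ellMap hE hw0]
          exact rootFactor_ne_zero hE (ellMap_notMem_cut hE hw0)
        · rw [dslope_of_ne _ hzw, slope_def_field]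
          refine div_ne_zero (sub_ne_zero.mpr fun h' => hzw ?_) (sub_ne_zero.mpr hzw)
          refine eq_of_ellMap_eq hE (hr.trans_le hz.1) hw0 ?_ h'
          have h1 : c ≤ z.im := hz'.1
          have h2 : z.im ≤ c + 2 * Real.pi := hz'.2
          rw [abs_le]
          constructor <;> linarith)
  have heq : ∀ z, z ≠ w → h z = h₂ z := by
    intro z hz
    have hz' : z - w ≠ 0 := sub_ne_zero.mpr hz
    simp only [hh, hh₂, dslope_of_ne _ hz, slope_def_field]
    rw [div_div_div_cancel_right₀ hz']
    ring
  have hper₂ : ∀ z, h₂ (z + 2 * Real.pi * I) = h₂ z := by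
    intro z
    simp only [hh₂, hper, ellMap_add_period, ellMap'_add_period]
  have him : ∀ x y : ℝ, ((x : ℂ) + y * I).im = y := fun x y => by simp
  have hre : ∀ x y : ℝ, ((x : ℂ) + y * I).re = x := fun x y => by simp
  simp only [him, hre] at hrect
  have e1 : (∫ x in r..R, h (x + c * I)) = ∫ x in r..R, h (x + (c + 2 * Real.pi : ℝ) * I) := by
    refine intervalIntegral.integral_congr fun x _ => ?_
    rw [heq, heq, ← hper₂]
    · congr 1
      push_cast
      ring
    · intro h'
      have := congrArg Complex.im h'
      rw [him] at this
      linarith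
    · intro h'
      have := congrArg Complex.im h'
      rw [him] at this
      linarith
  have e2 : ∀ s : ℝ, s ≠ w.re → (∫ y in c..c + 2 * Real.pi, h (s + y * I)) =
      ∫ y in (0 : ℝ)..2 * Real.pi, h₂ (s + y * I) := by
    intro s hs
    have : (∫ y in c..c + 2 * Real.pi, h (s + y * I)) =
        ∫ y in c..c + 2 * Real.pi, h₂ (s + y * I) := by
      refine intervalIntegral.integral_congr fun y _ => heq _ fun h' => hs ?_
      rw [← h', hre]
    rw [this]
    have hp : Function.Periodic (fun y : ℝ => h₂ (s + y * I)) (2 * Real.pi) := by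
      intro y
      simp only
      rw [← hper₂ (s + y * I)]
      congr 1
      push_cast
      ring
    have := hp.intervalIntegral_add_eq c 0
    rwa [zero_add] at this
  have e3 : ∀ s : ℝ, 0 < s → s < ρ → s ≠ w.re →
      (∫ y in (0 : ℝ)..2 * Real.pi, h₂ (s + y * I)) * I = (2 * Real.pi * I) *
        cauchyInt E q s (ellMap E w) - q w * if w.re < s then 2 * Real.pi * I else 0 := by
    intro s hs0 hsρ hs
    have hne : ∀ θ : ℝ, ellMap E (s + θ * I) - ellMap E w ≠ 0 := fun θ =>
      sub_ne_zero.mpr (ellMap_ne_of_re hE (by rw [hre]; exact hs0) hw0 (by rw [hre]; exact hs))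
    have hc1 : Continuous fun θ : ℝ => ellMap' E (s + θ * I) * I /
        (ellMap E (s + θ * I) - ellMap E w) :=
      (((continuous_ellMap' E).comp (by fun_prop)).mul continuous_const).div
        (((continuous_ellMap E).comp (by fun_prop)).sub continuous_const) hne
    have hc2 : Continuous fun θ : ℝ => q (s + θ * I) := by
      refine continuous_iff_continuousAt.mpr fun θ => ?_
      have hm : (s : ℂ) + θ * I ∈ U := ⟨by rw [hre]; exact hs0, by rw [hre]; exact hsρ⟩
      exact ContinuousAt.comp (f := fun θ : ℝ => (s : ℂ) + θ * I)
        (hq.continuousOn.continuousAt (hUo.mem_nhds hm)) (by fun_prop)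
    have hi1 : IntervalIntegrable (fun θ : ℝ => q (s + θ * I) * (ellMap' E (s + θ * I) * I /
        (ellMap E (s + θ * I) - ellMap E w))) volume 0 (2 * Real.pi) :=
      (hc2.mul hc1).intervalIntegrable _ _
    have hi2 : IntervalIntegrable (fun θ : ℝ => q w * (ellMap' E (s + θ * I) * I /
        (ellMap E (s + θ * I) - ellMap E w))) volume 0 (2 * Real.pi) :=
      (hc1.const_mul _).intervalIntegrable _ _
    rw [cauchyInt, mul_inv_cancel_left₀ Complex.two_pi_I_ne_zero, ← integral_winding hE hs0 hw0 hs,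
      ← intervalIntegral.integral_const_mul, ← intervalIntegral.integral_mul_const,
      ← intervalIntegral.integral_sub hi1 hi2]
    refine intervalIntegral.integral_congr fun θ _ => ?_
    simp only [hh₂]
    ring
  rw [e1, sub_self, zero_add, e2 R hwR.ne', e2 r hrw.ne, smul_eq_mul, smul_eq_mul, mul_comm I,
    mul_comm I, e3 R (hw0.trans hwR) hR hwR.ne', e3 r hr (hrw.trans (hwR.trans hR)) hrw.ne,
    if_pos hwR, if_neg (not_lt.mpr hrw.le)] at hrect
  apply mul_left_cancel₀ Complex.two_pi_I_ne_zero
  linear_combination -hrect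

/-- A Cauchy integral is analytic off its curve. -/
theorem differentiableAt_cauchyKernel {W γ : ℝ → ℂ} (hW : Continuous W) (hγ : Continuous γ)
    {a b : ℝ} {k₀ : ℂ} (hk : ∀ θ, γ θ ≠ k₀) :
    DifferentiableAt ℂ (fun k => ∫ θ in a..b, W θ / (γ θ - k)) k₀ := by
  obtain ⟨δ, hδ, hδ'⟩ : ∃ δ > 0, ∀ θ ∈ uIcc a b, 2 * δ ≤ ‖γ θ - k₀‖ := by
    obtain ⟨θ₀, -, hmin⟩ := isCompact_uIcc.exists_isMinOn (nonempty_uIcc (a := a) (b := b))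
      ((hγ.sub continuous_const).norm : Continuous fun θ => ‖γ θ - k₀‖).continuousOn
    refine ⟨‖γ θ₀ - k₀‖ / 2, by
      have := norm_pos_iff.mpr (sub_ne_zero.mpr (hk θ₀))
      positivity, fun θ hθ => ?_⟩
    have : ‖γ θ₀ - k₀‖ ≤ ‖γ θ - k₀‖ := hmin hθ
    linarith
  have hfar : ∀ θ ∈ uIcc a b, ∀ k ∈ Metric.ball k₀ δ, δ ≤ ‖γ θ - k‖ := by
    intro θ hθ k hk
    have h1 := hδ' θ hθ
    have h2 : ‖k - k₀‖ < δ := by simpa [dist_eq_norm] using hk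
    have h3 : ‖γ θ - k₀‖ ≤ ‖γ θ - k‖ + ‖k - k₀‖ := by
      have := norm_add_le (γ θ - k) (k - k₀)
      rwa [sub_add_sub_cancel] at this
    linarith
  have hcontOn : ∀ k ∈ Metric.ball k₀ δ, ContinuousOn (fun θ => W θ / (γ θ - k)) (uIcc a b) := by
    intro k hk
    refine hW.continuousOn.div (hγ.sub continuous_const).continuousOn fun θ hθ h0 => ?_
    have := hfar θ hθ k hk
    rw [h0, norm_zero] at this
    linarith
  refine (intervalIntegral.hasDerivAt_integral_of_dominated_loc_of_deriv_le
    (F := fun k θ => W θ / (γ θ - k)) (F' := fun k θ => W θ / (γ θ - k) ^ 2)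
    (bound := fun θ => ‖W θ‖ / δ ^ 2) (s := Metric.ball k₀ δ) (Metric.ball_mem_nhds k₀ hδ)
    ?_ ?_ ?_ ?_ ?_ ?_).2.differentiableAt
  · filter_upwards [Metric.ball_mem_nhds k₀ hδ] with k hk
    exact ((hcontOn k hk).mono uIoc_subset_uIcc).aestronglyMeasurable measurableSet_uIoc
  · exact (hcontOn k₀ (Metric.mem_ball_self hδ)).intervalIntegrable
  · refine ContinuousOn.aestronglyMeasurable ?_ measurableSet_uIoc
    refine hW.continuousOn.div ((hγ.sub continuous_const).pow 2).continuousOn fun θ hθ => ?_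
    exact pow_ne_zero 2 (sub_ne_zero.mpr (hk θ))
  · refine Eventually.of_forall fun θ hθ k hk => ?_
    rw [norm_div, norm_pow]
    have := hfar θ (uIoc_subset_uIcc hθ) k hk
    gcongr
  · exact (hW.norm.div_const _).intervalIntegrable _ _
  · refine Eventually.of_forall fun θ hθ k hk => ?_
    have h1 := hfar θ (uIoc_subset_uIcc hθ) k hk
    have h2 : γ θ - k ≠ 0 := norm_pos_iff.mp (hδ.trans_le h1)
    have := (((hasDerivAt_id k).const_sub (γ θ)).fun_inv h2).const_mul (W θ)
    simp only [id] at this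
    convert! this using 1
    field_simp

theorem differentiableAt_cauchyInt {E k : ℂ} {q : ℂ → ℂ} {ρ s : ℝ} (hE : 0 < E.im)
    (hq : DifferentiableOn ℂ q {z | 0 < z.re ∧ z.re < ρ}) (hs : 0 < s) (hsρ : s < ρ)
    (hk : focal E k ≠ 2 * E.im * Real.cosh s) : DifferentiableAt ℂ (cauchyInt E q s) k := by
  have hre : ∀ x y : ℝ, ((x : ℂ) + y * I).re = x := fun x y => by simp
  have hUo : IsOpen {z : ℂ | 0 < z.re ∧ z.re < ρ} :=
    (isOpen_lt continuous_const continuous_re).inter (isOpen_lt continuous_re continuous_const)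
  have hc2 : Continuous fun θ : ℝ => q (s + θ * I) := by
    refine continuous_iff_continuousAt.mpr fun θ => ?_
    have hm : (s : ℂ) + θ * I ∈ {z : ℂ | 0 < z.re ∧ z.re < ρ} :=
      ⟨by rw [hre]; exact hs, by rw [hre]; exact hsρ⟩
    exact ContinuousAt.comp (f := fun θ : ℝ => (s : ℂ) + θ * I)
      (hq.continuousOn.continuousAt (hUo.mem_nhds hm)) (by fun_prop)
  have := differentiableAt_cauchyKernel (k₀ := k) (a := 0) (b := 2 * Real.pi)
    (W := fun θ : ℝ => q (s + θ * I) * (ellMap' E (s + θ * I) * I))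
    (γ := fun θ : ℝ => ellMap E (s + θ * I))
    (hc2.mul (((continuous_ellMap' E).comp (by fun_prop)).mul continuous_const))
    ((continuous_ellMap E).comp (by fun_prop)) (fun θ h' => hk (by
      rw [← h', focal_ellMap hE, hre]))
  have h2 := this.const_mul (2 * Real.pi * I)⁻¹
  have e : (fun y => (2 * Real.pi * I)⁻¹ * ∫ θ in (0 : ℝ)..(2 * Real.pi),
      q (s + θ * I) * (ellMap' E (s + θ * I) * I) / (ellMap E (s + θ * I) - y)) =
      cauchyInt E q s := by
    funext y
    simp only [cauchyInt, ← mul_div_assoc]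
  exact e ▸ h2

section

/-! ### Boundary values of Cauchy integrals -/

/-- Vitali's theorem for a sequence that is bounded in `L²` of a finite measure. -/
theorem tendsto_integral_of_sq_bounded {α : Type*} {m : MeasurableSpace α} {μ : Measure α}
    [IsFiniteMeasure μ] {h : ℕ → α → ℂ} {g : α → ℂ} {M : ℝ}
    (hm : ∀ n, AEStronglyMeasurable (h n) μ) (hint : ∀ n, Integrable (fun x => ‖h n x‖ ^ 2) μ)
    (hM : ∀ n, ∫ x, ‖h n x‖ ^ 2 ∂μ ≤ M)
    (hlim : ∀ᵐ x ∂μ, Tendsto (fun n => h n x) atTop (𝓝 (g x))) :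
    Integrable g μ ∧ Tendsto (fun n => ∫ x, h n x ∂μ) atTop (𝓝 (∫ x, g x ∂μ)) := by
  have hui : UniformIntegrable h 1 μ := by
    refine uniformIntegrable_of le_rfl ENNReal.one_ne_top hm fun ε hε => ?_
    -- Where `‖h n x‖ ≥ C`, it is at most `‖h n x‖² / C`, so the tails are bounded by `|M| / C ≤ ε`.
    -- This is uniform integrability.
    have hC0 : 0 < |M| / ε + 1 := by positivity
    refine ⟨Real.toNNReal (|M| / ε + 1), fun n => ?_⟩
    set C : ℝ := |M| / ε + 1
    rw [eLpNorm_one_eq_lintegral_enorm]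
    have hpt : ∀ x, ‖({x | Real.toNNReal C ≤ ‖h n x‖₊} : Set α).indicator (h n) x‖ₑ ≤
        ENNReal.ofReal (‖h n x‖ ^ 2 / C) := by
      intro x
      by_cases hx : x ∈ {x | Real.toNNReal C ≤ ‖h n x‖₊}
      · rw [Set.indicator_of_mem hx, ← ofReal_norm]
        have hx' : C ≤ ‖h n x‖ := by
          have : Real.toNNReal C ≤ ‖h n x‖₊ := hx
          rwa [Real.toNNReal_le_iff_le_coe, coe_nnnorm] at this
        refine ENNReal.ofReal_le_ofReal ?_
        rw [le_div_iff₀ hC0, pow_two]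
        exact mul_le_mul_of_nonneg_left hx' (norm_nonneg _)
      · rw [Set.indicator_of_notMem hx]
        simp
    refine (lintegral_mono hpt).trans ?_
    rw [← ofReal_integral_eq_lintegral_ofReal ((hint n).div_const C)
      (Eventually.of_forall fun x => by positivity)]
    refine ENNReal.ofReal_le_ofReal ?_
    rw [integral_div, div_le_iff₀ hC0]
    calc ∫ x, ‖h n x‖ ^ 2 ∂μ ≤ |M| := (hM n).trans (le_abs_self M)
      _ ≤ ε * C := by
        simp only [C]
        rw [mul_add, mul_div_cancel₀ _ hε.ne']
        linarith
  have hg := hui.integrable_of_ae_tendsto hlim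
  refine ⟨hg, tendsto_integral_of_L1' g hg.1
    (Eventually.of_forall fun n => memLp_one_iff_integrable.mp (hui.memLp n)) ?_⟩
  exact tendsto_Lp_finite_of_tendsto_ae le_rfl ENNReal.one_ne_top hm
    (memLp_one_iff_integrable.mpr hg) hui.2.1 hlim

theorem focal_sub_le (E k k' : ℂ) : focal E k - focal E k' ≤ 2 * ‖k' - k‖ := by
  have h1 := norm_sub_norm_le (k - E) (k' - E)
  have h2 := norm_sub_norm_le (k - conj E) (k' - conj E)
  rw [sub_sub_sub_cancel_right, norm_sub_rev k k'] at h1 h2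
  rw [focal, focal]
  linarith

theorem le_norm_ellMap_sub {E z w : ℂ} (hE : 0 < E.im) :
    E.im * (Real.cosh w.re - Real.cosh z.re) ≤ ‖ellMap E z - ellMap E w‖ := by
  have := focal_sub_le E (ellMap E w) (ellMap E z)
  rw [focal_ellMap hE, focal_ellMap hE] at this
  linarith

variable {E : ℂ} {q : ℂ → ℂ} {ρ : ℝ}

theorem continuous_comp_vertical (hq : DifferentiableOn ℂ q {z | 0 < z.re ∧ z.re < ρ}) {s : ℝ}
    (hs : 0 < s) (hsρ : s < ρ) : Continuous fun θ : ℝ => q (s + θ * I) := by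
  have hUo : IsOpen {z : ℂ | 0 < z.re ∧ z.re < ρ} :=
    (isOpen_lt continuous_const continuous_re).inter (isOpen_lt continuous_re continuous_const)
  refine continuous_iff_continuousAt.mpr fun θ => ?_
  have hm : (s : ℂ) + θ * I ∈ {z : ℂ | 0 < z.re ∧ z.re < ρ} := by
    constructor <;> simpa
  exact ContinuousAt.comp (f := fun θ : ℝ => (s : ℂ) + θ * I)
    (hq.continuousOn.continuousAt (hUo.mem_nhds hm)) (by fun_prop)

theorem continuous_kernel (hE : 0 < E.im) {s : ℝ} (hs : 0 ≤ s) {w : ℂ} (hw : s < w.re) :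
    Continuous fun θ : ℝ => ellMap' E (s + θ * I) * I / (ellMap E (s + θ * I) - ellMap E w) := by
  refine (((continuous_ellMap' E).comp (by fun_prop)).mul continuous_const).div
    (((continuous_ellMap E).comp (by fun_prop)).sub continuous_const) fun θ h0 => ?_
  have := le_norm_ellMap_sub (z := s + θ * I) (w := w) hE
  have hre : ((s : ℂ) + θ * I).re = s := by simp
  rw [h0, norm_zero, hre] at this
  have h2 : Real.cosh s < Real.cosh w.re := by
    rw [Real.cosh_lt_cosh, abs_of_nonneg hs, abs_of_pos (hs.trans_lt hw)]
    exact hw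
  nlinarith

/-- By `cauchy_annulus` the integrals over the inner ellipses do not depend on the ellipse. Along `r
n` Vitali's theorem replaces the integrand by its boundary values, since the kernel stays bounded
away from `ellMap E w`. -/
theorem cauchyInt_eq_boundary (hE : 0 < E.im)
    (hq : DifferentiableOn ℂ q {z | 0 < z.re ∧ z.re < ρ})
    (hper : ∀ z : ℂ, q (z + 2 * Real.pi * I) = q z) {r : ℕ → ℝ} {M : ℝ} (hr : ∀ n, 0 < r n)
    (hr0 : Tendsto r atTop (𝓝 0))
    (hM : ∀ n, ∫ θ in (0 : ℝ)..2 * Real.pi, ‖q (r n + θ * I) * ellMap' E (r n + θ * I)‖ ^ 2 ≤ M)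
    {b : ℝ → ℂ} (hb : ∀ᵐ θ : ℝ, θ ∈ Ioc 0 (2 * Real.pi) →
      Tendsto (fun s : ℝ => q (s + θ * I)) (𝓝[>] 0) (𝓝 (b θ)))
    {w : ℂ} (hw0 : 0 < w.re) (hw : w.re < ρ) {s : ℝ} (hs0 : 0 < s) (hs : s < w.re) :
    IntervalIntegrable (fun θ : ℝ => b θ * (ellMap' E (θ * I) * I /
        (ellMap E (θ * I) - ellMap E w))) volume 0 (2 * Real.pi) ∧
      cauchyInt E q s (ellMap E w) = (2 * Real.pi * I)⁻¹ * ∫ θ in (0 : ℝ)..2 * Real.pi,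
        b θ * (ellMap' E (θ * I) * I / (ellMap E (θ * I) - ellMap E w)) := by
  have hpi := Real.pi_pos
  have h2pi : (0 : ℝ) ≤ 2 * Real.pi := by positivity
  -- A lower bound for the distance from `ellMap E w` to the ellipses of parameter below `w.re / 2`.
  set D : ℝ := E.im * (Real.cosh w.re - Real.cosh (w.re / 2)) with hD
  have hD0 : 0 < D := by
    have : Real.cosh (w.re / 2) < Real.cosh w.re := by
      rw [Real.cosh_lt_cosh, abs_of_pos hw0, abs_of_pos (by positivity)]
      linarith
    exact mul_pos hE (by linarith)
  obtain ⟨N, hN⟩ := eventually_atTop.mp (hr0.eventually (gt_mem_nhds (half_pos hw0)))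
  set t : ℕ → ℝ := fun n => r (n + N)
  have ht0 : ∀ n, 0 < t n := fun n => hr _
  have htw : ∀ n, t n < w.re / 2 := fun n => hN _ (by omega)
  have htlim : Tendsto t atTop (𝓝[>] 0) :=
    tendsto_nhdsWithin_iff.mpr ⟨hr0.comp (tendsto_add_atTop_nat N),
      Eventually.of_forall fun n => ht0 n⟩
  set h : ℕ → ℝ → ℂ := fun n θ => q (t n + θ * I) *
    (ellMap' E (t n + θ * I) * I / (ellMap E (t n + θ * I) - ellMap E w)) with hh
  have hcont : ∀ n, Continuous (h n) := fun n =>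
    (continuous_comp_vertical hq (ht0 n) (by linarith [htw n])).mul
      (continuous_kernel hE (ht0 n).le (by linarith [htw n]))
  have hcont' : ∀ n, Continuous fun θ : ℝ => q (t n + θ * I) * ellMap' E (t n + θ * I) := fun n =>
    (continuous_comp_vertical hq (ht0 n) (by linarith [htw n])).mul
      ((continuous_ellMap' E).comp (by fun_prop))
  have hbound : ∀ n θ, ‖h n θ‖ ^ 2 ≤
      (D ^ 2)⁻¹ * ‖q (t n + θ * I) * ellMap' E (t n + θ * I)‖ ^ 2 := by
    intro n θ
    have h1 : D ≤ ‖ellMap E (t n + θ * I) - ellMap E w‖ := by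
      refine le_trans ?_ (le_norm_ellMap_sub hE)
      rw [hD]
      have hre : ((t n : ℂ) + θ * I).re = t n := by simp
      rw [hre]
      have : Real.cosh (t n) ≤ Real.cosh (w.re / 2) := by
        rw [Real.cosh_le_cosh, abs_of_pos (ht0 n), abs_of_pos (by positivity)]
        exact (htw n).le
      gcongr
    simp only [hh]
    rw [← mul_div_assoc, ← mul_assoc, norm_div, norm_mul _ I, norm_I, mul_one, div_pow,
      div_eq_inv_mul]
    gcongr
  have hlim : ∀ᵐ θ ∂(volume.restrict (Ioc 0 (2 * Real.pi))), Tendsto (fun n => h n θ) atTop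
      (𝓝 (b θ * (ellMap' E (θ * I) * I / (ellMap E (θ * I) - ellMap E w)))) := by
    rw [ae_restrict_iff' measurableSet_Ioc]
    filter_upwards [hb] with θ hθ hθm
    refine ((hθ hθm).comp htlim).mul ?_
    have hcz : Tendsto (fun n => (t n : ℂ) + θ * I) atTop (𝓝 (θ * I)) := by
      have := ((continuous_ofReal.tendsto 0).comp
        (tendsto_nhdsWithin_iff.mp htlim).1).add_const (θ * I)
      simpa using this
    have hne : ellMap E (θ * I) - ellMap E w ≠ 0 := by
      have := le_norm_ellMap_sub (z := θ * I) (w := w) hE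
      rw [← norm_pos_iff]
      refine lt_of_lt_of_le (mul_pos hE ?_) this
      have hre : ((θ : ℂ) * I).re = 0 := by simp
      rw [hre, sub_pos, Real.cosh_lt_cosh, abs_zero, abs_of_pos hw0]
      exact hw0
    exact ((((continuous_ellMap' E).tendsto _).comp hcz).mul_const I).div
      ((((continuous_ellMap E).tendsto _).comp hcz).sub_const _) hne
  obtain ⟨hint, hconv⟩ := tendsto_integral_of_sq_bounded (M := (D ^ 2)⁻¹ * M)
    (fun n => (hcont n).aestronglyMeasurable)
    (fun n => by
      have : IntervalIntegrable (fun θ => ‖h n θ‖ ^ 2) volume 0 (2 * Real.pi) :=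
        ((hcont n).norm.pow 2).intervalIntegrable _ _
      rwa [intervalIntegrable_iff_integrableOn_Ioc_of_le h2pi] at this)
    (fun n => by
      rw [← intervalIntegral.integral_of_le h2pi]
      have e : ∫ θ in (0 : ℝ)..2 * Real.pi,
          (D ^ 2)⁻¹ * ‖q (t n + θ * I) * ellMap' E (t n + θ * I)‖ ^ 2 ≤ (D ^ 2)⁻¹ * M := by
        rw [intervalIntegral.integral_const_mul]
        exact mul_le_mul_of_nonneg_left (hM (n + N)) (by positivity)
      refine le_trans (intervalIntegral.integral_mono_on h2pi
        (((hcont n).norm.pow 2).intervalIntegrable _ _)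
        ((((hcont' n).norm.pow 2).const_mul _).intervalIntegrable _ _)
        fun θ _ => hbound n θ) e) hlim
  refine ⟨(intervalIntegrable_iff_integrableOn_Ioc_of_le h2pi).mpr hint, ?_⟩
  simp_rw [← intervalIntegral.integral_of_le h2pi] at hconv
  have hconst : ∀ n, (2 * Real.pi * I)⁻¹ * (∫ θ in (0 : ℝ)..2 * Real.pi, h n θ) =
      cauchyInt E q s (ellMap E w) := by
    intro n
    have e1 := cauchy_annulus hE hq hper (ht0 n) (w := w) (R := (w.re + ρ) / 2)
      (by linarith [htw n]) (by linarith) (by linarith)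
    have e2 := cauchy_annulus hE hq hper hs0 (w := w) (R := (w.re + ρ) / 2) hs
      (by linarith) (by linarith)
    change cauchyInt E q (t n) (ellMap E w) = _
    linear_combination e1 - e2
  refine tendsto_nhds_unique ?_ (hconv.const_mul _)
  simp_rw [hconst]
  exact tendsto_const_nhds

/-- Symmetry of the boundary values, on the two sides of a cut, of a sum of functions given in the
coordinate `z` of `ellMap E z`. -/
def SymmetricLimits {ι : Type*} [Fintype ι] (q : ι → ℂ → ℂ) (θ : ℝ) : Prop :=
  ∃ L R : ι → ℂ,
    (∀ i, Tendsto (fun s : ℝ => q i (s + θ * I)) (𝓝[>] 0) (𝓝 (L i))) ∧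
    (∀ i, Tendsto (fun s : ℝ => q i (s + (2 * Real.pi - θ : ℝ) * I)) (𝓝[>] 0) (𝓝 (R i))) ∧
    ∑ i, L i = ∑ i, R i

theorem SymmetricLimits.reflect {ι : Type*} [Fintype ι] {q : ι → ℂ → ℂ} {θ : ℝ}
    (h : SymmetricLimits q (2 * Real.pi - θ)) : SymmetricLimits q θ := by
  obtain ⟨L, R, hL, hR, e⟩ := h
  rw [sub_sub_cancel] at hR
  exact ⟨R, L, hR, hL, e.symm⟩

theorem cauchyInt_sum {ι : Type*} [Fintype ι] {q : ι → ℂ → ℂ} (hE : 0 < E.im)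
    (hq : ∀ i, DifferentiableOn ℂ (q i) {z | 0 < z.re ∧ z.re < ρ}) {s : ℝ} (hs0 : 0 < s)
    (hsρ : s < ρ) {w : ℂ} (hs : s < w.re) :
    cauchyInt E (fun z => ∑ i, q i z) s (ellMap E w) =
      ∑ i, cauchyInt E (q i) s (ellMap E w) := by
  simp only [cauchyInt]
  rw [← Finset.mul_sum, ← intervalIntegral.integral_finsetSum]
  · simp only [Finset.sum_mul]
  · exact fun i _ => ((continuous_comp_vertical (hq i) hs0 hsρ).mul
      (continuous_kernel hE hs0.le hs)).intervalIntegrable _ _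

/-- A sum of functions near a cut that has symmetric boundary values is the Cauchy integral over
an outer ellipse. -/
theorem sum_eq_cauchyInt {ι : Type*} [Fintype ι] {q : ι → ℂ → ℂ} (hE : 0 < E.im)
    (hq : ∀ i, DifferentiableOn ℂ (q i) {z | 0 < z.re ∧ z.re < ρ})
    (hper : ∀ i, ∀ z : ℂ, q i (z + 2 * Real.pi * I) = q i z)
    (hbd : ∀ i, ∃ r : ℕ → ℝ, (∀ n, 0 < r n) ∧ Tendsto r atTop (𝓝 0) ∧ ∃ M : ℝ, ∀ n,
      ∫ θ in (0 : ℝ)..2 * Real.pi, ‖q i (r n + θ * I) * ellMap' E (r n + θ * I)‖ ^ 2 ≤ M)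
    (hsym : ∀ᵐ θ : ℝ, θ ∈ Ioo 0 Real.pi → SymmetricLimits q θ) {w : ℂ} {R : ℝ}
    (hw0 : 0 < w.re) (hw : w.re < R) (hR : R < ρ) :
    ∑ i, q i w = cauchyInt E (fun z => ∑ i, q i z) R (ellMap E w) := by
  have hpi := Real.pi_pos
  have hsym' : ∀ᵐ θ : ℝ, θ ∈ Ioo 0 (2 * Real.pi) → SymmetricLimits q θ := by
    have h2 := (Measure.measurePreserving_sub_left volume (2 * Real.pi)).quasiMeasurePreserving.ae hsym
    have h3 : ∀ᵐ θ : ℝ, θ ≠ Real.pi := by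
      rw [ae_iff]
      simp
    filter_upwards [hsym, h2, h3] with θ h1 h2 h3 hθ
    rcases lt_or_gt_of_ne h3 with h | h
    · exact h1 ⟨hθ.1, h⟩
    · exact (h2 ⟨by linarith [hθ.2], by linarith⟩).reflect
  have hlt : ∀ᵐ θ : ℝ, θ ≠ 2 * Real.pi := by
    rw [ae_iff]
    simp
  set b : ι → ℝ → ℂ := fun i θ => limUnder (𝓝[>] (0 : ℝ)) (fun s : ℝ => q i (s + θ * I)) with hb
  have hblim : ∀ i, ∀ᵐ θ : ℝ, θ ∈ Ioc 0 (2 * Real.pi) →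
      Tendsto (fun s : ℝ => q i (s + θ * I)) (𝓝[>] 0) (𝓝 (b i θ)) := by
    intro i
    filter_upwards [hsym', hlt] with θ h1 h2 hθ
    obtain ⟨L, -, hL, -⟩ := h1 ⟨hθ.1, lt_of_le_of_ne hθ.2 h2⟩
    simp only [hb]
    rw [(hL i).limUnder_eq]
    exact hL i
  have hbsym : ∀ᵐ θ : ℝ, θ ∈ Ioc 0 (2 * Real.pi) →
      ∑ i, b i (2 * Real.pi - θ) = ∑ i, b i θ := by
    filter_upwards [hsym', hlt] with θ h1 h2 hθ
    obtain ⟨L, R, hL, hR, e⟩ := h1 ⟨hθ.1, lt_of_le_of_ne hθ.2 h2⟩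
    simp only [hb]
    simp_rw [fun i => (hL i).limUnder_eq, fun i => (hR i).limUnder_eq]
    exact e.symm
  set K : ℝ → ℂ := fun θ => ellMap' E (θ * I) * I / (ellMap E (θ * I) - ellMap E w) with hK
  have hKsym : ∀ θ : ℝ, K (2 * Real.pi - θ) = -K θ := by
    intro θ
    have e : ((2 * Real.pi - θ : ℝ) : ℂ) * I = -(θ * I) + 2 * Real.pi * I := by
      push_cast
      ring
    simp only [hK]
    rw [e, ellMap'_add_period, ellMap_add_period, ellMap'_neg, ellMap_neg]
    ring
  -- The sum of the boundary values is symmetric under `θ ↦ 2π - θ` and the kernel is antisymmetric.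
  have hzero : ∫ θ in (0 : ℝ)..2 * Real.pi, (∑ i, b i θ) * K θ = 0 := by
    have e1 := intervalIntegral.integral_comp_sub_left (a := 0) (b := 2 * Real.pi)
      (fun θ => (∑ i, b i θ) * K θ) (2 * Real.pi)
    rw [sub_self, sub_zero] at e1
    have e2 : ∫ θ in (0 : ℝ)..2 * Real.pi, (∑ i, b i (2 * Real.pi - θ)) * K (2 * Real.pi - θ) =
        ∫ θ in (0 : ℝ)..2 * Real.pi, -((∑ i, b i θ) * K θ) := by
      refine intervalIntegral.integral_congr_ae ?_
      filter_upwards [hbsym] with θ hθ hm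
      rw [uIoc_of_le (by positivity)] at hm
      rw [hθ hm, hKsym]
      ring
    rw [e2, intervalIntegral.integral_neg] at e1
    linear_combination -e1 / 2
  have hs0 : 0 < w.re / 2 := by positivity
  have hsw : w.re / 2 < w.re := by linarith
  have hwρ := hw.trans hR
  -- Each summand comes with its own sequence of ellipses, so the passage to the cut is made for
  -- each one separately; only afterwards is the symmetry of the sum available.
  choose r hr hr0 M hM using hbd
  have hbdry := fun i => cauchyInt_eq_boundary hE (hq i) (hper i) (hr i) (hr0 i) (hM i)
    (hblim i) hw0 hwρ hs0 hsw
  have hinner : cauchyInt E (fun z => ∑ i, q i z) (w.re / 2) (ellMap E w) = 0 := by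
    rw [cauchyInt_sum hE hq hs0 (hsw.trans hwρ) hsw]
    simp_rw [fun i => (hbdry i).2]
    rw [← Finset.mul_sum, ← intervalIntegral.integral_finsetSum fun i _ => (hbdry i).1]
    simp_rw [← Finset.sum_mul]
    rw [hzero, mul_zero]
  have := cauchy_annulus (q := fun z => ∑ i, q i z) hE
    (DifferentiableOn.fun_sum fun i _ => hq i) (fun z => by simp only [hper]) hs0 hsw hw hR
  rwa [hinner, sub_zero] at this

end

/-! ### Extension across the cuts -/

/-- The conditions at a cut under which a sum of functions extends across it. -/
structure ExtendsAcross {ι : Type*} [Fintype ι] (E : ℂ) (F : ι → ℂ → ℂ) : Prop where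
  bound : ∀ i, ∃ r : ℕ → ℝ, (∀ n, 0 < r n) ∧ Tendsto r atTop (𝓝 0) ∧ ∃ M : ℝ, ∀ n,
    ∫ θ in (0 : ℝ)..2 * Real.pi,
      ‖F i (ellMap E (r n + θ * I)) * ellMap' E (r n + θ * I)‖ ^ 2 ≤ M
  symm : ∀ᵐ θ : ℝ, θ ∈ Ioo 0 Real.pi → SymmetricLimits (fun i z => F i (ellMap E z)) θ

theorem differentiableOn_comp_ellMap {E₁ E₂ : ℂ} {F : ℂ → ℂ} (h₁ : 0 < E₁.im)
    (hF : DifferentiableOn ℂ F (contour E₁ E₂)ᶜ) :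
    DifferentiableOn ℂ (fun z => F (ellMap E₁ z))
      {z | 0 < z.re ∧ z.re < stripRadius E₁ |E₁.re - E₂.re|} := fun z hz =>
  (DifferentiableAt.comp (f := ellMap E₁) (g := F) z
    (hF.differentiableAt ((isOpen_compl_contour E₁ E₂).mem_nhds (ellMap_notMem_contour h₁ hz.1 hz.2)))
    (differentiable_ellMap E₁ z)).differentiableWithinAt

/-- The Cauchy integral over an outer ellipse is analytic inside it, across the cut, and reproduces
the sum there. -/
theorem exists_local_extension {ι : Type*} [Fintype ι] {E₁ E₂ : ℂ} {F : ι → ℂ → ℂ}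
    (h₁ : 0 < E₁.im) (hne : E₁.re ≠ E₂.re)
    (hF : ∀ i, DifferentiableOn ℂ (F i) (contour E₁ E₂)ᶜ) (hc : ExtendsAcross E₁ F) :
    ∃ (H : ℂ → ℂ) (U : Set ℂ), IsOpen U ∧ cut E₁ ⊆ U ∧ Disjoint U (cut E₂) ∧
      DifferentiableOn ℂ H U ∧ ∀ k ∈ U, k ∉ cut E₁ → H k = ∑ i, F i k := by
  set ρ := stripRadius E₁ |E₁.re - E₂.re|
  have hρ : 0 < ρ := stripRadius_sep_pos h₁ hne
  set R := ρ / 2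
  have hR0 : 0 < R := by positivity
  have hR : R < ρ := by simp only [R]; linarith
  have hq := fun i => differentiableOn_comp_ellMap h₁ (hF i)
  have hsum := DifferentiableOn.fun_sum (u := Finset.univ) fun i _ => hq i
  have hex : ∀ k, focal E₁ k < 2 * E₁.im * Real.cosh R → ∃ z, 0 ≤ z.re ∧ z.re < R ∧
      ellMap E₁ z = k := by
    intro k hk
    obtain ⟨z, hz, hzk⟩ := exists_ellMap_eq h₁ k
    refine ⟨z, hz, ?_, hzk⟩
    rw [← hzk, focal_ellMap h₁] at hk
    have := lt_of_mul_lt_mul_left hk (by positivity)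
    rwa [Real.cosh_lt_cosh, abs_of_nonneg hz, abs_of_pos hR0] at this
  refine ⟨cauchyInt E₁ (fun z => ∑ i, F i (ellMap E₁ z)) R,
    {k | focal E₁ k < 2 * E₁.im * Real.cosh R}, isOpen_lt (continuous_focal E₁) continuous_const,
    fun k hk => ?_, ?_, fun k hk => ?_, fun k hk hk' => ?_⟩
  · change focal E₁ k < _
    rw [(mem_cut_iff_focal h₁).mp hk]
    have : 1 < Real.cosh R := Real.one_lt_cosh.mpr hR0.ne'
    nlinarith
  · rw [Set.disjoint_left]
    intro k hk
    obtain ⟨z, hz0, hz, rfl⟩ := hex k hk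
    exact ellMap_notMem_other h₁ (by rw [abs_of_nonneg hz0]; exact hz.trans hR)
  · exact (differentiableAt_cauchyInt h₁ hsum hR0 hR (ne_of_lt hk)).differentiableWithinAt
  · obtain ⟨z, hz0, hz, rfl⟩ := hex k hk
    have hz0' : 0 < z.re := lt_of_le_of_ne hz0 fun h' => hk' (ellMap_mem_cut h₁ h'.symm)
    exact (sum_eq_cauchyInt (q := fun i z => F i (ellMap E₁ z)) h₁ hq
      (fun i z => by rw [ellMap_add_period]) hc.bound hc.symm hz0' hz hR).symm

/-- A sum of functions that are analytic off the contour, and whose boundary values agree on the two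
sides of the cuts, extends to an entire function. -/
theorem exists_entire {ι : Type*} [Fintype ι] {E₁ E₂ : ℂ} {F : ι → ℂ → ℂ}
    (h₁ : 0 < E₁.im) (h₂ : 0 < E₂.im) (hne : E₁.re ≠ E₂.re)
    (hF : ∀ i, DifferentiableOn ℂ (F i) (contour E₁ E₂)ᶜ) (hc₁ : ExtendsAcross E₁ F)
    (hc₂ : ExtendsAcross E₂ F) :
    ∃ G : ℂ → ℂ, Differentiable ℂ G ∧ ∀ k ∉ contour E₁ E₂, G k = ∑ i, F i k := by
  classical
  obtain ⟨H₁, U₁, hU₁, hs₁, hd₁, hH₁, he₁⟩ := exists_local_extension h₁ hne hF hc₁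
  obtain ⟨H₂, U₂, hU₂, hs₂, hd₂, hH₂, he₂⟩ := exists_local_extension h₂ hne.symm
    (fun i => contour_comm E₁ E₂ ▸ hF i) hc₂
  rw [Set.disjoint_left] at hd₁ hd₂
  set G : ℂ → ℂ := fun k => if k ∈ cut E₁ then H₁ k else if k ∈ cut E₂ then H₂ k else ∑ i, F i k
    with hG
  have hG0 : ∀ k ∉ contour E₁ E₂, G k = ∑ i, F i k := fun k hk => by
    simp only [hG]
    rw [if_neg fun h' => hk (Or.inl h'), if_neg fun h' => hk (Or.inr h')]
  have hG1 : ∀ k ∈ U₁, G k = H₁ k := fun k hk => by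
    simp only [hG]
    split_ifs with ha hb
    · rfl
    · exact absurd hb (hd₁ hk)
    · exact (he₁ k hk ha).symm
  have hG2 : ∀ k ∈ U₂, G k = H₂ k := fun k hk => by
    simp only [hG]
    split_ifs with ha hb
    · exact absurd ha (hd₂ hk)
    · rfl
    · exact (he₂ k hk hb).symm
  refine ⟨G, fun k => ?_, hG0⟩
  by_cases hk : k ∈ contour E₁ E₂
  · rcases hk with hk | hk
    · exact (hH₁.differentiableAt (hU₁.mem_nhds (hs₁ hk))).congr_of_eventuallyEq
        (eventually_of_mem (hU₁.mem_nhds (hs₁ hk)) hG1)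
    · exact (hH₂.differentiableAt (hU₂.mem_nhds (hs₂ hk))).congr_of_eventuallyEq
        (eventually_of_mem (hU₂.mem_nhds (hs₂ hk)) hG2)
  · have hm := (isOpen_compl_contour E₁ E₂).mem_nhds hk
    exact ((DifferentiableOn.fun_sum fun i _ => hF i).differentiableAt hm).congr_of_eventuallyEq
      (eventually_of_mem hm hG0)

theorem isCompact_contour (E₁ E₂ : ℂ) : IsCompact (contour E₁ E₂) := by
  have : ∀ E : ℂ, IsCompact (cut E) := fun E => by
    rw [cut, segment_eq_image]
    exact isCompact_Icc.image (by fun_prop)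
  exact (this E₁).union (this E₂)

theorem eventually_notMem_contour (E₁ E₂ : ℂ) :
    ∀ᶠ k in Bornology.cobounded ℂ, k ∉ contour E₁ E₂ :=
  Bornology.isBounded_def.mp (isCompact_contour E₁ E₂).isBounded

/-- Liouville's theorem for functions whose boundary values agree on the two sides of the cuts. -/
theorem eq_of_extendsAcross {ι : Type*} [Fintype ι] {E₁ E₂ : ℂ} {F : ι → ℂ → ℂ} {c : ℂ}
    (h₁ : 0 < E₁.im) (h₂ : 0 < E₂.im) (hne : E₁.re ≠ E₂.re)
    (hF : ∀ i, DifferentiableOn ℂ (F i) (contour E₁ E₂)ᶜ) (hc₁ : ExtendsAcross E₁ F)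
    (hc₂ : ExtendsAcross E₂ F)
    (hlim : Tendsto (fun k => ∑ i, F i k) (Bornology.cobounded ℂ) (𝓝 c)) {k : ℂ}
    (hk : k ∉ contour E₁ E₂) : ∑ i, F i k = c := by
  obtain ⟨G, hG, hGF⟩ := exists_entire h₁ h₂ hne hF hc₁ hc₂
  rw [← hGF k hk]
  refine hG.apply_eq_of_tendsto_cocompact k ?_
  rw [← Metric.cobounded_eq_cocompact]
  refine hlim.congr' ?_
  filter_upwards [eventually_notMem_contour E₁ E₂] with k hk
  exact (hGF k hk).symm

/-! ### Boundary values in the coordinate of `ellMap` -/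

theorem ellMap_vertical (E : ℂ) (θ : ℝ) :
    ellMap E (θ * I) = (E.re : ℂ) + ((E.im * Real.cos θ : ℝ) : ℂ) * I := by
  rw [ellMap, Complex.cosh_mul_I]
  push_cast
  ring

theorem ellMap_reflect (E z : ℂ) : ellMap E (2 * Real.pi * I - z) = ellMap E z := by
  rw [show 2 * Real.pi * I - z = -z + 2 * Real.pi * I by ring, ellMap_add_period, ellMap_neg]

theorem tendsto_ellMap_vertical (E : ℂ) (θ : ℝ) :
    Tendsto (fun s : ℝ => ellMap E (s + θ * I)) (𝓝[>] 0) (𝓝 (ellMap E (θ * I))) := by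
  have h1 : Continuous fun s : ℝ => ellMap E (s + θ * I) :=
    (continuous_ellMap E).comp (by fun_prop)
  have := h1.tendsto 0
  simp only [ofReal_zero, zero_add] at this
  exact this.mono_left nhdsWithin_le_nhds

theorem cosh_sub_one_le_sinh {s : ℝ} (hs : 0 < s) : Real.cosh s - 1 ≤ Real.sinh s := by
  have h1 : Real.cosh s - Real.sinh s = Real.exp (-s) := Real.cosh_sub_sinh s
  have h2 : Real.exp (-s) ≤ 1 := Real.exp_le_one_iff.mpr (by linarith)
  linarith

theorem ellMap_vertical_re_sub (E : ℂ) (s θ : ℝ) :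
    (ellMap E (s + θ * I)).re - E.re = -(E.im * Real.sinh s * Real.sin θ) := by
  rw [ellMap_re]
  simp
  ring

theorem ellMap_vertical_im (E : ℂ) (s θ : ℝ) :
    (ellMap E (s + θ * I)).im = E.im * Real.cosh s * Real.cos θ := by
  rw [ellMap_im]
  simp
  ring

/-- For fixed `θ` the curve `s ↦ ellMap E (s + iθ)` meets the cut nontangentially, because `cosh s -
1 ≤ sinh s` controls the vertical displacement by the horizontal one. The summand `1` makes the
inequality strict. -/
theorem stolz_bound {E : ℂ} (hE : 0 < E.im) {s θ : ℝ} (hs : 0 < s) (hθ : Real.sin θ ≠ 0) :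
    |E.im * Real.cosh s * Real.cos θ - E.im * Real.cos θ| <
      (|Real.cos θ| / |Real.sin θ| + 1) * |E.im * Real.sinh s * Real.sin θ| := by
  have h1 := cosh_sub_one_le_sinh hs
  have h2 : 0 ≤ Real.cosh s - 1 := by linarith [Real.one_le_cosh s]
  have h3 := Real.sinh_pos_iff.mpr hs
  have h4 : 0 < |Real.sin θ| := abs_pos.mpr hθ
  rw [show E.im * Real.cosh s * Real.cos θ - E.im * Real.cos θ =
    E.im * (Real.cosh s - 1) * Real.cos θ by ring, abs_mul, abs_mul, abs_mul, abs_mul,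
    abs_of_pos hE, abs_of_nonneg h2, abs_of_pos h3]
  have e : (|Real.cos θ| / |Real.sin θ| + 1) * (E.im * Real.sinh s * |Real.sin θ|) =
      E.im * Real.sinh s * |Real.cos θ| + E.im * Real.sinh s * |Real.sin θ| := by
    field_simp
  rw [e]
  have h5 : E.im * (Real.cosh s - 1) * |Real.cos θ| ≤ E.im * Real.sinh s * |Real.cos θ| := by
    gcongr
  have h6 : 0 < E.im * Real.sinh s * |Real.sin θ| := by positivity
  linarith

theorem tendsto_of_isLeftValue {E : ℂ} {m : ℂ → Matrix (Fin 2) (Fin 2) ℂ}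
    {L : Matrix (Fin 2) (Fin 2) ℂ} (hE : 0 < E.im) {θ : ℝ} (hθ : 0 < Real.sin θ)
    (hL : IsLeftValue m (ellMap E (θ * I)) L) :
    Tendsto (fun s : ℝ => m (ellMap E (s + θ * I))) (𝓝[>] 0) (𝓝 L) := by
  refine (hL (|Real.cos θ| / |Real.sin θ| + 1) (by positivity)).comp
    (tendsto_nhdsWithin_iff.mpr ⟨tendsto_ellMap_vertical E θ, ?_⟩)
  filter_upwards [self_mem_nhdsWithin] with s hs
  have hs' : 0 < s := hs
  have h1 := ellMap_vertical_re_sub E s θ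
  have h0 := ellMap_vertical_re_sub E 0 θ
  have h2 := ellMap_vertical_im E s θ
  have h20 := ellMap_vertical_im E 0 θ
  simp only [ofReal_zero, zero_add, Real.sinh_zero, Real.cosh_zero, mul_one, mul_zero,
    zero_mul, neg_zero] at h0 h20
  have h3 : 0 < E.im * Real.sinh s * Real.sin θ :=
    mul_pos (mul_pos hE (Real.sinh_pos_iff.mpr hs')) hθ
  have h4 := stolz_bound hE hs' hθ.ne'
  rw [abs_of_pos h3] at h4
  refine ⟨by linarith, ?_⟩
  rw [h2, h20]
  rwa [show (ellMap E (θ * I)).re - (ellMap E (s + θ * I)).re =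
    E.im * Real.sinh s * Real.sin θ by linarith]

theorem tendsto_of_isRightValue {E : ℂ} {m : ℂ → Matrix (Fin 2) (Fin 2) ℂ}
    {L : Matrix (Fin 2) (Fin 2) ℂ} (hE : 0 < E.im) {θ : ℝ} (hθ : Real.sin θ < 0)
    (hL : IsRightValue m (ellMap E (θ * I)) L) :
    Tendsto (fun s : ℝ => m (ellMap E (s + θ * I))) (𝓝[>] 0) (𝓝 L) := by
  refine (hL (|Real.cos θ| / |Real.sin θ| + 1) (by positivity)).comp
    (tendsto_nhdsWithin_iff.mpr ⟨tendsto_ellMap_vertical E θ, ?_⟩)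
  filter_upwards [self_mem_nhdsWithin] with s hs
  have hs' : 0 < s := hs
  have h1 := ellMap_vertical_re_sub E s θ
  have h0 := ellMap_vertical_re_sub E 0 θ
  have h2 := ellMap_vertical_im E s θ
  have h20 := ellMap_vertical_im E 0 θ
  simp only [ofReal_zero, zero_add, Real.sinh_zero, Real.cosh_zero, mul_one, mul_zero,
    zero_mul, neg_zero] at h0 h20
  have h3 : E.im * Real.sinh s * Real.sin θ < 0 :=
    mul_neg_of_pos_of_neg (mul_pos hE (Real.sinh_pos_iff.mpr hs')) hθ
  have h4 := stolz_bound hE hs' hθ.ne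
  rw [abs_of_neg h3] at h4
  refine ⟨by linarith, ?_⟩
  rw [h2, h20]
  rwa [show (ellMap E (s + θ * I)).re - (ellMap E (θ * I)).re =
    -(E.im * Real.sinh s * Real.sin θ) by linarith]

theorem cos_mem_Ioo {θ : ℝ} (hθ : θ ∈ Ioo 0 Real.pi) : Real.cos θ ∈ Ioo (-1) 1 := by
  constructor
  · rw [← Real.cos_pi]
    exact Real.strictAntiOn_cos ⟨hθ.1.le, hθ.2.le⟩ ⟨Real.pi_pos.le, le_rfl⟩ hθ.2
  · rw [← Real.cos_zero]
    exact Real.strictAntiOn_cos ⟨le_rfl, Real.pi_pos.le⟩ ⟨hθ.1.le, hθ.2.le⟩ hθ.1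

/-- The exceptional set of `θ` is the image of a null set under `y ↦ arccos (y / A)`, which is
differentiable in the open interval and hence preserves null sets. -/
theorem ae_cos_of_ae {A : ℝ} (hA : 0 < A) {p : ℝ → Prop}
    (hp : ∀ᵐ y ∂(volume.restrict (Icc (-A) A)), p y) :
    ∀ᵐ θ : ℝ, θ ∈ Ioo 0 Real.pi → p (A * Real.cos θ) := by
  rw [ae_restrict_iff' measurableSet_Icc, ae_iff] at hp
  set N : Set ℝ := {y | ¬(y ∈ Icc (-A) A → p y)} ∩ Ioo (-A) A
  have hN : volume N = 0 := measure_mono_null inter_subset_left hp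
  have hd : DifferentiableOn ℝ (fun y => Real.arccos (y / A)) N := by
    intro y hy
    refine DifferentiableAt.differentiableWithinAt ?_
    refine DifferentiableAt.comp (g := Real.arccos) y (Real.differentiableAt_arccos.mpr ⟨?_, ?_⟩)
      (differentiableAt_id.div_const A)
    · intro h'
      rw [div_eq_iff hA.ne'] at h'
      linarith [hy.2.1]
    · intro h'
      rw [div_eq_iff hA.ne'] at h'
      linarith [hy.2.2]
  have := addHaar_image_eq_zero_of_differentiableOn_of_addHaar_eq_zero volume hd hN
  rw [ae_iff]
  refine measure_mono_null (fun θ hθ => ?_) this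
  simp only [mem_ofPred_eq, Classical.not_imp] at hθ
  obtain ⟨hθ, hnp⟩ := hθ
  have hc := cos_mem_Ioo hθ
  have h1 : A * Real.cos θ ∈ Ioo (-A) A := ⟨by nlinarith [hc.1], by nlinarith [hc.2]⟩
  refine ⟨A * Real.cos θ, ⟨?_, h1⟩, ?_⟩
  · simp only [mem_ofPred_eq, Classical.not_imp]
    exact ⟨Ioo_subset_Icc_self h1, hnp⟩
  · simp only
    rw [mul_div_cancel_left₀ _ hA.ne', Real.arccos_cos hθ.1.le hθ.2.le]

theorem ae_limits_of_hasJump {E : ℂ} {m : ℂ → Matrix (Fin 2) (Fin 2) ℂ}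
    {v : Matrix (Fin 2) (Fin 2) ℂ} (hE : 0 < E.im) (hm : HasJump m E v) :
    ∀ᵐ θ : ℝ, θ ∈ Ioo 0 Real.pi → ∃ L R : Matrix (Fin 2) (Fin 2) ℂ, L = R * v ∧
      Tendsto (fun s : ℝ => m (ellMap E (s + θ * I))) (𝓝[>] 0) (𝓝 L) ∧
      Tendsto (fun s : ℝ => m (ellMap E (s + (2 * Real.pi - θ : ℝ) * I))) (𝓝[>] 0) (𝓝 R) := by
  filter_upwards [ae_cos_of_ae hE hm] with θ h hθ
  obtain ⟨L, R, hL, hR, hLR⟩ := h hθ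
  have hsin : 0 < Real.sin θ := Real.sin_pos_of_pos_of_lt_pi hθ.1 hθ.2
  refine ⟨L, R, hLR, tendsto_of_isLeftValue hE hsin (by rwa [ellMap_vertical]),
    tendsto_of_isRightValue hE (by rw [Real.sin_two_pi_sub]; linarith) ?_⟩
  rwa [ellMap_vertical, Real.cos_two_pi_sub]

/-- Continuity of `q` on the imaginary axis gives limits from the full half planes, which is more
than nontangential ones. The end points of the cut, `θ = 0, π, 2π`, are left out, as `ν` is singular
there. -/
theorem hasJump_of_local {E : ℂ} {m q : ℂ → Matrix (Fin 2) (Fin 2) ℂ}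
    {v : Matrix (Fin 2) (Fin 2) ℂ} {ρ : ℝ} (hE : 0 < E.im) (hρ : 0 < ρ)
    (hm : ∀ z : ℂ, 0 < z.re → z.re < ρ → 0 < z.im → z.im < 2 * Real.pi → m (ellMap E z) = q z)
    (hq : ∀ θ : ℝ, 0 < θ → θ < 2 * Real.pi → θ ≠ Real.pi → ContinuousAt q (θ * I))
    (hv : ∀ θ : ℝ, θ ∈ Ioo 0 Real.pi → q (θ * I) = q (2 * Real.pi * I - θ * I) * v) :
    HasJump m E v := by
  have hpi := Real.pi_pos
  rw [HasJump, ← restrict_Ioo_eq_restrict_Icc, ae_restrict_iff' measurableSet_Ioo]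
  refine Eventually.of_forall fun y hy => ?_
  set θ := Real.arccos (y / E.im) with hθdef
  have h1 : -1 < y / E.im := by rw [lt_div_iff₀ hE]; linarith [hy.1]
  have h2 : y / E.im < 1 := by rw [div_lt_iff₀ hE]; linarith [hy.2]
  have hcos : E.im * Real.cos θ = y := by
    rw [hθdef, Real.cos_arccos h1.le h2.le]
    field_simp
  have hθ : θ ∈ Ioo 0 Real.pi := by
    constructor
    · exact Real.arccos_pos.mpr h2
    · refine lt_of_le_of_ne (Real.arccos_le_pi _) fun h' => ?_
      rw [h', Real.cos_pi] at hcos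
      linarith [hy.1]
  have hk : ellMap E (θ * I) = (E.re : ℂ) + (y : ℂ) * I := by rw [ellMap_vertical, hcos]
  have hcast : ((2 * Real.pi - θ : ℝ) : ℂ) * I = 2 * Real.pi * I - θ * I := by
    push_cast
    ring
  have hk' : ellMap E ((2 * Real.pi - θ : ℝ) * I) = (E.re : ℂ) + (y : ℂ) * I := by
    rw [hcast, ellMap_reflect, hk]
  have hre : ((E.re : ℂ) + (y : ℂ) * I).re = E.re := by simp
  have tl := tendsto_left_interior hE hρ hm hθ
    (hq θ hθ.1 (by linarith [hθ.2]) hθ.2.ne)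
  have tr := tendsto_right_interior hE hρ hm (θ := 2 * Real.pi - θ)
    ⟨by linarith [hθ.2], by linarith [hθ.1]⟩
    (hq _ (by linarith [hθ.2]) (by linarith [hθ.1]) (by linarith [hθ.2]))
  rw [hk] at tl
  rw [hk', hcast] at tr
  refine ⟨q (θ * I), q (2 * Real.pi * I - θ * I), fun α _ => tl.mono_left (nhdsWithin_mono _ ?_),
    fun α _ => tr.mono_left (nhdsWithin_mono _ ?_), hv θ hθ⟩
  · rintro k ⟨hk1, -⟩
    rwa [hre] at hk1
  · rintro k ⟨hk1, -⟩
    rwa [hre] at hk1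

/-! ### Functions that are continuous up to a cut -/

theorem exists_norm_le_of_continuousOn_strip {T : ℂ → ℂ} {ρ r : ℝ}
    (hT : ContinuousOn T {z | |z.re| < ρ}) (hr : r < ρ) :
    ∃ C : ℝ, 0 ≤ C ∧ ∀ s θ : ℝ, 0 ≤ s → s ≤ r → θ ∈ Icc 0 (2 * Real.pi) →
      ‖T (s + θ * I)‖ ≤ C := by
  have hK : IsCompact (Icc (0 : ℝ) r ×ˢ Icc (0 : ℝ) (2 * Real.pi)) := isCompact_Icc.prod isCompact_Icc
  have hc : ContinuousOn (fun p : ℝ × ℝ => T (p.1 + p.2 * I))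
      (Icc (0 : ℝ) r ×ˢ Icc (0 : ℝ) (2 * Real.pi)) := by
    refine hT.comp (by fun_prop) fun p hp => ?_
    change |((p.1 : ℂ) + p.2 * I).re| < ρ
    simp only [add_re, ofReal_re, mul_re, I_re, mul_zero, ofReal_im, I_im, mul_one, sub_self,
      add_zero]
    rw [abs_of_nonneg hp.1.1]
    exact hp.1.2.trans_lt hr
  obtain ⟨C, hC⟩ := hK.exists_bound_of_continuousOn hc
  exact ⟨max C 0, le_max_right _ _, fun s θ hs0 hs hθ =>
    (hC (s, θ) ⟨⟨hs0, hs⟩, hθ⟩).trans (le_max_left _ _)⟩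

theorem exists_sequence_of_bound {E : ℂ} {q : ℂ → ℂ} {r C : ℝ} (hr : 0 < r)
    (hq : ∀ s θ : ℝ, 0 < s → s ≤ r → θ ∈ Icc 0 (2 * Real.pi) →
      ‖q (s + θ * I) * ellMap' E (s + θ * I)‖ ≤ C) :
    ∃ t : ℕ → ℝ, (∀ n, 0 < t n) ∧ Tendsto t atTop (𝓝 0) ∧ ∃ M : ℝ, ∀ n,
      ∫ θ in (0 : ℝ)..2 * Real.pi, ‖q (t n + θ * I) * ellMap' E (t n + θ * I)‖ ^ 2 ≤ M := by
  have hpi := Real.pi_pos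
  refine ⟨fun n => r / (n + 1), fun n => by positivity, ?_, C ^ 2 * |2 * Real.pi - 0|, fun n => ?_⟩
  · have := (tendsto_one_div_add_atTop_nhds_zero_nat (𝕜 := ℝ)).const_mul r
    simpa [div_eq_mul_inv] using this
  · refine (le_abs_self _).trans ?_
    rw [← Real.norm_eq_abs]
    refine intervalIntegral.norm_integral_le_of_norm_le_const fun θ hθ => ?_
    rw [uIoc_of_le (by positivity)] at hθ
    rw [norm_pow, norm_norm]
    refine pow_le_pow_left₀ (norm_nonneg _) (hq _ θ (by positivity) ?_ ⟨hθ.1.le, hθ.2⟩) 2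
    rw [div_le_iff₀ (by positivity)]
    nlinarith [(Nat.cast_nonneg n : (0 : ℝ) ≤ n)]

theorem tendsto_vertical {X : Type*} [TopologicalSpace X] {T : ℂ → X} {θ : ℝ}
    (hT : ContinuousAt T (θ * I)) :
    Tendsto (fun s : ℝ => T (s + θ * I)) (𝓝[>] 0) (𝓝 (T (θ * I))) := by
  have h1 : Continuous fun s : ℝ => (s : ℂ) + θ * I := by fun_prop
  have h2 := h1.tendsto 0
  simp only [ofReal_zero, zero_add] at h2
  exact hT.tendsto.comp (h2.mono_left nhdsWithin_le_nhds)

theorem eventually_vertical {p : ℂ → Prop} {ρ : ℝ} (hρ : 0 < ρ)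
    (hp : ∀ z : ℂ, 0 < z.re → z.re < ρ → p z) (θ : ℝ) : ∀ᶠ s : ℝ in 𝓝[>] 0, p (s + θ * I) := by
  filter_upwards [self_mem_nhdsWithin, mem_nhdsWithin_of_mem_nhds (Iio_mem_nhds hρ)] with s h0 h1
  exact hp _ (by simpa using h0) (by simpa using h1)

theorem extendsAcross_of_continuousOn {E : ℂ} {F T : ℂ → ℂ} {ρ : ℝ} (hρ : 0 < ρ)
    (hT : ContinuousOn T {z | |z.re| < ρ})
    (hFT : ∀ z : ℂ, 0 < z.re → z.re < ρ → F (ellMap E z) = T z)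
    (hsym : ∀ θ : ℝ, T (2 * Real.pi * I - θ * I) = T (θ * I)) :
    ExtendsAcross E (fun _ : Unit => F) := by
  have hTc : ∀ θ : ℝ, ContinuousAt T (θ * I) := fun θ =>
    hT.continuousAt ((isOpen_strip ρ).mem_nhds (by simpa using hρ))
  have hlim : ∀ θ : ℝ, Tendsto (fun s : ℝ => F (ellMap E (s + θ * I))) (𝓝[>] 0)
      (𝓝 (T (θ * I))) := fun θ =>
    (tendsto_vertical (hTc θ)).congr' ((eventually_vertical hρ hFT θ).mono fun s hs => hs.symm)
  refine ⟨fun _ => ?_, Eventually.of_forall fun θ _ => ⟨fun _ => T (θ * I),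
    fun _ => T ((2 * Real.pi - θ : ℝ) * I), fun _ => hlim θ, fun _ => hlim _, ?_⟩⟩
  · obtain ⟨C, -, hC⟩ := exists_norm_le_of_continuousOn_strip (r := ρ / 2)
      (hT.mul (continuous_ellMap' E).continuousOn) (by linarith)
    refine exists_sequence_of_bound (q := fun z => F (ellMap E z)) (C := C) (half_pos hρ)
      fun s θ hs0 hs hθ => ?_
    rw [hFT _ (by simpa using hs0) (by simp; linarith)]
    exact hC s θ hs0.le hs hθ
  · have e : ((2 * Real.pi - θ : ℝ) : ℂ) * I = 2 * Real.pi * I - θ * I := by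
      push_cast
      ring
    rw [e, hsym]

/-! ### The Cauchy integral over the cut -/

theorem ellMap_vertical_ne {E k : ℂ} (hE : 0 < E.im) (hk : k ∉ cut E) (θ : ℝ) :
    ellMap E ((0 : ℝ) + θ * I) ≠ k := by
  rintro rfl
  exact hk (ellMap_mem_cut hE (by simp))

theorem continuous_vertical_zero {q : ℂ → ℂ} {ρ : ℝ} (hρ : 0 < ρ)
    (hq : ContinuousOn q {z | |z.re| < ρ}) : Continuous fun θ : ℝ => q ((0 : ℝ) + θ * I) :=
  hq.comp_continuous (by fun_prop) fun θ => by simpa using hρ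

theorem differentiableAt_cauchyInt_zero {E k : ℂ} {q : ℂ → ℂ} {ρ : ℝ} (hE : 0 < E.im)
    (hρ : 0 < ρ) (hq : ContinuousOn q {z | |z.re| < ρ}) (hk : k ∉ cut E) :
    DifferentiableAt ℂ (cauchyInt E q 0) k := by
  have := differentiableAt_cauchyKernel (k₀ := k) (a := 0) (b := 2 * Real.pi)
    (W := fun θ : ℝ => q ((0 : ℝ) + θ * I) * (ellMap' E ((0 : ℝ) + θ * I) * I))
    (γ := fun θ : ℝ => ellMap E ((0 : ℝ) + θ * I))
    ((continuous_vertical_zero hρ hq).mul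
      (((continuous_ellMap' E).comp (by fun_prop)).mul continuous_const))
    ((continuous_ellMap E).comp (by fun_prop)) (ellMap_vertical_ne hE hk)
  have h2 := this.const_mul (2 * Real.pi * I)⁻¹
  have e : (fun y => (2 * Real.pi * I)⁻¹ * ∫ θ in (0 : ℝ)..(2 * Real.pi),
      q ((0 : ℝ) + θ * I) * (ellMap' E ((0 : ℝ) + θ * I) * I) / (ellMap E ((0 : ℝ) + θ * I) - y)) =
      cauchyInt E q 0 := by
    funext y
    simp only [cauchyInt, ← mul_div_assoc]
  exact e ▸ h2

theorem tendsto_cauchyInt_zero {E : ℂ} {q : ℂ → ℂ} {ρ : ℝ} (hρ : 0 < ρ)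
    (hq : ContinuousOn q {z | |z.re| < ρ}) :
    Tendsto (cauchyInt E q 0) (Bornology.cobounded ℂ) (𝓝 0) := by
  obtain ⟨C, hC0, hC⟩ := exists_norm_le_of_continuousOn_strip (r := 0)
    (hq.mul (continuous_ellMap' E).continuousOn) hρ
  obtain ⟨D, hD0, hD⟩ := exists_norm_le_of_continuousOn_strip (r := 0) (ρ := ρ)
    (continuous_ellMap E).continuousOn hρ
  have hpi := Real.pi_pos
  have hbound : ∀ k : ℂ, D + 1 ≤ ‖k‖ → ‖cauchyInt E q 0 k‖ ≤
      ‖(2 * Real.pi * I : ℂ)⁻¹‖ * (C / (‖k‖ - D) * |2 * Real.pi - 0|) := by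
    intro k hk
    rw [cauchyInt, norm_mul]
    gcongr
    refine intervalIntegral.norm_integral_le_of_norm_le_const fun θ hθ => ?_
    rw [uIoc_of_le (by positivity)] at hθ
    have h1 := hC 0 θ le_rfl le_rfl ⟨hθ.1.le, hθ.2⟩
    have h2 := hD 0 θ le_rfl le_rfl ⟨hθ.1.le, hθ.2⟩
    rw [← mul_div_assoc, ← mul_assoc, norm_div, norm_mul _ I, norm_I, mul_one]
    have h3 : ‖k‖ - D ≤ ‖ellMap E ((0 : ℝ) + θ * I) - k‖ := by
      have := norm_sub_norm_le k (ellMap E ((0 : ℝ) + θ * I))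
      rw [norm_sub_rev] at this
      linarith
    exact div_le_div₀ hC0 h1 (by linarith) h3
  refine squeeze_zero_norm' ((tendsto_norm_cobounded_atTop.eventually_ge_atTop (D + 1)).mono hbound) ?_
  have h1 : Tendsto (fun k : ℂ => ‖k‖ - D) (Bornology.cobounded ℂ) atTop :=
    tendsto_atTop_add_const_right _ _ tendsto_norm_cobounded_atTop
  have h2 : Tendsto (fun k : ℂ => C / (‖k‖ - D)) (Bornology.cobounded ℂ) (𝓝 0) :=
    h1.const_div_atTop C
  simpa using (h2.mul_const |2 * Real.pi - 0|).const_mul ‖(2 * Real.pi * I : ℂ)⁻¹‖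

/-- Here `q` is continuous on the imaginary axis, so the inner ellipse may shrink to the cut. This
splits `q` into a part regular across the cut and a part analytic off it. -/
theorem eq_cauchyInt_sub_zero {E w : ℂ} {q : ℂ → ℂ} {ρ R : ℝ} (hE : 0 < E.im)
    (hq : DifferentiableOn ℂ q {z | |z.re| < ρ})
    (hper : ∀ z : ℂ, q (z + 2 * Real.pi * I) = q z) (hw0 : 0 < w.re)
    (hwR : w.re < R) (hR : R < ρ) :
    q w = cauchyInt E q R (ellMap E w) - cauchyInt E q 0 (ellMap E w) := by
  have hρ : 0 < ρ := hw0.trans (hwR.trans hR)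
  have hq' : DifferentiableOn ℂ q {z | 0 < z.re ∧ z.re < ρ} := hq.mono fun z hz => by
    change |z.re| < ρ
    rw [abs_of_pos hz.1]
    exact hz.2
  obtain ⟨C, -, hC⟩ := exists_norm_le_of_continuousOn_strip (r := ρ / 2)
    (hq.continuousOn.mul (continuous_ellMap' E).continuousOn) (by linarith)
  obtain ⟨r, hr, hr0, M, hM⟩ := exists_sequence_of_bound (half_pos hρ)
    fun s θ hs0 hs hθ => hC s θ hs0.le hs hθ
  have hb := (cauchyInt_eq_boundary hE hq' hper hr hr0 hM (b := fun θ => q (θ * I))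
    (Eventually.of_forall fun θ _ => tendsto_vertical (hq.continuousOn.continuousAt
      ((isOpen_strip ρ).mem_nhds (by simpa using hρ)))) hw0 (hwR.trans hR) (half_pos hw0)
      (half_lt_self hw0)).2
  rw [cauchy_annulus hE hq' hper (half_pos hw0) (half_lt_self hw0) hwR hR, hb]
  simp only [cauchyInt, ofReal_zero, zero_add]

/-! ### Behaviour of the root at infinity -/

theorem tendsto_sub_inv_cobounded (c : ℂ) :
    Tendsto (fun k : ℂ => (k - c)⁻¹) (Bornology.cobounded ℂ) (𝓝 0) :=
  tendsto_inv₀_cobounded.comp (tendsto_sub_const_cobounded c)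

theorem tendsto_sub_div_sub_cobounded (a b : ℂ) :
    Tendsto (fun k : ℂ => (k - a) / (k - b)) (Bornology.cobounded ℂ) (𝓝 1) := by
  have h1 : Tendsto (fun k : ℂ => 1 + (b - a) * (k - b)⁻¹) (Bornology.cobounded ℂ) (𝓝 1) := by
    simpa using ((tendsto_sub_inv_cobounded b).const_mul (b - a)).const_add 1
  refine h1.congr' ?_
  filter_upwards [Bornology.isBounded_def.mp (Bornology.isBounded_singleton (x := b))] with k hk
  have : k - b ≠ 0 := sub_ne_zero.mpr hk
  field_simp
  ring

theorem tendsto_rootFactor_div (E c : ℂ) :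
    Tendsto (fun k => rootFactor E k / (k - c)) (Bornology.cobounded ℂ) (𝓝 1) := by
  have h1 : Tendsto (fun k : ℂ => 1 + ((E.im : ℂ) / (k - (E.re : ℂ))) ^ 2) (Bornology.cobounded ℂ)
      (𝓝 1) := by
    have := (((tendsto_sub_inv_cobounded (E.re : ℂ)).const_mul (E.im : ℂ)).pow 2).const_add 1
    simpa [div_eq_mul_inv] using this
  have h2 := h1.cpow (tendsto_const_nhds (x := (1 : ℂ) / 2)) one_mem_slitPlane
  rw [one_cpow] at h2
  have := (tendsto_sub_div_sub_cobounded (E.re : ℂ) c).mul h2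
  rw [one_mul] at this
  refine this.congr fun k => ?_
  rw [rootFactor]
  ring

section

/-! ### The zeros of the theta functions -/

/-- The function of the Abel map whose only zero off the contour is `P₁`. -/
def thetaProd (E₁ E₂ w : ℂ) : ℂ :=
  theta E₁ E₂ (w + dTilde E₁ E₂) * theta E₁ E₂ (w - dTilde E₁ E₂)

/-- A logarithm of the quotient of `exp (2πi φ̃)` and `exp z` near `Σ₁`. -/
def leftLog (E₁ E₂ z : ℂ) : ℂ :=
  if |z.re| < stripRadius E₁ |E₁.re - E₂.re| then 2 * Real.pi * I * abelLeft E₁ E₂ z - z else 0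

/-- The factor that makes `thetaProd` a polynomial. -/
def outFactor (E₁ E₂ k : ℂ) : ℂ :=
  (k - E₁.re + rootFactor E₁ k) * cexp (-cauchyInt E₁ (leftLog E₁ E₂) 0 k)

variable {E₁ E₂ : ℂ}

theorem differentiable_theta_add (h₁ : 0 < E₁.im) (h₂ : 0 < E₂.im) (h : E₁.re < E₂.re) (c : ℂ) :
    Differentiable ℂ fun w => theta E₁ E₂ (w + c) :=
  (differentiable_theta h₁ h₂ h).comp (differentiable_id.add_const c)

theorem periodic_theta_add (c : ℂ) : Function.Periodic (fun w => theta E₁ E₂ (w + c)) 1 := by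
  intro w
  simp only
  rw [add_right_comm, theta_add_one]

theorem differentiable_thetaProd (h₁ : 0 < E₁.im) (h₂ : 0 < E₂.im) (h : E₁.re < E₂.re) :
    Differentiable ℂ (thetaProd E₁ E₂) :=
  (differentiable_theta_add h₁ h₂ h _).mul
    (by simpa only [sub_eq_add_neg] using differentiable_theta_add h₁ h₂ h (-dTilde E₁ E₂))

theorem periodic_thetaProd : Function.Periodic (thetaProd E₁ E₂) 1 := by
  intro w
  rw [thetaProd, add_right_comm, theta_add_one, add_sub_right_comm, theta_add_one, thetaProd]

theorem thetaProd_neg (w : ℂ) : thetaProd E₁ E₂ (-w) = thetaProd E₁ E₂ w := by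
  rw [thetaProd, thetaProd, ← theta_neg, ← theta_neg (-w - _), mul_comm]
  congr 2 <;> ring

/-- The shifts by `±d̃` cancel in the product of the two multipliers, so the quasi-period can be
absorbed by an exponential of `w` alone. -/
theorem thetaProd_tau_sub (w : ℂ) :
    thetaProd E₁ E₂ (tau E₁ E₂ - w) * cexp (2 * Real.pi * I * (tau E₁ E₂ - w)) =
      thetaProd E₁ E₂ w * cexp (2 * Real.pi * I * w) := by
  have e1 := theta_tau_sub (E₁ := E₁) (E₂ := E₂) w (dTilde E₁ E₂)
  have e2 := theta_tau_sub (E₁ := E₁) (E₂ := E₂) w (-dTilde E₁ E₂)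
  rw [← sub_eq_add_neg, sub_neg_eq_add] at e2
  rw [thetaProd, e1, e2, thetaProd]
  have e3 : cexp (2 * Real.pi * I * w) =
      cexp (Real.pi * I * (2 * (w - dTilde E₁ E₂) - tau E₁ E₂)) *
        cexp (Real.pi * I * (2 * (w + dTilde E₁ E₂) - tau E₁ E₂)) *
        cexp (2 * Real.pi * I * (tau E₁ E₂ - w)) := by
    rw [← Complex.exp_add, ← Complex.exp_add]
    congr 1
    ring
  rw [e3]
  ring

theorem differentiableOn_leftLog (h₁ : 0 < E₁.im) (h₂ : 0 < E₂.im) (h : E₁.re < E₂.re) :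
    DifferentiableOn ℂ (leftLog E₁ E₂) {z | |z.re| < stripRadius E₁ |E₁.re - E₂.re|} :=
  (((differentiableOn_abelLeft h₁ h₂ h).const_mul (2 * Real.pi * I)).sub
    differentiableOn_id).congr fun _ hz => if_pos hz

theorem leftLog_add_period (h₁ : 0 < E₁.im) (h₂ : 0 < E₂.im) (h : E₁.re < E₂.re) (z : ℂ) :
    leftLog E₁ E₂ (z + 2 * Real.pi * I) = leftLog E₁ E₂ z := by
  have hre : (z + 2 * Real.pi * I).re = z.re := by simp
  rw [leftLog, leftLog, hre]
  -- Going round `Σ₁` adds `1` to the Abel map, which `-z` compensates. The default value `0`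
  -- outside the strip makes the periodicity hold for every `z`, as the Cauchy formulas require.
  split_ifs with hz
  · rw [abelLeft_add_period h₁ h₂ h hz]
    ring
  · rfl

theorem differentiableAt_outFactor (h₁ : 0 < E₁.im) (h₂ : 0 < E₂.im) (h : E₁.re < E₂.re) {k : ℂ}
    (hk : k ∉ cut E₁) : DifferentiableAt ℂ (outFactor E₁ E₂) k :=
  ((differentiableAt_id.sub_const _).add (differentiableAt_rootFactor h₁ hk)).mul
    (differentiableAt_cauchyInt_zero h₁ (stripRadius_sep_pos h₁ h.ne)
      (differentiableOn_leftLog h₁ h₂ h).continuousOn hk).neg.cexp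

theorem differentiableAt_thetaProd_mul (h₁ : 0 < E₁.im) (h₂ : 0 < E₂.im) (h : E₁.re < E₂.re)
    {k : ℂ} (hk : k ∉ contour E₁ E₂) :
    DifferentiableAt ℂ (fun k => thetaProd E₁ E₂ (abelPlus E₁ E₂ k) * outFactor E₁ E₂ k) k :=
  (differentiableAt_comp_abelPlus h₁ h₂ h (differentiable_thetaProd h₁ h₂ h)
    periodic_thetaProd hk).mul (differentiableAt_outFactor h₁ h₂ h fun h' => hk (Or.inl h'))

/-- The local expression of `thetaProd * outFactor` near `Σ₁`. -/
theorem exists_local_left (h₁ : 0 < E₁.im) (h₂ : 0 < E₂.im) (h : E₁.re < E₂.re) :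
    ∃ (u : ℂ → ℂ) (R : ℝ), 0 < R ∧ R ≤ stripRadius E₁ |E₁.re - E₂.re| ∧
      ContinuousOn (fun z => thetaProd E₁ E₂ (abelLeft E₁ E₂ z) * u z) {z | |z.re| < R} ∧
      (∀ z : ℂ, 0 < z.re → z.re < R → thetaProd E₁ E₂ (abelPlus E₁ E₂ (ellMap E₁ z)) *
        outFactor E₁ E₂ (ellMap E₁ z) = thetaProd E₁ E₂ (abelLeft E₁ E₂ z) * u z) ∧
      ∀ θ : ℝ, thetaProd E₁ E₂ (abelLeft E₁ E₂ (2 * Real.pi * I - θ * I)) *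
        u (2 * Real.pi * I - θ * I) = thetaProd E₁ E₂ (abelLeft E₁ E₂ (θ * I)) * u (θ * I) := by
  set ρ := stripRadius E₁ |E₁.re - E₂.re| with hρdef
  have hρ : 0 < ρ := stripRadius_sep_pos h₁ h.ne
  set R := ρ / 2 with hRdef
  have hR0 : 0 < R := by positivity
  have hR : R < ρ := by rw [hRdef]; linarith
  have hlog := differentiableOn_leftLog h₁ h₂ h
  have hlog' : DifferentiableOn ℂ (leftLog E₁ E₂) {z | 0 < z.re ∧ z.re < ρ} := hlog.mono fun z hz => by
    change |z.re| < ρ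
    rw [abs_of_pos hz.1]
    exact hz.2
  set S : ℂ → ℂ := fun z => cauchyInt E₁ (leftLog E₁ E₂) R (ellMap E₁ z)
  refine ⟨fun z => E₁.im * I * (cexp (2 * Real.pi * I * abelLeft E₁ E₂ z) * cexp (-S z)), R, hR0,
    hR.le, ?_, fun z hz0 hz => ?_, fun θ => ?_⟩
  · have hφ := (differentiableOn_abelLeft h₁ h₂ h).continuousOn.mono
      (show {z : ℂ | |z.re| < R} ⊆ {z | |z.re| < ρ} from fun z hz => lt_trans hz hR)
    have hS : ContinuousOn S {z : ℂ | |z.re| < R} := by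
      intro z hz
      have hz' : |z.re| < R := hz
      refine ContinuousAt.continuousWithinAt (ContinuousAt.comp
        (g := cauchyInt E₁ (leftLog E₁ E₂) R) (differentiableAt_cauchyInt h₁ hlog' hR0 hR ?_).continuousAt (continuous_ellMap E₁).continuousAt)
      rw [focal_ellMap h₁]
      have : Real.cosh z.re < Real.cosh R := by
        rw [Real.cosh_lt_cosh, abs_of_pos hR0]
        exact hz'
      nlinarith
    exact ((differentiable_thetaProd h₁ h₂ h).continuous.comp_continuousOn hφ).mul
      (continuousOn_const.mul ((continuousOn_const.mul hφ).cexp.mul hS.neg.cexp))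
  · have hzρ := hz.trans hR
    have hin : |z.re| < ρ := by rwa [abs_of_pos hz0]
    rw [comp_abelPlus_ellMap_left h₁ h₂ h (differentiable_thetaProd h₁ h₂ h) periodic_thetaProd
      hz0 hzρ, outFactor, rootFactor_ellMap h₁ hz0]
    have e1 := eq_cauchyInt_sub_zero h₁ hlog (leftLog_add_period h₁ h₂ h) hz0 hz hR
    rw [leftLog, if_pos hin] at e1
    -- Together with `e3` this shows that near `Σ₁` the factor `outFactor` is `i E₁.im exp (2πi φ)
    -- exp (-S)`. Here `S` depends on `ellMap E₁ z` only, so it does not see the two sides of the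
    -- cut.
    have e2 : -cauchyInt E₁ (leftLog E₁ E₂) 0 (ellMap E₁ z) =
        2 * Real.pi * I * abelLeft E₁ E₂ z + -S z + -z := by
      simp only [S]
      linear_combination -e1
    have e3 : ellMap E₁ z - E₁.re + ellMap' E₁ z = E₁.im * I * cexp z := by
      rw [ellMap, ellMap', ← Complex.cosh_add_sinh]
      ring
    rw [e2, e3, Complex.exp_add, Complex.exp_add, Complex.exp_neg z]
    have := exp_ne_zero z
    field_simp
  · have hθ : |((θ : ℂ) * I).re| < ρ := by simpa using hρ
    have e1 := thetaProd_tau_sub (E₁ := E₁) (E₂ := E₂) (abelLeft E₁ E₂ (θ * I))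
    simp only [S]
    rw [ellMap_reflect, abelLeft_reflect h₁ h₂ h hθ]
    linear_combination (E₁.im * I * cexp (-cauchyInt E₁ (leftLog E₁ E₂) R (ellMap E₁ (θ * I)))) * e1

theorem continuousOn_local_right (h₁ : 0 < E₁.im) (h₂ : 0 < E₂.im) (h : E₁.re < E₂.re) :
    ContinuousOn (fun z => thetaProd E₁ E₂ (abelRight E₁ E₂ z) * outFactor E₁ E₂ (ellMap E₂ z))
      {z | |z.re| < stripRadius E₂ |E₂.re - E₁.re|} := by
  refine ((differentiable_thetaProd h₁ h₂ h).continuous.comp_continuousOn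
    (differentiableOn_abelRight h₁ h₂ h).continuousOn).mul fun z hz =>
      ContinuousAt.continuousWithinAt ?_
  exact ContinuousAt.comp (g := outFactor E₁ E₂)
    (differentiableAt_outFactor h₁ h₂ h (ellMap_notMem_other h₂ hz)).continuousAt
    (continuous_ellMap E₂).continuousAt

theorem thetaProd_abelInfty_ne_zero (h₁ : 0 < E₁.im) (h₂ : 0 < E₂.im) (h : E₁.re < E₂.re) :
    thetaProd E₁ E₂ (abelInfty E₁ E₂) ≠ 0 := by
  have := theta_abelInfty_add_ne_zero h₁ h₂ h 0
  rw [ofReal_zero, add_zero] at this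
  exact mul_ne_zero this (theta_abelInfty_sub_ne_zero h₁ h₂ h)

theorem tendsto_thetaProd_mul_div (h₁ : 0 < E₁.im) (h₂ : 0 < E₂.im) (h : E₁.re < E₂.re) (c : ℂ) :
    Tendsto (fun k => thetaProd E₁ E₂ (abelPlus E₁ E₂ k) * outFactor E₁ E₂ k / (k - c))
      (Bornology.cobounded ℂ) (𝓝 (thetaProd E₁ E₂ (abelInfty E₁ E₂) * 2)) := by
  have e1 := ((differentiable_thetaProd h₁ h₂ h).continuous.tendsto _).comp
    (tendsto_abelPlus h₁ h₂)
  have e2 := (tendsto_sub_div_sub_cobounded (E₁.re : ℂ) c).add (tendsto_rootFactor_div E₁ c)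
  have e3 := (tendsto_cauchyInt_zero (E := E₁) (stripRadius_sep_pos h₁ h.ne)
    (differentiableOn_leftLog h₁ h₂ h).continuousOn).neg.cexp
  have := e1.mul (e2.mul e3)
  rw [neg_zero, Complex.exp_zero, mul_one, one_add_one_eq_two] at this
  refine this.congr fun k => ?_
  simp only [Function.comp_apply]
  rw [outFactor]
  ring

/-- The function `thetaProd * outFactor` is linear. -/
theorem exists_thetaProd_mul_eq (h₁ : 0 < E₁.im) (h₂ : 0 < E₂.im) (h : E₁.re < E₂.re) :
    ∃ C : ℂ, C ≠ 0 ∧ ∀ k ∉ contour E₁ E₂,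
      thetaProd E₁ E₂ (abelPlus E₁ E₂ k) * outFactor E₁ E₂ k = C * (k - P₁ E₁ E₂) := by
  obtain ⟨u, R, hR0, hRρ, hc, hu, husym⟩ := exists_local_left h₁ h₂ h
  have hx₁ := extendsAcross_of_continuousOn (E := E₁)
    (F := fun k => thetaProd E₁ E₂ (abelPlus E₁ E₂ k) * outFactor E₁ E₂ k) hR0 hc hu husym
  have hρ₂ : 0 < stripRadius E₂ |E₂.re - E₁.re| := stripRadius_sep_pos h₂ h.ne'
  have hx₂ := extendsAcross_of_continuousOn (E := E₂)
    (F := fun k => thetaProd E₁ E₂ (abelPlus E₁ E₂ k) * outFactor E₁ E₂ k) hρ₂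
    (continuousOn_local_right h₁ h₂ h)
    (fun z hz0 hz => by
      rw [comp_abelPlus_ellMap_right h₁ h₂ h (differentiable_thetaProd h₁ h₂ h) periodic_thetaProd
        hz0 hz])
    (fun θ => by
      rw [ellMap_reflect, abelRight_reflect h₁ h₂ h (by simpa using hρ₂), thetaProd_neg])
  obtain ⟨G, hG, hGF⟩ := exists_entire h₁ h₂ h.ne
    (fun _ k hk => (differentiableAt_thetaProd_mul h₁ h₂ h hk).differentiableWithinAt) hx₁ hx₂
  simp only [Finset.univ_unique, Finset.sum_const, Finset.card_singleton, one_smul] at hGF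
  set P := P₁ E₁ E₂
  have hP := P₁_notMem_contour h₁ h₂ h
  have hGP : G P = 0 := by
    obtain ⟨n, hn⟩ := exists_abelPlus_P₁ h₁ h₂ h
    rw [hGF P hP, hn, periodic_add_int periodic_thetaProd, thetaProd, theta_abelMap_P₁_sub,
      mul_zero, zero_mul]
  -- Liouville's theorem is applied to the difference quotient of `G` at its zero `P`, which has a
  -- finite limit at infinity.
  have hD : Differentiable ℂ (dslope G P) := by
    rw [← differentiableOn_univ] at hG ⊢
    exact (Complex.differentiableOn_dslope univ_mem).mpr hG
  have hlim : Tendsto (dslope G P) (Bornology.cobounded ℂ)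
      (𝓝 (thetaProd E₁ E₂ (abelInfty E₁ E₂) * 2)) := by
    refine (tendsto_thetaProd_mul_div h₁ h₂ h P).congr' ?_
    filter_upwards [eventually_notMem_contour E₁ E₂,
      Bornology.isBounded_def.mp (Bornology.isBounded_singleton (x := P))] with k hk hkP
    rw [dslope_of_ne _ hkP, slope_def_field, hGP, sub_zero, hGF k hk]
  refine ⟨thetaProd E₁ E₂ (abelInfty E₁ E₂) * 2,
    mul_ne_zero (thetaProd_abelInfty_ne_zero h₁ h₂ h) two_ne_zero, fun k hk => ?_⟩
  rw [Metric.cobounded_eq_cocompact] at hlim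
  have e := hD.apply_eq_of_tendsto_cocompact k hlim
  have e2 := sub_smul_dslope G P k
  rw [e, hGP, sub_zero, hGF k hk, smul_eq_mul] at e2
  rw [← e2, mul_comm]

/-! ### Nonvanishing of the denominators, off the cuts and on them -/

theorem theta_abelPlus_add_ne_zero (h₁ : 0 < E₁.im) (h₂ : 0 < E₂.im) (h : E₁.re < E₂.re) {k : ℂ}
    (hk : k ∉ contour E₁ E₂) : theta E₁ E₂ (abelPlus E₁ E₂ k + dTilde E₁ E₂) ≠ 0 := by
  obtain ⟨C, hC, H⟩ := exists_thetaProd_mul_eq h₁ h₂ h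
  intro h0
  have hkP : k = P₁ E₁ E₂ := by
    have := H k hk
    rw [thetaProd, h0, zero_mul, zero_mul] at this
    exact sub_eq_zero.mp ((mul_eq_zero.mp this.symm).resolve_left hC)
  -- The other factor vanishes at `P₁` as well, so the product would have a double zero, in
  -- contradiction to the simple zero of `C (k - P₁)`.
  have h0' : theta E₁ E₂ (abelPlus E₁ E₂ k + -dTilde E₁ E₂) = 0 := by
    obtain ⟨n, hn⟩ := exists_abelPlus_P₁ h₁ h₂ h
    rw [hkP, hn, add_right_comm, periodic_add_int (fun z => theta_add_one z), ← sub_eq_add_neg,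
      theta_abelMap_P₁_sub]
  have d1 := (differentiableAt_comp_abelPlus h₁ h₂ h (differentiable_theta_add h₁ h₂ h
    (dTilde E₁ E₂)) (periodic_theta_add _) hk).hasDerivAt
  have d2 := (differentiableAt_comp_abelPlus h₁ h₂ h (differentiable_theta_add h₁ h₂ h
    (-dTilde E₁ E₂)) (periodic_theta_add _) hk).hasDerivAt
  have d3 := (differentiableAt_outFactor h₁ h₂ h fun h' => hk (Or.inl h')).hasDerivAt
  have d4 := (d1.fun_mul d2).fun_mul d3
  rw [h0, h0'] at d4
  have d5 : HasDerivAt (fun k => C * (k - P₁ E₁ E₂)) (C * 1) k :=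
    ((hasDerivAt_id k).sub_const _).const_mul C
  have d6 := d5.congr_of_eventuallyEq (f₁ := fun k => theta E₁ E₂ (abelPlus E₁ E₂ k + dTilde E₁ E₂) *
    theta E₁ E₂ (abelPlus E₁ E₂ k + -dTilde E₁ E₂) * outFactor E₁ E₂ k) (by
      filter_upwards [(isOpen_compl_contour E₁ E₂).mem_nhds hk] with k' hk'
      rw [← H k' hk', thetaProd, ← sub_eq_add_neg])
  have := d6.unique d4
  simp at this
  exact hC this

theorem theta_abelPlus_sub_ne_zero (h₁ : 0 < E₁.im) (h₂ : 0 < E₂.im) (h : E₁.re < E₂.re) {k : ℂ}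
    (hk : k ∉ contour E₁ E₂) (hkP : k ≠ P₁ E₁ E₂) :
    theta E₁ E₂ (abelPlus E₁ E₂ k - dTilde E₁ E₂) ≠ 0 := by
  obtain ⟨C, hC, H⟩ := exists_thetaProd_mul_eq h₁ h₂ h
  intro h0
  have := H k hk
  rw [thetaProd, h0, mul_zero, zero_mul] at this
  exact (mul_ne_zero hC (sub_ne_zero.mpr hkP)) this.symm

/-- The linear formula passes to the limit at the cut, and `P₁` is not on the cut. -/
theorem thetaProd_abelLeft_ne_zero (h₁ : 0 < E₁.im) (h₂ : 0 < E₂.im) (h : E₁.re < E₂.re) (θ : ℝ) :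
    thetaProd E₁ E₂ (abelLeft E₁ E₂ (θ * I)) ≠ 0 := by
  obtain ⟨C, hC, H⟩ := exists_thetaProd_mul_eq h₁ h₂ h
  obtain ⟨u, R, hR0, hRρ, hc, hu, -⟩ := exists_local_left h₁ h₂ h
  have e1 := tendsto_vertical (hc.continuousAt ((isOpen_strip R).mem_nhds
    (show (θ : ℂ) * I ∈ {z : ℂ | |z.re| < R} by simpa using hR0)))
  have e2 : Tendsto (fun s : ℝ => C * (ellMap E₁ (s + θ * I) - P₁ E₁ E₂)) (𝓝[>] 0)
      (𝓝 (C * (ellMap E₁ (θ * I) - P₁ E₁ E₂))) :=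
    ((tendsto_ellMap_vertical E₁ θ).sub_const _).const_mul C
  have e3 := tendsto_nhds_unique (e1.congr' ?_) e2
  · intro h0
    rw [h0, zero_mul] at e3
    refine (mul_ne_zero hC (sub_ne_zero.mpr fun h' => ?_)) e3.symm
    exact P₁_notMem_contour h₁ h₂ h (h' ▸ Or.inl (ellMap_mem_cut h₁ (by simp)))
  · refine (eventually_vertical hR0 (p := fun z => thetaProd E₁ E₂ (abelLeft E₁ E₂ z) * u z =
      C * (ellMap E₁ z - P₁ E₁ E₂)) (fun z hz0 hz => ?_) θ)
    rw [← hu z hz0 hz, H _ (ellMap_notMem_contour h₁ hz0 (hz.trans_le hRρ))]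

theorem thetaProd_abelRight_ne_zero (h₁ : 0 < E₁.im) (h₂ : 0 < E₂.im) (h : E₁.re < E₂.re) (θ : ℝ) :
    thetaProd E₁ E₂ (abelRight E₁ E₂ (θ * I)) ≠ 0 := by
  obtain ⟨C, hC, H⟩ := exists_thetaProd_mul_eq h₁ h₂ h
  have hρ₂ : 0 < stripRadius E₂ |E₂.re - E₁.re| := stripRadius_sep_pos h₂ h.ne'
  have e1 := tendsto_vertical ((continuousOn_local_right h₁ h₂ h).continuousAt
    ((isOpen_strip _).mem_nhds (show (θ : ℂ) * I ∈ {z : ℂ | |z.re| < _} by simpa using hρ₂)))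
  have e2 : Tendsto (fun s : ℝ => C * (ellMap E₂ (s + θ * I) - P₁ E₁ E₂)) (𝓝[>] 0)
      (𝓝 (C * (ellMap E₂ (θ * I) - P₁ E₁ E₂))) :=
    ((tendsto_ellMap_vertical E₂ θ).sub_const _).const_mul C
  have e3 := tendsto_nhds_unique (e1.congr' ?_) e2
  · intro h0
    rw [h0, zero_mul] at e3
    refine (mul_ne_zero hC (sub_ne_zero.mpr fun h' => ?_)) e3.symm
    exact P₁_notMem_contour h₁ h₂ h (h' ▸ Or.inr (ellMap_mem_cut h₂ (by simp)))
  · refine (eventually_vertical hρ₂ (p := fun z => thetaProd E₁ E₂ (abelRight E₁ E₂ z) *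
      outFactor E₁ E₂ (ellMap E₂ z) = C * (ellMap E₂ z - P₁ E₁ E₂)) (fun z hz0 hz => ?_) θ)
    rw [← H _ (contour_comm E₁ E₂ ▸ ellMap_notMem_contour h₂ hz0 hz),
      comp_abelPlus_ellMap_right h₁ h₂ h (differentiable_thetaProd h₁ h₂ h) periodic_thetaProd
        hz0 hz]

end

section

/-! ### The function `ν` -/

variable {E E₁ E₂ k z : ℂ}

theorem div_mem_slitPlane (hk : k ∉ cut E) : (k - E) / (k - conj E) ∈ slitPlane := by
  by_contra h
  rw [mem_slitPlane_iff, not_or, not_lt, not_not] at h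
  refine hk (mem_cut_of_div_nonpos h.1 ?_ (ne_conj_of_notMem_cut hk))
  apply Complex.ext <;> simp [h.2]

theorem differentiableAt_div_conj (hk : k ∉ cut E) :
    DifferentiableAt ℂ (fun k => (k - E) / (k - conj E)) k :=
  (differentiableAt_id.sub_const E).div (differentiableAt_id.sub_const (conj E))
    (sub_ne_zero.mpr (ne_conj_of_notMem_cut hk))

theorem div_conj_ne_zero (hk : k ∉ cut E) : (k - E) / (k - conj E) ≠ 0 :=
  div_ne_zero (sub_ne_zero.mpr (ne_of_notMem_cut hk)) (sub_ne_zero.mpr (ne_conj_of_notMem_cut hk))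

theorem differentiableAt_nu (hk : k ∉ contour E₁ E₂) : DifferentiableAt ℂ (nu E₁ E₂) k := by
  have h1 : k ∉ cut E₁ := fun h' => hk (Or.inl h')
  have h2 : k ∉ cut E₂ := fun h' => hk (Or.inr h')
  exact ((differentiableAt_div_conj h1).cpow_const (div_mem_slitPlane h1)).mul
    ((differentiableAt_div_conj h2).cpow_const (div_mem_slitPlane h2))

theorem nu_ne_zero (hk : k ∉ contour E₁ E₂) : nu E₁ E₂ k ≠ 0 := by
  have h1 : k ∉ cut E₁ := fun h' => hk (Or.inl h')
  have h2 : k ∉ cut E₂ := fun h' => hk (Or.inr h')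
  rw [nu]
  exact mul_ne_zero (cpow_ne_zero_iff.mpr (Or.inl (div_conj_ne_zero h1)))
    (cpow_ne_zero_iff.mpr (Or.inl (div_conj_ne_zero h2)))

theorem nu_comm (E₁ E₂ k : ℂ) : nu E₂ E₁ k = nu E₁ E₂ k := mul_comm _ _

theorem nu_sq_add_one_ne_zero (h₁ : 0 < E₁.im) (h₂ : 0 < E₂.im) (h : E₁.re < E₂.re)
    (hk : k ∉ contour E₁ E₂) : nu E₁ E₂ k ^ 2 + 1 ≠ 0 := fun h0 =>
  neg_nu_sq_ne_one h₁ h₂ h hk (by linear_combination -h0)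

theorem tendsto_nu (E₁ E₂ : ℂ) : Tendsto (nu E₁ E₂) (Bornology.cobounded ℂ) (𝓝 1) := by
  have key : ∀ E : ℂ, Tendsto (fun k => ((k - E) / (k - conj E)) ^ ((1 : ℂ) / 4))
      (Bornology.cobounded ℂ) (𝓝 1) := by
    intro E
    have := (tendsto_sub_div_sub_cobounded E (conj E)).cpow
      (tendsto_const_nhds (x := (1 : ℂ) / 4)) one_mem_slitPlane
    rwa [one_cpow] at this
  have := (key E₁).mul (key E₂)
  rwa [one_mul] at this

theorem nu_pow_four_sub_one (h₁ : 0 < E₁.im) (h₂ : 0 < E₂.im) (hk : k ∉ contour E₁ E₂) :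
    nu E₁ E₂ k ^ 4 - 1 = -2 * I * ((E₁ + E₂).im : ℂ) * (k - P₁ E₁ E₂) /
      ((k - conj E₁) * (k - conj E₂)) := by
  have hc1 := sub_ne_zero.mpr (ne_conj_of_notMem_cut fun h' => hk (Or.inl h'))
  have hc2 := sub_ne_zero.mpr (ne_conj_of_notMem_cut fun h' => hk (Or.inr h'))
  have hS : (((E₁ + E₂).im : ℝ) : ℂ) ≠ 0 := by
    rw [Complex.ofReal_ne_zero, Complex.add_im]
    positivity
  have e1 := Complex.sub_conj (E₁ + E₂)
  have e2 := Complex.sub_conj (E₁ * E₂)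
  rw [map_add] at e1
  rw [map_mul] at e2
  have hP : ((E₁ + E₂).im : ℂ) * P₁ E₁ E₂ = ((E₁ * E₂).im : ℂ) := by
    rw [P₁]
    push_cast
    rw [mul_div_cancel₀]
    exact hS
  rw [nu_pow_four, div_mul_div_comm, eq_div_iff (mul_ne_zero hc1 hc2), sub_mul,
    div_mul_cancel₀ _ (mul_ne_zero hc1 hc2)]
  push_cast at e1 e2
  linear_combination -k * e1 + e2 - 2 * I * hP

/-- From `ν - ν⁻¹ = (ν⁴ - 1) / (ν (ν² + 1))`. The explicit zero at `P₁` is the one that cancels the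
zero of `Θ̃(φ - d̃)`. -/
theorem nu_sub_inv (h₁ : 0 < E₁.im) (h₂ : 0 < E₂.im) (h : E₁.re < E₂.re)
    (hk : k ∉ contour E₁ E₂) : nu E₁ E₂ k - (nu E₁ E₂ k)⁻¹ =
      -2 * I * ((E₁ + E₂).im : ℂ) * (k - P₁ E₁ E₂) / ((k - conj E₁) * (k - conj E₂)) /
        (nu E₁ E₂ k * (nu E₁ E₂ k ^ 2 + 1)) := by
  rw [← nu_pow_four_sub_one h₁ h₂ hk]
  have hn := nu_ne_zero hk
  have hn2 := nu_sq_add_one_ne_zero h₁ h₂ h hk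
  field_simp
  ring

theorem tendsto_mul_nu_sub_inv (h₁ : 0 < E₁.im) (h₂ : 0 < E₂.im) (h : E₁.re < E₂.re) :
    Tendsto (fun k => k * (nu E₁ E₂ k - (nu E₁ E₂ k)⁻¹)) (Bornology.cobounded ℂ)
      (𝓝 (-I * ((E₁ + E₂).im : ℂ))) := by
  have e1 := tendsto_sub_div_sub_cobounded 0 (conj E₁)
  have e2 := tendsto_sub_div_sub_cobounded (P₁ E₁ E₂) (conj E₂)
  have e3 := (tendsto_nu E₁ E₂).mul (((tendsto_nu E₁ E₂).pow 2).add_const 1)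
  have := ((e1.mul e2).const_mul (-2 * I * ((E₁ + E₂).im : ℂ))).div e3 (by norm_num)
  have hval : -2 * I * ((E₁ + E₂).im : ℂ) * (1 * 1) / (1 * (1 ^ 2 + 1)) =
      -I * ((E₁ + E₂).im : ℂ) := by ring
  rw [hval] at this
  refine this.congr' ?_
  filter_upwards [eventually_notMem_contour E₁ E₂] with k hk
  simp only [Pi.div_apply]
  rw [nu_sub_inv h₁ h₂ h hk, div_mul_div_comm]
  ring

/-! ### The function `ν` near a cut -/

theorem sinh_div_cosh_re_pos (hz : 0 < z.re) : 0 < (sinh z / cosh z).re := by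
  have e : (sinh z * conj (cosh z)).re = Real.sinh (2 * z.re) / 2 := by
    rw [← Complex.cosh_conj]
    have h1 := Complex.sinh_add z (conj z)
    have h2 := Complex.sinh_sub z (conj z)
    have h3 : sinh z * cosh (conj z) = (sinh (z + conj z) + sinh (z - conj z)) / 2 := by
      rw [h1, h2]
      ring
    rw [h3, Complex.add_conj, Complex.sub_conj, Complex.sinh_mul_I, ← Complex.ofReal_sinh,
      ← Complex.ofReal_sin, show ∀ a b : ℝ, ((a : ℂ) + (b : ℂ) * I) / 2 =
        ((a / 2 : ℝ) : ℂ) + ((b / 2 : ℝ) : ℂ) * I from fun a b => by push_cast; ring, add_re,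
      ofReal_re, re_ofReal_mul, I_re, mul_zero, add_zero]
  have hpos : 0 < (sinh z * conj (cosh z)).re := by
    rw [e]
    have := Real.sinh_pos_iff.mpr (show 0 < 2 * z.re by linarith)
    positivity
  have hc : cosh z ≠ 0 := by
    intro h0
    rw [h0] at hpos
    simp at hpos
  rw [Complex.div_re, ← add_div]
  rw [mul_re, conj_re, conj_im, mul_neg, sub_neg_eq_add] at hpos
  exact div_pos hpos (normSq_pos.mpr hc)

theorem sq_cpow_quarter {t : ℂ} (ht : 0 < t.re) :
    (t ^ 2) ^ ((1 : ℂ) / 4) = t ^ ((1 : ℂ) / 2) := by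
  have ha := abs_lt.mp (Complex.abs_arg_lt_pi_div_two_iff.mpr (Or.inl ht))
  rw [← Complex.cpow_nat_mul' (by push_cast; linarith [ha.1]) (by push_cast; linarith [ha.2])]
  congr 1
  norm_num

/-- The function `ν` in the coordinate `z` of `ellMap E z`. -/
def nuLoc (E E' z : ℂ) : ℂ := (sinh (z / 2) / cosh (z / 2)) ^ ((1 : ℂ) / 2) *
  ((ellMap E z - E') / (ellMap E z - conj E')) ^ ((1 : ℂ) / 4)

variable {E' : ℂ}

theorem half_re_pos (hz : 0 < z.re) : 0 < (z / 2).re := by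
  simpa using hz

/-- The quotient `(k - E) / (k - conj E)` is `tanh² (z/2)` with `tanh (z/2)` in the right half
plane, so its fourth root is the square root of `tanh (z/2)`. The latter is continuous on the
imaginary axis between the multiples of `π`. -/
theorem nu_ellMap (hE : 0 < E.im) (hz : 0 < z.re) : nu E E' (ellMap E z) = nuLoc E E' z := by
  have hA : (2 : ℂ) * (E.im * I) ≠ 0 :=
    mul_ne_zero two_ne_zero (mul_ne_zero (ofReal_ne_zero.mpr hE.ne') I_ne_zero)
  rw [nu, nuLoc, ellMap_sub, ellMap_sub_conj, mul_div_mul_left _ _ hA, ← div_pow,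
    sq_cpow_quarter (sinh_div_cosh_re_pos (half_re_pos hz))]

theorem sinh_div_cosh_vertical (θ : ℝ) :
    sinh ((θ : ℂ) * I / 2) / cosh ((θ : ℂ) * I / 2) = ((Real.tan (θ / 2) : ℝ) : ℂ) * I := by
  rw [show (θ : ℂ) * I / 2 = ((θ / 2 : ℝ) : ℂ) * I by push_cast; ring, Complex.sinh_mul_I,
    Complex.cosh_mul_I, Real.tan_eq_sin_div_cos]
  push_cast
  ring

theorem tan_half_ne_zero {θ : ℝ} (h0 : 0 < θ) (h1 : θ < 2 * Real.pi) (h2 : θ ≠ Real.pi) :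
    Real.tan (θ / 2) ≠ 0 ∧ Real.cos (θ / 2) ≠ 0 := by
  have hs : Real.sin (θ / 2) ≠ 0 :=
    (Real.sin_pos_of_pos_of_lt_pi (by linarith) (by linarith)).ne'
  have hc : Real.cos (θ / 2) ≠ 0 := by
    rcases lt_or_gt_of_ne h2 with h | h
    · exact (Real.cos_pos_of_mem_Ioo ⟨by linarith, by linarith⟩).ne'
    · exact (Real.cos_neg_of_pi_div_two_lt_of_lt (by linarith) (by linarith)).ne
  exact ⟨by rw [Real.tan_eq_sin_div_cos]; exact div_ne_zero hs hc, hc⟩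

theorem continuousAt_otherFactor (hz : ellMap E z ∉ cut E') : ContinuousAt
    (fun z => ((ellMap E z - E') / (ellMap E z - conj E')) ^ ((1 : ℂ) / 4)) z := by
  have := (differentiableAt_div_conj hz).cpow_const (c := (1 : ℂ) / 4) (div_mem_slitPlane hz)
  exact ContinuousAt.comp (g := fun k => ((k - E') / (k - conj E')) ^ ((1 : ℂ) / 4))
    this.continuousAt (continuous_ellMap E).continuousAt

theorem otherFactor_ne_zero (hz : ellMap E z ∉ cut E') :
    ((ellMap E z - E') / (ellMap E z - conj E')) ^ ((1 : ℂ) / 4) ≠ 0 :=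
  cpow_ne_zero_iff.mpr (Or.inl (div_conj_ne_zero hz))

theorem continuousAt_nuLoc {θ : ℝ} (hz : ellMap E (θ * I) ∉ cut E') (h0 : 0 < θ)
    (h1 : θ < 2 * Real.pi) (h2 : θ ≠ Real.pi) : ContinuousAt (nuLoc E E') (θ * I) := by
  obtain ⟨ht, hc⟩ := tan_half_ne_zero h0 h1 h2
  refine ContinuousAt.mul (ContinuousAt.cpow ?_ continuousAt_const ?_) (continuousAt_otherFactor hz)
  · refine ContinuousAt.div (by fun_prop) (by fun_prop) ?_
    rw [show (θ : ℂ) * I / 2 = ((θ / 2 : ℝ) : ℂ) * I by push_cast; ring, Complex.cosh_mul_I,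
      ← Complex.ofReal_cos]
    exact ofReal_ne_zero.mpr hc
  · rw [sinh_div_cosh_vertical, mem_slitPlane_iff]
    right
    rw [im_ofReal_mul, I_im, mul_one]
    exact ht

theorem nuLoc_ne_zero {θ : ℝ} (hz : ellMap E (θ * I) ∉ cut E') (h0 : 0 < θ)
    (h1 : θ < 2 * Real.pi) (h2 : θ ≠ Real.pi) : nuLoc E E' (θ * I) ≠ 0 := by
  refine mul_ne_zero (cpow_ne_zero_iff.mpr (Or.inl ?_)) (otherFactor_ne_zero hz)
  rw [sinh_div_cosh_vertical]
  exact mul_ne_zero (ofReal_ne_zero.mpr (tan_half_ne_zero h0 h1 h2).1) I_ne_zero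

theorem cpow_half_mul_I {a : ℝ} (ha : 0 < a) :
    ((a : ℂ) * I) ^ ((1 : ℂ) / 2) = I * (-((a : ℂ) * I)) ^ ((1 : ℂ) / 2) := by
  have ha' : (a : ℂ) ≠ 0 := ofReal_ne_zero.mpr ha.ne'
  rw [← mul_neg, cpow_def_of_ne_zero (mul_ne_zero ha' I_ne_zero),
    cpow_def_of_ne_zero (mul_ne_zero ha' (neg_ne_zero.mpr I_ne_zero)), log_ofReal_mul ha I_ne_zero,
    log_ofReal_mul ha (neg_ne_zero.mpr I_ne_zero), log_I, log_neg_I]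
  nth_rewrite 2 [← Complex.exp_pi_div_two_mul_I]
  rw [← Complex.exp_add]
  congr 1
  ring

/-- On the imaginary axis `tanh (z/2)` is `i tan (θ/2)`, and the reflection changes its sign; the
principal root then changes by the factor `i`. The second factor of `nuLoc` depends on `ellMap E z`
only. -/
theorem nuLoc_reflect {θ : ℝ} (hθ : θ ∈ Ioo 0 Real.pi) :
    nuLoc E E' (θ * I) = I * nuLoc E E' (2 * Real.pi * I - θ * I) := by
  have hpi := Real.pi_pos
  have ht : 0 < Real.tan (θ / 2) :=
    Real.tan_pos_of_pos_of_lt_pi_div_two (by linarith [hθ.1]) (by linarith [hθ.2])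
  have e : sinh ((2 * Real.pi * I - θ * I) / 2) / cosh ((2 * Real.pi * I - θ * I) / 2) =
      -(((Real.tan (θ / 2) : ℝ) : ℂ) * I) := by
    have := sinh_div_cosh_vertical (2 * Real.pi - θ)
    rw [show (2 * Real.pi - θ) / 2 = Real.pi - θ / 2 by ring, Real.tan_pi_sub] at this
    push_cast at this ⊢
    rw [← sub_mul, this]
    ring
  rw [nuLoc, nuLoc, ellMap_reflect, e, sinh_div_cosh_vertical, cpow_half_mul_I ht]
  ring

/-- `|ν|²` carries `|tanh (z/2)|` and `dk/dz` carries `sinh (z/2) cosh (z/2)`, so the singularity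
cancels. This and its counterpart for `ν⁻¹` give the `L²` bounds with respect to arc length. -/
theorem norm_nuLoc_sq_mul (hz : 0 < z.re) : ‖nuLoc E E' z‖ ^ 2 * ‖ellMap' E z‖ =
    ‖((ellMap E z - E') / (ellMap E z - conj E')) ^ ((1 : ℂ) / 4)‖ ^ 2 *
      ‖2 * (E.im * I) * sinh (z / 2) ^ 2‖ := by
  have hc : cosh (z / 2) ≠ 0 := by
    intro h0
    have := sinh_div_cosh_re_pos (half_re_pos hz)
    rw [h0] at this
    simp at this
  set t := sinh (z / 2) / cosh (z / 2) with ht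
  have h1 : ‖t ^ ((1 : ℂ) / 2)‖ ^ 2 = ‖t‖ := by
    rw [← norm_pow, ← Complex.cpow_nat_mul]
    norm_num
  rw [nuLoc, norm_mul, mul_pow, h1, ellMap'_eq, mul_right_comm, mul_comm, ← norm_mul, ht]
  congr 2
  field_simp

theorem norm_nuLoc_inv_sq_mul (hz : 0 < z.re) : ‖(nuLoc E E' z)⁻¹‖ ^ 2 * ‖ellMap' E z‖ =
    ‖(((ellMap E z - E') / (ellMap E z - conj E')) ^ ((1 : ℂ) / 4))⁻¹‖ ^ 2 *
      ‖2 * (E.im * I) * cosh (z / 2) ^ 2‖ := by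
  have hs : sinh (z / 2) ≠ 0 := by
    intro h0
    have := sinh_div_cosh_re_pos (half_re_pos hz)
    rw [h0] at this
    simp at this
  set t := sinh (z / 2) / cosh (z / 2) with ht
  have h1 : ‖(t ^ ((1 : ℂ) / 2))⁻¹‖ ^ 2 = ‖t⁻¹‖ := by
    rw [norm_inv, inv_pow, ← norm_pow, ← Complex.cpow_nat_mul]
    norm_num
  rw [nuLoc, mul_inv, norm_mul, mul_pow, h1, ellMap'_eq, mul_right_comm, mul_comm, ← norm_mul, ht,
    inv_div]
  congr 2
  field_simp

end

section

/-! ### The entries of the solution -/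

/-- The quotient of theta functions in the diagonal entries. -/
def ratioPlus (E₁ E₂ v w : ℂ) : ℂ :=
  theta E₁ E₂ (w + v + dTilde E₁ E₂) / theta E₁ E₂ (w + dTilde E₁ E₂)

/-- The quotient of theta functions in the off-diagonal entries. -/
def ratioMinus (E₁ E₂ v w : ℂ) : ℂ :=
  theta E₁ E₂ (w - v - dTilde E₁ E₂) / theta E₁ E₂ (w - dTilde E₁ E₂)

/-- The normalizing constant of the entries. -/
def kappa (E₁ E₂ v : ℂ) : ℂ := (ratioPlus E₁ E₂ v (abelInfty E₁ E₂))⁻¹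

/-- The diagonal entries of the solution. -/
def solDiag (E₁ E₂ v k : ℂ) : ℂ :=
  kappa E₁ E₂ v / 2 * (nu E₁ E₂ k + (nu E₁ E₂ k)⁻¹) * ratioPlus E₁ E₂ v (abelPlus E₁ E₂ k)

variable {E₁ E₂ k z : ℂ}

theorem ratioPlus_neg (v w : ℂ) : ratioPlus E₁ E₂ v (-w) = ratioMinus E₁ E₂ v w := by
  rw [ratioPlus, ratioMinus, ← theta_neg, ← theta_neg (-w + dTilde E₁ E₂)]
  congr 2 <;> ring

theorem ratioMinus_neg (v w : ℂ) : ratioMinus E₁ E₂ v (-w) = ratioPlus E₁ E₂ v w := by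
  rw [← ratioPlus_neg, neg_neg]

/-- The multipliers of numerator and denominator differ only through the shift `v`. The factor left
over is the phase in the jump on `Σ₁`. -/
theorem ratioPlus_tau_sub (v w : ℂ) : ratioPlus E₁ E₂ v (tau E₁ E₂ - w) =
    (cexp (2 * Real.pi * I * v))⁻¹ * ratioMinus E₁ E₂ v w := by
  rw [ratioPlus, ratioMinus, add_assoc, theta_tau_sub, theta_tau_sub, mul_div_mul_comm,
    ← Complex.exp_sub, ← Complex.exp_neg, ← sub_sub]
  congr 2
  ring

theorem ratioMinus_tau_sub (v w : ℂ) : ratioMinus E₁ E₂ v (tau E₁ E₂ - w) =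
    cexp (2 * Real.pi * I * v) * ratioPlus E₁ E₂ v w := by
  have := ratioPlus_tau_sub (E₁ := E₁) (E₂ := E₂) v (tau E₁ E₂ - w)
  rw [sub_sub_cancel] at this
  rw [this, mul_inv_cancel_left₀ (exp_ne_zero _)]

theorem differentiableAt_theta_abelPlus (h₁ : 0 < E₁.im) (h₂ : 0 < E₂.im) (h : E₁.re < E₂.re)
    (hk : k ∉ contour E₁ E₂) (c : ℂ) :
    DifferentiableAt ℂ (fun k => theta E₁ E₂ (abelPlus E₁ E₂ k + c)) k :=
  differentiableAt_comp_abelPlus h₁ h₂ h (differentiable_theta_add h₁ h₂ h c)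
    (periodic_theta_add c) hk

theorem differentiableOn_solDiag (h₁ : 0 < E₁.im) (h₂ : 0 < E₂.im) (h : E₁.re < E₂.re) (v : ℂ) :
    DifferentiableOn ℂ (solDiag E₁ E₂ v) (contour E₁ E₂)ᶜ := fun k hk => by
  refine DifferentiableAt.differentiableWithinAt ?_
  refine (((differentiableAt_nu hk).add ((differentiableAt_nu hk).inv (nu_ne_zero hk))).const_mul
    _).mul (DifferentiableAt.div ?_ (differentiableAt_theta_abelPlus h₁ h₂ h hk _)
      (theta_abelPlus_add_ne_zero h₁ h₂ h hk))
  simpa only [add_assoc] using differentiableAt_theta_abelPlus h₁ h₂ h hk (v + dTilde E₁ E₂)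

/-- `k - P₁` from `nu_sub_inv`, divided by `Θ̃(φ - d̃)`, is replaced by `Θ̃(φ + d̃)` times
`outFactor / C`, according to `exists_thetaProd_mul_eq`. The resulting expression is analytic at
`P₁` too. -/
theorem exists_solOff (h₁ : 0 < E₁.im) (h₂ : 0 < E₂.im) (h : E₁.re < E₂.re) (v : ℂ) :
    ∃ g : ℂ → ℂ, DifferentiableOn ℂ g (contour E₁ E₂)ᶜ ∧
      ∀ k ∉ contour E₁ E₂, k ≠ P₁ E₁ E₂ → g k = kappa E₁ E₂ v / 2 *
        (nu E₁ E₂ k - (nu E₁ E₂ k)⁻¹) * ratioMinus E₁ E₂ v (abelPlus E₁ E₂ k) := by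
  obtain ⟨C, hC, H⟩ := exists_thetaProd_mul_eq h₁ h₂ h
  refine ⟨fun k => kappa E₁ E₂ v / 2 * (-2 * I * ((E₁ + E₂).im : ℂ) /
    ((k - conj E₁) * (k - conj E₂)) / (nu E₁ E₂ k * (nu E₁ E₂ k ^ 2 + 1))) *
      (theta E₁ E₂ (abelPlus E₁ E₂ k + (-v - dTilde E₁ E₂)) *
        theta E₁ E₂ (abelPlus E₁ E₂ k + dTilde E₁ E₂) * (outFactor E₁ E₂ k / C)),
    fun k hk => ?_, fun k hk hkP => ?_⟩
  · have hc1 := sub_ne_zero.mpr (ne_conj_of_notMem_cut fun h' => hk (Or.inl h'))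
    have hc2 := sub_ne_zero.mpr (ne_conj_of_notMem_cut fun h' => hk (Or.inr h'))
    have hn := differentiableAt_nu hk
    have d1 : DifferentiableAt ℂ (fun k => -2 * I * ((E₁ + E₂).im : ℂ) /
        ((k - conj E₁) * (k - conj E₂))) k :=
      (differentiableAt_const _).div (by fun_prop) (mul_ne_zero hc1 hc2)
    have d2 : DifferentiableAt ℂ (fun k => nu E₁ E₂ k * (nu E₁ E₂ k ^ 2 + 1)) k :=
      hn.fun_mul ((hn.fun_pow 2).add_const 1)
    have d3 := ((differentiableAt_theta_abelPlus h₁ h₂ h hk (-v - dTilde E₁ E₂)).fun_mul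
      (differentiableAt_theta_abelPlus h₁ h₂ h hk (dTilde E₁ E₂))).fun_mul
        ((differentiableAt_outFactor h₁ h₂ h fun h' => hk (Or.inl h')).div_const C)
    have d4 := d1.fun_div d2 (mul_ne_zero (nu_ne_zero hk) (nu_sq_add_one_ne_zero h₁ h₂ h hk))
    exact ((d4.const_mul (kappa E₁ E₂ v / 2)).fun_mul d3).differentiableWithinAt
  · simp only
    have hk' := H k hk
    have hθ := theta_abelPlus_sub_ne_zero h₁ h₂ h hk hkP
    rw [nu_sub_inv h₁ h₂ h hk, ratioMinus]
    have e : theta E₁ E₂ (abelPlus E₁ E₂ k + (-v - dTilde E₁ E₂)) *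
        theta E₁ E₂ (abelPlus E₁ E₂ k + dTilde E₁ E₂) * (outFactor E₁ E₂ k / C) =
        (k - P₁ E₁ E₂) * (theta E₁ E₂ (abelPlus E₁ E₂ k - v - dTilde E₁ E₂) /
          theta E₁ E₂ (abelPlus E₁ E₂ k - dTilde E₁ E₂)) := by
      rw [thetaProd] at hk'
      rw [show abelPlus E₁ E₂ k + (-v - dTilde E₁ E₂) = abelPlus E₁ E₂ k - v - dTilde E₁ E₂ by ring]
      field_simp
      linear_combination theta E₁ E₂ (abelPlus E₁ E₂ k - v - dTilde E₁ E₂) * hk'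
    rw [e]
    ring

theorem tendsto_theta_abelPlus (h₁ : 0 < E₁.im) (h₂ : 0 < E₂.im) (h : E₁.re < E₂.re) (c : ℂ) :
    Tendsto (fun k => theta E₁ E₂ (abelPlus E₁ E₂ k + c)) (Bornology.cobounded ℂ)
      (𝓝 (theta E₁ E₂ (abelInfty E₁ E₂ + c))) :=
  ((differentiable_theta_add h₁ h₂ h c).continuous.tendsto _).comp (tendsto_abelPlus h₁ h₂)

theorem tendsto_ratioPlus (h₁ : 0 < E₁.im) (h₂ : 0 < E₂.im) (h : E₁.re < E₂.re) (v : ℂ) :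
    Tendsto (fun k => ratioPlus E₁ E₂ v (abelPlus E₁ E₂ k)) (Bornology.cobounded ℂ)
      (𝓝 (ratioPlus E₁ E₂ v (abelInfty E₁ E₂))) := by
  have h0 := theta_abelInfty_add_ne_zero h₁ h₂ h 0
  rw [ofReal_zero, add_zero] at h0
  have := (tendsto_theta_abelPlus h₁ h₂ h (v + dTilde E₁ E₂)).div
    (tendsto_theta_abelPlus h₁ h₂ h (dTilde E₁ E₂)) h0
  simp only [← add_assoc] at this
  exact this

theorem tendsto_ratioMinus (h₁ : 0 < E₁.im) (h₂ : 0 < E₂.im) (h : E₁.re < E₂.re) (v : ℂ) :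
    Tendsto (fun k => ratioMinus E₁ E₂ v (abelPlus E₁ E₂ k)) (Bornology.cobounded ℂ)
      (𝓝 (ratioMinus E₁ E₂ v (abelInfty E₁ E₂))) := by
  have h0 := theta_abelInfty_sub_ne_zero h₁ h₂ h
  rw [sub_eq_add_neg] at h0
  have := (tendsto_theta_abelPlus h₁ h₂ h (-v + -dTilde E₁ E₂)).div
    (tendsto_theta_abelPlus h₁ h₂ h (-dTilde E₁ E₂)) h0
  simpa only [ratioMinus, Pi.div_def, sub_eq_add_neg, add_assoc] using this

/-- Reality of `v` keeps the argument of the theta function on the line `ℝ + τ`, where it has no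
zero. -/
theorem kappa_mul_ratioPlus (h₁ : 0 < E₁.im) (h₂ : 0 < E₂.im) (h : E₁.re < E₂.re) (v : ℝ) :
    kappa E₁ E₂ v * ratioPlus E₁ E₂ v (abelInfty E₁ E₂) = 1 := by
  have h0 := theta_abelInfty_add_ne_zero h₁ h₂ h 0
  rw [ofReal_zero, add_zero] at h0
  exact inv_mul_cancel₀ (div_ne_zero (theta_abelInfty_add_ne_zero h₁ h₂ h v) h0)

theorem tendsto_solDiag (h₁ : 0 < E₁.im) (h₂ : 0 < E₂.im) (h : E₁.re < E₂.re) (v : ℝ) :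
    Tendsto (solDiag E₁ E₂ v) (Bornology.cobounded ℂ) (𝓝 1) := by
  have hn := tendsto_nu E₁ E₂
  have := ((hn.add (hn.inv₀ one_ne_zero)).const_mul (kappa E₁ E₂ v / 2)).mul
    (tendsto_ratioPlus h₁ h₂ h v)
  have e : kappa E₁ E₂ v / 2 * (1 + 1⁻¹) * ratioPlus E₁ E₂ v (abelInfty E₁ E₂) = 1 := by
    rw [inv_one]
    linear_combination kappa_mul_ratioPlus h₁ h₂ h v
  rwa [e] at this

theorem tendsto_mul_solOff (h₁ : 0 < E₁.im) (h₂ : 0 < E₂.im) (h : E₁.re < E₂.re) {v : ℂ}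
    {g : ℂ → ℂ} (hg : ∀ k ∉ contour E₁ E₂, k ≠ P₁ E₁ E₂ → g k = kappa E₁ E₂ v / 2 *
      (nu E₁ E₂ k - (nu E₁ E₂ k)⁻¹) * ratioMinus E₁ E₂ v (abelPlus E₁ E₂ k)) :
    Tendsto (fun k => k * g k) (Bornology.cobounded ℂ)
      (𝓝 (-(I / 2) * ((E₁ + E₂).im : ℂ) *
        (kappa E₁ E₂ v * ratioMinus E₁ E₂ v (abelInfty E₁ E₂)))) := by
  have := ((tendsto_mul_nu_sub_inv h₁ h₂ h).const_mul (kappa E₁ E₂ v / 2)).mul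
    (tendsto_ratioMinus h₁ h₂ h v)
  have e : kappa E₁ E₂ v / 2 * (-I * ((E₁ + E₂).im : ℂ)) *
      ratioMinus E₁ E₂ v (abelInfty E₁ E₂) = -(I / 2) * ((E₁ + E₂).im : ℂ) *
        (kappa E₁ E₂ v * ratioMinus E₁ E₂ v (abelInfty E₁ E₂)) := by ring
  rw [e] at this
  refine this.congr' ?_
  filter_upwards [eventually_notMem_contour E₁ E₂,
    Bornology.isBounded_def.mp (Bornology.isBounded_singleton (x := P₁ E₁ E₂))] with k hk hkP
  rw [hg k hk hkP]
  ring

theorem tendsto_zero_of_tendsto_mul {g : ℂ → ℂ} {c : ℂ}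
    (hg : Tendsto (fun k => k * g k) (Bornology.cobounded ℂ) (𝓝 c)) :
    Tendsto g (Bornology.cobounded ℂ) (𝓝 0) := by
  have := (tendsto_inv₀_cobounded (α := ℂ)).mul hg
  rw [zero_mul] at this
  refine this.congr' ?_
  filter_upwards [Bornology.isBounded_def.mp (Bornology.isBounded_singleton (x := (0 : ℂ)))] with k hk
  exact inv_mul_cancel_left₀ hk _

/-! ### The entries near a cut -/

/-- The facts on the Abel map near the cut with end point `E` that are used for the solution. -/
structure IsLocalAbel (E₁ E₂ E E' : ℂ) (φ : ℂ → ℂ) (r : ℝ) : Prop where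
  pos : 0 < r
  im_pos : 0 < E.im
  cont : ContinuousOn φ {z | |z.re| < r}
  ne_zero : ∀ z : ℂ, |z.re| < r → thetaProd E₁ E₂ (φ z) ≠ 0
  comp : ∀ c z : ℂ, 0 < z.re → z.re < r →
    theta E₁ E₂ (abelPlus E₁ E₂ (ellMap E z) + c) = theta E₁ E₂ (φ z + c)
  notMem : ∀ z : ℂ, |z.re| < r → ellMap E z ∉ cut E'
  notMem_contour : ∀ z : ℂ, 0 < z.re → z.re < r → ellMap E z ∉ contour E₁ E₂
  ne_P₁ : ∀ z : ℂ, 0 < z.re → z.re < r → ellMap E z ≠ P₁ E₁ E₂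
  nu_eq : ∀ z : ℂ, 0 < z.re → nu E₁ E₂ (ellMap E z) = nuLoc E E' z

theorem thetaProd_abelPlus_ne_zero (h₁ : 0 < E₁.im) (h₂ : 0 < E₂.im) (h : E₁.re < E₂.re)
    (hk : k ∉ contour E₁ E₂) (hkP : k ≠ P₁ E₁ E₂) :
    thetaProd E₁ E₂ (abelPlus E₁ E₂ k) ≠ 0 :=
  mul_ne_zero (theta_abelPlus_add_ne_zero h₁ h₂ h hk) (theta_abelPlus_sub_ne_zero h₁ h₂ h hk hkP)

theorem vertical_eq (hz : z.re = 0) : z = (z.im : ℂ) * I := by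
  apply Complex.ext <;> simp [hz]

/-- The strip is narrowed so that no ellipse passes through `P₁`. Then `thetaProd` has no zero for
positive `z.re` by the linear formula, none on the axis by its limit, and none for negative `z.re`
by reflection. -/
theorem exists_isLocalAbel_left (h₁ : 0 < E₁.im) (h₂ : 0 < E₂.im) (h : E₁.re < E₂.re) :
    ∃ r, r ≤ stripRadius E₁ |E₁.re - E₂.re| ∧ IsLocalAbel E₁ E₂ E₁ E₂ (abelLeft E₁ E₂) r := by
  have hP := P₁_notMem_contour h₁ h₂ h
  obtain ⟨w, hw0, hw⟩ := exists_ellMap_eq_of_notMem_cut h₁ fun h' => hP (Or.inl h')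
  set ρ := stripRadius E₁ |E₁.re - E₂.re|
  have hρ : 0 < ρ := stripRadius_sep_pos h₁ h.ne
  have hP' : ∀ z : ℂ, 0 < z.re → z.re < min ρ w.re → ellMap E₁ z ≠ P₁ E₁ E₂ := fun z hz0 hz => by
    rw [← hw]
    exact ellMap_ne_of_re h₁ hz0 hw0 (hz.trans_le (min_le_right _ _)).ne
  have hpos : ∀ z : ℂ, 0 < z.re → z.re < min ρ w.re → thetaProd E₁ E₂ (abelLeft E₁ E₂ z) ≠ 0 :=
    fun z hz0 hz => by
      rw [← comp_abelPlus_ellMap_left h₁ h₂ h (differentiable_thetaProd h₁ h₂ h)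
        periodic_thetaProd hz0 (hz.trans_le (min_le_left _ _))]
      exact thetaProd_abelPlus_ne_zero h₁ h₂ h
        (ellMap_notMem_contour h₁ hz0 (hz.trans_le (min_le_left _ _))) (hP' z hz0 hz)
  refine ⟨min ρ w.re, min_le_left _ _, lt_min hρ hw0, h₁,
    (differentiableOn_abelLeft h₁ h₂ h).continuousOn.mono
      fun z (hz : |z.re| < min ρ w.re) => lt_of_lt_of_le hz (min_le_left _ _), fun z hz => ?_, fun c z hz0 hz =>
    comp_abelPlus_ellMap_left h₁ h₂ h (differentiable_theta_add h₁ h₂ h c) (periodic_theta_add c)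
      hz0 (hz.trans_le (min_le_left _ _)),
    fun z hz => ellMap_notMem_other h₁ (hz.trans_le (min_le_left _ _)),
    fun z hz0 hz => ellMap_notMem_contour h₁ hz0 (hz.trans_le (min_le_left _ _)), hP',
    fun z hz => nu_ellMap h₁ hz⟩
  rcases lt_trichotomy z.re 0 with h0 | h0 | h0
  · rw [abs_of_neg h0] at hz
    have hz2 : |z.re| < ρ := by
      rw [abs_of_neg h0]
      exact hz.trans_le (min_le_left _ _)
    have e := hpos (2 * Real.pi * I - z) (by simpa using h0) (by simpa using hz)
    rw [abelLeft_reflect h₁ h₂ h hz2] at e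
    intro h'
    have := thetaProd_tau_sub (E₁ := E₁) (E₂ := E₂) (abelLeft E₁ E₂ z)
    rw [h', zero_mul] at this
    exact mul_ne_zero e (exp_ne_zero _) this
  · rw [vertical_eq h0]
    exact thetaProd_abelLeft_ne_zero h₁ h₂ h _
  · rw [abs_of_pos h0] at hz
    exact hpos z h0 hz

theorem exists_isLocalAbel_right (h₁ : 0 < E₁.im) (h₂ : 0 < E₂.im) (h : E₁.re < E₂.re) :
    ∃ r, r ≤ stripRadius E₂ |E₂.re - E₁.re| ∧ IsLocalAbel E₁ E₂ E₂ E₁ (abelRight E₁ E₂) r := by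
  have hP := P₁_notMem_contour h₁ h₂ h
  obtain ⟨w, hw0, hw⟩ := exists_ellMap_eq_of_notMem_cut h₂ fun h' => hP (Or.inr h')
  set ρ := stripRadius E₂ |E₂.re - E₁.re|
  have hρ : 0 < ρ := stripRadius_sep_pos h₂ h.ne'
  have hP' : ∀ z : ℂ, 0 < z.re → z.re < min ρ w.re → ellMap E₂ z ≠ P₁ E₁ E₂ := fun z hz0 hz => by
    rw [← hw]
    exact ellMap_ne_of_re h₂ hz0 hw0 (hz.trans_le (min_le_right _ _)).ne
  have hmem : ∀ z : ℂ, 0 < z.re → z.re < min ρ w.re → ellMap E₂ z ∉ contour E₁ E₂ :=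
    fun z hz0 hz => contour_comm E₁ E₂ ▸
      ellMap_notMem_contour h₂ hz0 (hz.trans_le (min_le_left _ _))
  have hpos : ∀ z : ℂ, 0 < z.re → z.re < min ρ w.re → thetaProd E₁ E₂ (abelRight E₁ E₂ z) ≠ 0 :=
    fun z hz0 hz => by
      rw [← comp_abelPlus_ellMap_right h₁ h₂ h (differentiable_thetaProd h₁ h₂ h)
        periodic_thetaProd hz0 (hz.trans_le (min_le_left _ _))]
      exact thetaProd_abelPlus_ne_zero h₁ h₂ h (hmem z hz0 hz) (hP' z hz0 hz)
  refine ⟨min ρ w.re, min_le_left _ _, lt_min hρ hw0, h₂,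
    (differentiableOn_abelRight h₁ h₂ h).continuousOn.mono
      fun z (hz : |z.re| < min ρ w.re) => lt_of_lt_of_le hz (min_le_left _ _), fun z hz => ?_, fun c z hz0 hz =>
    comp_abelPlus_ellMap_right h₁ h₂ h (differentiable_theta_add h₁ h₂ h c) (periodic_theta_add c)
      hz0 (hz.trans_le (min_le_left _ _)),
    fun z hz => ellMap_notMem_other h₂ (hz.trans_le (min_le_left _ _)), hmem, hP',
    fun z hz => by rw [← nu_comm, nu_ellMap h₂ hz]⟩
  rcases lt_trichotomy z.re 0 with h0 | h0 | h0
  · rw [abs_of_neg h0] at hz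
    have hz2 : |z.re| < ρ := by
      rw [abs_of_neg h0]
      exact hz.trans_le (min_le_left _ _)
    have e := hpos (2 * Real.pi * I - z) (by simpa using h0) (by simpa using hz)
    rwa [abelRight_reflect h₁ h₂ h hz2, thetaProd_neg] at e
  · rw [vertical_eq h0]
    exact thetaProd_abelRight_ne_zero h₁ h₂ h _
  · rw [abs_of_pos h0] at hz
    exact hpos z h0 hz

end

section

/-! ### Half-order bounds at the cuts -/

/-- `|f|² |dk|` is bounded near the cut with end point `E`, with respect to `dθ`. -/
def IsHalfBounded (E : ℂ) (f : ℂ → ℂ) : Prop :=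
  ∃ r : ℝ, 0 < r ∧ ∃ C : ℝ, ∀ s θ : ℝ, 0 < s → s ≤ r → θ ∈ Icc 0 (2 * Real.pi) →
    ‖f (ellMap E (s + θ * I))‖ ^ 2 * ‖ellMap' E (s + θ * I)‖ ≤ C

theorem IsHalfBounded.sub_const {E : ℂ} {f : ℂ → ℂ} (hf : IsHalfBounded E f) (c : ℂ) :
    IsHalfBounded E (fun k => f k - c) := by
  obtain ⟨r, hr, C, hC⟩ := hf
  obtain ⟨D, hD0, hD⟩ := exists_norm_le_of_continuousOn_strip (r := r) (ρ := r + 1)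
    (continuous_ellMap' E).continuousOn (by linarith)
  refine ⟨r, hr, 2 * C + 2 * (‖c‖ ^ 2 * D), fun s θ hs0 hs hθ => ?_⟩
  have h1 := hC s θ hs0 hs hθ
  have h2 := hD s θ hs0.le hs hθ
  set a := ‖f (ellMap E (s + θ * I))‖
  set J := ‖ellMap' E (s + θ * I)‖
  have h3 : ‖f (ellMap E (s + θ * I)) - c‖ ^ 2 ≤ 2 * a ^ 2 + 2 * ‖c‖ ^ 2 :=
    (pow_le_pow_left₀ (norm_nonneg _) (norm_sub_le _ _) 2).trans
      (by nlinarith [sq_nonneg (a - ‖c‖)])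
  calc _ ≤ (2 * a ^ 2 + 2 * ‖c‖ ^ 2) * J := by gcongr
    _ = 2 * (a ^ 2 * J) + 2 * (‖c‖ ^ 2 * J) := by ring
    _ ≤ _ := by gcongr

theorem deriv_ellipse (E : ℂ) (r θ : ℝ) : deriv (ellipse E r) θ = ellMap' E (r + θ * I) * I := by
  have h1 : HasDerivAt (fun θ : ℝ => (r : ℂ) + θ * I) I θ := by
    simpa using ((hasDerivAt_id θ).ofReal_comp.mul_const I).const_add (r : ℂ)
  exact ((hasDerivAt_ellMap E _).scomp θ h1 |>.congr_deriv (by simp [mul_comm])).deriv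

theorem ellipseNormSq_eq (f : ℂ → ℂ) (E : ℂ) (r : ℝ) : ellipseNormSq f E r =
    ∫ θ in (0 : ℝ)..(2 * Real.pi), ‖f (ellMap E (r + θ * I))‖ ^ 2 * ‖ellMap' E (r + θ * I)‖ := by
  simp only [ellipseNormSq, deriv_ellipse, ellipse_eq, norm_mul, norm_I, mul_one]

theorem ellipseNormSq_le {f : ℂ → ℂ} {E : ℂ} {r s C : ℝ} (hC : ∀ s θ : ℝ, 0 < s → s ≤ r →
      θ ∈ Icc 0 (2 * Real.pi) → ‖f (ellMap E (s + θ * I))‖ ^ 2 * ‖ellMap' E (s + θ * I)‖ ≤ C)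
    (hs0 : 0 < s) (hs : s ≤ r) : ellipseNormSq f E s ≤ C * |2 * Real.pi - 0| := by
  have hpi := Real.pi_pos
  rw [ellipseNormSq_eq]
  refine (le_abs_self _).trans ?_
  rw [← Real.norm_eq_abs]
  refine intervalIntegral.norm_integral_le_of_norm_le_const fun θ hθ => ?_
  rw [uIoc_of_le (by positivity)] at hθ
  rw [Real.norm_of_nonneg (by positivity)]
  exact hC s θ hs0 hs ⟨hθ.1.le, hθ.2⟩

theorem isSmirnoff_of_isHalfBounded {E₁ E₂ : ℂ} (h₁ : 0 < E₁.im) (h₂ : 0 < E₂.im)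
    (h : E₁.re ≠ E₂.re) {f : ℂ → ℂ} (hd : DifferentiableOn ℂ f (contour E₁ E₂)ᶜ)
    (hlim : Tendsto f (Bornology.cobounded ℂ) (𝓝 0)) (hb₁ : IsHalfBounded E₁ f)
    (hb₂ : IsHalfBounded E₂ f) : IsSmirnoff E₁ E₂ f := by
  obtain ⟨r₁, hr₁, C₁, hC₁⟩ := hb₁
  obtain ⟨r₂, hr₂, C₂, hC₂⟩ := hb₂
  set δ₁ := min r₁ (stripRadius E₁ |E₁.re - E₂.re|)
  set δ₂ := min r₂ (stripRadius E₂ |E₂.re - E₁.re|)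
  have hδ₁ : 0 < δ₁ := lt_min hr₁ (stripRadius_sep_pos h₁ h)
  have hδ₂ : 0 < δ₂ := lt_min hr₂ (stripRadius_sep_pos h₂ h.symm)
  -- The denominator `n + 2` keeps every radius strictly below `δ`, where the ellipses are known to
  -- avoid both cuts.
  have hpos : ∀ {δ : ℝ}, 0 < δ → ∀ n : ℕ, 0 < δ / ((n : ℝ) + 1 + 1) := fun hδ n => by positivity
  have hlt : ∀ {δ : ℝ}, 0 < δ → ∀ n : ℕ, δ / ((n : ℝ) + 1 + 1) < δ := fun hδ n => by
    rw [div_lt_iff₀ (by positivity)]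
    nlinarith [(Nat.cast_nonneg n : (0 : ℝ) ≤ n)]
  have hten : ∀ δ : ℝ, Tendsto (fun n : ℕ => δ / ((n : ℝ) + 1 + 1)) atTop (𝓝 0) := fun δ =>
    (tendsto_atTop_add_const_right _ 1 (tendsto_atTop_add_const_right _ 1
      tendsto_natCast_atTop_atTop)).const_div_atTop δ
  have hre : ∀ x θ : ℝ, ((x : ℂ) + θ * I).re = x := fun x θ => by simp
  refine ⟨hd, hlim, fun n => δ₁ / ((n : ℝ) + 1 + 1), fun n => δ₂ / ((n : ℝ) + 1 + 1),
    fun n => ⟨hpos hδ₁ n, hpos hδ₂ n⟩, hten δ₁, hten δ₂, fun n θ => ⟨?_, ?_⟩,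
    C₁ * |2 * Real.pi - 0| + C₂ * |2 * Real.pi - 0|, fun n => add_le_add ?_ ?_⟩
  · rw [ellipse_eq]
    have h1 := hpos hδ₁ n
    have h2 := (hlt hδ₁ n).trans_le (min_le_right _ _)
    exact ellMap_notMem_contour h₁ (by rw [hre]; exact h1) (by rw [hre]; exact h2)
  · rw [ellipse_eq, contour_comm]
    have h1 := hpos hδ₂ n
    have h2 := (hlt hδ₂ n).trans_le (min_le_right _ _)
    exact ellMap_notMem_contour h₂ (by rw [hre]; exact h1) (by rw [hre]; exact h2)
  · exact ellipseNormSq_le hC₁ (hpos hδ₁ n) ((hlt hδ₁ n).le.trans (min_le_left _ _))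
  · exact ellipseNormSq_le hC₂ (hpos hδ₂ n) ((hlt hδ₂ n).le.trans (min_le_left _ _))

/-! ### The entries near a cut, continued -/

variable {E₁ E₂ E E' : ℂ} {φ : ℂ → ℂ} {r : ℝ}

theorem IsLocalAbel.continuousOn_ratioPlus (h₁ : 0 < E₁.im) (h₂ : 0 < E₂.im) (h : E₁.re < E₂.re)
    (hL : IsLocalAbel E₁ E₂ E E' φ r) (v : ℂ) :
    ContinuousOn (fun z => ratioPlus E₁ E₂ v (φ z)) {z | |z.re| < r} := by
  have hT := fun c => (differentiable_theta_add h₁ h₂ h c).continuous.comp_continuousOn hL.cont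
  have := (hT (v + dTilde E₁ E₂)).div (hT (dTilde E₁ E₂)) fun z hz =>
    left_ne_zero_of_mul (hL.ne_zero z hz)
  refine this.congr fun z _ => ?_
  simp only [ratioPlus, Function.comp_def, Pi.div_def, add_assoc]

theorem IsLocalAbel.continuousOn_ratioMinus (h₁ : 0 < E₁.im) (h₂ : 0 < E₂.im) (h : E₁.re < E₂.re)
    (hL : IsLocalAbel E₁ E₂ E E' φ r) (v : ℂ) :
    ContinuousOn (fun z => ratioMinus E₁ E₂ v (φ z)) {z | |z.re| < r} := by
  have hT := fun c => (differentiable_theta_add h₁ h₂ h c).continuous.comp_continuousOn hL.cont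
  have := (hT (-v + -dTilde E₁ E₂)).div (hT (-dTilde E₁ E₂)) fun z hz => by
    have := right_ne_zero_of_mul (hL.ne_zero z hz)
    simpa only [Function.comp_def, sub_eq_add_neg] using this
  refine this.congr fun z _ => ?_
  simp only [ratioMinus, Function.comp_def, Pi.div_def, sub_eq_add_neg, add_assoc]

/-- The diagonal entries in the local coordinate. -/
def locDiag (E₁ E₂ E E' : ℂ) (φ : ℂ → ℂ) (v z : ℂ) : ℂ :=
  kappa E₁ E₂ v / 2 * (nuLoc E E' z + (nuLoc E E' z)⁻¹) * ratioPlus E₁ E₂ v (φ z)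

/-- The off-diagonal entries in the local coordinate. -/
def locOff (E₁ E₂ E E' : ℂ) (φ : ℂ → ℂ) (v z : ℂ) : ℂ :=
  kappa E₁ E₂ v / 2 * (nuLoc E E' z - (nuLoc E E' z)⁻¹) * ratioMinus E₁ E₂ v (φ z)

theorem IsLocalAbel.solDiag_eq (hL : IsLocalAbel E₁ E₂ E E' φ r) (v : ℂ) {z : ℂ}
    (hz0 : 0 < z.re) (hz : z.re < r) :
    solDiag E₁ E₂ v (ellMap E z) = locDiag E₁ E₂ E E' φ v z := by
  rw [solDiag, locDiag, hL.nu_eq z hz0, ratioPlus, ratioPlus, add_assoc, hL.comp _ z hz0 hz,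
    hL.comp _ z hz0 hz, ← add_assoc]

theorem IsLocalAbel.solOff_eq (hL : IsLocalAbel E₁ E₂ E E' φ r) {v : ℂ} {g : ℂ → ℂ}
    (hg : ∀ k ∉ contour E₁ E₂, k ≠ P₁ E₁ E₂ → g k = kappa E₁ E₂ v / 2 *
      (nu E₁ E₂ k - (nu E₁ E₂ k)⁻¹) * ratioMinus E₁ E₂ v (abelPlus E₁ E₂ k)) {z : ℂ}
    (hz0 : 0 < z.re) (hz : z.re < r) : g (ellMap E z) = locOff E₁ E₂ E E' φ v z := by
  rw [hg _ (hL.notMem_contour z hz0 hz) (hL.ne_P₁ z hz0 hz), locOff, hL.nu_eq z hz0, ratioMinus,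
    ratioMinus]
  simp only [sub_eq_add_neg, add_assoc (abelPlus E₁ E₂ _), add_assoc (φ z)]
  rw [hL.comp _ z hz0 hz, hL.comp _ z hz0 hz]

/-- By `norm_nuLoc_sq_mul` and `norm_nuLoc_inv_sq_mul`, both `|ν|² |dk/dz|` and `|ν⁻¹|² |dk/dz|` are
continuous up to the cut; so is `T`, and everything is bounded on a compact rectangle. -/
theorem IsLocalAbel.isHalfBounded (hL : IsLocalAbel E₁ E₂ E E' φ r) {f T : ℂ → ℂ}
    (hT : ContinuousOn T {z | |z.re| < r}) (hf : ∀ z : ℂ, 0 < z.re → z.re < r →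
      ‖f (ellMap E z)‖ ≤ (‖nuLoc E E' z‖ + ‖(nuLoc E E' z)⁻¹‖) * ‖T z‖) :
    IsHalfBounded E f := by
  have hr := hL.pos
  set O : ℂ → ℂ := fun z => ((ellMap E z - E') / (ellMap E z - conj E')) ^ ((1 : ℂ) / 4) with hO
  have hOc : ContinuousOn O {z | |z.re| < r} := fun z hz =>
    (continuousAt_otherFactor (hL.notMem z hz)).continuousWithinAt
  have hA : ContinuousOn (fun z => O z ^ 2 * (2 * (E.im * I) * sinh (z / 2) ^ 2))
      {z | |z.re| < r} := (hOc.pow 2).mul (by fun_prop)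
  have hB : ContinuousOn (fun z => (O z)⁻¹ ^ 2 * (2 * (E.im * I) * cosh (z / 2) ^ 2))
      {z | |z.re| < r} :=
    ((hOc.inv₀ fun z hz => otherFactor_ne_zero (hL.notMem z hz)).pow 2).mul (by fun_prop)
  obtain ⟨A, -, hA⟩ := exists_norm_le_of_continuousOn_strip (r := r / 2) hA (by linarith)
  obtain ⟨B, -, hB⟩ := exists_norm_le_of_continuousOn_strip (r := r / 2) hB (by linarith)
  obtain ⟨D, hD0, hD⟩ := exists_norm_le_of_continuousOn_strip (r := r / 2) hT (by linarith)
  refine ⟨r / 2, half_pos hr, 2 * (A + B) * D ^ 2, fun s θ hs0 hs hθ => ?_⟩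
  have hz0 : 0 < ((s : ℂ) + θ * I).re := by simpa using hs0
  have hz : ((s : ℂ) + θ * I).re < r := by simp; linarith
  have a1 := hA s θ hs0.le hs hθ
  have b1 := hB s θ hs0.le hs hθ
  have d1 := hD s θ hs0.le hs hθ
  have f1 := hf _ hz0 hz
  have a2 := norm_nuLoc_sq_mul (E := E) (E' := E') hz0
  have b2 := norm_nuLoc_inv_sq_mul (E := E) (E' := E') hz0
  rw [norm_mul, norm_pow] at a1 b1
  rw [← a2] at a1
  rw [← b2] at b1
  set z : ℂ := s + θ * I
  set n := ‖nuLoc E E' z‖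
  set n' := ‖(nuLoc E E' z)⁻¹‖
  set J := ‖ellMap' E z‖ with hJ
  have hJ0 : 0 ≤ J := norm_nonneg _
  have hAB : (n + n') ^ 2 * J ≤ 2 * (A + B) := by
    have : (n + n') ^ 2 * J ≤ 2 * (n ^ 2 * J + n' ^ 2 * J) := by
      nlinarith [mul_nonneg (sq_nonneg (n - n')) hJ0]
    linarith
  calc ‖f (ellMap E z)‖ ^ 2 * J ≤ ((n + n') * ‖T z‖) ^ 2 * J := by gcongr
    _ = ((n + n') ^ 2 * J) * ‖T z‖ ^ 2 := by ring
    _ ≤ (2 * (A + B)) * D ^ 2 := by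
      have : 0 ≤ (n + n') ^ 2 * J := by positivity
      gcongr
      linarith

theorem IsLocalAbel.isHalfBounded_solDiag (h₁ : 0 < E₁.im) (h₂ : 0 < E₂.im) (h : E₁.re < E₂.re)
    (hL : IsLocalAbel E₁ E₂ E E' φ r) (v : ℂ) : IsHalfBounded E (solDiag E₁ E₂ v) := by
  refine hL.isHalfBounded ((hL.continuousOn_ratioPlus h₁ h₂ h v).const_mul (kappa E₁ E₂ v / 2))
    fun z hz0 hz => ?_
  rw [hL.solDiag_eq v hz0 hz, locDiag, mul_comm (kappa E₁ E₂ v / 2), mul_assoc, norm_mul]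
  gcongr
  exact norm_add_le _ _

theorem IsLocalAbel.isHalfBounded_solOff (h₁ : 0 < E₁.im) (h₂ : 0 < E₂.im) (h : E₁.re < E₂.re)
    (hL : IsLocalAbel E₁ E₂ E E' φ r) {v : ℂ} {g : ℂ → ℂ}
    (hg : ∀ k ∉ contour E₁ E₂, k ≠ P₁ E₁ E₂ → g k = kappa E₁ E₂ v / 2 *
      (nu E₁ E₂ k - (nu E₁ E₂ k)⁻¹) * ratioMinus E₁ E₂ v (abelPlus E₁ E₂ k)) :
    IsHalfBounded E g := by
  refine hL.isHalfBounded ((hL.continuousOn_ratioMinus h₁ h₂ h v).const_mul (kappa E₁ E₂ v / 2))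
    fun z hz0 hz => ?_
  rw [hL.solOff_eq hg hz0 hz, locOff, mul_comm (kappa E₁ E₂ v / 2), mul_assoc, norm_mul]
  gcongr
  exact norm_sub_le _ _

theorem IsLocalAbel.continuousAt_locDiag (h₁ : 0 < E₁.im) (h₂ : 0 < E₂.im) (h : E₁.re < E₂.re)
    (hL : IsLocalAbel E₁ E₂ E E' φ r) (v : ℂ) {θ : ℝ} (h0 : 0 < θ) (hθ : θ < 2 * Real.pi)
    (hne : θ ≠ Real.pi) : ContinuousAt (locDiag E₁ E₂ E E' φ v) (θ * I) := by
  have hm : (θ * I : ℂ) ∈ {z : ℂ | |z.re| < r} := by simpa using hL.pos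
  have hn := continuousAt_nuLoc (hL.notMem _ hm) h0 hθ hne
  exact (continuousAt_const.mul (hn.add (hn.inv₀ (nuLoc_ne_zero (hL.notMem _ hm) h0 hθ hne)))).mul
    ((hL.continuousOn_ratioPlus h₁ h₂ h v).continuousAt ((isOpen_strip r).mem_nhds hm))

theorem IsLocalAbel.continuousAt_locOff (h₁ : 0 < E₁.im) (h₂ : 0 < E₂.im) (h : E₁.re < E₂.re)
    (hL : IsLocalAbel E₁ E₂ E E' φ r) (v : ℂ) {θ : ℝ} (h0 : 0 < θ) (hθ : θ < 2 * Real.pi)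
    (hne : θ ≠ Real.pi) : ContinuousAt (locOff E₁ E₂ E E' φ v) (θ * I) := by
  have hm : (θ * I : ℂ) ∈ {z : ℂ | |z.re| < r} := by simpa using hL.pos
  have hn := continuousAt_nuLoc (hL.notMem _ hm) h0 hθ hne
  exact (continuousAt_const.mul (hn.sub (hn.inv₀ (nuLoc_ne_zero (hL.notMem _ hm) h0 hθ hne)))).mul
    ((hL.continuousOn_ratioMinus h₁ h₂ h v).continuousAt ((isOpen_strip r).mem_nhds hm))

/-! ### The jump relations and the existence of a solution -/

theorem locDiag_jump {v c : ℂ} {θ : ℝ} (hθ : θ ∈ Ioo 0 Real.pi)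
    (hc : ratioPlus E₁ E₂ v (φ (θ * I)) =
      c⁻¹ * ratioMinus E₁ E₂ v (φ (2 * Real.pi * I - θ * I))) :
    locDiag E₁ E₂ E E' φ v (θ * I) =
      locOff E₁ E₂ E E' φ v (2 * Real.pi * I - θ * I) * (I * c⁻¹) := by
  -- As `ν₊ = i ν₋`, the sum `ν + ν⁻¹` becomes `i (ν - ν⁻¹)`. So the two entries of a row are
  -- exchanged, as an antidiagonal jump matrix demands.
  rw [locDiag, locOff, hc, nuLoc_reflect hθ, mul_inv, inv_I]
  ring

theorem locOff_jump {v c : ℂ} {θ : ℝ} (hθ : θ ∈ Ioo 0 Real.pi)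
    (hc : ratioMinus E₁ E₂ v (φ (θ * I)) =
      c * ratioPlus E₁ E₂ v (φ (2 * Real.pi * I - θ * I))) :
    locOff E₁ E₂ E E' φ v (θ * I) =
      locDiag E₁ E₂ E E' φ v (2 * Real.pi * I - θ * I) * (I * c) := by
  rw [locDiag, locOff, hc, nuLoc_reflect hθ, mul_inv, inv_I]
  ring

/-- The matrix with the entries of the solution; `g` and `g'` are the off-diagonal ones. -/
def solMatrix (E₁ E₂ v : ℂ) (g g' : ℂ → ℂ) (k : ℂ) : Matrix (Fin 2) (Fin 2) ℂ :=
  !![solDiag E₁ E₂ v k, g k; g' k, solDiag E₁ E₂ (-v) k]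

/-- `c` stands for the multiplier of the theta quotients: `exp (2πi v)` at `Σ₁` and `1` at `Σ₂`. The
second row is the first with `-v` for `v` and the entries interchanged, whence the condition on `c
(-v)`. -/
theorem IsLocalAbel.hasJump (h₁ : 0 < E₁.im) (h₂ : 0 < E₂.im) (h : E₁.re < E₂.re)
    (hL : IsLocalAbel E₁ E₂ E E' φ r) {v : ℂ} {g g' : ℂ → ℂ}
    (hg : ∀ k ∉ contour E₁ E₂, k ≠ P₁ E₁ E₂ → g k = kappa E₁ E₂ v / 2 *
      (nu E₁ E₂ k - (nu E₁ E₂ k)⁻¹) * ratioMinus E₁ E₂ v (abelPlus E₁ E₂ k))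
    (hg' : ∀ k ∉ contour E₁ E₂, k ≠ P₁ E₁ E₂ → g' k = kappa E₁ E₂ (-v) / 2 *
      (nu E₁ E₂ k - (nu E₁ E₂ k)⁻¹) * ratioMinus E₁ E₂ (-v) (abelPlus E₁ E₂ k))
    {c : ℂ → ℂ} (hcv : c (-v) = (c v)⁻¹)
    (hp : ∀ v, ∀ θ ∈ Ioo 0 Real.pi, ratioPlus E₁ E₂ v (φ (θ * I)) =
      (c v)⁻¹ * ratioMinus E₁ E₂ v (φ (2 * Real.pi * I - θ * I)))
    (hm : ∀ v, ∀ θ ∈ Ioo 0 Real.pi, ratioMinus E₁ E₂ v (φ (θ * I)) =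
      c v * ratioPlus E₁ E₂ v (φ (2 * Real.pi * I - θ * I))) :
    HasJump (solMatrix E₁ E₂ v g g') E !![0, I * c v; I * (c v)⁻¹, 0] := by
  refine hasJump_of_local (q := fun z => !![locDiag E₁ E₂ E E' φ v z, locOff E₁ E₂ E E' φ v z;
    locOff E₁ E₂ E E' φ (-v) z, locDiag E₁ E₂ E E' φ (-v) z]) hL.im_pos hL.pos
    (fun z hz0 hz _ _ => ?_) (fun θ h0 hθ hne => ?_) (fun θ hθ => ?_)
  · rw [solMatrix, hL.solDiag_eq _ hz0 hz, hL.solDiag_eq _ hz0 hz, hL.solOff_eq hg hz0 hz,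
      hL.solOff_eq hg' hz0 hz]
  · refine continuousAt_pi.mpr fun i => continuousAt_pi.mpr fun j => ?_
    fin_cases i <;> fin_cases j
    · exact hL.continuousAt_locDiag h₁ h₂ h v h0 hθ hne
    · exact hL.continuousAt_locOff h₁ h₂ h v h0 hθ hne
    · exact hL.continuousAt_locOff h₁ h₂ h (-v) h0 hθ hne
    · exact hL.continuousAt_locDiag h₁ h₂ h (-v) h0 hθ hne
  · have e1 := locDiag_jump (E := E) (E' := E') hθ (hp v θ hθ)
    have e2 := locOff_jump (E := E) (E' := E') hθ (hm v θ hθ)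
    have e3 := locDiag_jump (E := E) (E' := E') hθ (hp (-v) θ hθ)
    have e4 := locOff_jump (E := E) (E' := E') hθ (hm (-v) θ hθ)
    rw [hcv, inv_inv] at e3
    rw [hcv] at e4
    simp only [e1, e2, e3, e4, Matrix.mul_fin_two, mul_zero, zero_add, add_zero]

/-- The half-order bounds are part of the conclusion because the uniqueness proof needs more of this
solution than membership in the Smirnoff class. -/
theorem exists_solution (h₁ : 0 < E₁.im) (h₂ : 0 < E₂.im) (h : E₁.re < E₂.re) (Ω₁ ω₁ t : ℝ) :
    ∃ m : ℂ → Matrix (Fin 2) (Fin 2) ℂ, IsModelSolution E₁ E₂ Ω₁ ω₁ t m ∧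
      (∀ i j, IsHalfBounded E₁ (fun k => m k i j) ∧ IsHalfBounded E₂ (fun k => m k i j)) ∧
      Tendsto (fun k : ℂ => k * m k 0 1) (Bornology.cobounded ℂ)
        (𝓝 (-(I / 2) * ((E₁ + E₂).im : ℂ) * (kappa E₁ E₂ (vTilde Ω₁ ω₁ t) *
          ratioMinus E₁ E₂ (vTilde Ω₁ ω₁ t) (abelInfty E₁ E₂)))) := by
  set v := vTilde Ω₁ ω₁ t with hv
  obtain ⟨g, hgd, hg⟩ := exists_solOff h₁ h₂ h (v : ℂ)
  obtain ⟨g', hgd', hg'⟩ := exists_solOff h₁ h₂ h (-v : ℂ)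
  obtain ⟨r₁, hr₁, hL₁⟩ := exists_isLocalAbel_left h₁ h₂ h
  obtain ⟨r₂, hr₂, hL₂⟩ := exists_isLocalAbel_right h₁ h₂ h
  have hb : ∀ i j, IsHalfBounded E₁ (fun k => solMatrix E₁ E₂ v g g' k i j) ∧
      IsHalfBounded E₂ (fun k => solMatrix E₁ E₂ v g g' k i j) := fun i j => by
    fin_cases i <;> fin_cases j
    · exact ⟨hL₁.isHalfBounded_solDiag h₁ h₂ h v, hL₂.isHalfBounded_solDiag h₁ h₂ h v⟩
    · exact ⟨hL₁.isHalfBounded_solOff h₁ h₂ h hg, hL₂.isHalfBounded_solOff h₁ h₂ h hg⟩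
    · exact ⟨hL₁.isHalfBounded_solOff h₁ h₂ h hg', hL₂.isHalfBounded_solOff h₁ h₂ h hg'⟩
    · exact ⟨hL₁.isHalfBounded_solDiag h₁ h₂ h (-v), hL₂.isHalfBounded_solDiag h₁ h₂ h (-v)⟩
  have hd : ∀ i j, DifferentiableOn ℂ (fun k => solMatrix E₁ E₂ v g g' k i j)
      (contour E₁ E₂)ᶜ := fun i j => by
    fin_cases i <;> fin_cases j
    · exact differentiableOn_solDiag h₁ h₂ h v
    · exact hgd
    · exact hgd'
    · exact differentiableOn_solDiag h₁ h₂ h (-v)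
  have hlim : ∀ i j, Tendsto (fun k => solMatrix E₁ E₂ v g g' k i j) (Bornology.cobounded ℂ)
      (𝓝 ((1 : Matrix (Fin 2) (Fin 2) ℂ) i j)) := fun i j => by
    fin_cases i <;> fin_cases j
    · exact tendsto_solDiag h₁ h₂ h v
    · exact tendsto_zero_of_tendsto_mul (tendsto_mul_solOff h₁ h₂ h hg)
    · exact tendsto_zero_of_tendsto_mul (tendsto_mul_solOff h₁ h₂ h hg')
    · have := tendsto_solDiag h₁ h₂ h (-v)
      rw [ofReal_neg] at this
      exact this
  have hpi : (Real.pi : ℂ) ≠ 0 := ofReal_ne_zero.mpr Real.pi_ne_zero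
  have hθr : ∀ (θ : ℝ) {r : ℝ}, 0 < r → |((2 * Real.pi * I - θ * I : ℂ)).re| < r :=
    fun θ r hr => by simpa using hr
  refine ⟨solMatrix E₁ E₂ v g g', ⟨fun i j => isSmirnoff_of_isHalfBounded h₁ h₂ h.ne
    ((hd i j).sub_const _) ?_ ((hb i j).1.sub_const _) ((hb i j).2.sub_const _), ?_, ?_⟩, hb,
    tendsto_mul_solOff h₁ h₂ h hg⟩
  · simpa only [sub_self] using (hlim i j).sub_const ((1 : Matrix (Fin 2) (Fin 2) ℂ) i j)
  · have key : ∀ θ : ℝ, abelLeft E₁ E₂ (θ * I) =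
        tau E₁ E₂ - abelLeft E₁ E₂ (2 * Real.pi * I - θ * I) := fun θ => by
      rw [← abelLeft_reflect h₁ h₂ h (hθr θ (hL₁.pos.trans_le hr₁)), sub_sub_cancel]
    have := hL₁.hasJump h₁ h₂ h hg hg' (c := fun v => cexp (2 * Real.pi * I * v))
      (by simp only [mul_neg, Complex.exp_neg])
      (fun v θ _ => by rw [key, ratioPlus_tau_sub]) (fun v θ _ => by rw [key, ratioMinus_tau_sub])
    convert this using 2
    have e : 2 * Real.pi * I * (v : ℂ) = -2 * I * (t * Ω₁ + ω₁) := by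
      rw [hv, vTilde]
      push_cast
      field_simp
    simp only [jump₁, e, ← Complex.exp_neg]
    congr 6
    ring
  · have key : ∀ θ : ℝ, abelRight E₁ E₂ (θ * I) =
        -abelRight E₁ E₂ (2 * Real.pi * I - θ * I) := fun θ => by
      rw [← abelRight_reflect h₁ h₂ h (hθr θ (hL₂.pos.trans_le hr₂)), sub_sub_cancel]
    have := hL₂.hasJump h₁ h₂ h hg hg' (c := fun _ => 1) (by simp)
      (fun v θ _ => by rw [key, ratioPlus_neg, inv_one, one_mul])
      (fun v θ _ => by rw [key, ratioMinus_neg, one_mul])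
    simpa only [jump₂, inv_one, mul_one] using this

end

section

/-! ### Uniqueness -/

/-- With `J = |dk/dz|`, the integrand is `(|f|² J)(|g|² J)`. The second factor is bounded pointwise,
and the first is integrated by the Smirnoff bound, after splitting off the constant `c`. -/
theorem exists_bound_mul {E c : ℂ} {f g : ℂ → ℂ} {r : ℕ → ℝ} {M : ℝ} (hr : ∀ n, 0 < r n)
    (hr0 : Tendsto r atTop (𝓝 0))
    (hf : ∀ n, Continuous fun θ : ℝ => f (ellMap E (r n + θ * I)))
    (hg : ∀ n, Continuous fun θ : ℝ => g (ellMap E (r n + θ * I)))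
    (hM : ∀ n, ellipseNormSq (fun k => f k - c) E (r n) ≤ M) (hb : IsHalfBounded E g) :
    ∃ r : ℕ → ℝ, (∀ n, 0 < r n) ∧ Tendsto r atTop (𝓝 0) ∧ ∃ M : ℝ, ∀ n,
      ∫ θ in (0 : ℝ)..2 * Real.pi,
        ‖f (ellMap E (r n + θ * I)) * g (ellMap E (r n + θ * I)) *
          ellMap' E (r n + θ * I)‖ ^ 2 ≤ M := by
  obtain ⟨ρ, hρ, C, hC⟩ := hb
  obtain ⟨D, hD0, hD⟩ := exists_norm_le_of_continuousOn_strip (r := ρ) (ρ := ρ + 1)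
    (continuous_ellMap' E).continuousOn (by linarith)
  obtain ⟨N, hN⟩ := eventually_atTop.mp (hr0.eventually_lt_const hρ)
  have hC0 : 0 ≤ C := le_trans (by positivity)
    (hC ρ 0 hρ le_rfl ⟨le_rfl, by linarith [Real.pi_pos]⟩)
  refine ⟨fun n => r (n + N), fun n => hr _, hr0.comp (tendsto_add_atTop_nat N),
    2 * C * M + 2 * C * ‖c‖ ^ 2 * D * (2 * Real.pi), fun n => ?_⟩
  have hs0 := hr (n + N)
  have hs := (hN (n + N) (Nat.le_add_left _ _)).le
  have hfc := hf (n + N)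
  have hgc := hg (n + N)
  have hMn := hM (n + N)
  beta_reduce
  generalize r (n + N) = s at *
  have hJ : Continuous fun θ : ℝ => ellMap' E (s + θ * I) :=
    (continuous_ellMap' E).comp (by fun_prop)
  have hd : Continuous fun θ : ℝ =>
      ‖f (ellMap E (s + θ * I)) - c‖ ^ 2 * ‖ellMap' E (s + θ * I)‖ :=
    ((hfc.sub continuous_const).norm.pow 2).mul hJ.norm
  have hle : ∀ θ ∈ Icc 0 (2 * Real.pi),
      ‖f (ellMap E (s + θ * I)) * g (ellMap E (s + θ * I)) * ellMap' E (s + θ * I)‖ ^ 2 ≤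
      2 * C * (‖f (ellMap E (s + θ * I)) - c‖ ^ 2 * ‖ellMap' E (s + θ * I)‖) +
        2 * C * ‖c‖ ^ 2 * D := by
    intro θ hθ
    have h1 := hC s θ hs0 hs hθ
    have h2 := hD s θ hs0.le hs hθ
    have h3 : ‖f (ellMap E (s + θ * I))‖ ≤ ‖f (ellMap E (s + θ * I)) - c‖ + ‖c‖ := by
      simpa using norm_add_le (f (ellMap E (s + θ * I)) - c) c
    set J := ‖ellMap' E (s + θ * I)‖
    set a := ‖f (ellMap E (s + θ * I))‖
    set b := ‖g (ellMap E (s + θ * I))‖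
    set d := ‖f (ellMap E (s + θ * I)) - c‖
    have hJ0 : 0 ≤ J := norm_nonneg _
    have ha : a ^ 2 ≤ 2 * d ^ 2 + 2 * ‖c‖ ^ 2 :=
      (pow_le_pow_left₀ (norm_nonneg _) h3 2).trans (by nlinarith [sq_nonneg (d - ‖c‖)])
    rw [norm_mul, norm_mul]
    calc (a * b * J) ^ 2 = (a ^ 2 * J) * (b ^ 2 * J) := by ring
      _ ≤ ((2 * d ^ 2 + 2 * ‖c‖ ^ 2) * J) * C := by gcongr
      _ = 2 * C * (d ^ 2 * J) + 2 * C * ‖c‖ ^ 2 * J := by ring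
      _ ≤ _ := by gcongr
  have hi : IntervalIntegrable (fun θ : ℝ => ‖f (ellMap E (s + θ * I)) *
      g (ellMap E (s + θ * I)) * ellMap' E (s + θ * I)‖ ^ 2) volume 0 (2 * Real.pi) :=
    (((hfc.mul hgc).mul hJ).norm.pow 2).intervalIntegrable _ _
  have hi' : IntervalIntegrable (fun θ : ℝ =>
      2 * C * (‖f (ellMap E (s + θ * I)) - c‖ ^ 2 * ‖ellMap' E (s + θ * I)‖) +
        2 * C * ‖c‖ ^ 2 * D) volume 0 (2 * Real.pi) :=
    ((hd.const_mul (2 * C)).add continuous_const).intervalIntegrable _ _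
  refine (intervalIntegral.integral_mono_on (by linarith [Real.pi_pos]) hi hi' hle).trans ?_
  rw [intervalIntegral.integral_add (μ := volume) ((hd.const_mul (2 * C)).intervalIntegrable _ _)
    intervalIntegrable_const, intervalIntegral.integral_const_mul,
    ← ellipseNormSq_eq (fun k => f k - c), intervalIntegral.integral_const, smul_eq_mul, sub_zero,
    mul_comm (2 * Real.pi)]
  gcongr

/-- Using the adjugate instead of the inverse requires no prior knowledge of the determinant of a
solution. -/
theorem mul_mul_adjugate {n : Type*} [Fintype n] [DecidableEq n] {v : Matrix n n ℂ}
    (hv : v.det = 1) (A B : Matrix n n ℂ) : A * v * (B * v).adjugate = A * B.adjugate := by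
  rw [Matrix.adjugate_mul_distrib, Matrix.mul_assoc, ← Matrix.mul_assoc v, Matrix.mul_adjugate, hv,
    one_smul, Matrix.one_mul]

theorem symmetricLimits_of_hasJump {E : ℂ} {m m' : ℂ → Matrix (Fin 2) (Fin 2) ℂ}
    {v : Matrix (Fin 2) (Fin 2) ℂ} (hE : 0 < E.im) (hv : v.det = 1) (hm : HasJump m E v)
    (hm' : HasJump m' E v) (i j : Fin 2) : ∀ᵐ θ : ℝ, θ ∈ Ioo 0 Real.pi →
      SymmetricLimits
        (fun l z => m' (ellMap E z) i l * (m (ellMap E z)).adjugate l j) θ := by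
  filter_upwards [ae_limits_of_hasJump hE hm, ae_limits_of_hasJump hE hm'] with θ h h' hθ
  obtain ⟨L, R, hLR, hL, hR⟩ := h hθ
  obtain ⟨L', R', hLR', hL', hR'⟩ := h' hθ
  have hadj : Continuous fun A : Matrix (Fin 2) (Fin 2) ℂ => A.adjugate :=
    continuous_id.matrix_adjugate
  have hent : ∀ a b : Fin 2, Continuous fun A : Matrix (Fin 2) (Fin 2) ℂ => A a b :=
    fun a b => continuous_id.matrix_elem a b
  refine ⟨fun l => L' i l * L.adjugate l j, fun l => R' i l * R.adjugate l j, fun l => ?_,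
    fun l => ?_, ?_⟩
  · exact (((hent i l).tendsto _).comp hL').mul
      (((hent l j).tendsto _).comp ((hadj.tendsto _).comp hL))
  · exact (((hent i l).tendsto _).comp hR').mul
      (((hent l j).tendsto _).comp ((hadj.tendsto _).comp hR))
  · rw [← Matrix.mul_apply, ← Matrix.mul_apply, hLR, hLR', mul_mul_adjugate hv]

theorem IsHalfBounded.neg {E : ℂ} {f : ℂ → ℂ} (hf : IsHalfBounded E f) :
    IsHalfBounded E (fun k => -f k) := by
  simpa only [IsHalfBounded, norm_neg] using hf

theorem isHalfBounded_adjugate {E : ℂ} {m : ℂ → Matrix (Fin 2) (Fin 2) ℂ}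
    (hm : ∀ i j, IsHalfBounded E (fun k => m k i j)) (i j : Fin 2) :
    IsHalfBounded E (fun k => (m k).adjugate i j) := by
  simp only [Matrix.adjugate_fin_two]
  fin_cases i <;> fin_cases j
  · exact hm 1 1
  · exact (hm 0 1).neg
  · exact (hm 1 0).neg
  · exact hm 0 0

theorem det_jump₁ (Ω₁ ω₁ t : ℝ) : (jump₁ Ω₁ ω₁ t).det = 1 := by
  rw [jump₁, Matrix.det_fin_two_of, neg_mul, neg_mul, Complex.exp_neg]
  have := exp_ne_zero (2 * I * (t * Ω₁ + ω₁))
  field_simp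
  simp

theorem det_jump₂ : jump₂.det = 1 := by
  simp [jump₂, Matrix.det_fin_two_of]

variable {E₁ E₂ : ℂ} {Ω₁ ω₁ t : ℝ} {m m' : ℂ → Matrix (Fin 2) (Fin 2) ℂ}

theorem IsModelSolution.differentiableOn (hm : IsModelSolution E₁ E₂ Ω₁ ω₁ t m) (i j : Fin 2) :
    DifferentiableOn ℂ (fun k => m k i j) (contour E₁ E₂)ᶜ := by
  simpa using (hm.smirnoff i j).1.add_const ((1 : Matrix (Fin 2) (Fin 2) ℂ) i j)

theorem IsModelSolution.tendsto (hm : IsModelSolution E₁ E₂ Ω₁ ω₁ t m) :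
    Tendsto m (Bornology.cobounded ℂ) (𝓝 1) :=
  tendsto_pi_nhds.mpr fun i => tendsto_pi_nhds.mpr fun j => by
    simpa using (hm.smirnoff i j).2.1.add_const ((1 : Matrix (Fin 2) (Fin 2) ℂ) i j)

theorem IsModelSolution.differentiableOn_adjugate (hm : IsModelSolution E₁ E₂ Ω₁ ω₁ t m)
    (i j : Fin 2) : DifferentiableOn ℂ (fun k => (m k).adjugate i j) (contour E₁ E₂)ᶜ := by
  simp only [Matrix.adjugate_fin_two]
  fin_cases i <;> fin_cases j
  · exact hm.differentiableOn 1 1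
  · exact (hm.differentiableOn 0 1).neg
  · exact (hm.differentiableOn 1 0).neg
  · exact hm.differentiableOn 0 0

theorem ellipseNormSq_nonneg (f : ℂ → ℂ) (E : ℂ) (r : ℝ) : 0 ≤ ellipseNormSq f E r :=
  intervalIntegral.integral_nonneg (by positivity) fun θ _ => by positivity

/-- The jumps cancel in every entry of the product, and the `L²` bounds allow extension across the
cuts, so Liouville's theorem applies. Only `m` needs half-order bounds; `m'` is an arbitrary
solution. -/
theorem IsModelSolution.mul_adjugate (h₁ : 0 < E₁.im) (h₂ : 0 < E₂.im) (h : E₁.re ≠ E₂.re)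
    (hm' : IsModelSolution E₁ E₂ Ω₁ ω₁ t m') (hm : IsModelSolution E₁ E₂ Ω₁ ω₁ t m)
    (hb : ∀ i j, IsHalfBounded E₁ (fun k => m k i j) ∧ IsHalfBounded E₂ (fun k => m k i j)) {k : ℂ}
    (hk : k ∉ contour E₁ E₂) : m' k * (m k).adjugate = 1 := by
  ext i j
  rw [Matrix.mul_apply]
  have hbound : ∀ l : Fin 2, ∀ (E : ℂ) (r : ℕ → ℝ) (M : ℝ), (∀ n, 0 < r n) →
      Tendsto r atTop (𝓝 0) → (∀ n θ, ellipse E (r n) θ ∉ contour E₁ E₂) →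
      (∀ n, ellipseNormSq (fun k => m' k i l - (1 : Matrix (Fin 2) (Fin 2) ℂ) i l) E (r n) ≤ M) →
      IsHalfBounded E (fun k => (m k).adjugate l j) →
      ∃ r : ℕ → ℝ, (∀ n, 0 < r n) ∧ Tendsto r atTop (𝓝 0) ∧ ∃ M : ℝ, ∀ n,
        ∫ θ in (0 : ℝ)..2 * Real.pi, ‖m' (ellMap E (r n + θ * I)) i l *
          (m (ellMap E (r n + θ * I))).adjugate l j * ellMap' E (r n + θ * I)‖ ^ 2 ≤ M :=
    fun l E r M hr hr0 hmem hM hg => by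
      have hc : ∀ n, Continuous fun θ : ℝ => ellMap E (r n + θ * I) := fun n =>
        (continuous_ellMap E).comp (by fun_prop)
      exact exists_bound_mul (f := fun k => m' k i l) (g := fun k => (m k).adjugate l j) hr hr0
        (fun n => (hm'.differentiableOn i l).continuousOn.comp_continuous (hc n) (hmem n))
        (fun n => (hm.differentiableOn_adjugate l j).continuousOn.comp_continuous (hc n) (hmem n))
        hM hg
  have hlim : Tendsto (fun k => m' k * (m k).adjugate) (Bornology.cobounded ℂ) (𝓝 1) := by
    have hadj : Continuous fun A : Matrix (Fin 2) (Fin 2) ℂ => A.adjugate :=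
      continuous_id.matrix_adjugate
    have := hm'.tendsto.mul ((hadj.tendsto 1).comp hm.tendsto)
    simpa using this
  refine eq_of_extendsAcross (F := fun l k => m' k i l * (m k).adjugate l j) h₁ h₂ h
    (fun l => (hm'.differentiableOn i l).mul (hm.differentiableOn_adjugate l j))
    ⟨fun l => ?_, symmetricLimits_of_hasJump h₁ (det_jump₁ _ _ _) hm.jump_one hm'.jump_one i j⟩
    ⟨fun l => ?_, symmetricLimits_of_hasJump h₂ det_jump₂ hm.jump_two hm'.jump_two i j⟩ ?_ hk
  · obtain ⟨-, -, r₁, r₂, hr, hr₁, hr₂, hmem, M, hM⟩ := hm'.smirnoff i l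
    exact hbound l E₁ r₁ M (fun n => (hr n).1) hr₁ (fun n θ => (hmem n θ).1)
      (fun n => (le_add_of_nonneg_right (ellipseNormSq_nonneg _ _ _)).trans (hM n))
      (isHalfBounded_adjugate (fun i j => (hb i j).1) l j)
  · obtain ⟨-, -, r₁, r₂, hr, hr₁, hr₂, hmem, M, hM⟩ := hm'.smirnoff i l
    exact hbound l E₂ r₂ M (fun n => (hr n).2) hr₂ (fun n θ => (hmem n θ).2)
      (fun n => (le_add_of_nonneg_left (ellipseNormSq_nonneg _ _ _)).trans (hM n))
      (isHalfBounded_adjugate (fun i j => (hb i j).2) l j)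
  · simp only [← Matrix.mul_apply]
    exact tendsto_pi_nhds.mp (tendsto_pi_nhds.mp hlim i) j

/-- With `m' = m` in `mul_adjugate`, the adjugate of `m` is its inverse, and the general case then
identifies `m'` with `m`. -/
theorem IsModelSolution.eqOn (h₁ : 0 < E₁.im) (h₂ : 0 < E₂.im) (h : E₁.re ≠ E₂.re)
    (hm' : IsModelSolution E₁ E₂ Ω₁ ω₁ t m') (hm : IsModelSolution E₁ E₂ Ω₁ ω₁ t m)
    (hb : ∀ i j, IsHalfBounded E₁ (fun k => m k i j) ∧ IsHalfBounded E₂ (fun k => m k i j)) :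
    EqOn m' m (contour E₁ E₂)ᶜ := fun k hk => by
  have h1 := hm'.mul_adjugate h₁ h₂ h hm hb hk
  have h2 := mul_eq_one_comm.mp (hm.mul_adjugate h₁ h₂ h hm hb hk)
  rw [← mul_one (m' k), ← h2, ← mul_assoc, h1, one_mul]

end

end ModelRH

end

/-! ### The theorem -/

theorem mainTheorem4 (E₁ E₂ : ℂ) (hE₁ : 0 < E₁.im) (hE₂ : 0 < E₂.im) (hE : E₁.re < E₂.re)
    (Ω₁ ω₁ t : ℝ) (ht : 0 ≤ t) :
    ∃ m : ℂ → Matrix (Fin 2) (Fin 2) ℂ,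
      ModelRH.IsModelSolution E₁ E₂ Ω₁ ω₁ t m ∧
      (∀ m' : ℂ → Matrix (Fin 2) (Fin 2) ℂ, ModelRH.IsModelSolution E₁ E₂ Ω₁ ω₁ t m' →
        Set.EqOn m' m (ModelRH.contour E₁ E₂)ᶜ) ∧
      Tendsto (fun k : ℂ => k * m k 0 1) (Bornology.cobounded ℂ)
        (𝓝 (-(I / 2) * ((E₁ + E₂).im : ℂ) *
          ((ModelRH.theta E₁ E₂ (ModelRH.abelInfty E₁ E₂ + ModelRH.dTilde E₁ E₂) *
            ModelRH.theta E₁ E₂ (ModelRH.abelInfty E₁ E₂ - ModelRH.vTilde Ω₁ ω₁ t -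
              ModelRH.dTilde E₁ E₂)) /
           (ModelRH.theta E₁ E₂ (ModelRH.abelInfty E₁ E₂ + ModelRH.vTilde Ω₁ ω₁ t +
              ModelRH.dTilde E₁ E₂) *
            ModelRH.theta E₁ E₂ (ModelRH.abelInfty E₁ E₂ - ModelRH.dTilde E₁ E₂))))) := by
  obtain ⟨m, hm, hb, hlim⟩ := ModelRH.exists_solution hE₁ hE₂ hE Ω₁ ω₁ t
  refine ⟨m, hm, fun m' hm' => hm'.eqOn hE₁ hE₂ hE.ne hm hb, ?_⟩
  rwa [ModelRH.kappa, ModelRH.ratioPlus, ModelRH.ratioMinus, inv_div, div_mul_div_comm] at hlim
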